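/- **Setting.** Let $L>0$, $\theta\in\mathbb R$ with $\cos\theta\neq 0$, $\gamma\ge 0$, and let $j\ge 1$ be an integer. Let $D_0\subset\mathbb R^2$ be a nonempty compact set whose boundary consists of finitely many disjoint simple closed regular $C^2$ curves, with $D_0$ locally on exactly one side of each, and let $\nu$ be the unit normal on $\partial D_0$ pointing out of $D_0$. Assume that the translates $D_n=D_0+(nL,0)$, $n\in\mathbb Z$, are mutually disjoint, put $D=\bigcup_n D_n$ and $\Omega=\mathbb R^2\setminus D$, and let $h>\max\{|y-y'| : (x,y),(x',y')\in\partial D_0\}$. $C(\partial D_0)$ is the Banach space of continuous complex functions on $\partial D_0$ with the maximum norm. For $k>0$ put $\alpha=k\sin\theta$, $\alpha_n(k)=\alpha+\frac{2\pi}{L}n$, and let $\beta_n(k)$ be the square root of $k^2-\alpha_n(k)^2$ that is nonnegative or a positive multiple of $i$. Call $k>0$ a *Wood frequency* if $\beta_n(k)=0$ for some $n\in\mathbb Z$. Put $u^{\rm inc}_k(x,y)=e^{i\alpha x-ik\cos(\theta) y}$, $\sigma_n(k)=(1-e^{i\beta_n(k)h})^j-1$, $$G^q_{j,k}(X,Y)=\sum_{n\in\mathbb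 Z}e^{-i\alpha nL}\,\frac i4\sum_{\ell=0}^{j}(-1)^\ell\binom j\ell H^{(1)}_0\!\left(k\sqrt{(X+nL)^2+(Y+\ell h)^2}\right),$$ $$I^+_{n,k}[\psi]=\int_{\partial D_0}\Big(\frac{\partial}{\partial\nu(r')}-i\gamma\Big)e^{-i\alpha_n(k)x'-i\beta_n(k)y'}\,\psi(r')\,dS(r').$$ For a wave number $k$ that is not a Wood frequency, the *hybrid integral equation* for $\psi\in C(\partial D_0)$ is $$\frac12\psi(r)+\int_{\partial D_0}\Big(\frac{\partial G^q_{j,k}}{\partial\nu(r')}-i\gamma G^q_{j,k}\Big)(r-r')\psi(r')\,dS(r')-\frac{i}{2L}\sum_{n\in\mathbb Z}\sigma_n(k)\frac{I^+_{n,k}[\psi]}{\beta_n(k)}e^{i\alpha_n(k)x+i\beta_n(k)y}=-u^{\rm inc}_k(r),\qquad r=(x,y)\in\partial D_0.$$ Fix a Wood frequency $k_0$ and let $\mathcal N_{\rm wa}=\{n:\beta_n(k_0)=0\}=\{n_1,\dots,n_r\}$ ($r\in\{1,2\}$). For $k$ near $k_0$ let $A_k\psi$ be the left-hand side of the hybrid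 equation with the sum restricted to $n\notin\mathcal N_{\rm wa}$, let $w_l=w_l(k)=e^{i\alpha_{n_l}(k)x+i\beta_{n_l}(k)y}|_{\partial D_0}$, $S=S(k)=\mathrm{span}\{w_1,\dots,w_r\}\subset C(\partial D_0)$, and $$\widetilde R_k\psi=-\frac{i}{2L}\sum_{l=1}^r\sigma_{n_l}(k)\,I^+_{n_l,k}[\psi]\,w_l .$$ A function $u$ is called a *radiating solution* at the frequency $k$ if it is $C^2$ in $\Omega$ and continuous on $\overline\Omega$, satisfies $\Delta u+k^2u=0$ in $\Omega$ and $u(x+nL,y)=e^{i\alpha nL}u(x,y)$ for all $n\in\mathbb Z$, and has expansions $u=\sum_nC_n^{+}e^{i\alpha_nx+i\beta_ny}$ above $D$ and $u=\sum_nC_n^{-}e^{i\alpha_nx-i\beta_ny}$ below $D$. **Theorem.** Assume that $A_{k_0}:C(\partial D_0)\to C(\partial D_0)$ is invertible, and that the only radiating solution at the frequency $k_0$ that vanishes on $\partial D$ is $u=0$. Then there is $\delta>0$ such that for $|k-k_0|<\delta$: 1. $A_k$ is an invertible bounded operator on $C(\partial D_0)$, and $A_k^{-1}$ is continuous in $k$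 (in the operator norm). 2. $w_1,\dots,w_r$ are linearly independent; the restriction $\widetilde T_k=\widetilde R_kA_k^{-1}|_S$ maps $S$ bijectively and bicontinuously onto itself; and $\widetilde T_k^{-1}$ is continuous in $k$, i.e. its matrix in the basis $w_1,\dots,w_r$ of $S$ is. 3. Let $D_{\boldsymbol\beta(k)}:S\to S$ be the linear operator with $D_{\boldsymbol\beta(k)}w_l=\beta_{n_l}(k)w_l$. The operator $D_{\boldsymbol\beta(k)}+\widetilde T_k$ is invertible on $S$, so that $$\psi_k=-A_k^{-1}\Big(\mathbb I-(D_{\boldsymbol\beta(k)}+\widetilde T_k)^{-1}\widetilde R_kA_k^{-1}\Big)u^{\rm inc}_k$$ is well defined, also at $k=k_0$. If $0<|k-k_0|<\delta$, then $k>0$ is not a Wood frequency and $\psi_k$ is the unique solution in $C(\partial D_0)$ of the hybrid integral equation. Moreover $k\mapsto\psi_k$ maps $(k_0-\delta,k_0+\delta)$ continuously into $C(\partial D_0)$; in particular $\psi_k\to\psi_{k_0}$ uniformly as $k\to k_0$. -/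

import Mathlib

open scoped Topology

noncomputable section

/-- The Euclidean plane; `p 0` and `p 1` are the coordinates `x` and `y` of a point `p`. -/
abbrev Plane : Type := EuclideanSpace ℝ (Fin 2)

/-- The Hankel function `H₀⁽¹⁾ = J₀ + i Y₀` of the first kind and order zero at `t > 0`, written as
Hankel's (absolutely convergent) integral
`H₀⁽¹⁾(t) = √(2/(πt)) e^{i(t - π/4)} Γ(1/2)⁻¹ ∫₀^∞ e^{-u} u^{-1/2} (1 + iu/(2t))^{-1/2} du`,
with the principal branch of the power and `Γ(1/2) = √π`. -/
def hankelH0 (t : ℝ) : ℂ :=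
  (Real.sqrt (2 / (Real.pi * t)) : ℂ) * Complex.exp (Complex.I * ((t : ℂ) - (Real.pi : ℂ) / 4)) *
    ((Real.sqrt Real.pi : ℝ) : ℂ)⁻¹ *
    ∫ u in Set.Ioi (0 : ℝ),
      ((Real.exp (-u) * u ^ (-(1 / 2) : ℝ) : ℝ) : ℂ) *
        (1 + Complex.I * (u : ℂ) / (2 * (t : ℂ))) ^ (-(1 / 2) : ℂ)

/-- The data of the scattering problem and of its integral formulation: the period `L`, the
incidence angle `θ` (measured from the `y`-axis, not grazing), the obstacle `D₀` of one period,
which is a compact set whose boundary consists of finitely many disjoint simple closed `C²` curves,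
the number `j ≥ 1` of shifts, the shift spacing `h`, and the coupling parameter `γ ≥ 0`. -/
structure ScatteringSetup where
  /-- the period -/
  L : ℝ
  L_pos : 0 < L
  /-- the angle of incidence -/
  θ : ℝ
  cos_ne_zero : Real.cos θ ≠ 0
  /-- the obstacle in the reference cell -/
  D₀ : Set Plane
  compact_D₀ : IsCompact D₀
  nonempty_D₀ : D₀.Nonempty
  /-- the number of boundary curves -/
  m : ℕ
  /-- the `2π`-periodic parametrizations of the boundary curves -/
  z : Fin m → ℝ → Plane
  z_smooth : ∀ i, ContDiff ℝ 2 (z i)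
  z_periodic : ∀ i, Function.Periodic (z i) (2 * Real.pi)
  z_regular : ∀ i t, deriv (z i) t ≠ 0
  z_simple : ∀ i i' s t, z i s = z i' t → i = i' ∧ ∃ n : ℤ, s = t + n * (2 * Real.pi)
  frontier_D₀ : frontier D₀ = ⋃ i, Set.range (z i)
  /-- `D₀` lies to the left of each boundary curve, so that `(y', -x')` points out of `D₀` -/
  outward : ∀ i t, ∀ᶠ s in 𝓝[>] (0 : ℝ),
    z i t + s • !₂[deriv (z i) t 1, -(deriv (z i) t 0)] ∉ D₀ ∧
    z i t - s • !₂[deriv (z i) t 1, -(deriv (z i) t 0)] ∈ interior D₀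
  /-- the translates of `D₀` by multiples of the period are mutually disjoint -/
  disjoint_translates : ∀ n : ℤ, n ≠ 0 → ∀ p ∈ D₀, p + !₂[n * L, 0] ∉ D₀
  /-- the number of shifts -/
  j : ℕ
  one_le_j : 1 ≤ j
  /-- the shift spacing -/
  h : ℝ
  h_large : ∀ p ∈ frontier D₀, ∀ q ∈ frontier D₀, |p 1 - q 1| < h
  /-- the coupling parameter of the combined layer potential -/
  γ : ℝ
  γ_nonneg : 0 ≤ γ

namespace ScatteringSetup

/-! ### Wave numbers and Wood frequencies -/

/-- `α = k sin θ`. -/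
def α (P : ScatteringSetup) (k : ℝ) : ℝ := k * Real.sin P.θ

/-- `α_n = α + 2πn/L`. -/
def αn (P : ScatteringSetup) (n : ℤ) (k : ℝ) : ℝ := P.α k + 2 * Real.pi / P.L * n

/-- The root `β_n` of `β_n² = k² - α_n²` that is nonnegative when `k² ≥ α_n²` and is `i` times a
positive number when `k² < α_n²` (recall that `Real.sqrt` vanishes on negative numbers). -/
def βn (P : ScatteringSetup) (n : ℤ) (k : ℝ) : ℂ :=
  (Real.sqrt (k ^ 2 - P.αn n k ^ 2) : ℂ) + Complex.I * (Real.sqrt (P.αn n k ^ 2 - k ^ 2) : ℂ)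

/-- The set of all Wood frequencies. -/
def woodFrequencies (P : ScatteringSetup) : Set ℝ := {k | 0 < k ∧ ∃ n : ℤ, k ^ 2 = P.αn n k ^ 2}

/-- The set `𝒩_wa(k₀)` of the indices of the Wood modes at `k₀`. -/
def Nwa (P : ScatteringSetup) (k₀ : ℝ) : Set ℤ := {n | P.βn n k₀ = 0}

theorem finite_Nwa (P : ScatteringSetup) (k₀ : ℝ) : (P.Nwa k₀).Finite := by
  have hinj : Function.Injective (fun n : ℤ => P.αn n k₀) := by
    intro a b hab
    have hL := P.L_pos
    have hc : 2 * Real.pi / P.L ≠ 0 := by positivity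
    simp only [αn, add_right_inj] at hab
    exact_mod_cast mul_left_cancel₀ hc hab
  refine ((Set.toFinite ({k₀, -k₀} : Set ℝ)).preimage hinj.injOn).subset ?_
  intro n hn
  have hn' : P.βn n k₀ = 0 := hn
  have h1 := congrArg Complex.re hn'
  have h2 := congrArg Complex.im hn'
  simp only [βn, Complex.add_re, Complex.ofReal_re, Complex.mul_re, Complex.I_re, Complex.I_im,
    Complex.ofReal_im, Complex.add_im, Complex.mul_im, Complex.zero_re, Complex.zero_im] at h1 h2
  have h3 : k₀ ^ 2 - P.αn n k₀ ^ 2 ≤ 0 := Real.sqrt_eq_zero'.1 (by linarith)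
  have h4 : P.αn n k₀ ^ 2 - k₀ ^ 2 ≤ 0 := Real.sqrt_eq_zero'.1 (by linarith)
  have h5 : P.αn n k₀ ^ 2 = k₀ ^ 2 := by linarith
  rcases sq_eq_sq_iff_eq_or_eq_neg.1 h5 with h6 | h6 <;> simp [h6]

instance instFintypeNwa (P : ScatteringSetup) (k₀ : ℝ) : Fintype (P.Nwa k₀) :=
  (P.finite_Nwa k₀).fintype

/-! ### Green functions -/

/-- The shifted Green function `G_{j,k}`. -/
def shiftedGreen (P : ScatteringSetup) (k : ℝ) (p : Plane) : ℂ :=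
  Complex.I / 4 * ∑ l ∈ Finset.range (P.j + 1), (-1) ^ l * (P.j.choose l : ℂ) *
    hankelH0 (k * Real.sqrt (p 0 ^ 2 + (p 1 + l * P.h) ^ 2))

/-- The shifted quasi-periodic Green function `G^q_{j,k}`. -/
def quasiGreen (P : ScatteringSetup) (k : ℝ) (p : Plane) : ℂ :=
  ∑' n : ℤ, Complex.exp (-Complex.I * P.α k * n * P.L) * P.shiftedGreen k (p + !₂[n * P.L, 0])

/-! ### The boundary and the space of densities -/

instance instCompactBoundary (P : ScatteringSetup) : CompactSpace (frontier P.D₀) :=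
  isCompact_iff_compactSpace.1
    (P.compact_D₀.of_isClosed_subset isClosed_frontier P.compact_D₀.isClosed.frontier_subset)

/-- The Banach space `C(∂D₀)`, with the maximum norm. -/
abbrev Density (P : ScatteringSetup) : Type := C(frontier P.D₀, ℂ)

/-- The point of `∂D₀` with parameter `t` on the `i`-th boundary curve. -/
def bdryPoint (P : ScatteringSetup) (i : Fin P.m) (t : ℝ) : frontier P.D₀ :=
  ⟨P.z i t, by rw [P.frontier_D₀]; exact Set.mem_iUnion.2 ⟨i, Set.mem_range_self t⟩⟩

/-- The unit normal at `bdryPoint i t` that points out of `D₀`. -/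
def normal (P : ScatteringSetup) (i : Fin P.m) (t : ℝ) : Plane :=
  ‖deriv (P.z i) t‖⁻¹ • !₂[deriv (P.z i) t 1, -(deriv (P.z i) t 0)]

/-- `∫_{∂D₀} (∂F/∂ν(r') - iγ F)(r') ψ(r') dS(r')`. -/
def combinedIntegral (P : ScatteringSetup) (F : Plane → ℂ) (ψ : P.Density) : ℂ :=
  ∑ i, ∫ t in (0 : ℝ)..(2 * Real.pi),
    (fderiv ℝ F (P.z i t) (P.normal i t) - Complex.I * P.γ * F (P.z i t)) *
      ψ (P.bdryPoint i t) * ‖deriv (P.z i) t‖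

/-- The functional `I⁺_{n,k}`. -/
def Iplus (P : ScatteringSetup) (n : ℤ) (k : ℝ) (ψ : P.Density) : ℂ :=
  P.combinedIntegral
    (fun s => Complex.exp (-Complex.I * P.αn n k * s 0 - Complex.I * P.βn n k * s 1)) ψ

/-- `σ_n(k) = (1 - e^{iβ_n(k)h})^j - 1`. -/
def σn (P : ScatteringSetup) (n : ℤ) (k : ℝ) : ℂ :=
  (1 - Complex.exp (Complex.I * P.βn n k * P.h)) ^ P.j - 1

/-- The restriction of the mode `e^{iα_n x + iβ_n y}` to `∂D₀`. -/
def mode (P : ScatteringSetup) (n : ℤ) (k : ℝ) : P.Density where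
  toFun r := Complex.exp (Complex.I * P.αn n k * r.1 0 + Complex.I * P.βn n k * r.1 1)
  continuous_toFun := by fun_prop

/-- The restriction of the incident wave `e^{iαx - iβy}`, `β = k cos θ`, to `∂D₀`. -/
def uinc (P : ScatteringSetup) (k : ℝ) : P.Density where
  toFun r := Complex.exp (Complex.I * P.α k * r.1 0 - Complex.I * (k * Real.cos P.θ : ℝ) * r.1 1)
  continuous_toFun := by fun_prop

/-! ### The operators -/

/-- The value `(A_k ψ)(r)`, where `A_k` is formed with respect to the Wood frequency `k₀`. -/
def opA (P : ScatteringSetup) (k₀ k : ℝ) (ψ : P.Density) (r : frontier P.D₀) : ℂ :=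
  1 / 2 * ψ r + P.combinedIntegral (fun s => P.quasiGreen k (r.1 - s)) ψ
    - Complex.I / (2 * P.L) * ∑' n : ↥(P.Nwa k₀)ᶜ,
        P.σn n k * (P.Iplus n k ψ / P.βn n k) * P.mode n k r

/-- `A_{k₀}` is invertible on `C(∂D₀)`: for every `f` in `C(∂D₀)` the equation `A_{k₀} ψ = f` has
exactly one solution `ψ` in `C(∂D₀)`. -/
def OpAInvertible (P : ScatteringSetup) (k₀ : ℝ) : Prop :=
  ∀ f : P.Density, ∃! ψ : P.Density, ∀ r, P.opA k₀ k₀ ψ r = f r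

/-- `ψ` solves the hybrid integral equation at the frequency `k` (which is not a Wood frequency). -/
def SolvesHybrid (P : ScatteringSetup) (k : ℝ) (ψ : P.Density) : Prop :=
  ∀ r : frontier P.D₀,
    1 / 2 * ψ r + P.combinedIntegral (fun s => P.quasiGreen k (r.1 - s)) ψ
      - Complex.I / (2 * P.L) * ∑' n : ℤ,
          P.σn n k * (P.Iplus n k ψ / P.βn n k) * P.mode n k r
      = -P.uinc k r

/-- The span `S` (at the frequency `k`) of the Wood modes of the Wood frequency `k₀`. -/
def woodSpan (P : ScatteringSetup) (k₀ k : ℝ) : Submodule ℂ P.Density :=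
  Submodule.span ℂ (Set.range fun n : P.Nwa k₀ => P.mode n k)

/-- The Wood mode `w_n` as an element of `S`. -/
def woodMode (P : ScatteringSetup) (k₀ k : ℝ) (n : P.Nwa k₀) : P.woodSpan k₀ k :=
  ⟨P.mode n k, Submodule.subset_span (Set.mem_range_self n)⟩

/-- The finite-rank operator `R̃_k`, with values in `S`. -/
def Rtilde (P : ScatteringSetup) (k₀ k : ℝ) (ψ : P.Density) : P.woodSpan k₀ k :=
  ∑ n : P.Nwa k₀, (-(Complex.I / (2 * P.L)) * (P.σn n k * P.Iplus n k ψ)) • P.woodMode k₀ k n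

/-! ### The boundary value problem -/

/-- The union `D` of all translates of `D₀`. -/
def array (P : ScatteringSetup) : Set Plane := {p | ∃ n : ℤ, p + !₂[n * P.L, 0] ∈ P.D₀}

/-- `u` is an `α`-quasi-periodic radiating solution of the Helmholtz equation `Δu + k²u = 0` in
`Ω = ℝ² \ D` that is continuous up to the boundary. -/
structure IsRadiatingSolution (P : ScatteringSetup) (k : ℝ) (u : Plane → ℂ) : Prop where
  smooth : ContDiffOn ℝ 2 u P.arrayᶜ
  continuous : ContinuousOn u (closure P.arrayᶜ)
  helmholtz : ∀ p ∈ P.arrayᶜ, Laplacian.laplacian u p + (k : ℂ) ^ 2 * u p = 0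
  quasiperiodic : ∀ p ∈ P.arrayᶜ, ∀ n : ℤ,
    u (p + !₂[n * P.L, 0]) = Complex.exp (Complex.I * P.α k * n * P.L) * u p
  radiating_above : ∃ C : ℤ → ℂ, ∀ p : Plane, (∀ q ∈ P.D₀, q 1 < p 1) →
    HasSum (fun n : ℤ => C n *
      Complex.exp (Complex.I * P.αn n k * p 0 + Complex.I * P.βn n k * p 1)) (u p)
  radiating_below : ∃ C : ℤ → ℂ, ∀ p : Plane, (∀ q ∈ P.D₀, p 1 < q 1) →
    HasSum (fun n : ℤ => C n *
      Complex.exp (Complex.I * P.αn n k * p 0 - Complex.I * P.βn n k * p 1)) (u p)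

/-- Uniqueness of radiating solutions of the Dirichlet problem at the frequency `k`. -/
def UniqueRadiating (P : ScatteringSetup) (k : ℝ) : Prop :=
  ∀ u : Plane → ℂ, P.IsRadiatingSolution k u → (∀ p ∈ frontier P.array, u p = 0) →
    ∀ p ∈ P.arrayᶜ, u p = 0

end ScatteringSetup

end

section

open scoped Topology ContDiff
open MeasureTheory Set Filter

/-! ### The Hankel function as a Laplace transform -/

/-- The density `s^{-1/2} (1 + is/2)^{-1/2}` of the Laplace representation of `H₀⁽¹⁾`. -/
noncomputable def hankelWeight (s : ℝ) : ℂ :=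
  ((s ^ (-(1 / 2) : ℝ) : ℝ) : ℂ) * (1 + Complex.I * (s : ℂ) / 2) ^ (-(1 / 2) : ℂ)

/-- The `m`-th derivative of the holomorphic extension of `H₀⁽¹⁾` to the right half plane. -/
noncomputable def hankelD (m : ℕ) (z : ℂ) : ℂ :=
  (1 - Complex.I) / Real.pi *
    ∫ s in Ioi (0 : ℝ), (Complex.I - s) ^ m * Complex.exp ((Complex.I - s) * z) * hankelWeight s

theorem norm_one_add_I_mul_half_ge_one (s : ℝ) : 1 ≤ ‖1 + Complex.I * (s : ℂ) / 2‖ := by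
  have := Complex.abs_re_le_norm (1 + Complex.I * (s : ℂ) / 2)
  simpa using this

theorem norm_one_add_I_mul_half_ge {s : ℝ} (hs : 0 < s) :
    s / 2 ≤ ‖1 + Complex.I * (s : ℂ) / 2‖ := by
  have := Complex.abs_im_le_norm (1 + Complex.I * (s : ℂ) / 2)
  have h2 : (1 + Complex.I * (s : ℂ) / 2).im = s / 2 := by simp
  rw [h2, abs_of_pos (by positivity)] at this
  exact this

theorem norm_cpow_neg_half (z : ℂ) : ‖z ^ (-(1 / 2) : ℂ)‖ = ‖z‖ ^ (-(1 / 2) : ℝ) := by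
  have := Complex.norm_cpow_real z (-(1 / 2))
  push_cast at this
  exact this

theorem norm_hankelWeight {s : ℝ} (hs : 0 < s) :
    ‖hankelWeight s‖ = s ^ (-(1 / 2) : ℝ) * ‖1 + Complex.I * (s : ℂ) / 2‖ ^ (-(1 / 2) : ℝ) := by
  rw [hankelWeight, norm_mul, norm_cpow_neg_half, Complex.norm_real, Real.norm_of_nonneg (by positivity)]

theorem norm_hankelWeight_le {s : ℝ} (hs : 0 < s) : ‖hankelWeight s‖ ≤ s ^ (-(1 / 2) : ℝ) := by
  rw [norm_hankelWeight hs]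
  refine mul_le_of_le_one_right (by positivity) ?_
  exact Real.rpow_le_one_of_one_le_of_nonpos (norm_one_add_I_mul_half_ge_one s) (by norm_num)

theorem one_add_I_mul_half_mem_slitPlane (s : ℝ) :
    1 + Complex.I * (s : ℂ) / 2 ∈ Complex.slitPlane := by
  left; simp

theorem continuousOn_hankelWeight : ContinuousOn hankelWeight (Ioi 0) := by
  intro s hs
  refine ContinuousAt.continuousWithinAt ?_
  unfold hankelWeight
  refine ContinuousAt.mul ?_ ?_
  · exact Complex.continuous_ofReal.continuousAt.comp
      (Real.continuousAt_rpow_const _ _ (Or.inl (ne_of_gt hs)))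
  · refine ContinuousAt.cpow (by fun_prop) continuousAt_const (one_add_I_mul_half_mem_slitPlane s)

theorem norm_I_sub_pow_le (m : ℕ) {s : ℝ} (hs : 0 < s) :
    ‖(Complex.I - s) ^ m‖ ≤ 2 ^ m * (1 + s ^ m) := by
  rw [norm_pow]
  have h1 : ‖Complex.I - (s : ℂ)‖ ≤ 1 + s := by
    refine (norm_sub_le _ _).trans ?_
    simp [abs_of_pos hs]
  calc ‖Complex.I - (s : ℂ)‖ ^ m ≤ (1 + s) ^ m := pow_le_pow_left₀ (norm_nonneg _) h1 m
    _ ≤ 2 ^ (m - 1) * (1 ^ m + s ^ m) := add_pow_le zero_le_one hs.le m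
    _ ≤ 2 ^ m * (1 + s ^ m) := by
      rw [one_pow]; gcongr
      · norm_num
      · omega

theorem norm_exp_I_sub_mul (s : ℝ) (z : ℂ) :
    ‖Complex.exp ((Complex.I - s) * z)‖ = Real.exp (-z.im) * Real.exp (-(z.re * s)) := by
  rw [Complex.norm_exp, ← Real.exp_add]
  congr 1
  simp; ring

theorem norm_hankel_integrand_le (m : ℕ) {s : ℝ} (hs : 0 < s) (z : ℂ) :
    ‖(Complex.I - s) ^ m * Complex.exp ((Complex.I - s) * z) * hankelWeight s‖ ≤
      2 ^ m * Real.exp (-z.im) * (s ^ ((1 / 2 : ℝ) - 1) * Real.exp (-(z.re * s)) +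
        s ^ ((m + 1 / 2 : ℝ) - 1) * Real.exp (-(z.re * s))) := by
  rw [norm_mul, norm_mul, norm_exp_I_sub_mul]
  have h1 := norm_hankelWeight_le hs
  have h2 := norm_I_sub_pow_le m hs
  have e1 : s ^ ((m + 1 / 2 : ℝ) - 1) = s ^ m * s ^ (-(1 / 2) : ℝ) := by
    rw [← Real.rpow_natCast, ← Real.rpow_add hs]; congr 1; ring
  have e2 : s ^ ((1 / 2 : ℝ) - 1) = s ^ (-(1 / 2) : ℝ) := by norm_num
  rw [e1, e2]
  calc _ ≤ (2 ^ m * (1 + s ^ m)) * (Real.exp (-z.im) * Real.exp (-(z.re * s))) *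
        s ^ (-(1 / 2) : ℝ) := by gcongr
    _ = _ := by ring

theorem integrableOn_rpow_sub_one_mul_exp {a x : ℝ} (ha : 0 < a) (hx : 0 < x) :
    IntegrableOn (fun s : ℝ => s ^ (a - 1) * Real.exp (-(x * s))) (Ioi 0) := by
  have := integrableOn_rpow_mul_exp_neg_mul_rpow (p := 1) (s := a - 1) (b := x) (by linarith)
    one_pos hx
  simpa [neg_mul] using this

theorem aestronglyMeasurable_hankel_integrand (m : ℕ) (z : ℂ) :
    AEStronglyMeasurable (fun s : ℝ => (Complex.I - s) ^ m * Complex.exp ((Complex.I - s) * z) *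
      hankelWeight s) (volume.restrict (Ioi 0)) := by
  refine ContinuousOn.aestronglyMeasurable ?_ measurableSet_Ioi
  refine ContinuousOn.mul ?_ continuousOn_hankelWeight
  fun_prop

theorem integrableOn_hankel_integrand (m : ℕ) {z : ℂ} (hz : 0 < z.re) :
    IntegrableOn (fun s : ℝ => (Complex.I - s) ^ m * Complex.exp ((Complex.I - s) * z) *
      hankelWeight s) (Ioi 0) := by
  refine Integrable.mono' (((integrableOn_rpow_sub_one_mul_exp (a := 1 / 2) (by norm_num) hz).add
    (integrableOn_rpow_sub_one_mul_exp (a := m + 1 / 2) (by positivity) hz)).const_mul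
      (2 ^ m * Real.exp (-z.im))) (aestronglyMeasurable_hankel_integrand m z) ?_
  filter_upwards [ae_restrict_mem measurableSet_Ioi] with s hs
  exact norm_hankel_integrand_le m hs z

/-- The basic bound for the derivatives of the Hankel function. -/
theorem norm_hankelD_le (m : ℕ) : ∃ C : ℝ, 0 < C ∧ ∀ z : ℂ, 0 < z.re →
    ‖hankelD m z‖ ≤ C * Real.exp (-z.im) * (z.re ^ (-(1 / 2) : ℝ) + z.re ^ (-(m + 1 / 2) : ℝ)) := by
  refine ⟨‖(1 - Complex.I) / Real.pi‖ * 2 ^ m * (Real.Gamma (1 / 2) + Real.Gamma (m + 1 / 2)), ?_,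
    fun z hz => ?_⟩
  · have h1 := Real.Gamma_pos_of_pos (s := 1 / 2) (by norm_num)
    have h2 := Real.Gamma_pos_of_pos (s := m + 1 / 2) (by positivity)
    have h3 : 0 < ‖(1 - Complex.I) / Real.pi‖ := by
      rw [norm_pos_iff]
      refine div_ne_zero ?_ (by exact_mod_cast Real.pi_ne_zero)
      intro h
      simpa using congrArg Complex.re h
    positivity
  · have h1 := Real.Gamma_pos_of_pos (s := 1 / 2) (by norm_num)
    have h2 := Real.Gamma_pos_of_pos (s := m + 1 / 2) (by positivity)
    rw [hankelD, norm_mul]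
    have i1 := integrableOn_rpow_sub_one_mul_exp (a := 1 / 2) (by norm_num) hz
    have i2 := integrableOn_rpow_sub_one_mul_exp (a := m + 1 / 2) (by positivity) hz
    have hb : ‖∫ s in Ioi (0 : ℝ), (Complex.I - s) ^ m * Complex.exp ((Complex.I - s) * z) *
        hankelWeight s‖ ≤ 2 ^ m * Real.exp (-z.im) *
          ((1 / z.re) ^ (1 / 2 : ℝ) * Real.Gamma (1 / 2) +
            (1 / z.re) ^ (m + 1 / 2 : ℝ) * Real.Gamma (m + 1 / 2)) := by
      rw [← Real.integral_rpow_mul_exp_neg_mul_Ioi (by norm_num) hz,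
        ← Real.integral_rpow_mul_exp_neg_mul_Ioi (by positivity) hz, ← integral_add i1 i2,
        ← integral_const_mul]
      refine norm_integral_le_of_norm_le ((i1.add i2).const_mul _) ?_
      filter_upwards [ae_restrict_mem measurableSet_Ioi] with s hs
      exact norm_hankel_integrand_le m hs z
    have e1 : ∀ a : ℝ, (1 / z.re) ^ a = z.re ^ (-a) := fun a => by
      rw [one_div, Real.inv_rpow hz.le, Real.rpow_neg hz.le]
    rw [e1, e1] at hb
    have p1 : 0 < z.re ^ (-(1 / 2) : ℝ) := by positivity
    have p2 : 0 < z.re ^ (-(m + 1 / 2) : ℝ) := by positivity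
    calc _ ≤ ‖(1 - Complex.I) / Real.pi‖ * (2 ^ m * Real.exp (-z.im) *
          (z.re ^ (-(1 / 2) : ℝ) * Real.Gamma (1 / 2) +
            z.re ^ (-(m + 1 / 2) : ℝ) * Real.Gamma (m + 1 / 2))) := by gcongr
      _ ≤ ‖(1 - Complex.I) / Real.pi‖ * (2 ^ m * Real.exp (-z.im) *
          ((Real.Gamma (1 / 2) + Real.Gamma (m + 1 / 2)) *
            (z.re ^ (-(1 / 2) : ℝ) + z.re ^ (-(m + 1 / 2) : ℝ)))) := by
          gcongr
          nlinarith [mul_pos p1 h2, mul_pos p2 h1]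
      _ = _ := by ring

theorem hasDerivAt_hankelD (m : ℕ) {z : ℂ} (hz : 0 < z.re) :
    HasDerivAt (hankelD m) (hankelD (m + 1) z) z := by
  unfold hankelD
  refine HasDerivAt.const_mul _ ?_
  have hr : 0 < z.re / 2 := by positivity
  refine (hasDerivAt_integral_of_dominated_loc_of_deriv_le
    (F' := fun w s => (Complex.I - s) ^ (m + 1) * Complex.exp ((Complex.I - s) * w) *
      hankelWeight s)
    (bound := fun s : ℝ => 2 ^ (m + 1) * Real.exp (-z.im + z.re / 2) *
      (s ^ ((1 / 2 : ℝ) - 1) * Real.exp (-(z.re / 2 * s)) +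
        s ^ (((m + 1 : ℕ) + 1 / 2 : ℝ) - 1) * Real.exp (-(z.re / 2 * s))))
    (Metric.ball_mem_nhds z hr)
    (Eventually.of_forall fun w => aestronglyMeasurable_hankel_integrand m w)
    (integrableOn_hankel_integrand m hz) (aestronglyMeasurable_hankel_integrand (m + 1) z)
    ?_ ?_ ?_).2
  · filter_upwards [ae_restrict_mem measurableSet_Ioi] with s hs w hw
    have hs' : (0 : ℝ) < s := hs
    refine (norm_hankel_integrand_le (m + 1) hs w).trans ?_
    rw [Metric.mem_ball, dist_eq_norm] at hw
    have h1 : |w.re - z.re| < z.re / 2 := by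
      rw [← Complex.sub_re]; exact (Complex.abs_re_le_norm _).trans_lt hw
    have h2 : |w.im - z.im| < z.re / 2 := by
      rw [← Complex.sub_im]; exact (Complex.abs_im_le_norm _).trans_lt hw
    rw [abs_lt] at h1 h2
    have h3 : z.re / 2 ≤ w.re := by linarith
    have h4 : -w.im ≤ -z.im + z.re / 2 := by linarith
    gcongr
  · exact ((integrableOn_rpow_sub_one_mul_exp (by norm_num) hr).add
      (integrableOn_rpow_sub_one_mul_exp (by positivity) hr)).const_mul _
  · refine Eventually.of_forall fun s w _ => ?_
    have : HasDerivAt (fun w : ℂ => Complex.exp ((Complex.I - s) * w))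
        (Complex.exp ((Complex.I - s) * w) * (Complex.I - s)) w := by
      simpa using ((hasDerivAt_id w).const_mul (Complex.I - (s : ℂ))).cexp
    refine ((this.const_mul ((Complex.I - (s : ℂ)) ^ m)).mul_const (hankelWeight s)).congr_deriv ?_
    ring

theorem hankelH0_eq {t : ℝ} (ht : 0 < t) : hankelH0 t = hankelD 0 t := by
  have key := integral_comp_mul_left_Ioi (fun u : ℝ => ((Real.exp (-u) * u ^ (-(1 / 2) : ℝ) : ℝ) : ℂ) *
        (1 + Complex.I * (u : ℂ) / (2 * (t : ℂ))) ^ (-(1 / 2) : ℂ)) 0 ht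
  have htc : (t : ℂ) ≠ 0 := by exact_mod_cast ht.ne'
  rw [mul_zero] at key
  have e1 : ∀ s ∈ Ioi (0 : ℝ), ((Real.exp (-(t * s)) * (t * s) ^ (-(1 / 2) : ℝ) : ℝ) : ℂ) *
      (1 + Complex.I * ((t * s : ℝ) : ℂ) / (2 * (t : ℂ))) ^ (-(1 / 2) : ℂ) =
      (((t ^ (-(1 / 2) : ℝ) : ℝ) : ℂ) * Complex.exp (-(Complex.I * t))) *
        ((Complex.I - s) ^ 0 * Complex.exp ((Complex.I - s) * t) * hankelWeight s) := by
    intro s hs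
    have hs' : (0 : ℝ) < s := hs
    have : Complex.I * ((t * s : ℝ) : ℂ) / (2 * (t : ℂ)) = Complex.I * (s : ℂ) / 2 := by
      push_cast; field_simp
    rw [this, hankelWeight, Real.mul_rpow ht.le hs'.le]
    have e2 : Complex.exp ((Complex.I - s) * t) =
        Complex.exp (Complex.I * t) * Complex.exp (-(t * s)) := by
      rw [← Complex.exp_add]; congr 1; ring
    have e3 : Complex.exp (-(Complex.I * t)) * Complex.exp (Complex.I * t) = 1 := by
      rw [← Complex.exp_add]; simp
    rw [e2]
    push_cast
    linear_combination (-(((t ^ (-(1 / 2) : ℝ) : ℝ) : ℂ)) * Complex.exp (-(t * s)) *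
      ((s ^ (-(1 / 2) : ℝ) : ℝ) : ℂ) * (1 + Complex.I * (s : ℂ) / 2) ^ (-(1 / 2) : ℂ)) * e3
  rw [setIntegral_congr_fun measurableSet_Ioi e1, integral_const_mul] at key
  rw [hankelH0, hankelD]
  have key2 : (∫ u in Ioi (0 : ℝ), ((Real.exp (-u) * u ^ (-(1 / 2) : ℝ) : ℝ) : ℂ) *
        (1 + Complex.I * (u : ℂ) / (2 * (t : ℂ))) ^ (-(1 / 2) : ℂ)) =
      t * ((((t ^ (-(1 / 2) : ℝ) : ℝ) : ℂ) * Complex.exp (-(Complex.I * t))) *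
      ∫ s in Ioi (0 : ℝ), (Complex.I - s) ^ 0 * Complex.exp ((Complex.I - s) * t) *
        hankelWeight s) := by
    rw [key, Complex.real_smul, ← mul_assoc, Complex.ofReal_inv, mul_inv_cancel₀ htc, one_mul]
  rw [key2]
  have e4 : Complex.exp (Complex.I * ((t : ℂ) - (Real.pi : ℂ) / 4)) *
      Complex.exp (-(Complex.I * t)) = (1 - Complex.I) * ((Real.sqrt 2 : ℝ) : ℂ)⁻¹ := by
    rw [← Complex.exp_add]
    have : Complex.I * ((t : ℂ) - (Real.pi : ℂ) / 4) + -(Complex.I * t) =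
        ((-(Real.pi / 4) : ℝ) : ℂ) * Complex.I := by push_cast; ring
    rw [this, Complex.exp_mul_I, ← Complex.ofReal_cos, ← Complex.ofReal_sin, Real.cos_neg,
      Real.sin_neg, Real.cos_pi_div_four, Real.sin_pi_div_four]
    have h2 : ((Real.sqrt 2 : ℝ) : ℂ) * ((Real.sqrt 2 : ℝ) : ℂ) = 2 := by
      rw [← Complex.ofReal_mul, Real.mul_self_sqrt (by norm_num)]; norm_num
    have h3 : ((Real.sqrt 2 : ℝ) : ℂ) ≠ 0 := by
      intro h; rw [h] at h2; norm_num at h2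
    field_simp
    push_cast
    linear_combination (1 / 2) * (1 - Complex.I) * h2
  have e5 : Real.sqrt (2 / (Real.pi * t)) * (Real.sqrt Real.pi)⁻¹ * t * t ^ (-(1 / 2) : ℝ) *
      (Real.sqrt 2)⁻¹ = Real.pi⁻¹ := by
    rw [Real.sqrt_div (by norm_num), Real.sqrt_mul Real.pi_pos.le, Real.rpow_neg ht.le,
      ← Real.sqrt_eq_rpow]
    have h1 : Real.sqrt 2 ≠ 0 := by positivity
    have h2 : Real.sqrt Real.pi ≠ 0 := by positivity
    have h3 : Real.sqrt t ≠ 0 := by positivity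
    have h4 := Real.mul_self_sqrt ht.le
    have h5 := Real.mul_self_sqrt Real.pi_pos.le
    have : Real.pi ≠ 0 := Real.pi_ne_zero
    field_simp
    nlinarith
  have e5' := congrArg (fun x : ℝ => (x : ℂ)) e5
  push_cast at e5'
  generalize (∫ s in Ioi (0 : ℝ), (Complex.I - s) ^ 0 * Complex.exp ((Complex.I - s) * t) *
        hankelWeight s) = J
  rw [div_eq_mul_inv (1 - Complex.I), ← e5']
  linear_combination ((Real.sqrt (2 / (Real.pi * t)) : ℝ) : ℂ) * ((Real.sqrt Real.pi : ℝ) : ℂ)⁻¹ * t *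
    ((t ^ (-(1 / 2) : ℝ) : ℝ) : ℂ) * J * e4

theorem hasDerivAt_sqrt_mul_one_add {s : ℝ} (hs : 0 < s) :
    HasDerivAt (fun s : ℝ => ((s ^ (1 / 2 : ℝ) : ℝ) : ℂ) *
      (1 + Complex.I * (s : ℂ) / 2) ^ (1 / 2 : ℂ)) (1 / 2 * (1 + Complex.I * s) * hankelWeight s)
      s := by
  have h1 : HasDerivAt (fun s : ℝ => ((s ^ (1 / 2 : ℝ) : ℝ) : ℂ))
      ((((1 / 2 : ℝ) * s ^ ((1 / 2 : ℝ) - 1) : ℝ)) : ℂ) s :=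
    (Real.hasDerivAt_rpow_const (Or.inl hs.ne')).ofReal_comp
  have h2 : HasDerivAt (fun s : ℝ => 1 + Complex.I * (s : ℂ) / 2) (Complex.I / 2) s := by
    have := ((Complex.ofRealCLM.hasDerivAt (x := s)).const_mul (Complex.I / 2)).const_add 1
    refine (this.congr_deriv (by simp)).congr_of_eventuallyEq (Eventually.of_forall fun y => ?_)
    simp; ring
  have h3 := (Complex.hasStrictDerivAt_cpow_const (c := 1 / 2)
    (one_add_I_mul_half_mem_slitPlane s)).hasDerivAt.comp s h2
  refine (h1.mul h3).congr_deriv ?_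
  have hne : 1 + Complex.I * (s : ℂ) / 2 ≠ 0 :=
    Complex.slitPlane_ne_zero (one_add_I_mul_half_mem_slitPlane s)
  have e1 : (1 + Complex.I * (s : ℂ) / 2) ^ (1 / 2 : ℂ) =
      (1 + Complex.I * (s : ℂ) / 2) * (1 + Complex.I * (s : ℂ) / 2) ^ (-(1 / 2) : ℂ) := by
    nth_rewrite 2 [← Complex.cpow_one (1 + Complex.I * (s : ℂ) / 2)]
    rw [← Complex.cpow_add _ _ hne]; norm_num
  have e2 : s ^ (1 / 2 : ℝ) = s * s ^ (-(1 / 2) : ℝ) := by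
    nth_rewrite 2 [← Real.rpow_one s]
    rw [← Real.rpow_add hs]; norm_num
  have e3 : ((1 / 2 : ℝ) - 1) = -(1 / 2) := by norm_num
  have e4 : ((1 / 2 : ℂ) - 1) = -(1 / 2) := by norm_num
  simp only [Function.comp_apply]
  rw [e3, e4, e1, e2, hankelWeight]
  push_cast
  ring

/-- Bessel's equation of order zero. -/
theorem bessel_hankelD {z : ℂ} (hz : 0 < z.re) :
    z * (hankelD 2 z + hankelD 0 z) + hankelD 1 z = 0 := by
  have i0 := integrableOn_hankel_integrand 0 hz
  have i1 := integrableOn_hankel_integrand 1 hz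
  have i2 := integrableOn_hankel_integrand 2 hz
  set g : ℝ → ℂ := fun s => (-2 * Complex.I) * (((s ^ (1 / 2 : ℝ) : ℝ) : ℂ) *
      (1 + Complex.I * (s : ℂ) / 2) ^ (1 / 2 : ℂ)) * Complex.exp ((Complex.I - s) * z) with hg
  have hint := (((i2.add i0).const_mul z).add i1).neg
  have hd : ∀ s ∈ Ioi (0 : ℝ), HasDerivAt g
      (-(z * ((Complex.I - s) ^ 2 * Complex.exp ((Complex.I - s) * z) * hankelWeight s +
        (Complex.I - s) ^ 0 * Complex.exp ((Complex.I - s) * z) * hankelWeight s) +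
        (Complex.I - s) ^ 1 * Complex.exp ((Complex.I - s) * z) * hankelWeight s)) s := by
    intro s hs
    have hs' : (0 : ℝ) < s := hs
    have h1 : HasDerivAt (fun s : ℝ => Complex.exp ((Complex.I - s) * z))
        (Complex.exp ((Complex.I - s) * z) * (-1 * z)) s := by
      refine HasDerivAt.cexp (HasDerivAt.mul_const ?_ z)
      simpa using (Complex.ofRealCLM.hasDerivAt (x := s)).const_sub Complex.I
    refine (((hasDerivAt_sqrt_mul_one_add hs').const_mul (-2 * Complex.I)).mul h1).congr_deriv ?_
    have hne : 1 + Complex.I * (s : ℂ) / 2 ≠ 0 :=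
      Complex.slitPlane_ne_zero (one_add_I_mul_half_mem_slitPlane s)
    have e1 : (1 + Complex.I * (s : ℂ) / 2) ^ (1 / 2 : ℂ) =
        (1 + Complex.I * (s : ℂ) / 2) * (1 + Complex.I * (s : ℂ) / 2) ^ (-(1 / 2) : ℂ) := by
      nth_rewrite 2 [← Complex.cpow_one (1 + Complex.I * (s : ℂ) / 2)]
      rw [← Complex.cpow_add _ _ hne]; norm_num
    have e2 : s ^ (1 / 2 : ℝ) = s * s ^ (-(1 / 2) : ℝ) := by
      nth_rewrite 2 [← Real.rpow_one s]
      rw [← Real.rpow_add hs']; norm_num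
    rw [e1, e2, hankelWeight]
    have hI := Complex.I_sq
    push_cast
    generalize (1 + Complex.I * (s : ℂ) / 2) ^ (-(1 / 2) : ℂ) = a
    generalize ((s ^ (-(1 / 2) : ℝ) : ℝ) : ℂ) = b
    generalize Complex.exp ((Complex.I - s) * z) = c
    linear_combination (-(s : ℂ) * b * a * c + z * b * a * c + s ^ 2 * b * a * c * z) * hI
  have hc : ContinuousWithinAt g (Ici 0) 0 := by
    refine ContinuousAt.continuousWithinAt ?_
    refine ContinuousAt.mul (ContinuousAt.mul continuousAt_const (ContinuousAt.mul ?_ ?_)) ?_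
    · exact Complex.continuous_ofReal.continuousAt.comp
        (Real.continuousAt_rpow_const _ _ (Or.inr (by norm_num)))
    · exact ContinuousAt.cpow (by fun_prop) continuousAt_const (one_add_I_mul_half_mem_slitPlane 0)
    · fun_prop
  have hinf : Tendsto g atTop (𝓝 0) := by
    have h2 : Tendsto (fun s : ℝ => 2 * Real.exp (-z.im) * ((s ^ (1 / 2 : ℝ) *
        Real.exp (-z.re * s)) + s ^ (3 / 2 : ℝ) * Real.exp (-z.re * s))) atTop (𝓝 0) := by
      have := ((tendsto_rpow_mul_exp_neg_mul_atTop_nhds_zero (1 / 2) z.re hz).add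
        (tendsto_rpow_mul_exp_neg_mul_atTop_nhds_zero (3 / 2) z.re hz)).const_mul
          (2 * Real.exp (-z.im))
      simpa using this
    refine squeeze_zero_norm' ?_ h2
    filter_upwards [eventually_gt_atTop 0] with s hs
    rw [hg]
    simp only [norm_mul, norm_exp_I_sub_mul]
    have e1 : ‖(1 + Complex.I * (s : ℂ) / 2) ^ (1 / 2 : ℂ)‖ ≤ 1 + s := by
      have := Complex.norm_cpow_real (1 + Complex.I * (s : ℂ) / 2) (1 / 2)
      push_cast at this
      rw [this]
      have h3 : ‖1 + Complex.I * (s : ℂ) / 2‖ ≤ 1 + s := by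
        refine (norm_add_le _ _).trans ?_
        simp [abs_of_pos hs]; linarith
      calc _ ≤ ‖1 + Complex.I * (s : ℂ) / 2‖ ^ (1 : ℝ) :=
            Real.rpow_le_rpow_of_exponent_le (norm_one_add_I_mul_half_ge_one s) (by norm_num)
        _ ≤ _ := by rwa [Real.rpow_one]
    have e2 : s ^ (3 / 2 : ℝ) = s ^ (1 / 2 : ℝ) * s := by
      nth_rewrite 3 [← Real.rpow_one s]
      rw [← Real.rpow_add hs]; norm_num
    rw [e2, Complex.norm_real, Real.norm_of_nonneg (by positivity)]
    simp only [norm_neg, Complex.norm_ofNat, Complex.norm_I, mul_one]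
    rw [← neg_mul]
    calc _ ≤ 2 * (s ^ (1 / 2 : ℝ) * (1 + s)) * (Real.exp (-z.im) * Real.exp (-z.re * s)) := by
          gcongr
      _ = _ := by ring
  have key := integral_Ioi_of_hasDerivAt_of_tendsto hc hd hint hinf
  have hg0 : g 0 = 0 := by simp [hg]
  rw [hg0, sub_zero, integral_neg, neg_eq_zero] at key
  have i2' : IntegrableOn (fun s : ℝ => z * ((Complex.I - s) ^ 2 *
      Complex.exp ((Complex.I - s) * z) * hankelWeight s + (Complex.I - s) ^ 0 *
      Complex.exp ((Complex.I - s) * z) * hankelWeight s)) (Ioi 0) := (i2.add i0).const_mul z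
  rw [integral_add i2' i1, integral_const_mul, integral_add i2 i0] at key
  unfold hankelD
  linear_combination ((1 - Complex.I) / Real.pi) * key

theorem norm_I_sub_mul_hankelWeight_add_le {s : ℝ} (hs : 0 < s) :
    ‖(Complex.I - s) * hankelWeight s + (1 - Complex.I)‖ ≤ 4 * s ^ (-(1 / 2) : ℝ) := by
  have hne : 1 + Complex.I * (s : ℂ) / 2 ≠ 0 :=
    Complex.slitPlane_ne_zero (one_add_I_mul_half_mem_slitPlane s)
  set ξ : ℂ := s * hankelWeight s with hξ
  have hsq : ξ ^ 2 * (1 + Complex.I * (s : ℂ) / 2) = s := by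
    have e1 : ((1 + Complex.I * (s : ℂ) / 2) ^ (-(1 / 2) : ℂ)) ^ 2 *
        (1 + Complex.I * (s : ℂ) / 2) = 1 := by
      rw [← Complex.cpow_nat_mul]
      norm_num
      rw [Complex.cpow_neg_one, inv_mul_cancel₀ hne]
    have e2 : (s ^ (-(1 / 2) : ℝ)) ^ 2 * s = 1 := by
      rw [← Real.rpow_natCast, ← Real.rpow_mul hs.le]
      norm_num
      rw [Real.rpow_neg_one, inv_mul_cancel₀ hs.ne']
    have e2' : (((s ^ (-(1 / 2) : ℝ) : ℝ) : ℂ)) ^ 2 * s = 1 := by exact_mod_cast e2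
    rw [hξ, hankelWeight]
    linear_combination (s : ℂ) * e1 * (((s ^ (-(1 / 2) : ℝ) : ℝ) : ℂ) ^ 2 * s) + (s : ℂ) * e2'
  have hre : 0 ≤ ξ.re := by
    have h1 : 0 ≤ ((1 + Complex.I * (s : ℂ) / 2) ^ (-(1 / 2) : ℂ)).re := by
      have harg : |(1 + Complex.I * (s : ℂ) / 2).arg| ≤ Real.pi / 2 :=
        Complex.abs_arg_le_pi_div_two_iff.2 (by simp)
      rw [Complex.cpow_def_of_ne_zero hne, Complex.exp_re]
      refine mul_nonneg (Real.exp_pos _).le (Real.cos_nonneg_of_neg_pi_div_two_le_of_le ?_ ?_)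
      all_goals
        have : (Complex.log (1 + Complex.I * (s : ℂ) / 2) * -(1 / 2)).im =
          -(1 / 2) * (1 + Complex.I * (s : ℂ) / 2).arg := by
            simp [Complex.mul_im, Complex.log_im]
            try ring
        rw [this]
        have := abs_le.1 harg
        linarith [Real.pi_pos]
    rw [hξ, hankelWeight, ← mul_assoc, ← Complex.ofReal_mul, Complex.re_ofReal_mul]
    positivity
  have hfac : (ξ - (1 - Complex.I)) * (ξ + (1 - Complex.I)) * (1 + Complex.I * (s : ℂ) / 2) =
      2 * Complex.I := by
    linear_combination hsq + (-(s : ℂ) * Complex.I / 2 + (s : ℂ) - 1) * Complex.I_sq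
  have hden : 1 ≤ ‖ξ + (1 - Complex.I)‖ := by
    have := Complex.abs_re_le_norm (ξ + (1 - Complex.I))
    simp at this
    exact le_trans (by rw [abs_of_nonneg] <;> linarith) this
  have hD : s ^ (1 / 2 : ℝ) ≤ ‖1 + Complex.I * (s : ℂ) / 2‖ * (3 / 2) := by
    have h1 := norm_one_add_I_mul_half_ge_one s
    have h2 := norm_one_add_I_mul_half_ge hs
    have h3 : s ^ (1 / 2 : ℝ) ≤ (1 + s) / 2 := by
      rw [← Real.sqrt_eq_rpow]
      nlinarith [Real.sq_sqrt hs.le, sq_nonneg (Real.sqrt s - 1)]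
    linarith
  have hsub : ‖ξ - (1 - Complex.I)‖ ≤ 3 * s ^ (-(1 / 2) : ℝ) := by
    have h1 := congrArg norm hfac
    rw [norm_mul, norm_mul] at h1
    simp only [norm_mul, Complex.norm_ofNat, Complex.norm_I, mul_one] at h1
    have h0 := norm_nonneg (ξ - (1 - Complex.I))
    have hp : 0 < s ^ (1 / 2 : ℝ) := by positivity
    rw [Real.rpow_neg hs.le, ← div_eq_mul_inv, le_div_iff₀ hp]
    have h4 : ‖ξ - (1 - Complex.I)‖ * ‖1 + Complex.I * (s : ℂ) / 2‖ ≤ 2 := by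
      rw [← h1]
      have : ‖ξ - (1 - Complex.I)‖ * 1 * ‖1 + Complex.I * (s : ℂ) / 2‖ ≤
        ‖ξ - (1 - Complex.I)‖ * ‖ξ + (1 - Complex.I)‖ * ‖1 + Complex.I * (s : ℂ) / 2‖ := by gcongr
      simpa using this
    nlinarith
  have hw := norm_hankelWeight_le hs
  calc _ = ‖Complex.I * hankelWeight s - (ξ - (1 - Complex.I))‖ := by rw [hξ]; congr 1; ring
    _ ≤ ‖Complex.I * hankelWeight s‖ + ‖ξ - (1 - Complex.I)‖ := norm_sub_le _ _
    _ ≤ s ^ (-(1 / 2) : ℝ) + 3 * s ^ (-(1 / 2) : ℝ) := by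
      gcongr
      simpa using hw
    _ = _ := by ring

/-- The singularity of the derivative of the Hankel function. -/
theorem norm_hankelD_one_sub_le : ∃ C : ℝ, 0 < C ∧ ∀ z : ℂ, 0 < z.re →
    ‖hankelD 1 z - 2 * Complex.I / Real.pi * Complex.exp (Complex.I * z) / z‖ ≤
      C * Real.exp (-z.im) * z.re ^ (-(1 / 2) : ℝ) := by
  have hCpos : 0 < ‖(1 - Complex.I) / (Real.pi : ℂ)‖ := by
    rw [norm_pos_iff]
    refine div_ne_zero ?_ (by exact_mod_cast Real.pi_ne_zero)
    intro h
    simpa using congrArg Complex.re h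
  have hG := Real.Gamma_pos_of_pos (s := 1 / 2) (by norm_num)
  refine ⟨‖(1 - Complex.I) / (Real.pi : ℂ)‖ * (4 * Real.Gamma (1 / 2)), by positivity,
    fun z hz => ?_⟩
  have hz0 : z ≠ 0 := by rintro rfl; simp at hz
  have hexp : ∫ s in Ioi (0 : ℝ), Complex.exp ((Complex.I - s) * z) =
      Complex.exp (Complex.I * z) / z := by
    have h1 := integral_exp_mul_complex_Ioi (a := -z) (by simpa using hz) 0
    have : ∀ s : ℝ, Complex.exp ((Complex.I - s) * z) =
        Complex.exp (Complex.I * z) * Complex.exp (-z * s) := fun s => by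
      rw [← Complex.exp_add]; congr 1; ring
    simp_rw [this]
    rw [integral_const_mul, h1]
    simp
    rw [div_eq_mul_inv]
  have hexpi : IntegrableOn (fun s : ℝ => Complex.exp ((Complex.I - s) * z)) (Ioi 0) := by
    have h1 := (integrableOn_exp_mul_complex_Ioi (a := -z) (by simpa using hz) 0).const_mul
      (Complex.exp (Complex.I * z))
    refine IntegrableOn.congr_fun h1 (fun s _ => ?_) measurableSet_Ioi
    rw [← Complex.exp_add]; congr 1; ring
  have i1 := integrableOn_hankel_integrand 1 hz
  have e1 : hankelD 1 z - 2 * Complex.I / Real.pi * Complex.exp (Complex.I * z) / z =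
      (1 - Complex.I) / Real.pi * ∫ s in Ioi (0 : ℝ), Complex.exp ((Complex.I - s) * z) *
        ((Complex.I - s) * hankelWeight s + (1 - Complex.I)) := by
    have : ∀ s : ℝ, Complex.exp ((Complex.I - s) * z) *
        ((Complex.I - s) * hankelWeight s + (1 - Complex.I)) = (Complex.I - s) ^ 1 *
          Complex.exp ((Complex.I - s) * z) * hankelWeight s +
          (1 - Complex.I) * Complex.exp ((Complex.I - s) * z) := fun s => by ring
    simp_rw [this]
    rw [integral_add i1 (hexpi.const_mul _), integral_const_mul, hexp, hankelD]
    generalize (∫ s in Ioi (0 : ℝ), (Complex.I - s) ^ 1 * Complex.exp ((Complex.I - s) * z) *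
      hankelWeight s) = J
    have hpi : (Real.pi : ℂ) ≠ 0 := by exact_mod_cast Real.pi_ne_zero
    field_simp
    linear_combination (-Complex.exp (Complex.I * z)) * Complex.I_sq
  rw [e1, norm_mul, mul_assoc, mul_assoc]
  refine mul_le_mul_of_nonneg_left ?_ (norm_nonneg _)
  have hI := integrableOn_rpow_sub_one_mul_exp (a := 1 / 2) (by norm_num) hz
  have e2 : 4 * Real.Gamma (1 / 2) * (Real.exp (-z.im) * z.re ^ (-(1 / 2) : ℝ)) =
      ∫ s in Ioi (0 : ℝ), 4 * Real.exp (-z.im) * (s ^ ((1 / 2 : ℝ) - 1) *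
        Real.exp (-(z.re * s))) := by
    rw [integral_const_mul, Real.integral_rpow_mul_exp_neg_mul_Ioi (by norm_num) hz,
      one_div z.re, Real.inv_rpow hz.le, Real.rpow_neg hz.le]
    ring
  rw [← mul_assoc, mul_assoc (4 : ℝ)] at *
  rw [e2]
  refine norm_integral_le_of_norm_le (hI.const_mul _) ?_
  filter_upwards [ae_restrict_mem measurableSet_Ioi] with s hs
  rw [norm_mul, norm_exp_I_sub_mul]
  have h5 := norm_I_sub_mul_hankelWeight_add_le (s := s) hs
  have e3 : s ^ ((1 / 2 : ℝ) - 1) = s ^ (-(1 / 2) : ℝ) := by norm_num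
  rw [e3]
  calc _ ≤ Real.exp (-z.im) * Real.exp (-(z.re * s)) * (4 * s ^ (-(1 / 2) : ℝ)) := by gcongr
    _ = _ := by ring

/-! ### The Fourier transform of the fundamental solution -/

theorem hasDerivAt_sqrt_sq_add_sq {x y : ℝ} (h : 0 < x ^ 2 + y ^ 2) :
    HasDerivAt (fun y : ℝ => Real.sqrt (x ^ 2 + y ^ 2)) (y / Real.sqrt (x ^ 2 + y ^ 2)) y := by
  have h1 : HasDerivAt (fun y : ℝ => x ^ 2 + y ^ 2) (2 * y) y := by
    simpa using ((hasDerivAt_id y).pow 2).const_add (x ^ 2)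
  refine (h1.sqrt h.ne').congr_deriv ?_
  have : Real.sqrt (x ^ 2 + y ^ 2) ≠ 0 := (Real.sqrt_pos.2 h).ne'
  field_simp

theorem re_mul_ofReal_pos {k : ℂ} (hk : 0 < k.re) {r : ℝ} (hr : 0 < r) : 0 < (k * r).re := by
  rw [Complex.re_mul_ofReal]; positivity

theorem hasDerivAt_hankelD_comp_sqrt (m : ℕ) {k : ℂ} (hk : 0 < k.re) {x y : ℝ}
    (h : 0 < x ^ 2 + y ^ 2) :
    HasDerivAt (fun y : ℝ => hankelD m (k * Real.sqrt (x ^ 2 + y ^ 2)))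
      (k * (y / Real.sqrt (x ^ 2 + y ^ 2) : ℝ) *
        hankelD (m + 1) (k * Real.sqrt (x ^ 2 + y ^ 2))) y := by
  have h1 := ((hasDerivAt_sqrt_sq_add_sq h).ofReal_comp).const_mul k
  have h2 := (hasDerivAt_hankelD m (re_mul_ofReal_pos hk (Real.sqrt_pos.2 h))).comp y h1
  exact h2.congr_deriv (by ring)

/-- The derivative of `H₀⁽¹⁾(k√(x²+y²))` with respect to `y`. -/
noncomputable def hankelGrad (k : ℂ) (x y : ℝ) : ℂ :=
  k * (y / Real.sqrt (x ^ 2 + y ^ 2) : ℝ) * hankelD 1 (k * Real.sqrt (x ^ 2 + y ^ 2))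

/-- The second derivative of `H₀⁽¹⁾(k√(x²+y²))` with respect to `y`. -/
noncomputable def hankelHess (k : ℂ) (x y : ℝ) : ℂ :=
  k ^ 2 * (y ^ 2 / Real.sqrt (x ^ 2 + y ^ 2) ^ 2 : ℝ) *
      hankelD 2 (k * Real.sqrt (x ^ 2 + y ^ 2)) +
    k * (x ^ 2 / Real.sqrt (x ^ 2 + y ^ 2) ^ 3 : ℝ) * hankelD 1 (k * Real.sqrt (x ^ 2 + y ^ 2))

theorem hasDerivAt_hankel_radial {k : ℂ} (hk : 0 < k.re) {x y : ℝ} (h : 0 < x ^ 2 + y ^ 2) :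
    HasDerivAt (fun y : ℝ => hankelD 0 (k * Real.sqrt (x ^ 2 + y ^ 2))) (hankelGrad k x y) y :=
  hasDerivAt_hankelD_comp_sqrt 0 hk h

theorem hasDerivAt_hankelGrad {k : ℂ} (hk : 0 < k.re) {x y : ℝ} (h : 0 < x ^ 2 + y ^ 2) :
    HasDerivAt (fun y : ℝ => hankelGrad k x y) (hankelHess k x y) y := by
  have hr : Real.sqrt (x ^ 2 + y ^ 2) ≠ 0 := (Real.sqrt_pos.2 h).ne'
  have hsq : Real.sqrt (x ^ 2 + y ^ 2) ^ 2 = x ^ 2 + y ^ 2 := Real.sq_sqrt h.le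
  have h1 : HasDerivAt (fun y : ℝ => y / Real.sqrt (x ^ 2 + y ^ 2))
      (x ^ 2 / Real.sqrt (x ^ 2 + y ^ 2) ^ 3) y := by
    refine ((hasDerivAt_id y).div (hasDerivAt_sqrt_sq_add_sq h) hr).congr_deriv ?_
    simp only [id]
    field_simp
    rw [hsq]; ring
  have h2 := ((h1.ofReal_comp).const_mul k).mul (hasDerivAt_hankelD_comp_sqrt 1 hk h)
  refine h2.congr_deriv ?_
  rw [hankelHess]
  push_cast
  ring

theorem hankelHess_add_hankelHess {k : ℂ} (hk : 0 < k.re) {x y : ℝ} (h : 0 < x ^ 2 + y ^ 2) :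
    hankelHess k x y + hankelHess k y x =
      -k ^ 2 * hankelD 0 (k * Real.sqrt (x ^ 2 + y ^ 2)) := by
  have hr : 0 < Real.sqrt (x ^ 2 + y ^ 2) := Real.sqrt_pos.2 h
  have hB := bessel_hankelD (re_mul_ofReal_pos hk hr)
  have hsq : Real.sqrt (x ^ 2 + y ^ 2) ^ 2 = x ^ 2 + y ^ 2 := Real.sq_sqrt h.le
  have hsqc : ((Real.sqrt (x ^ 2 + y ^ 2) : ℝ) : ℂ) ^ 2 = (x : ℂ) ^ 2 + (y : ℂ) ^ 2 := by
    exact_mod_cast hsq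
  have hrc : ((Real.sqrt (x ^ 2 + y ^ 2) : ℝ) : ℂ) ≠ 0 := by exact_mod_cast hr.ne'
  rw [hankelHess, hankelHess, add_comm (y ^ 2) (x ^ 2)]
  generalize Real.sqrt (x ^ 2 + y ^ 2) = r at *
  push_cast
  field_simp
  linear_combination k * ((r : ℂ) * k * hankelD 2 (k * r) + hankelD 1 (k * r)) * (-hsqc) +
    k * (r : ℂ) ^ 2 * hB

theorem integrable_comp_abs {f : ℝ → ℝ} (hf : IntegrableOn f (Ioi 0)) :
    Integrable fun x : ℝ => f |x| := by
  have h1 : IntegrableOn (fun x => f |x|) (Ioi 0) :=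
    hf.congr_fun (fun x hx => by rw [abs_of_pos (show (0 : ℝ) < x from hx)]) measurableSet_Ioi
  have h2 : IntegrableOn (fun x => f |x|) (Iic 0) := by
    rw [← Measure.map_neg_eq_self (volume : Measure ℝ)]
    let m : MeasurableEmbedding fun x : ℝ => -x := (Homeomorph.neg ℝ).measurableEmbedding
    rw [m.integrableOn_map_iff]
    simp_rw [Function.comp_def, abs_neg, neg_preimage, neg_Iic, neg_zero]
    exact Iff.mpr integrableOn_Ici_iff_integrableOn_Ioi h1
  rw [← integrableOn_univ, ← Iic_union_Ioi (a := (0 : ℝ))]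
  exact h2.union h1

theorem integrable_exp_neg_mul_abs {ε : ℝ} (hε : 0 < ε) :
    Integrable fun x : ℝ => Real.exp (-(ε * |x|)) := by
  have h1 : IntegrableOn (fun x : ℝ => Real.exp (-(ε * x))) (Ioi 0) := by
    simpa [neg_mul] using exp_neg_integrableOn_Ioi 0 hε
  exact integrable_comp_abs h1

theorem le_sqrt_sq_add_sq_left (x y : ℝ) : |x| ≤ Real.sqrt (x ^ 2 + y ^ 2) := by
  rw [← Real.sqrt_sq_eq_abs]
  exact Real.sqrt_le_sqrt (by nlinarith [sq_nonneg y])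

theorem le_sqrt_sq_add_sq_right (x y : ℝ) : |y| ≤ Real.sqrt (x ^ 2 + y ^ 2) := by
  rw [← Real.sqrt_sq_eq_abs]
  exact Real.sqrt_le_sqrt (by nlinarith [sq_nonneg x])

theorem continuous_hankelD_sqrt (m : ℕ) {k : ℂ} (hk : 0 < k.re) {y : ℝ} (hy : y ≠ 0) :
    Continuous fun x : ℝ => hankelD m (k * Real.sqrt (x ^ 2 + y ^ 2)) := by
  rw [continuous_iff_continuousAt]
  intro x
  have hr : 0 < Real.sqrt (x ^ 2 + y ^ 2) := Real.sqrt_pos.2 (by positivity)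
  refine ContinuousAt.comp (f := fun x : ℝ => k * (Real.sqrt (x ^ 2 + y ^ 2) : ℂ))
    (hasDerivAt_hankelD m (re_mul_ofReal_pos hk hr)).continuousAt ?_
  fun_prop

theorem sqrt_sq_add_sq_ne_zero (x : ℝ) {y : ℝ} (hy : y ≠ 0) : Real.sqrt (x ^ 2 + y ^ 2) ≠ 0 :=
  (Real.sqrt_pos.2 (by positivity)).ne'

theorem continuous_hankelGrad {k : ℂ} (hk : 0 < k.re) {y : ℝ} (hy : y ≠ 0) :
    Continuous fun x : ℝ => hankelGrad k x y := by
  unfold hankelGrad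
  refine Continuous.mul (continuous_const.mul (Complex.continuous_ofReal.comp
    (Continuous.div (by fun_prop) (by fun_prop) fun x => sqrt_sq_add_sq_ne_zero x hy)))
    (continuous_hankelD_sqrt 1 hk hy)

theorem continuous_hankelGrad_swap {k : ℂ} (hk : 0 < k.re) {y : ℝ} (hy : y ≠ 0) :
    Continuous fun x : ℝ => hankelGrad k y x := by
  unfold hankelGrad
  simp_rw [add_comm (y ^ 2)]
  refine Continuous.mul (continuous_const.mul (Complex.continuous_ofReal.comp
    (Continuous.div (by fun_prop) (by fun_prop) fun x => sqrt_sq_add_sq_ne_zero x hy)))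
    (continuous_hankelD_sqrt 1 hk hy)

theorem continuous_hankelHess {k : ℂ} (hk : 0 < k.re) {y : ℝ} (hy : y ≠ 0) :
    Continuous fun x : ℝ => hankelHess k x y := by
  unfold hankelHess
  refine Continuous.add (Continuous.mul (continuous_const.mul (Complex.continuous_ofReal.comp
    (Continuous.div (by fun_prop) (by fun_prop) fun x =>
      pow_ne_zero 2 (sqrt_sq_add_sq_ne_zero x hy)))) (continuous_hankelD_sqrt 2 hk hy))
    (Continuous.mul (continuous_const.mul (Complex.continuous_ofReal.comp
    (Continuous.div (by fun_prop) (by fun_prop) fun x =>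
      pow_ne_zero 3 (sqrt_sq_add_sq_ne_zero x hy)))) (continuous_hankelD_sqrt 1 hk hy))

section ComplexWaveNumber

variable {k : ℂ}

theorem norm_hankelD_sqrt_le_exp (hk : 0 < k.re) (hk' : 0 < k.im) (m : ℕ) {y₀ : ℝ} (hy₀ : 0 < y₀) :
    ∃ C : ℝ, 0 ≤ C ∧ ∀ x y : ℝ, y₀ ≤ y →
      ‖hankelD m (k * Real.sqrt (x ^ 2 + y ^ 2))‖ ≤ C * Real.exp (-(k.im * |x|)) := by
  obtain ⟨C, hC, h⟩ := norm_hankelD_le m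
  refine ⟨C * ((k.re * y₀) ^ (-(1 / 2) : ℝ) + (k.re * y₀) ^ (-(m + 1 / 2) : ℝ)), by positivity,
    fun x y hy => ?_⟩
  have hr : y₀ ≤ Real.sqrt (x ^ 2 + y ^ 2) :=
    (hy.trans (le_abs_self y)).trans (le_sqrt_sq_add_sq_right x y)
  have hr0 : 0 < Real.sqrt (x ^ 2 + y ^ 2) := hy₀.trans_le hr
  have h1 := h _ (re_mul_ofReal_pos hk hr0)
  rw [Complex.re_mul_ofReal, Complex.im_mul_ofReal] at h1
  refine h1.trans ?_
  have e1 : (k.re * Real.sqrt (x ^ 2 + y ^ 2)) ^ (-(1 / 2) : ℝ) ≤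
      (k.re * y₀) ^ (-(1 / 2) : ℝ) :=
    Real.rpow_le_rpow_of_nonpos (by positivity) (by gcongr) (by norm_num)
  have e2 : (k.re * Real.sqrt (x ^ 2 + y ^ 2)) ^ (-(m + 1 / 2) : ℝ) ≤
      (k.re * y₀) ^ (-(m + 1 / 2) : ℝ) :=
    Real.rpow_le_rpow_of_nonpos (by positivity) (by gcongr) (by
      have : (0 : ℝ) ≤ m := by positivity
      linarith)
  have e3 : Real.exp (-(k.im * Real.sqrt (x ^ 2 + y ^ 2))) ≤ Real.exp (-(k.im * |x|)) := by
    have := le_sqrt_sq_add_sq_left x y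
    gcongr
  calc _ ≤ C * Real.exp (-(k.im * |x|)) * ((k.re * y₀) ^ (-(1 / 2) : ℝ) +
        (k.re * y₀) ^ (-(m + 1 / 2) : ℝ)) := by gcongr
    _ = _ := by ring

theorem norm_hankelGrad_le (x y : ℝ) :
    ‖hankelGrad k x y‖ ≤ ‖k‖ * ‖hankelD 1 (k * Real.sqrt (x ^ 2 + y ^ 2))‖ := by
  rw [hankelGrad, norm_mul, norm_mul, Complex.norm_real, Real.norm_eq_abs, abs_div,
    abs_of_nonneg (Real.sqrt_nonneg _)]
  have := div_le_one_of_le₀ (le_sqrt_sq_add_sq_right x y) (Real.sqrt_nonneg _)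
  gcongr
  exact mul_le_of_le_one_right (norm_nonneg _) this

theorem norm_hankelHess_le {x y : ℝ} (h : 0 < x ^ 2 + y ^ 2) :
    ‖hankelHess k x y‖ ≤ ‖k‖ ^ 2 * ‖hankelD 2 (k * Real.sqrt (x ^ 2 + y ^ 2))‖ +
      ‖k‖ * (Real.sqrt (x ^ 2 + y ^ 2))⁻¹ * ‖hankelD 1 (k * Real.sqrt (x ^ 2 + y ^ 2))‖ := by
  have hr : 0 < Real.sqrt (x ^ 2 + y ^ 2) := Real.sqrt_pos.2 h
  have hsq : Real.sqrt (x ^ 2 + y ^ 2) ^ 2 = x ^ 2 + y ^ 2 := Real.sq_sqrt h.le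
  refine (norm_add_le _ _).trans ?_
  rw [norm_mul, norm_mul, norm_mul, norm_mul, Complex.norm_real, Complex.norm_real, norm_pow,
    Real.norm_of_nonneg (by positivity), Real.norm_of_nonneg (by positivity)]
  have h1 : y ^ 2 / Real.sqrt (x ^ 2 + y ^ 2) ^ 2 ≤ 1 := by
    rw [div_le_one (by positivity), hsq]; nlinarith [sq_nonneg x]
  have h2 : x ^ 2 / Real.sqrt (x ^ 2 + y ^ 2) ^ 3 ≤ (Real.sqrt (x ^ 2 + y ^ 2))⁻¹ := by
    have e : (Real.sqrt (x ^ 2 + y ^ 2))⁻¹ * Real.sqrt (x ^ 2 + y ^ 2) ^ 3 =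
        Real.sqrt (x ^ 2 + y ^ 2) ^ 2 := by field_simp
    rw [div_le_iff₀ (by positivity), e, hsq]; nlinarith [sq_nonneg y]
  gcongr
  exact mul_le_of_le_one_right (by positivity) h1

theorem exists_hankel_exp_bound (hk : 0 < k.re) (hk' : 0 < k.im) {y₀ : ℝ} (hy₀ : 0 < y₀) :
    ∃ C : ℝ, 0 ≤ C ∧ ∀ x y : ℝ, y₀ ≤ y →
      ‖hankelD 0 (k * Real.sqrt (x ^ 2 + y ^ 2))‖ ≤ C * Real.exp (-(k.im * |x|)) ∧
      ‖hankelGrad k x y‖ ≤ C * Real.exp (-(k.im * |x|)) ∧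
      ‖hankelGrad k y x‖ ≤ C * Real.exp (-(k.im * |x|)) ∧
      ‖hankelHess k x y‖ ≤ C * Real.exp (-(k.im * |x|)) ∧
      ‖hankelHess k y x‖ ≤ C * Real.exp (-(k.im * |x|)) := by
  obtain ⟨C0, hC0, h0⟩ := norm_hankelD_sqrt_le_exp hk hk' 0 hy₀
  obtain ⟨C1, hC1, h1⟩ := norm_hankelD_sqrt_le_exp hk hk' 1 hy₀
  obtain ⟨C2, hC2, h2⟩ := norm_hankelD_sqrt_le_exp hk hk' 2 hy₀
  refine ⟨C0 + ‖k‖ * C1 + (‖k‖ ^ 2 * C2 + ‖k‖ * y₀⁻¹ * C1), by positivity, fun x y hy => ?_⟩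
  have hpos : 0 < x ^ 2 + y ^ 2 := by
    have : 0 < y := hy₀.trans_le hy
    positivity
  have hE := Real.exp_pos (-(k.im * |x|))
  have hr : y₀ ≤ Real.sqrt (x ^ 2 + y ^ 2) :=
    (hy.trans (le_abs_self y)).trans (le_sqrt_sq_add_sq_right x y)
  have hinv : (Real.sqrt (x ^ 2 + y ^ 2))⁻¹ ≤ y₀⁻¹ := by gcongr
  have b1 : ‖k‖ * ‖hankelD 1 (k * Real.sqrt (x ^ 2 + y ^ 2))‖ ≤
      ‖k‖ * (C1 * Real.exp (-(k.im * |x|))) := by gcongr; exact h1 x y hy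
  have b2 : ‖k‖ ^ 2 * ‖hankelD 2 (k * Real.sqrt (x ^ 2 + y ^ 2))‖ +
      ‖k‖ * (Real.sqrt (x ^ 2 + y ^ 2))⁻¹ * ‖hankelD 1 (k * Real.sqrt (x ^ 2 + y ^ 2))‖ ≤
      ‖k‖ ^ 2 * (C2 * Real.exp (-(k.im * |x|))) +
        ‖k‖ * y₀⁻¹ * (C1 * Real.exp (-(k.im * |x|))) := by
    gcongr
    · exact h2 x y hy
    · exact h1 x y hy
  have p0 : 0 ≤ C0 * Real.exp (-(k.im * |x|)) := by positivity
  have p1 : 0 ≤ ‖k‖ * (C1 * Real.exp (-(k.im * |x|))) := by positivity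
  have p2 : 0 ≤ ‖k‖ ^ 2 * (C2 * Real.exp (-(k.im * |x|))) +
        ‖k‖ * y₀⁻¹ * (C1 * Real.exp (-(k.im * |x|))) := by positivity
  have e : (C0 + ‖k‖ * C1 + (‖k‖ ^ 2 * C2 + ‖k‖ * y₀⁻¹ * C1)) * Real.exp (-(k.im * |x|)) =
      C0 * Real.exp (-(k.im * |x|)) + ‖k‖ * (C1 * Real.exp (-(k.im * |x|))) +
      (‖k‖ ^ 2 * (C2 * Real.exp (-(k.im * |x|))) +
        ‖k‖ * y₀⁻¹ * (C1 * Real.exp (-(k.im * |x|)))) := by ring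
  rw [e]
  refine ⟨(h0 x y hy).trans (by linarith), ((norm_hankelGrad_le x y).trans b1).trans (by linarith),
    ?_, ((norm_hankelHess_le hpos).trans b2).trans (by linarith), ?_⟩
  · refine (norm_hankelGrad_le y x).trans ?_
    rw [add_comm (y ^ 2)]
    exact b1.trans (by linarith)
  · refine (norm_hankelHess_le (by linarith)).trans ?_
    rw [add_comm (y ^ 2)]
    exact b2.trans (by linarith)

end ComplexWaveNumber

section ComplexWaveNumber

variable {k : ℂ}

theorem norm_cexp_neg_I_mul (a x : ℝ) : ‖Complex.exp (-(Complex.I * a * x))‖ = 1 := by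
  rw [Complex.norm_exp]; simp

theorem hasDerivAt_cexp_neg_I_mul (a x : ℝ) :
    HasDerivAt (fun x : ℝ => Complex.exp (-(Complex.I * a * x)))
      (-(Complex.I * a) * Complex.exp (-(Complex.I * a * x))) x := by
  have h1 : HasDerivAt (fun x : ℝ => -(Complex.I * a * (x : ℂ))) (-(Complex.I * a)) x := by
    refine (((Complex.ofRealCLM.hasDerivAt (x := x)).const_mul (Complex.I * a)).neg).congr_deriv ?_
    simp
  exact h1.cexp.congr_deriv (by ring)

theorem integrable_mul_cexp_of_bound {f : ℝ → ℂ} (hf : Continuous f) {C ε : ℝ} (hε : 0 < ε)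
    (h : ∀ x, ‖f x‖ ≤ C * Real.exp (-(ε * |x|))) (a : ℝ) :
    Integrable fun x : ℝ => f x * Complex.exp (-(Complex.I * a * x)) := by
  refine Integrable.mono' ((integrable_exp_neg_mul_abs hε).const_mul C)
    (Continuous.aestronglyMeasurable (by fun_prop)) (Eventually.of_forall fun x => ?_)
  rw [norm_mul, norm_cexp_neg_I_mul, mul_one]
  exact h x

/-- The second derivative of the partial Fourier transform, for complex wave numbers. -/
theorem fourier_hankel_ode (hk : 0 < k.re) (hk' : 0 < k.im) (a : ℝ) {y : ℝ} (hy : 0 < y) :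
    HasDerivAt (fun y : ℝ => ∫ x : ℝ, hankelD 0 (k * Real.sqrt (x ^ 2 + y ^ 2)) *
      Complex.exp (-(Complex.I * a * x)))
      (∫ x : ℝ, hankelGrad k x y * Complex.exp (-(Complex.I * a * x))) y ∧
    HasDerivAt (fun y : ℝ => ∫ x : ℝ, hankelGrad k x y * Complex.exp (-(Complex.I * a * x)))
      ((a ^ 2 - k ^ 2) * ∫ x : ℝ, hankelD 0 (k * Real.sqrt (x ^ 2 + y ^ 2)) *
        Complex.exp (-(Complex.I * a * x))) y := by
  have hy2 : 0 < y / 2 := by positivity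
  obtain ⟨C, hC, hb⟩ := exists_hankel_exp_bound hk hk' hy2
  have hpos : ∀ x : ℝ, ∀ z : ℝ, y / 2 < z → 0 < x ^ 2 + z ^ 2 := fun x z hz => by
    have : 0 < z := hy2.trans hz
    positivity
  have hs : Ioi (y / 2) ∈ 𝓝 y := Ioi_mem_nhds (by linarith)
  have hye : y / 2 ≤ y := by linarith
  have i0 := integrable_mul_cexp_of_bound (continuous_hankelD_sqrt 0 hk hy.ne') hk'
    (fun x => (hb x y hye).1) a
  have i1 := integrable_mul_cexp_of_bound (continuous_hankelGrad hk hy.ne') hk'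
    (fun x => (hb x y hye).2.1) a
  have i1' := integrable_mul_cexp_of_bound (continuous_hankelGrad_swap hk hy.ne') hk'
    (fun x => (hb x y hye).2.2.1) a
  have i2 := integrable_mul_cexp_of_bound (continuous_hankelHess hk hy.ne') hk'
    (fun x => (hb x y hye).2.2.2.1) a
  refine ⟨?_, ?_⟩
  · refine (hasDerivAt_integral_of_dominated_loc_of_deriv_le (μ := volume)
      (F := fun (y : ℝ) (x : ℝ) => hankelD 0 (k * Real.sqrt (x ^ 2 + y ^ 2)) *
        Complex.exp (-(Complex.I * a * x)))
      (F' := fun (y : ℝ) (x : ℝ) => hankelGrad k x y * Complex.exp (-(Complex.I * a * x)))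
      (bound := fun x : ℝ => C * Real.exp (-(k.im * |x|))) hs ?_ i0 i1.aestronglyMeasurable ?_
      ((integrable_exp_neg_mul_abs hk').const_mul C) ?_).2
    · filter_upwards [hs] with z hz
      exact ((continuous_hankelD_sqrt 0 hk (hy2.trans hz).ne').mul
        (by fun_prop)).aestronglyMeasurable
    · refine Eventually.of_forall fun x z hz => ?_
      rw [norm_mul, norm_cexp_neg_I_mul, mul_one]
      exact (hb x z (le_of_lt hz)).2.1
    · exact Eventually.of_forall fun x z hz => (hasDerivAt_hankel_radial hk (hpos x z hz)).mul_const _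
  · have key : HasDerivAt (fun y : ℝ => ∫ x : ℝ, hankelGrad k x y *
        Complex.exp (-(Complex.I * a * x)))
        (∫ x : ℝ, hankelHess k x y * Complex.exp (-(Complex.I * a * x))) y := by
      refine (hasDerivAt_integral_of_dominated_loc_of_deriv_le (μ := volume)
        (F := fun (y : ℝ) (x : ℝ) => hankelGrad k x y * Complex.exp (-(Complex.I * a * x)))
        (F' := fun (y : ℝ) (x : ℝ) => hankelHess k x y * Complex.exp (-(Complex.I * a * x)))
        (bound := fun x : ℝ => C * Real.exp (-(k.im * |x|))) hs ?_ i1 i2.aestronglyMeasurable ?_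
        ((integrable_exp_neg_mul_abs hk').const_mul C) ?_).2
      · filter_upwards [hs] with z hz
        exact ((continuous_hankelGrad hk (hy2.trans hz).ne').mul
          (by fun_prop)).aestronglyMeasurable
      · refine Eventually.of_forall fun x z hz => ?_
        rw [norm_mul, norm_cexp_neg_I_mul, mul_one]
        exact (hb x z (le_of_lt hz)).2.2.2.1
      · exact Eventually.of_forall fun x z hz => (hasDerivAt_hankelGrad hk (hpos x z hz)).mul_const _
    refine key.congr_deriv ?_
    have hpos' : ∀ x : ℝ, 0 < y ^ 2 + x ^ 2 := fun x => by positivity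
    have hcont : Continuous fun x : ℝ => hankelHess k y x := by
      have : (fun x : ℝ => hankelHess k y x) = fun x : ℝ =>
          -k ^ 2 * hankelD 0 (k * Real.sqrt (x ^ 2 + y ^ 2)) - hankelHess k x y := by
        funext x
        rw [← hankelHess_add_hankelHess hk (by rw [add_comm]; exact hpos' x)]; ring
      rw [this]
      exact (continuous_const.mul (continuous_hankelD_sqrt 0 hk hy.ne')).sub
        (continuous_hankelHess hk hy.ne')
    have i2' := integrable_mul_cexp_of_bound hcont hk' (fun x => (hb x y hye).2.2.2.2) a
    have hd0 : ∀ x : ℝ, HasDerivAt (fun x : ℝ => hankelD 0 (k * Real.sqrt (x ^ 2 + y ^ 2)))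
        (hankelGrad k y x) x := fun x => by
      have := hasDerivAt_hankel_radial hk (hpos' x)
      simp_rw [add_comm (y ^ 2)] at this
      exact this
    have hd1 : ∀ x : ℝ, HasDerivAt (fun x : ℝ => hankelGrad k y x) (hankelHess k y x) x :=
      fun x => hasDerivAt_hankelGrad hk (hpos' x)
    have ibp : ∀ (f f' : ℝ → ℂ), (∀ x, HasDerivAt f (f' x) x) →
        Integrable (fun x : ℝ => f x * Complex.exp (-(Complex.I * a * x))) →
        Integrable (fun x : ℝ => f' x * Complex.exp (-(Complex.I * a * x))) →
        ∫ x : ℝ, f' x * Complex.exp (-(Complex.I * a * x)) =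
          Complex.I * a * ∫ x : ℝ, f x * Complex.exp (-(Complex.I * a * x)) := by
      intro f f' hf hi hi'
      have h3 := integral_mul_deriv_eq_deriv_mul_of_integrable (u := f)
        (v := fun x : ℝ => Complex.exp (-(Complex.I * a * x))) (u' := f')
        (v' := fun x : ℝ => -(Complex.I * a) * Complex.exp (-(Complex.I * a * x)))
        (fun x _ => hf x) (fun x _ => hasDerivAt_cexp_neg_I_mul a x)
        ((hi.const_mul (-(Complex.I * a))).congr (Eventually.of_forall fun x => by
          simp only [Pi.mul_apply]; ring)) hi' hi
      rw [eq_comm, neg_eq_iff_eq_neg] at h3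
      rw [h3, ← integral_const_mul, ← integral_neg]
      congr 1; funext x; ring
    have e1 := ibp _ _ hd0 i0 i1'
    have e2 := ibp _ _ hd1 i1' i2'
    have e3 : ∫ x : ℝ, hankelHess k x y * Complex.exp (-(Complex.I * a * x)) =
        -k ^ 2 * (∫ x : ℝ, hankelD 0 (k * Real.sqrt (x ^ 2 + y ^ 2)) *
          Complex.exp (-(Complex.I * a * x))) -
        ∫ x : ℝ, hankelHess k y x * Complex.exp (-(Complex.I * a * x)) := by
      rw [← integral_const_mul, ← integral_sub (i0.const_mul _) i2']
      congr 1; funext x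
      rw [← mul_assoc, ← hankelHess_add_hankelHess hk (by rw [add_comm]; exact hpos' x)]; ring
    rw [e3, e2, e1]
    linear_combination (-(a : ℂ) ^ 2 * ∫ x : ℝ, hankelD 0 (k * Real.sqrt (x ^ 2 + y ^ 2)) *
          Complex.exp (-(Complex.I * a * x))) * Complex.I_sq

theorem exists_norm_mul_hankelD_one_le (hk : 0 < k.re) (hk' : 0 < k.im) :
    ∃ C : ℝ, 0 ≤ C ∧ ∀ r : ℝ, 0 < r → ‖k * hankelD 1 (k * r)‖ ≤ C / r := by
  obtain ⟨C, hC, h⟩ := norm_hankelD_one_sub_le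
  refine ⟨‖k‖ * (C * (k.re ^ (-(1 / 2) : ℝ) * k.im⁻¹ ^ (1 / 2 : ℝ)) + 2 / Real.pi / ‖k‖),
    by positivity, fun r hr => ?_⟩
  have hkr := re_mul_ofReal_pos hk hr
  have hk0 : k ≠ 0 := by rintro rfl; simp at hk
  have h1 := h _ hkr
  rw [Complex.re_mul_ofReal, Complex.im_mul_ofReal] at h1
  have h2 : ‖2 * Complex.I / Real.pi * Complex.exp (Complex.I * (k * r)) / (k * r)‖ ≤
      2 / Real.pi / ‖k‖ / r := by
    rw [norm_div, norm_mul, norm_div, norm_mul, norm_mul, Complex.norm_exp]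
    simp only [Complex.norm_ofNat, Complex.norm_I, mul_one, Complex.norm_real,
      Real.norm_of_nonneg Real.pi_pos.le, Real.norm_of_nonneg hr.le]
    have : Real.exp (Complex.I * (k * r)).re ≤ 1 := by
      rw [Real.exp_le_one_iff]
      simp
      positivity
    rw [div_div _ ‖k‖]
    gcongr
    exact mul_le_of_le_one_right (by positivity) this
  have h3 : Real.exp (-(k.im * r)) * (k.re * r) ^ (-(1 / 2) : ℝ) ≤
      k.re ^ (-(1 / 2) : ℝ) * k.im⁻¹ ^ (1 / 2 : ℝ) / r := by
    rw [Real.mul_rpow hk.le hr.le]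
    have e1 : Real.exp (-(k.im * r)) ≤ k.im⁻¹ ^ (1 / 2 : ℝ) * r ^ (-(1 / 2) : ℝ) := by
      have e2 : Real.exp (-(k.im * r)) ≤ (Real.exp (-(k.im * r))) ^ (1 / 2 : ℝ) := by
        refine Real.self_le_rpow_of_le_one (Real.exp_pos _).le ?_ (by norm_num)
        rw [Real.exp_le_one_iff]
        have : 0 < k.im * r := by positivity
        linarith
      refine e2.trans ?_
      have e3 : Real.exp (-(k.im * r)) ≤ k.im⁻¹ * r⁻¹ := by
        rw [Real.exp_neg, ← mul_inv]
        have := Real.add_one_le_exp (k.im * r)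
        gcongr
        linarith
      rw [Real.rpow_neg hr.le, ← Real.inv_rpow hr.le, ← Real.mul_rpow (by positivity) (by positivity)]
      gcongr
    have e4 : r ^ (-(1 / 2) : ℝ) * r ^ (-(1 / 2) : ℝ) = r⁻¹ := by
      rw [← Real.rpow_add hr]; norm_num; exact Real.rpow_neg_one r
    calc _ ≤ (k.im⁻¹ ^ (1 / 2 : ℝ) * r ^ (-(1 / 2) : ℝ)) *
          (k.re ^ (-(1 / 2) : ℝ) * r ^ (-(1 / 2) : ℝ)) := by gcongr
      _ = k.re ^ (-(1 / 2) : ℝ) * k.im⁻¹ ^ (1 / 2 : ℝ) * (r ^ (-(1 / 2) : ℝ) * r ^ (-(1 / 2) : ℝ)) := by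
        ring
      _ = _ := by rw [e4]; exact (div_eq_mul_inv _ _).symm
  rw [norm_mul, mul_div_assoc]
  refine mul_le_mul_of_nonneg_left ?_ (norm_nonneg _)
  calc ‖hankelD 1 (k * r)‖ = ‖(hankelD 1 (k * r) - 2 * Complex.I / Real.pi *
        Complex.exp (Complex.I * (k * r)) / (k * r)) + 2 * Complex.I / Real.pi *
        Complex.exp (Complex.I * (k * r)) / (k * r)‖ := by congr 1; ring
    _ ≤ C * (Real.exp (-(k.im * r)) * (k.re * r) ^ (-(1 / 2) : ℝ)) + 2 / Real.pi / ‖k‖ / r := by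
      rw [mul_assoc] at h1
      exact (norm_add_le _ _).trans (add_le_add h1 h2)
    _ ≤ C * (k.re ^ (-(1 / 2) : ℝ) * k.im⁻¹ ^ (1 / 2 : ℝ) / r) + 2 / Real.pi / ‖k‖ / r := by gcongr
    _ = _ := by ring

theorem tendsto_mul_hankelD_one (hk : 0 < k.re) :
    Tendsto (fun r : ℝ => k * r * hankelD 1 (k * r)) (𝓝[>] 0) (𝓝 (2 * Complex.I / Real.pi)) := by
  obtain ⟨C, hC, h⟩ := norm_hankelD_one_sub_le
  have h1 : Tendsto (fun r : ℝ => 2 * Complex.I / Real.pi * Complex.exp (Complex.I * (k * r)))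
      (𝓝[>] 0) (𝓝 (2 * Complex.I / Real.pi)) := by
    have : Continuous fun r : ℝ => 2 * Complex.I / Real.pi * Complex.exp (Complex.I * (k * r)) := by
      fun_prop
    have h2 := this.tendsto 0
    simp only [Complex.ofReal_zero, mul_zero, Complex.exp_zero, mul_one] at h2
    exact h2.mono_left nhdsWithin_le_nhds
  have h2 : Tendsto (fun r : ℝ => ‖k‖ * (C * Real.exp (-(k.im * r)) * k.re ^ (-(1 / 2) : ℝ)) *
      r ^ (1 / 2 : ℝ)) (𝓝[>] 0) (𝓝 0) := by
    have : ContinuousAt (fun r : ℝ => ‖k‖ * (C * Real.exp (-(k.im * r)) * k.re ^ (-(1 / 2) : ℝ)) *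
      r ^ (1 / 2 : ℝ)) 0 :=
      ContinuousAt.mul (by fun_prop) (Real.continuousAt_rpow_const _ _ (Or.inr (by norm_num)))
    have h3 := this.tendsto
    rw [Real.zero_rpow (by norm_num), mul_zero] at h3
    exact h3.mono_left nhdsWithin_le_nhds
  have h3 : Tendsto (fun r : ℝ => k * r * hankelD 1 (k * r) -
      2 * Complex.I / Real.pi * Complex.exp (Complex.I * (k * r))) (𝓝[>] 0) (𝓝 0) := by
    refine squeeze_zero_norm' ?_ h2
    filter_upwards [self_mem_nhdsWithin] with r hr
    have hr : (0 : ℝ) < r := hr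
    have hkr := re_mul_ofReal_pos hk hr
    have hkr0 : k * r ≠ 0 := by intro h0; rw [h0] at hkr; simp at hkr
    have h4 := h _ hkr
    rw [Complex.re_mul_ofReal, Complex.im_mul_ofReal, Real.mul_rpow hk.le hr.le] at h4
    have e1 : k * r * hankelD 1 (k * r) -
        2 * Complex.I / Real.pi * Complex.exp (Complex.I * (k * r)) = k * r * (hankelD 1 (k * r) -
        2 * Complex.I / Real.pi * Complex.exp (Complex.I * (k * r)) / (k * r)) := by
      rw [mul_sub, mul_div_cancel₀ _ hkr0]
    have e2 : r ^ (1 / 2 : ℝ) = r * r ^ (-(1 / 2) : ℝ) := by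
      nth_rewrite 2 [← Real.rpow_one r]
      rw [← Real.rpow_add hr]; norm_num
    rw [e1, norm_mul, norm_mul, Complex.norm_real, Real.norm_of_nonneg hr.le, e2]
    calc _ ≤ ‖k‖ * r * (C * Real.exp (-(k.im * r)) *
          (k.re ^ (-(1 / 2) : ℝ) * r ^ (-(1 / 2) : ℝ))) := by gcongr
      _ = _ := by ring
  simpa using h3.add h1

theorem tendsto_fourier_hankelGrad (hk : 0 < k.re) (hk' : 0 < k.im) (a : ℝ) :
    Tendsto (fun y : ℝ => ∫ x : ℝ, hankelGrad k x y * Complex.exp (-(Complex.I * a * x)))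
      (𝓝[>] 0) (𝓝 (2 * Complex.I)) := by
  obtain ⟨C, hC, hb⟩ := exists_norm_mul_hankelD_one_le hk hk'
  have hρ : ∀ σ : ℝ, 0 < Real.sqrt (σ ^ 2 + 1) := fun σ => Real.sqrt_pos.2 (by positivity)
  have hρ2 : ∀ σ : ℝ, Real.sqrt (σ ^ 2 + 1) ^ 2 = 1 + σ ^ 2 := fun σ => by
    rw [Real.sq_sqrt (by positivity)]; ring
  have hsub : ∀ y : ℝ, 0 < y → (∫ x : ℝ, hankelGrad k x y * Complex.exp (-(Complex.I * a * x))) =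
      ∫ σ : ℝ, ((Real.sqrt (σ ^ 2 + 1))⁻¹ ^ 2 : ℝ) * (k * (y * Real.sqrt (σ ^ 2 + 1) : ℝ) *
        hankelD 1 (k * (y * Real.sqrt (σ ^ 2 + 1) : ℝ))) *
        Complex.exp (-(Complex.I * a * (y * σ : ℝ))) := by
    intro y hy
    have h1 := Measure.integral_comp_mul_left (fun x : ℝ => hankelGrad k x y *
      Complex.exp (-(Complex.I * a * x))) y
    rw [abs_of_pos (by positivity)] at h1
    have h2 : ∫ x : ℝ, hankelGrad k x y * Complex.exp (-(Complex.I * a * x)) =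
        (y : ℂ) * ∫ σ : ℝ, hankelGrad k (y * σ) y * Complex.exp (-(Complex.I * a * (y * σ : ℝ))) := by
      rw [h1, Complex.real_smul, ← mul_assoc, Complex.ofReal_inv,
        mul_inv_cancel₀ (by exact_mod_cast hy.ne'), one_mul]
    rw [h2, ← integral_const_mul]
    congr 1; funext σ
    have e1 : Real.sqrt ((y * σ) ^ 2 + y ^ 2) = y * Real.sqrt (σ ^ 2 + 1) := by
      rw [show (y * σ) ^ 2 + y ^ 2 = y ^ 2 * (σ ^ 2 + 1) by ring, Real.sqrt_mul (by positivity),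
        Real.sqrt_sq hy.le]
    have hyc : (y : ℂ) ≠ 0 := by exact_mod_cast hy.ne'
    have hρc : ((Real.sqrt (σ ^ 2 + 1) : ℝ) : ℂ) ≠ 0 := by exact_mod_cast (hρ σ).ne'
    rw [hankelGrad, e1]
    push_cast
    field_simp
  have hlim : Tendsto (fun y : ℝ => ∫ σ : ℝ, ((Real.sqrt (σ ^ 2 + 1))⁻¹ ^ 2 : ℝ) *
      (k * (y * Real.sqrt (σ ^ 2 + 1) : ℝ) *
        hankelD 1 (k * (y * Real.sqrt (σ ^ 2 + 1) : ℝ))) *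
        Complex.exp (-(Complex.I * a * (y * σ : ℝ)))) (𝓝[>] 0)
      (𝓝 (∫ σ : ℝ, ((1 + σ ^ 2)⁻¹ : ℝ) * (2 * Complex.I / Real.pi))) := by
    refine tendsto_integral_filter_of_dominated_convergence (fun σ : ℝ => C * (1 + σ ^ 2)⁻¹) ?_ ?_
      (integrable_inv_one_add_sq.const_mul C) ?_
    · filter_upwards [self_mem_nhdsWithin] with y hy
      have hy : (0 : ℝ) < y := hy
      refine Continuous.aestronglyMeasurable ?_
      refine Continuous.mul (Continuous.mul ?_ (Continuous.mul (by fun_prop) ?_)) (by fun_prop)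
      · refine Complex.continuous_ofReal.comp (Continuous.pow (Continuous.inv₀ (by fun_prop)
          fun σ => (hρ σ).ne') 2)
      · rw [continuous_iff_continuousAt]
        intro σ
        refine ContinuousAt.comp (f := fun σ : ℝ => k * ((y * Real.sqrt (σ ^ 2 + 1) : ℝ) : ℂ))
          (hasDerivAt_hankelD 1 (re_mul_ofReal_pos hk (mul_pos hy (hρ σ)))).continuousAt ?_
        fun_prop
    · filter_upwards [self_mem_nhdsWithin] with y hy
      have hy : (0 : ℝ) < y := hy
      refine Eventually.of_forall fun σ => ?_
      rw [norm_mul, norm_cexp_neg_I_mul, mul_one, norm_mul, Complex.norm_real,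
        Real.norm_of_nonneg (by positivity), mul_comm C, inv_pow, hρ2]
      refine mul_le_mul_of_nonneg_left ?_ (by positivity)
      have h1 := hb _ (mul_pos hy (hρ σ))
      rw [le_div_iff₀ (mul_pos hy (hρ σ))] at h1
      refine le_trans (le_of_eq ?_) h1
      rw [mul_right_comm, norm_mul _ (((y * Real.sqrt (σ ^ 2 + 1) : ℝ)) : ℂ), Complex.norm_real,
        Real.norm_of_nonneg (mul_pos hy (hρ σ)).le]
    · refine Eventually.of_forall fun σ => ?_
      have h1 : Tendsto (fun y : ℝ => y * Real.sqrt (σ ^ 2 + 1)) (𝓝[>] 0) (𝓝[>] 0) := by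
        refine tendsto_nhdsWithin_iff.2 ⟨?_, ?_⟩
        · have : Continuous fun y : ℝ => y * Real.sqrt (σ ^ 2 + 1) := by fun_prop
          have h2 := this.tendsto 0
          rw [zero_mul] at h2
          exact h2.mono_left nhdsWithin_le_nhds
        · filter_upwards [self_mem_nhdsWithin] with y hy
          exact mul_pos hy (hρ σ)
      have h2 := (tendsto_mul_hankelD_one hk).comp h1
      have h3 : Tendsto (fun y : ℝ => Complex.exp (-(Complex.I * a * (y * σ : ℝ)))) (𝓝[>] 0)
          (𝓝 1) := by
        have : Continuous fun y : ℝ => Complex.exp (-(Complex.I * a * (y * σ : ℝ))) := by fun_prop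
        have h2 := this.tendsto 0
        simp only [zero_mul, Complex.ofReal_zero, mul_zero, neg_zero, Complex.exp_zero] at h2
        exact h2.mono_left nhdsWithin_le_nhds
      have h4 := (h2.const_mul (((Real.sqrt (σ ^ 2 + 1))⁻¹ ^ 2 : ℝ) : ℂ)).mul h3
      rw [mul_one, inv_pow, hρ2] at h4
      rw [inv_pow, hρ2]
      exact h4
  have hval : (∫ σ : ℝ, (((1 + σ ^ 2)⁻¹ : ℝ) : ℂ) * (2 * Complex.I / Real.pi)) =
      2 * Complex.I := by
    have hpi : (Real.pi : ℂ) ≠ 0 := by exact_mod_cast Real.pi_ne_zero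
    rw [integral_mul_const, integral_complex_ofReal, integral_univ_inv_one_add_sq]
    field_simp
  rw [hval] at hlim
  refine hlim.congr' ?_
  filter_upwards [self_mem_nhdsWithin] with y hy
  exact (hsub y hy).symm

theorem eq_of_hasDerivAt_zero_Ioi {f : ℝ → ℂ} (h : ∀ y, 0 < y → HasDerivAt f 0 y) {x y : ℝ}
    (hx : 0 < x) (hy : 0 < y) : f x = f y := by
  wlog hxy : x ≤ y generalizing x y
  · exact (this hy hx (le_of_not_ge hxy)).symm
  refine (constant_of_has_deriv_right_zero (f := f) (a := x) (b := y) ?_ ?_ y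
    (right_mem_Icc.2 hxy)).symm
  · exact fun z hz => (h z (hx.trans_le hz.1)).continuousAt.continuousWithinAt
  · exact fun z hz => (h z (hx.trans_le hz.1)).hasDerivWithinAt

/-- The partial Fourier transform of the Hankel function for complex wave numbers. -/
theorem integral_hankel_mul_cexp (hk : 0 < k.re) (hk' : 0 < k.im) (a : ℝ) {b : ℂ}
    (hb : b ^ 2 = a ^ 2 - k ^ 2) (hbre : 0 < b.re) {y : ℝ} (hy : 0 < y) :
    ∫ x : ℝ, hankelD 0 (k * Real.sqrt (x ^ 2 + y ^ 2)) * Complex.exp (-(Complex.I * a * x)) =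
      -2 * Complex.I / b * Complex.exp (-(b * y)) := by
  set F0 : ℝ → ℂ := fun y => ∫ x : ℝ, hankelD 0 (k * Real.sqrt (x ^ 2 + y ^ 2)) *
    Complex.exp (-(Complex.I * a * x)) with hF0
  set F1 : ℝ → ℂ := fun y => ∫ x : ℝ, hankelGrad k x y * Complex.exp (-(Complex.I * a * x)) with hF1
  have hb0 : b ≠ 0 := by rintro rfl; simp at hbre
  have d0 : ∀ y, 0 < y → HasDerivAt F0 (F1 y) y := fun y hy => (fourier_hankel_ode hk hk' a hy).1
  have d1 : ∀ y, 0 < y → HasDerivAt F1 (b ^ 2 * F0 y) y := fun y hy => by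
    rw [hb]; exact (fourier_hankel_ode hk hk' a hy).2
  have hexp : ∀ (c : ℂ) (y : ℝ), HasDerivAt (fun y : ℝ => Complex.exp (c * y))
      (c * Complex.exp (c * y)) y := fun c y => by
    have h1 : HasDerivAt (fun y : ℝ => c * (y : ℂ)) c y :=
      ((Complex.ofRealCLM.hasDerivAt (x := y)).const_mul c).congr_deriv (by simp)
    exact h1.cexp.congr_deriv (by ring)
  obtain ⟨C, hC, hbd⟩ := exists_hankel_exp_bound hk hk' one_pos
  have hint := (integrable_exp_neg_mul_abs hk').const_mul C
  have bd : ∀ y : ℝ, 1 ≤ y → ‖F1 y + b * F0 y‖ ≤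
      (∫ x : ℝ, C * Real.exp (-(k.im * |x|))) + ‖b‖ * ∫ x : ℝ, C * Real.exp (-(k.im * |x|)) := by
    intro y hy
    refine (norm_add_le _ _).trans (add_le_add ?_ ?_)
    · refine norm_integral_le_of_norm_le hint (Eventually.of_forall fun x => ?_)
      rw [norm_mul, norm_cexp_neg_I_mul, mul_one]
      exact (hbd x y hy).2.1
    · rw [norm_mul]
      refine mul_le_mul_of_nonneg_left ?_ (norm_nonneg _)
      refine norm_integral_le_of_norm_le hint (Eventually.of_forall fun x => ?_)
      rw [norm_mul, norm_cexp_neg_I_mul, mul_one]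
      exact (hbd x y hy).1
  have hW : ∀ y, 0 < y → F1 y + b * F0 y = 0 := by
    intro y hy
    have hV : ∀ z, 0 < z → HasDerivAt (fun z : ℝ => (F1 z + b * F0 z) * Complex.exp (-b * z)) 0 z :=
      fun z hz => (((d1 z hz).add ((d0 z hz).const_mul b)).mul (hexp (-b) z)).congr_deriv (by
        simp only [Pi.add_apply]; ring)
    have hlim : Tendsto (fun z : ℝ => (F1 z + b * F0 z) * Complex.exp (-b * z)) atTop (𝓝 0) := by
      have h1 : Tendsto (fun z : ℝ => ((∫ x : ℝ, C * Real.exp (-(k.im * |x|))) +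
          ‖b‖ * ∫ x : ℝ, C * Real.exp (-(k.im * |x|))) * Real.exp (-b.re * z)) atTop (𝓝 0) := by
        have h2 : Tendsto (fun z : ℝ => Real.exp (-b.re * z)) atTop (𝓝 0) :=
          Real.tendsto_exp_atBot.comp (tendsto_id.const_mul_atTop_of_neg (by linarith))
        simpa using h2.const_mul _
      refine squeeze_zero_norm' ?_ h1
      filter_upwards [eventually_ge_atTop 1] with z hz
      rw [norm_mul, Complex.norm_exp]
      have : (-b * z).re = -b.re * z := by simp
      rw [this]
      have := bd z hz
      gcongr
    have hconst : Tendsto (fun z : ℝ => (F1 z + b * F0 z) * Complex.exp (-b * z)) atTop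
        (𝓝 ((F1 y + b * F0 y) * Complex.exp (-b * y))) := by
      refine tendsto_const_nhds.congr' ?_
      filter_upwards [eventually_gt_atTop 0] with z hz
      exact eq_of_hasDerivAt_zero_Ioi hV hy hz
    have := tendsto_nhds_unique hconst hlim
    exact (mul_eq_zero.1 this).resolve_right (Complex.exp_ne_zero _)
  have hA : ∀ z, 0 < z → F0 z * Complex.exp (b * z) = F0 y * Complex.exp (b * y) := by
    intro z hz
    refine eq_of_hasDerivAt_zero_Ioi (f := fun z : ℝ => F0 z * Complex.exp (b * z))
      (fun w hw => ((d0 w hw).mul (hexp b w)).congr_deriv ?_) hz hy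
    linear_combination Complex.exp (b * w) * hW w hw
  have hF1' : ∀ z, 0 < z → F1 z = -b * (F0 y * Complex.exp (b * y)) * Complex.exp (-b * z) := by
    intro z hz
    have h1 : Complex.exp (b * z) * Complex.exp (-b * z) = 1 := by
      rw [← Complex.exp_add]; simp
    linear_combination hW z hz - b * Complex.exp (-b * z) * hA z hz + b * F0 z * h1
  have hl1 := tendsto_fourier_hankelGrad hk hk' a
  have hl2 : Tendsto F1 (𝓝[>] 0) (𝓝 (-b * (F0 y * Complex.exp (b * y)))) := by
    have : Continuous fun z : ℝ => -b * (F0 y * Complex.exp (b * y)) * Complex.exp (-b * z) := by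
      fun_prop
    have h2 := this.tendsto 0
    simp only [Complex.ofReal_zero, mul_zero, Complex.exp_zero, mul_one] at h2
    refine (h2.mono_left nhdsWithin_le_nhds).congr' ?_
    filter_upwards [self_mem_nhdsWithin] with z hz
    exact (hF1' z hz).symm
  have hfin := tendsto_nhds_unique hl1 hl2
  have h1 : Complex.exp (b * y) * Complex.exp (-(b * y)) = 1 := by
    rw [← Complex.exp_add]; simp
  have : F0 y = -2 * Complex.I / b * Complex.exp (-(b * y)) := by
    rw [div_mul_eq_mul_div, eq_div_iff hb0]
    linear_combination Complex.exp (-(b * y)) * hfin - b * F0 y * h1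
  exact this

end ComplexWaveNumber

/-! ### Decay of differences of shifted Hankel functions -/

/-- The Hankel function as a function of the square of the distance. -/
noncomputable def hankelSq (k ζ : ℂ) : ℂ := hankelD 0 (k * ζ ^ (1 / 2 : ℂ))

theorem ofReal_cpow_half {r : ℝ} (hr : 0 ≤ r) : ((r : ℂ)) ^ (1 / 2 : ℂ) = (Real.sqrt r : ℝ) := by
  rw [Real.sqrt_eq_rpow, Complex.ofReal_cpow hr]; norm_num

theorem hankelSq_ofReal (k : ℂ) {r : ℝ} (hr : 0 ≤ r) :
    hankelSq k r = hankelD 0 (k * Real.sqrt r) := by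
  rw [hankelSq, ofReal_cpow_half hr]

theorem cpow_half_sq (ζ : ℂ) : (ζ ^ (1 / 2 : ℂ)) ^ 2 = ζ := by
  rw [← Complex.cpow_nat_mul]; norm_num

theorem re_cpow_half_nonneg (ζ : ℂ) : 0 ≤ (ζ ^ (1 / 2 : ℂ)).re := by
  by_cases h : ζ = 0
  · simp [h]
  rw [Complex.cpow_def_of_ne_zero h, Complex.exp_re]
  have h1 := Complex.neg_pi_lt_arg ζ
  have h2 := Complex.arg_le_pi ζ
  have : (Complex.log ζ * (1 / 2)).im = 1 / 2 * ζ.arg := by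
    simp [Complex.mul_im, Complex.log_im]
    try ring
  rw [this]
  exact mul_nonneg (Real.exp_pos _).le
    (Real.cos_nonneg_of_neg_pi_div_two_le_of_le (by linarith) (by linarith))

theorem norm_cpow_half_sub_le {q B : ℝ} (hq : 0 < q) {ζ : ℂ} (h : ‖ζ - (q : ℂ) ^ 2‖ ≤ B * q) :
    ‖ζ ^ (1 / 2 : ℂ) - q‖ ≤ B := by
  have h1 := re_cpow_half_nonneg ζ
  have h2 : q ≤ ‖ζ ^ (1 / 2 : ℂ) + q‖ := by
    have := (le_abs_self _).trans (Complex.abs_re_le_norm (ζ ^ (1 / 2 : ℂ) + q))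
    simp only [Complex.add_re, Complex.ofReal_re] at this
    linarith
  have h3 : (ζ ^ (1 / 2 : ℂ) - q) * (ζ ^ (1 / 2 : ℂ) + q) = ζ - (q : ℂ) ^ 2 := by
    linear_combination cpow_half_sq ζ
  rw [← h3, norm_mul] at h
  have h4 : ‖ζ ^ (1 / 2 : ℂ) - q‖ * q ≤ B * q :=
    (mul_le_mul_of_nonneg_left h2 (norm_nonneg _)).trans h
  exact le_of_mul_le_mul_right h4 hq

/-- The region in which the far terms of lattice sums are controlled. -/
theorem hankelSq_far {ka kb B : ℝ} (hka : 0 < ka) (hkb : ka ≤ kb) (hB : 0 < B) :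
    ∃ C q₀ : ℝ, 0 < C ∧ 1 ≤ q₀ ∧ ∀ k : ℂ, ka ≤ k.re → k.re ≤ kb → 0 ≤ k.im → k.im ≤ 1 →
      ∀ q : ℝ, q₀ ≤ q → ∀ ζ ∈ Metric.closedBall ((q : ℂ) ^ 2) (B * q),
        ζ ∈ Complex.slitPlane ∧ 0 < (k * ζ ^ (1 / 2 : ℂ)).re ∧
        ∃ d : ℂ, HasDerivAt (hankelSq k) d ζ ∧ ‖d‖ ≤ C * q ^ (-(3 / 2) : ℝ) := by
  obtain ⟨C, hC, hH⟩ := norm_hankelD_le 1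
  have hkb0 : 0 < kb := hka.trans_le hkb
  refine ⟨C * Real.exp (kb * B) * (2 * (ka / 4) ^ (-(1 / 2) : ℝ)) * (kb + 1), 1 + 4 * B + 4 * B / ka + 4 / ka,
    by positivity, by
      have : 0 < 4 * B / ka := by positivity
      have : 0 < 4 / ka := by positivity
      linarith, ?_⟩
  intro k hk1 hk2 hk3 hk4 q hq ζ hζ
  have p1 : 0 < 4 * B / ka := by positivity
  have p2 : 0 < 4 / ka := by positivity
  have hq0 : 0 < q := by linarith
  have hqB : 4 * B ≤ q := by linarith
  rw [Metric.mem_closedBall, dist_eq_norm] at hζ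
  have hs := norm_cpow_half_sub_le hq0 hζ
  have hre : 0 < ζ.re := by
    have h1 := (Complex.abs_re_le_norm (ζ - (q : ℂ) ^ 2)).trans hζ
    have h2 : (ζ - (q : ℂ) ^ 2).re = ζ.re - q ^ 2 := by
      rw [Complex.sub_re, ← Complex.ofReal_pow, Complex.ofReal_re]
    rw [h2, abs_le] at h1
    nlinarith
  have hslit : ζ ∈ Complex.slitPlane := Or.inl hre
  set s := ζ ^ (1 / 2 : ℂ) with hsdef
  have hsre : |s.re - q| ≤ B := by
    simpa using (Complex.abs_re_le_norm (s - q)).trans hs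
  have hsim : |s.im| ≤ B := by
    simpa using (Complex.abs_im_le_norm (s - q)).trans hs
  rw [abs_le] at hsre hsim
  have hk0 : 0 < k.re := hka.trans_le hk1
  have hksre : ka * q / 4 ≤ (k * s).re := by
    rw [Complex.mul_re]
    have h1 : q / 2 ≤ s.re := by linarith
    have h2 : ka * (q / 2) ≤ k.re * s.re := by gcongr
    have h3 : k.im * s.im ≤ B := by nlinarith
    have h4 : B ≤ ka * q / 4 := by
      have : 4 * B / ka ≤ q := by linarith
      rw [div_le_iff₀ hka] at this
      linarith
    linarith
  have hksim : -(kb * B) ≤ (k * s).im := by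
    rw [Complex.mul_im]
    have h1 : 0 ≤ k.im * s.re := mul_nonneg hk3 (by linarith)
    have h2 : -(kb * B) ≤ k.re * s.im := by nlinarith
    linarith
  have hpos : 0 < ka * q / 4 := by positivity
  have hone : 1 ≤ ka * q / 4 := by
    have : 4 / ka ≤ q := by linarith
    rw [div_le_iff₀ hka] at this
    linarith
  have hksre0 : 0 < (k * s).re := hpos.trans_le hksre
  refine ⟨hslit, hksre0, _, (hasDerivAt_hankelD 0 hksre0).comp ζ
    ((Complex.hasStrictDerivAt_cpow_const hslit).hasDerivAt.const_mul k), ?_⟩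
  have h1 := hH _ hksre0
  have e1 : ((k * s).re) ^ (-(1 / 2) : ℝ) ≤ (ka * q / 4) ^ (-(1 / 2) : ℝ) :=
    Real.rpow_le_rpow_of_nonpos hpos hksre (by norm_num)
  have e2 : ((k * s).re) ^ (-((1 : ℕ) + 1 / 2) : ℝ) ≤ (ka * q / 4) ^ (-(1 / 2) : ℝ) :=
    (Real.rpow_le_rpow_of_exponent_le (hone.trans hksre) (by norm_num)).trans e1
  have e3 : Real.exp (-(k * s).im) ≤ Real.exp (kb * B) := by gcongr; linarith
  have e4 : (ka * q / 4) ^ (-(1 / 2) : ℝ) = (ka / 4) ^ (-(1 / 2) : ℝ) * q ^ (-(1 / 2) : ℝ) := by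
    rw [← Real.mul_rpow (by positivity) hq0.le]; congr 1; ring
  have e5 : ‖1 / 2 * ζ ^ ((1 / 2 : ℂ) - 1)‖ ≤ q⁻¹ := by
    have hsn : q / 2 ≤ ‖s‖ := by
      have := (le_abs_self _).trans (Complex.abs_re_le_norm s)
      linarith
    have : ζ ^ ((1 / 2 : ℂ) - 1) = s⁻¹ := by
      rw [hsdef, ← Complex.cpow_neg]; norm_num
    rw [this, norm_mul, norm_inv]
    have h5 : ‖s‖⁻¹ ≤ (q / 2)⁻¹ := by gcongr
    have h6 : (q / 2)⁻¹ = 2 * q⁻¹ := by rw [inv_div]; ring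
    norm_num
    linarith
  have e6 : ‖k‖ ≤ kb + 1 := by
    refine (Complex.norm_le_abs_re_add_abs_im k).trans ?_
    rw [abs_of_pos hk0, abs_of_nonneg hk3]; linarith
  have e7 : q ^ (-(3 / 2) : ℝ) = q ^ (-(1 / 2) : ℝ) * q⁻¹ := by
    rw [← Real.rpow_neg_one, ← Real.rpow_add hq0]; norm_num
  rw [norm_mul, norm_mul, e7]
  calc ‖hankelD (0 + 1) (k * s)‖ * (‖k‖ * ‖1 / 2 * ζ ^ ((1 / 2 : ℂ) - 1)‖)
      ≤ (C * Real.exp (kb * B) * (2 * ((ka / 4) ^ (-(1 / 2) : ℝ) * q ^ (-(1 / 2) : ℝ)))) *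
        ((kb + 1) * q⁻¹) := by
        gcongr
        refine h1.trans ?_
        rw [← e4]
        gcongr
        linarith
    _ = _ := by ring

theorem norm_hankelSq_sub_le_of_far {k : ℂ} {q B D : ℝ}
    (h : ∀ ζ ∈ Metric.closedBall ((q : ℂ) ^ 2) (B * q), ∃ d : ℂ, HasDerivAt (hankelSq k) d ζ ∧ ‖d‖ ≤ D)
    {ζ ζ' : ℂ} (hζ : ζ ∈ Metric.closedBall ((q : ℂ) ^ 2) (B * q))
    (hζ' : ζ' ∈ Metric.closedBall ((q : ℂ) ^ 2) (B * q)) :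
    ‖hankelSq k ζ' - hankelSq k ζ‖ ≤ D * ‖ζ' - ζ‖ := by
  choose! d hd hb using h
  exact (convex_closedBall _ _).norm_image_sub_le_of_norm_hasDerivWithin_le
    (fun z hz => (hd z hz).hasDerivWithinAt) hb hζ hζ'

theorem one_add_abs_rpow_ge {q₀ x : ℝ} (hx : |x| ≤ q₀) :
    1 ≤ (1 + q₀) ^ (3 / 2 : ℝ) * (1 + |x|) ^ (-(3 / 2) : ℝ) := by
  have h0 : 0 ≤ |x| := abs_nonneg x
  rw [Real.rpow_neg (by positivity), ← div_eq_mul_inv, one_le_div (by positivity)]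
  gcongr

theorem abs_rpow_le_one_add_abs_rpow {x : ℝ} (hx : 1 ≤ |x|) :
    |x| ^ (-(3 / 2) : ℝ) ≤ 4 * (1 + |x|) ^ (-(3 / 2) : ℝ) := by
  have h1 : (2 * |x|) ^ (-(3 / 2) : ℝ) ≤ (1 + |x|) ^ (-(3 / 2) : ℝ) :=
    Real.rpow_le_rpow_of_nonpos (by positivity) (by linarith) (by norm_num)
  rw [Real.mul_rpow (by norm_num) (by positivity)] at h1
  have h2 : (1 : ℝ) ≤ 4 * 2 ^ (-(3 / 2) : ℝ) := by
    have : (4 : ℝ) = 2 ^ (2 : ℝ) := by norm_num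
    rw [this, ← Real.rpow_add (by norm_num)]
    exact Real.one_le_rpow (by norm_num) (by norm_num)
  have h3 : 0 < |x| ^ (-(3 / 2) : ℝ) := by positivity
  nlinarith

/-- Combinations of shifted Hankel functions with vanishing coefficient sum decay like
`|x| ^ (-3/2)`, locally uniformly in the wave number. -/
theorem exists_bound_hankel_combination {ka kb : ℝ} (hka : 0 < ka) (hkb : ka ≤ kb) (s : Finset ℕ)
    (c : ℕ → ℂ) (hc : ∑ l ∈ s, c l = 0) (Y : ℕ → ℝ) (hY : ∀ l ∈ s, Y l ≠ 0) :
    ∃ M : ℝ, ∀ k : ℂ, ka ≤ k.re → k.re ≤ kb → 0 ≤ k.im → k.im ≤ 1 → ∀ x : ℝ,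
      ‖∑ l ∈ s, c l * hankelD 0 (k * Real.sqrt (x ^ 2 + Y l ^ 2))‖ ≤
        M * (1 + |x|) ^ (-(3 / 2) : ℝ) := by
  rcases s.eq_empty_or_nonempty with rfl | hs
  · exact ⟨0, fun k _ _ _ _ x => by simp⟩
  obtain ⟨l₀, hl₀⟩ := hs
  set B : ℝ := 1 + ∑ l ∈ s, Y l ^ 2 with hBdef
  have hB1 : ∀ l ∈ s, Y l ^ 2 ≤ B := fun l hl => by
    have := Finset.single_le_sum (f := fun l => Y l ^ 2) (fun i _ => sq_nonneg (Y i)) hl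
    rw [hBdef]; linarith
  have hB : 0 < B := by
    have : 0 ≤ ∑ l ∈ s, Y l ^ 2 := Finset.sum_nonneg fun i _ => sq_nonneg (Y i)
    rw [hBdef]; linarith
  obtain ⟨C, q₀, hC, hq₀, hfar⟩ := hankelSq_far hka hkb hB
  obtain ⟨C0, hC0, hH⟩ := norm_hankelD_le 0
  set N : ℝ := ∑ l ∈ s, ‖c l‖ * (C0 * (2 * (ka * |Y l|) ^ (-(1 / 2) : ℝ))) with hN
  have hN0 : 0 ≤ N := Finset.sum_nonneg fun i _ => by positivity
  have hS0 : 0 ≤ ∑ l ∈ s, ‖c l‖ := Finset.sum_nonneg fun i _ => by positivity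
  refine ⟨N * (1 + q₀) ^ (3 / 2 : ℝ) + (∑ l ∈ s, ‖c l‖) * (C * (2 * B)) * 4, ?_⟩
  intro k hk1 hk2 hk3 hk4 x
  have hk0 : 0 < k.re := hka.trans_le hk1
  rcases le_total |x| q₀ with hx | hx
  · have h1 : ‖∑ l ∈ s, c l * hankelD 0 (k * Real.sqrt (x ^ 2 + Y l ^ 2))‖ ≤ N := by
      refine norm_sum_le_of_le _ fun l hl => ?_
      rw [norm_mul]
      refine mul_le_mul_of_nonneg_left ?_ (norm_nonneg _)
      have hr0 : 0 < |Y l| := abs_pos.2 (hY l hl)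
      have hr := le_sqrt_sq_add_sq_right x (Y l)
      have hr1 := hr0.trans_le hr
      have h2 := hH _ (re_mul_ofReal_pos hk0 hr1)
      rw [Complex.re_mul_ofReal, Complex.im_mul_ofReal] at h2
      have e1 : (k.re * Real.sqrt (x ^ 2 + Y l ^ 2)) ^ (-(1 / 2) : ℝ) ≤
          (ka * |Y l|) ^ (-(1 / 2) : ℝ) :=
        Real.rpow_le_rpow_of_nonpos (by positivity) (by gcongr) (by norm_num)
      have e2 : Real.exp (-(k.im * Real.sqrt (x ^ 2 + Y l ^ 2))) ≤ 1 := by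
        rw [Real.exp_le_one_iff]
        have : 0 ≤ k.im * Real.sqrt (x ^ 2 + Y l ^ 2) := by positivity
        linarith
      have e3 : (-((0 : ℕ) + 1 / 2) : ℝ) = -(1 / 2) := by norm_num
      rw [e3] at h2
      refine h2.trans ?_
      calc _ ≤ C0 * 1 * ((ka * |Y l|) ^ (-(1 / 2) : ℝ) + (ka * |Y l|) ^ (-(1 / 2) : ℝ)) := by
            gcongr
        _ = _ := by ring
    have h2 := one_add_abs_rpow_ge hx
    have h3 : 0 < (1 + |x|) ^ (-(3 / 2) : ℝ) := by positivity
    have h4 : 0 ≤ (∑ l ∈ s, ‖c l‖) * (C * (2 * B)) * 4 * (1 + |x|) ^ (-(3 / 2) : ℝ) := by positivity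
    calc _ ≤ N * 1 := by rwa [mul_one]
      _ ≤ N * ((1 + q₀) ^ (3 / 2 : ℝ) * (1 + |x|) ^ (-(3 / 2) : ℝ)) := by gcongr
      _ ≤ _ := by linarith
  · have hx1 : 1 ≤ |x| := hq₀.trans hx
    have hmem : ∀ l ∈ s, ((x ^ 2 + Y l ^ 2 : ℝ) : ℂ) ∈
        Metric.closedBall (((|x| : ℝ) : ℂ) ^ 2) (B * |x|) := fun l hl => by
      rw [Metric.mem_closedBall, dist_eq_norm, ← Complex.ofReal_pow, ← Complex.ofReal_sub,
        Complex.norm_real, sq_abs, add_sub_cancel_left, Real.norm_of_nonneg (sq_nonneg _)]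
      nlinarith [hB1 l hl]
    have e1 : ∑ l ∈ s, c l * hankelD 0 (k * Real.sqrt (x ^ 2 + Y l ^ 2)) =
        ∑ l ∈ s, c l * (hankelSq k ((x ^ 2 + Y l ^ 2 : ℝ) : ℂ) -
          hankelSq k ((x ^ 2 + Y l₀ ^ 2 : ℝ) : ℂ)) := by
      simp_rw [mul_sub, Finset.sum_sub_distrib, ← Finset.sum_mul, hc, zero_mul, sub_zero]
      refine Finset.sum_congr rfl fun l _ => ?_
      rw [hankelSq_ofReal k (by positivity)]
    have h1 : ‖∑ l ∈ s, c l * hankelD 0 (k * Real.sqrt (x ^ 2 + Y l ^ 2))‖ ≤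
        (∑ l ∈ s, ‖c l‖) * (C * |x| ^ (-(3 / 2) : ℝ) * (2 * B)) := by
      rw [e1, Finset.sum_mul]
      refine norm_sum_le_of_le _ fun l hl => ?_
      rw [norm_mul]
      refine mul_le_mul_of_nonneg_left ?_ (norm_nonneg _)
      refine (norm_hankelSq_sub_le_of_far (fun ζ hζ =>
        (hfar k hk1 hk2 hk3 hk4 |x| hx ζ hζ).2.2) (hmem l₀ hl₀) (hmem l hl)).trans ?_
      refine mul_le_mul_of_nonneg_left ?_ (by positivity)
      rw [← Complex.ofReal_sub, Complex.norm_real, Real.norm_eq_abs, abs_le]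
      constructor <;> nlinarith [hB1 l hl, hB1 l₀ hl₀, sq_nonneg (Y l), sq_nonneg (Y l₀)]
    have h2 := abs_rpow_le_one_add_abs_rpow hx1
    have h3 : 0 ≤ N * (1 + q₀) ^ (3 / 2 : ℝ) * (1 + |x|) ^ (-(3 / 2) : ℝ) := by positivity
    calc _ ≤ (∑ l ∈ s, ‖c l‖) * (C * (4 * (1 + |x|) ^ (-(3 / 2) : ℝ)) * (2 * B)) :=
          h1.trans (by gcongr)
      _ ≤ _ := by linarith

/-! ### The partial Fourier transform at real wave numbers -/

/-- The partial Fourier transform of a combination of shifted fundamental solutions, up to a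
constant factor; for `b = 0` it is defined by continuity. -/
noncomputable def shiftProfile (s : Finset ℕ) (c : ℕ → ℂ) (Y : ℕ → ℝ) (b : ℂ) : ℂ :=
  if b = 0 then -∑ l ∈ s, c l * (|Y l| : ℝ) else (∑ l ∈ s, c l * Complex.exp (-(b * (|Y l| : ℝ)))) / b

theorem continuous_shiftProfile (s : Finset ℕ) (c : ℕ → ℂ) (hc : ∑ l ∈ s, c l = 0) (Y : ℕ → ℝ) :
    Continuous (shiftProfile s c Y) := by
  have hd : ∀ b : ℂ, HasDerivAt (fun b : ℂ => ∑ l ∈ s, c l * Complex.exp (-(b * (|Y l| : ℝ))))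
      (∑ l ∈ s, c l * (Complex.exp (-(b * (|Y l| : ℝ))) * -(|Y l| : ℝ))) b := fun b =>
    HasDerivAt.fun_sum fun l _ =>
      ((((hasDerivAt_id b).mul_const ((|Y l| : ℝ) : ℂ)).neg.cexp).const_mul (c l)).congr_deriv
        (by simp)
  rw [continuous_iff_continuousAt]
  intro b₀
  by_cases hb : b₀ = 0
  · subst hb
    have h0 : (∑ l ∈ s, c l * Complex.exp (-((0 : ℂ) * (|Y l| : ℝ)))) = 0 := by simpa using hc
    have h1 := (hd 0).tendsto_slope
    rw [← continuousWithinAt_compl_self]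
    have hv : shiftProfile s c Y 0 = ∑ l ∈ s, c l * (Complex.exp (-((0 : ℂ) * (|Y l| : ℝ))) *
        -(|Y l| : ℝ)) := by
      simp [shiftProfile]
    rw [ContinuousWithinAt, hv]
    refine h1.congr' ?_
    filter_upwards [self_mem_nhdsWithin] with b hb
    have hb : b ≠ 0 := hb
    rw [slope_def_field, h0, shiftProfile, if_neg hb]
    simp
  · have h1 : ContinuousAt (fun b : ℂ => (∑ l ∈ s, c l * Complex.exp (-(b * (|Y l| : ℝ)))) / b) b₀ :=
      ContinuousAt.div (hd b₀).continuousAt continuousAt_id hb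
    refine h1.congr ?_
    filter_upwards [isOpen_ne.mem_nhds hb] with b hb'
    rw [shiftProfile, if_neg hb']

theorem integrable_one_add_abs_rpow : Integrable fun x : ℝ => (1 + |x|) ^ (-(3 / 2) : ℝ) := by
  have := integrable_one_add_norm (E := ℝ) (μ := volume) (r := 3 / 2) (by simp; norm_num)
  simpa using this

theorem norm_sub_sq_le_of_re_im {b b₀ : ℂ} (h1 : 0 ≤ b.re) (h2 : b.im ≤ 0) (h3 : 0 ≤ b₀.re)
    (h4 : b₀.im ≤ 0) : ‖b - b₀‖ ^ 2 ≤ ‖b ^ 2 - b₀ ^ 2‖ := by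
  have h5 : ‖b - b₀‖ ≤ ‖b + b₀‖ := by
    rw [← sq_le_sq₀ (norm_nonneg _) (norm_nonneg _), Complex.sq_norm, Complex.sq_norm,
      Complex.normSq_apply, Complex.normSq_apply]
    simp only [Complex.sub_re, Complex.sub_im, Complex.add_re, Complex.add_im]
    nlinarith [mul_nonneg h1 h3, mul_nonneg_of_nonpos_of_nonpos h2 h4]
  rw [sq_sub_sq, norm_mul, sq]
  gcongr

/-- The partial Fourier transform of a combination of shifted fundamental solutions with vanishing
coefficient sum, for real wave numbers. -/
theorem integral_hankel_combination_mul_cexp {k : ℝ} (hk : 0 < k) (a : ℝ) {b : ℂ}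
    (hb : b ^ 2 = a ^ 2 - k ^ 2) (hbre : 0 ≤ b.re) (hbim : b.im ≤ 0) (s : Finset ℕ) (c : ℕ → ℂ)
    (hc : ∑ l ∈ s, c l = 0) (Y : ℕ → ℝ) (hY : ∀ l ∈ s, Y l ≠ 0) :
    ∫ x : ℝ, (∑ l ∈ s, c l * hankelD 0 (k * Real.sqrt (x ^ 2 + Y l ^ 2))) *
      Complex.exp (-(Complex.I * a * x)) = -2 * Complex.I * shiftProfile s c Y b := by
  obtain ⟨M, hM⟩ := exists_bound_hankel_combination hk le_rfl s c hc Y hY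
  have hroot : ∀ ε : ℝ, ∃ β : ℂ, 0 < ε → (β ^ 2 = a ^ 2 - (k + Complex.I * ε) ^ 2 ∧ 0 < β.re ∧
      β.im < 0) := by
    intro ε
    have hw : ((a : ℂ) ^ 2 - (k + Complex.I * ε) ^ 2).im = -(2 * k * ε) := by
      simp [sq]; ring
    refine ⟨(((a : ℂ) ^ 2 - (k + Complex.I * ε) ^ 2)) ^ (1 / 2 : ℂ), fun hε => ?_⟩
    have hsq := cpow_half_sq ((a : ℂ) ^ 2 - (k + Complex.I * ε) ^ 2)
    have hre := re_cpow_half_nonneg ((a : ℂ) ^ 2 - (k + Complex.I * ε) ^ 2)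
    have him := congrArg Complex.im hsq
    rw [hw, sq, Complex.mul_im] at him
    have hkε : 0 < k * ε := by positivity
    refine ⟨hsq, ?_, ?_⟩
    · rcases hre.lt_or_eq with h | h
      · exact h
      · rw [← h] at him; exfalso; linarith
    · by_contra hcon
      push Not at hcon
      have := mul_nonneg hre hcon
      linarith
  choose β hβ using hroot
  have hβlim : Tendsto β (𝓝[>] 0) (𝓝 b) := by
    rw [tendsto_iff_norm_sub_tendsto_zero]
    have h1 : Tendsto (fun ε : ℝ => Real.sqrt ‖((a : ℂ) ^ 2 - (k + Complex.I * ε) ^ 2) - b ^ 2‖)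
        (𝓝[>] 0) (𝓝 0) := by
      have : Continuous fun ε : ℝ =>
          Real.sqrt ‖((a : ℂ) ^ 2 - (k + Complex.I * ε) ^ 2) - b ^ 2‖ := by fun_prop
      have h2 := this.tendsto 0
      simp only [Complex.ofReal_zero, mul_zero, add_zero, hb, sub_self, norm_zero,
        Real.sqrt_zero] at h2
      rw [← hb] at h2
      exact h2.mono_left nhdsWithin_le_nhds
    refine squeeze_zero' (Eventually.of_forall fun ε => norm_nonneg _) ?_ h1
    filter_upwards [self_mem_nhdsWithin] with ε hε
    obtain ⟨e1, e2, e3⟩ := hβ ε hε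
    refine Real.le_sqrt_of_sq_le ?_
    rw [← e1]
    exact norm_sub_sq_le_of_re_im e2.le e3.le hbre hbim
  have hY' : ∀ l ∈ s, 0 < |Y l| := fun l hl => abs_pos.2 (hY l hl)
  have hval : ∀ ε : ℝ, 0 < ε → ∫ x : ℝ, (∑ l ∈ s, c l * hankelD 0 ((k + Complex.I * ε) *
      Real.sqrt (x ^ 2 + Y l ^ 2))) * Complex.exp (-(Complex.I * a * x)) =
      -2 * Complex.I * shiftProfile s c Y (β ε) := by
    intro ε hε
    obtain ⟨e1, e2, e3⟩ := hβ ε hε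
    have hkr : 0 < ((k : ℂ) + Complex.I * ε).re := by simpa using hk
    have hki : 0 < ((k : ℂ) + Complex.I * ε).im := by simpa using hε
    have hβ0 : β ε ≠ 0 := by intro h; rw [h] at e2; simp at e2
    have hi : ∀ l ∈ s, Integrable fun x : ℝ => c l * (hankelD 0 ((k + Complex.I * ε) *
        Real.sqrt (x ^ 2 + |Y l| ^ 2)) * Complex.exp (-(Complex.I * a * x))) := fun l hl => by
      obtain ⟨C, hC, hb⟩ := exists_hankel_exp_bound hkr hki (hY' l hl)
      exact (integrable_mul_cexp_of_bound (continuous_hankelD_sqrt 0 hkr (hY' l hl).ne') hki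
        (fun x => (hb x _ le_rfl).1) a).const_mul _
    rw [shiftProfile, if_neg hβ0]
    have h2 : (fun x : ℝ => (∑ l ∈ s, c l * hankelD 0 ((k + Complex.I * ε) *
        Real.sqrt (x ^ 2 + Y l ^ 2))) * Complex.exp (-(Complex.I * a * x))) = fun x : ℝ =>
        ∑ l ∈ s, c l * (hankelD 0 ((k + Complex.I * ε) * Real.sqrt (x ^ 2 + |Y l| ^ 2)) *
          Complex.exp (-(Complex.I * a * x))) := by
      funext x
      rw [Finset.sum_mul]
      refine Finset.sum_congr rfl fun l _ => ?_
      rw [sq_abs, mul_assoc]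
    rw [h2, integral_finsetSum _ hi, Finset.sum_div, Finset.mul_sum]
    refine Finset.sum_congr rfl fun l hl => ?_
    rw [integral_const_mul, integral_hankel_mul_cexp hkr hki a e1 e2 (hY' l hl)]
    ring
  have hlim1 : Tendsto (fun ε : ℝ => -2 * Complex.I * shiftProfile s c Y (β ε)) (𝓝[>] 0)
      (𝓝 (-2 * Complex.I * shiftProfile s c Y b)) :=
    (((continuous_shiftProfile s c hc Y).tendsto b).comp hβlim).const_mul _
  have hlim2 : Tendsto (fun ε : ℝ => ∫ x : ℝ, (∑ l ∈ s, c l * hankelD 0 ((k + Complex.I * ε) *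
      Real.sqrt (x ^ 2 + Y l ^ 2))) * Complex.exp (-(Complex.I * a * x))) (𝓝[>] 0)
      (𝓝 (∫ x : ℝ, (∑ l ∈ s, c l * hankelD 0 (k * Real.sqrt (x ^ 2 + Y l ^ 2))) *
        Complex.exp (-(Complex.I * a * x)))) := by
    have hev : ∀ᶠ ε : ℝ in 𝓝[>] 0, 0 < ε ∧ ε ≤ 1 := by
      filter_upwards [self_mem_nhdsWithin, nhdsWithin_le_nhds (Iio_mem_nhds one_pos)] with ε h1 h2
      exact ⟨h1, h2.le⟩
    refine tendsto_integral_filter_of_dominated_convergence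
      (fun x : ℝ => M * (1 + |x|) ^ (-(3 / 2) : ℝ)) ?_ ?_
      (integrable_one_add_abs_rpow.const_mul M) ?_
    · filter_upwards [hev] with ε hε
      have hkr : 0 < ((k : ℂ) + Complex.I * ε).re := by simpa using hk
      refine Continuous.aestronglyMeasurable (Continuous.mul ?_ (by fun_prop))
      exact continuous_finsetSum _ fun l hl =>
        continuous_const.mul (continuous_hankelD_sqrt 0 hkr (hY l hl))
    · filter_upwards [hev] with ε hε
      refine Eventually.of_forall fun x => ?_
      rw [norm_mul, norm_cexp_neg_I_mul, mul_one]
      exact hM _ (by simp) (by simp) (by simpa using hε.1.le) (by simpa using hε.2) x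
    · refine Eventually.of_forall fun x => Tendsto.mul_const _ ?_
      refine tendsto_finsetSum _ fun l hl => Tendsto.const_mul _ ?_
      have hr : 0 < Real.sqrt (x ^ 2 + Y l ^ 2) :=
        Real.sqrt_pos.2 (by have := hY l hl; positivity)
      have h3 : Continuous fun ε : ℝ => ((k : ℂ) + Complex.I * ε) * Real.sqrt (x ^ 2 + Y l ^ 2) := by
        fun_prop
      have h4 := h3.tendsto 0
      simp only [Complex.ofReal_zero, mul_zero, add_zero] at h4
      exact ((hasDerivAt_hankelD 0 (re_mul_ofReal_pos (by simpa using hk) hr)).continuousAt.tendsto.comp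
        h4).mono_left nhdsWithin_le_nhds
  refine tendsto_nhds_unique hlim2 (hlim1.congr' ?_)
  filter_upwards [self_mem_nhdsWithin] with ε hε
  exact (hval ε hε).symm

/-- Poisson summation with a quasi-periodicity parameter. -/
theorem tsum_quasiperiodic_eq {f F : ℝ → ℂ} (hf : Continuous f) {M : ℝ}
    (hM : ∀ x, ‖f x‖ ≤ M * (1 + |x|) ^ (-(3 / 2) : ℝ)) {L : ℝ} (hL : 0 < L) (α : ℝ)
    (hF : ∀ a : ℝ, ∫ x : ℝ, f x * Complex.exp (-(Complex.I * a * x)) = F a)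
    (hs : Summable fun n : ℤ => F (α + 2 * Real.pi / L * n)) (x : ℝ) :
    ∑' n : ℤ, Complex.exp (-Complex.I * α * n * L) * f (x + n * L) =
      ∑' n : ℤ, (1 / L : ℂ) * F (α + 2 * Real.pi / L * n) *
        Complex.exp (Complex.I * (α + 2 * Real.pi / L * n : ℝ) * x) := by
  have hLc : (L : ℂ) ≠ 0 := by exact_mod_cast hL.ne'
  set g : ℝ → ℂ := fun v => Complex.exp (-(Complex.I * (α * L : ℝ) * v)) * f (L * v) with hg
  have hgc : Continuous g := by rw [hg]; fun_prop
  have hgn : ∀ v, ‖g v‖ = ‖f (L * v)‖ := fun v => by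
    rw [hg]; simp only [norm_mul]; rw [norm_cexp_neg_I_mul, one_mul]
  have hO : g =O[cocompact ℝ] fun x : ℝ => |x| ^ (-(3 / 2) : ℝ) := by
    refine Asymptotics.IsBigO.of_bound (|M| * L ^ (-(3 / 2) : ℝ)) ?_
    have : ∀ᶠ v : ℝ in cocompact ℝ, v ≠ 0 := by
      have := (isCompact_singleton (x := (0 : ℝ))).compl_mem_cocompact
      filter_upwards [this] with v hv using hv
    filter_upwards [this] with v hv
    have hv' : 0 < |v| := abs_pos.2 hv
    rw [hgn, Real.norm_of_nonneg (by positivity)]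
    refine (hM _).trans ?_
    have h1 : (1 + |L * v|) ^ (-(3 / 2) : ℝ) ≤ (L * |v|) ^ (-(3 / 2) : ℝ) := by
      refine Real.rpow_le_rpow_of_nonpos (by positivity) ?_ (by norm_num)
      rw [abs_mul, abs_of_pos hL]; linarith
    rw [mul_assoc, ← Real.mul_rpow hL.le hv'.le]
    exact mul_le_mul (le_abs_self M) h1 (by positivity) (abs_nonneg M)
  have hFg : ∀ n : ℤ, FourierTransform.fourier g (n : ℝ) =
      (1 / L : ℂ) * F (α + 2 * Real.pi / L * n) := by
    intro n
    rw [Real.fourier_real_eq_integral_exp_smul]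
    have h1 := Measure.integral_comp_mul_left (fun x : ℝ => f x *
      Complex.exp (-(Complex.I * (α + 2 * Real.pi / L * n : ℝ) * x))) L
    rw [hF, abs_of_pos (by positivity), Complex.real_smul] at h1
    have e0 : ((L⁻¹ : ℝ) : ℂ) = 1 / L := by rw [Complex.ofReal_inv, one_div]
    rw [e0] at h1
    rw [← h1]
    congr 1; funext v
    rw [hg]
    simp only [smul_eq_mul]
    rw [← mul_assoc, ← Complex.exp_add, mul_comm (f _)]
    congr 2
    push_cast
    field_simp
    try ring
  have hsg : Summable fun n : ℤ => FourierTransform.fourier g (n : ℝ) := by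
    simp_rw [hFg]; exact hs.mul_left _
  have key := Real.tsum_eq_tsum_fourier_of_rpow_decay_of_summable hgc (by norm_num) hO hsg (x / L)
  have e1 : ∀ n : ℤ, Complex.exp (-Complex.I * α * n * L) * f (x + n * L) =
      Complex.exp (Complex.I * α * x) * g (x / L + n) := by
    intro n
    rw [hg]
    simp only
    rw [← mul_assoc, ← Complex.exp_add]
    have : L * (x / L + n) = x + n * L := by field_simp
    rw [this]
    congr 2
    push_cast
    field_simp
    try ring
  simp_rw [e1]
  rw [tsum_mul_left, key, ← tsum_mul_left]
  refine tsum_congr fun n => ?_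
  rw [hFg, fourier_coe_apply, mul_left_comm, ← Complex.exp_add]
  congr 2
  push_cast
  field_simp
  try ring

/-! ### Series of holomorphic functions -/

theorem norm_fderiv_le_of_holomorphic {E F : Type} [NormedAddCommGroup E] [NormedSpace ℂ E]
    [NormedAddCommGroup F] [NormedSpace ℂ F] {f : E → F} {x : E} {r M : ℝ} (hr : 0 < r)
    (hf : DifferentiableOn ℂ f (Metric.ball x r)) (hM : ∀ y ∈ Metric.ball x r, ‖f y‖ ≤ M) :
    ‖fderiv ℂ f x‖ ≤ M / (r / 2) := by
  have hM0 : 0 ≤ M := (norm_nonneg _).trans (hM x (Metric.mem_ball_self hr))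
  refine ContinuousLinearMap.opNorm_le_bound _ (by positivity) fun v => ?_
  rcases eq_or_ne v 0 with rfl | hv
  · simp
  have hv' : 0 < ‖v‖ := norm_pos_iff.2 hv
  set R : ℝ := r / 2 / ‖v‖ with hR
  have hR0 : 0 < R := by positivity
  have hmem : ∀ t ∈ Metric.closedBall (0 : ℂ) R, x + t • v ∈ Metric.ball x r := fun t ht => by
    rw [mem_closedBall_zero_iff] at ht
    rw [Metric.mem_ball, dist_eq_norm, add_sub_cancel_left, norm_smul]
    calc ‖t‖ * ‖v‖ ≤ R * ‖v‖ := by gcongr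
      _ = r / 2 := by rw [hR]; field_simp
      _ < r := by linarith
  have hd : ∀ t ∈ Metric.closedBall (0 : ℂ) R, HasDerivAt (fun t : ℂ => f (x + t • v))
      (fderiv ℂ f (x + t • v) v) t := fun t ht => by
    have h1 := (hf.differentiableAt (Metric.isOpen_ball.mem_nhds (hmem t ht))).hasFDerivAt
    have h2 : HasDerivAt (fun t : ℂ => x + t • v) v t := by
      simpa using ((hasDerivAt_id t).smul_const v).const_add x
    exact h1.comp_hasDerivAt t h2
  have h0 := hd 0 (by simp [hR0.le])
  rw [zero_smul, add_zero] at h0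
  have key := Complex.norm_deriv_le_of_forall_mem_sphere_norm_le (f := fun t : ℂ => f (x + t • v))
    (c := 0) (C := M) hR0 ?_ fun t ht => hM _ (hmem t (Metric.sphere_subset_closedBall ht))
  · rw [h0.deriv] at key
    calc _ ≤ M / R := key
      _ = _ := by rw [hR]; field_simp
  · refine DifferentiableOn.diffContOnCl fun t ht => ?_
    rw [closure_ball _ hR0.ne'] at ht
    exact (hd t ht).differentiableAt.differentiableWithinAt

theorem hasFDerivAt_tsum_holomorphic {E F ι : Type} [NormedAddCommGroup E] [NormedSpace ℂ E]
    [NormedAddCommGroup F] [NormedSpace ℂ F] [CompleteSpace F] {f : ι → E → F} {u : ι → ℝ}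
    (hu : Summable u) {U : Set E} (hU : IsOpen U) (hf : ∀ i, DifferentiableOn ℂ (f i) U)
    (hb : ∀ i, ∀ x ∈ U, ‖f i x‖ ≤ u i) {x : E} (hx : x ∈ U) :
    HasFDerivAt (fun y => ∑' i, f i y) (∑' i, fderiv ℂ (f i) x) x := by
  obtain ⟨r, hr, hrU⟩ := Metric.isOpen_iff.1 hU x hx
  have hr2 : 0 < r / 2 := by positivity
  have hsub : ∀ y ∈ Metric.ball x (r / 2), Metric.ball y (r / 2) ⊆ U := fun y hy =>
    (Metric.ball_subset_ball' (by rw [Metric.mem_ball] at hy; linarith)).trans hrU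
  refine hasFDerivAt_tsum_of_isPreconnected (𝕜 := ℂ) (u := fun i => u i / (r / 2 / 2))
    (s := Metric.ball x (r / 2)) (hu.div_const _) Metric.isOpen_ball
    (Metric.isPreconnected_ball) (fun i y hy => ?_) (fun i y hy => ?_)
    (Metric.mem_ball_self hr2) ?_ (Metric.mem_ball_self hr2)
  · exact ((hf i).differentiableAt (hU.mem_nhds (hsub y hy (Metric.mem_ball_self hr2)))).hasFDerivAt
  · exact norm_fderiv_le_of_holomorphic hr2 ((hf i).mono (hsub y hy))
      fun z hz => hb i z (hsub y hy hz)
  · exact Summable.of_norm_bounded hu fun i => hb i x hx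

theorem contDiffOn_tsum_holomorphic {E ι : Type} [NormedAddCommGroup E] [NormedSpace ℂ E] (m : ℕ) :
    ∀ {F : Type} [NormedAddCommGroup F] [NormedSpace ℂ F] [CompleteSpace F] {f : ι → E → F}
    {u : ι → ℝ} (_ : Summable u) {U : Set E} (_ : IsOpen U) (_ : ∀ i, ContDiffOn ℂ ∞ (f i) U)
    (_ : ∀ i, ∀ x ∈ U, ‖f i x‖ ≤ u i), ContDiffOn ℂ m (fun y => ∑' i, f i y) U := by
  induction m with
  | zero =>
    intro F _ _ _ f u hu U hU hf hb
    refine contDiffOn_zero.2 fun x hx => ?_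
    exact (hasFDerivAt_tsum_holomorphic hu hU (fun i => (hf i).differentiableOn (by simp)) hb
      hx).continuousAt.continuousWithinAt
  | succ m ih =>
    intro F _ _ _ f u hu U hU hf hb
    have hdiff := fun x hx => hasFDerivAt_tsum_holomorphic hu hU
      (fun i => (hf i).differentiableOn (by simp)) hb (x := x) hx
    have : ((m + 1 : ℕ) : WithTop ℕ∞) = (m : WithTop ℕ∞) + 1 := by push_cast; rfl
    rw [this, contDiffOn_succ_iff_fderiv_of_isOpen hU]
    refine ⟨fun x hx => (hdiff x hx).differentiableAt.differentiableWithinAt, by simp, ?_⟩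
    intro x hx
    obtain ⟨r, hr, hrU⟩ := Metric.isOpen_iff.1 hU x hx
    have hr2 : 0 < r / 2 := by positivity
    have hsub : ∀ y ∈ Metric.ball x (r / 2), Metric.ball y (r / 2) ⊆ U := fun y hy =>
      (Metric.ball_subset_ball' (by rw [Metric.mem_ball] at hy; linarith)).trans hrU
    have hsub' : Metric.ball x (r / 2) ⊆ U := (Metric.ball_subset_ball (by linarith)).trans hrU
    have h1 := ih (f := fun i => fderiv ℂ (f i)) (u := fun i => u i / (r / 2 / 2)) (hu.div_const _)
      (U := Metric.ball x (r / 2)) Metric.isOpen_ball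
      (fun i => ((hf i).fderiv_of_isOpen hU (by simp)).mono hsub')
      (fun i y hy => norm_fderiv_le_of_holomorphic hr2
        (((hf i).differentiableOn (by simp)).mono (hsub y hy)) fun z hz => hb i z (hsub y hy hz))
    have h2 := h1.contDiffAt (Metric.ball_mem_nhds x hr2)
    refine (h2.congr_of_eventuallyEq ?_).contDiffWithinAt
    filter_upwards [Metric.ball_mem_nhds x hr2] with y hy
    exact (hdiff y (hsub' hy)).fderiv

/-- The embedding of the real plane into its complexification. -/
noncomputable def complexify : Plane →L[ℝ] ℂ × ℂ :=
  (Complex.ofRealCLM.comp (EuclideanSpace.proj (0 : Fin 2))).prod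
    (Complex.ofRealCLM.comp (EuclideanSpace.proj (1 : Fin 2)))

@[simp] theorem complexify_apply (p : Plane) : complexify p = ((p 0 : ℂ), (p 1 : ℂ)) := rfl

/-- A family (with a parameter `k` in `V`) of series of functions on the plane which near `p₀` extend
holomorphically to complex arguments, with summable uniform bounds. -/
def HolSeries {ι : Type} (V : Set ℝ) (f : ℝ → ι → Plane → ℂ) (p₀ : Plane) : Prop :=
  ∃ (U : Set (ℂ × ℂ)) (g : ℝ → ι → ℂ × ℂ → ℂ) (u : ι → ℝ), IsOpen U ∧ complexify p₀ ∈ U ∧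
    Summable u ∧ (∀ k ∈ V, ∀ i, ContDiffOn ℂ ∞ (g k i) U) ∧
    (∀ k ∈ V, ∀ i, ∀ z ∈ U, ‖g k i z‖ ≤ u i) ∧
    ∀ k ∈ V, ∀ i, ∀ p, complexify p ∈ U → f k i p = g k i (complexify p)

namespace HolSeries

variable {ι : Type} {V : Set ℝ} {f : ℝ → ι → Plane → ℂ} {p₀ : Plane}

theorem eventually (h : HolSeries V f p₀) : ∀ᶠ p in 𝓝 p₀, HolSeries V f p := by
  obtain ⟨U, g, u, hU, hp, h⟩ := h
  filter_upwards [complexify.continuous.continuousAt.preimage_mem_nhds (hU.mem_nhds hp)] with p hp'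
  exact ⟨U, g, u, hU, hp', h⟩

theorem mono {V' : Set ℝ} (h : HolSeries V f p₀) (hV : V' ⊆ V) : HolSeries V' f p₀ := by
  obtain ⟨U, g, u, hU, hp, hu, h1, h2, h3⟩ := h
  exact ⟨U, g, u, hU, hp, hu, fun k hk => h1 k (hV hk), fun k hk => h2 k (hV hk),
    fun k hk => h3 k (hV hk)⟩

theorem uniform_bound (h : HolSeries V f p₀) : ∃ u : ι → ℝ, Summable u ∧
    ∀ᶠ p in 𝓝 p₀, ∀ k ∈ V, ∀ i, ‖f k i p‖ ≤ u i := by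
  obtain ⟨U, g, u, hU, hp, hu, h1, h2, h3⟩ := h
  refine ⟨u, hu, ?_⟩
  filter_upwards [complexify.continuous.continuousAt.preimage_mem_nhds (hU.mem_nhds hp)] with p hp'
    k hk i
  rw [h3 k hk i p hp']
  exact h2 k hk i _ hp'

theorem summable (h : HolSeries V f p₀) {k : ℝ} (hk : k ∈ V) : Summable fun i => f k i p₀ := by
  obtain ⟨u, hu, h1⟩ := h.uniform_bound
  exact Summable.of_norm_bounded hu fun i => h1.self_of_nhds k hk i

theorem eventuallyEq_comp {U : Set (ℂ × ℂ)} (hU : IsOpen U) {f : Plane → ℂ} {g : ℂ × ℂ → ℂ}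
    (h : ∀ p, complexify p ∈ U → f p = g (complexify p)) {p : Plane} (hp : complexify p ∈ U) :
    f =ᶠ[𝓝 p] g ∘ complexify := by
  filter_upwards [complexify.continuous.continuousAt.preimage_mem_nhds (hU.mem_nhds hp)] with q hq
  exact h q hq

theorem contDiffAt (h : HolSeries V f p₀) {k : ℝ} (hk : k ∈ V) (i : ι) :
    ContDiffAt ℝ ∞ (f k i) p₀ := by
  obtain ⟨U, g, u, hU, hp, hu, h1, h2, h3⟩ := h
  refine ContDiffAt.congr_of_eventuallyEq ?_ (eventuallyEq_comp hU (h3 k hk i) hp)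
  exact (((h1 k hk i).contDiffAt (hU.mem_nhds hp)).restrict_scalars ℝ).comp p₀
    complexify.contDiff.contDiffAt

theorem contDiffAt_tsum (h : HolSeries V f p₀) {k : ℝ} (hk : k ∈ V) (m : ℕ) :
    ContDiffAt ℝ m (fun p => ∑' i, f k i p) p₀ := by
  obtain ⟨U, g, u, hU, hp, hu, h1, h2, h3⟩ := h
  have h4 := contDiffOn_tsum_holomorphic m hu hU (h1 k hk) (h2 k hk)
  refine ContDiffAt.congr_of_eventuallyEq (((h4.contDiffAt (hU.mem_nhds hp)).restrict_scalars ℝ).comp p₀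
    complexify.contDiff.contDiffAt) ?_
  exact eventuallyEq_comp (f := fun p => ∑' i, f k i p) (g := fun z => ∑' i, g k i z) hU
    (fun p hp => tsum_congr fun i => h3 k hk i p hp) hp

theorem hasFDerivAt_comp_complexify {g : ℂ × ℂ → ℂ} {g' : ℂ × ℂ →L[ℂ] ℂ} {p : Plane}
    (h : HasFDerivAt g g' (complexify p)) :
    HasFDerivAt (g ∘ complexify) ((g'.restrictScalars ℝ).comp complexify) p :=
  (h.restrictScalars ℝ).comp p complexify.hasFDerivAt

theorem fderiv_tsum (h : HolSeries V f p₀) {k : ℝ} (hk : k ∈ V) (v : Plane) :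
    fderiv ℝ (fun p => ∑' i, f k i p) p₀ v = ∑' i, fderiv ℝ (f k i) p₀ v := by
  obtain ⟨U, g, u, hU, hp, hu, h1, h2, h3⟩ := h
  have hd : ∀ i, DifferentiableOn ℂ (g k i) U := fun i => (h1 k hk i).differentiableOn (by simp)
  have h4 := hasFDerivAt_tsum_holomorphic hu hU hd (h2 k hk) hp
  have h5 : (fun p => ∑' i, f k i p) =ᶠ[𝓝 p₀] (fun z => ∑' i, g k i z) ∘ complexify :=
    eventuallyEq_comp hU (fun p hp => tsum_congr fun i => h3 k hk i p hp) hp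
  have h6 := (hasFDerivAt_comp_complexify h4).congr_of_eventuallyEq h5
  obtain ⟨r, hr, hrU⟩ := Metric.isOpen_iff.1 hU _ hp
  have hsum : Summable fun i => fderiv ℂ (g k i) (complexify p₀) :=
    Summable.of_norm_bounded (hu.div_const (r / 2)) fun i =>
      norm_fderiv_le_of_holomorphic hr ((hd i).mono hrU) fun z hz => h2 k hk i z (hrU hz)
  rw [h6.fderiv]
  have h7 := (ContinuousLinearMap.apply ℂ ℂ (complexify v)).map_tsum hsum
  simp only [ContinuousLinearMap.apply_apply] at h7
  rw [ContinuousLinearMap.comp_apply, ContinuousLinearMap.coe_restrictScalars', h7]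
  refine tsum_congr fun i => ?_
  have h8 := (hasFDerivAt_comp_complexify ((hd i).differentiableAt
    (hU.mem_nhds hp)).hasFDerivAt).congr_of_eventuallyEq (eventuallyEq_comp hU (h3 k hk i) hp)
  rw [h8.fderiv]
  rfl

theorem deriv (h : HolSeries V f p₀) (v : Plane) :
    HolSeries V (fun k i p => fderiv ℝ (f k i) p v) p₀ := by
  obtain ⟨U, g, u, hU, hp, hu, h1, h2, h3⟩ := h
  obtain ⟨r, hr, hrU⟩ := Metric.isOpen_iff.1 hU _ hp
  have hr2 : 0 < r / 2 := by positivity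
  have hsub : ∀ y ∈ Metric.ball (complexify p₀) (r / 2), Metric.ball y (r / 2) ⊆ U := fun y hy =>
    (Metric.ball_subset_ball' (by rw [Metric.mem_ball] at hy; linarith)).trans hrU
  have hsub' : Metric.ball (complexify p₀) (r / 2) ⊆ U :=
    (Metric.ball_subset_ball (by linarith)).trans hrU
  refine ⟨Metric.ball (complexify p₀) (r / 2), fun k i z => fderiv ℂ (g k i) z (complexify v),
    fun i => u i / (r / 2 / 2) * ‖complexify v‖, Metric.isOpen_ball, Metric.mem_ball_self hr2,
    (hu.div_const _).mul_right _, fun k hk i => ?_, fun k hk i z hz => ?_, fun k hk i p hp' => ?_⟩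
  · exact (((h1 k hk i).fderiv_of_isOpen hU (by simp)).mono hsub').clm_apply contDiffOn_const
  · refine (ContinuousLinearMap.le_opNorm _ _).trans
      (mul_le_mul_of_nonneg_right ?_ (norm_nonneg _))
    exact norm_fderiv_le_of_holomorphic hr2
      (((h1 k hk i).differentiableOn (by simp)).mono (hsub z hz)) fun w hw =>
        h2 k hk i w (hsub z hz hw)
  · have h8 := (hasFDerivAt_comp_complexify (((h1 k hk i).differentiableOn (by simp)).differentiableAt
      (hU.mem_nhds (hsub' hp'))).hasFDerivAt).congr_of_eventuallyEq
        (eventuallyEq_comp hU (h3 k hk i) (hsub' hp'))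
    change fderiv ℝ (f k i) p v = _
    rw [h8.fderiv]
    rfl

theorem continuousAt_tsum (h : HolSeries V f p₀) {k₀ : ℝ} (hV : V ∈ 𝓝 k₀)
    (hc : ∀ i, ContinuousAt (fun q : ℝ × Plane => f q.1 i q.2) (k₀, p₀)) :
    ContinuousAt (fun q : ℝ × Plane => ∑' i, f q.1 i q.2) (k₀, p₀) := by
  obtain ⟨u, hu, hb⟩ := h.uniform_bound
  refine tendsto_tsum_of_dominated_convergence hu hc ?_
  rw [nhds_prod_eq]
  filter_upwards [prod_mem_prod hV hb] with q hq i
  exact hq.2 _ hq.1 i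

end HolSeries

/-! ### The Helmholtz operator -/

/-- The Helmholtz operator `Δ + k²`, by means of iterated directional derivatives. -/
noncomputable def helm (k : ℝ) (f : Plane → ℂ) (p : Plane) : ℂ :=
  ∑ i : Fin 2, fderiv ℝ (fun q => fderiv ℝ f q (EuclideanSpace.single i 1)) p
    (EuclideanSpace.single i 1) + (k : ℂ) ^ 2 * f p

theorem helm_eq_laplacian {k : ℝ} {f : Plane → ℂ} {p : Plane} (hf : ContDiffAt ℝ 2 f p) :
    helm k f p = Laplacian.laplacian f p + (k : ℂ) ^ 2 * f p := by
  rw [helm, InnerProductSpace.laplacian_eq_iteratedFDeriv_orthonormalBasis f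
    (EuclideanSpace.basisFun (Fin 2) ℝ)]
  congr 1
  refine Finset.sum_congr rfl fun i _ => ?_
  have h1 : DifferentiableAt ℝ (fderiv ℝ f) p :=
    (hf.fderiv_right (m := 1) (by norm_num)).differentiableAt (by norm_num)
  rw [iteratedFDeriv_two_apply, EuclideanSpace.basisFun_apply]
  simp only [Matrix.cons_val_zero, Matrix.cons_val_one]
  rw [fderiv_clm_apply h1 (by fun_prop)]
  simp

theorem fderiv_congr_apply {f g : Plane → ℂ} {p : Plane} (h : f =ᶠ[𝓝 p] g) (v : Plane) :
    (fun q => fderiv ℝ f q v) =ᶠ[𝓝 p] fun q => fderiv ℝ g q v :=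
  (h.fderiv (𝕜 := ℝ)).mono fun q hq => by simp only [hq]

theorem helm_congr {k : ℝ} {f g : Plane → ℂ} {p : Plane} (h : f =ᶠ[𝓝 p] g) :
    helm k f p = helm k g p := by
  rw [helm, helm, h.self_of_nhds]
  congr 1
  refine Finset.sum_congr rfl fun i _ => ?_
  rw [(fderiv_congr_apply h _).fderiv_eq]

theorem fderiv_apply_comm {f : Plane → ℂ} {p : Plane} (hf : ContDiffAt ℝ 2 f p) (v w : Plane) :
    fderiv ℝ (fun q => fderiv ℝ f q v) p w = fderiv ℝ (fun q => fderiv ℝ f q w) p v := by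
  have h1 : DifferentiableAt ℝ (fderiv ℝ f) p :=
    (hf.fderiv_right (m := 1) (by norm_num)).differentiableAt (by norm_num)
  rw [fderiv_clm_apply h1 (by fun_prop), fderiv_clm_apply h1 (by fun_prop)]
  have h2 : IsSymmSndFDerivAt ℝ f p := hf.isSymmSndFDerivAt (by simp)
  simpa using h2 w v

theorem contDiffAt_fderiv_apply {f : Plane → ℂ} {p : Plane} {m : ℕ}
    (hf : ContDiffAt ℝ (m + 1 : ℕ) f p) (v : Plane) :
    ContDiffAt ℝ m (fun q => fderiv ℝ f q v) p :=
  (hf.fderiv_right (m := m) (by push_cast; exact le_rfl)).clm_apply contDiffAt_const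

/-- Directional derivatives of solutions of the Helmholtz equation are solutions. -/
theorem helm_fderiv_apply {k : ℝ} {f : Plane → ℂ} {p : Plane} (hf : ContDiffAt ℝ 3 f p)
    (h : ∀ᶠ q in 𝓝 p, helm k f q = 0) (v : Plane) :
    helm k (fun q => fderiv ℝ f q v) p = 0 := by
  have hf3 : ContDiffAt ℝ (2 + 1 : ℕ) f p := hf
  have hev : ∀ᶠ q in 𝓝 p, ContDiffAt ℝ 2 f q :=
    (hf.of_le (by norm_num : (2 : WithTop ℕ∞) ≤ 3)).eventually (by simp)
  have h1 : ∀ i : Fin 2, fderiv ℝ (fun q => fderiv ℝ (fun q => fderiv ℝ f q v) q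
      (EuclideanSpace.single i 1)) p (EuclideanSpace.single i 1) =
      fderiv ℝ (fun q => fderiv ℝ (fun q => fderiv ℝ f q (EuclideanSpace.single i 1)) q
        (EuclideanSpace.single i 1)) p v := by
    intro i
    have h2 : (fun q => fderiv ℝ (fun q => fderiv ℝ f q v) q (EuclideanSpace.single i 1)) =ᶠ[𝓝 p]
        fun q => fderiv ℝ (fun q => fderiv ℝ f q (EuclideanSpace.single i 1)) q v :=
      hev.mono fun q hq => fderiv_apply_comm hq _ _
    rw [h2.fderiv_eq]
    exact fderiv_apply_comm (contDiffAt_fderiv_apply hf3 _) _ _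
  have hd : ∀ i : Fin 2, DifferentiableAt ℝ (fun q => fderiv ℝ (fun q => fderiv ℝ f q
      (EuclideanSpace.single i 1)) q (EuclideanSpace.single i 1)) p := fun i =>
    (contDiffAt_fderiv_apply (m := 1) (contDiffAt_fderiv_apply (m := 2) hf3 _) _).differentiableAt
      (by simp)
  have hz : fderiv ℝ (helm k f) p = 0 := by
    have : helm k f =ᶠ[𝓝 p] fun _ => 0 := h
    rw [this.fderiv_eq]; simp
  have hdf : DifferentiableAt ℝ f p := hf.differentiableAt (by simp)
  have h3 : fderiv ℝ (helm k f) p v = helm k (fun q => fderiv ℝ f q v) p := by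
    have h4 : HasFDerivAt (helm k f) (∑ i : Fin 2, fderiv ℝ (fun q => fderiv ℝ (fun q => fderiv ℝ f q
        (EuclideanSpace.single i 1)) q (EuclideanSpace.single i 1)) p + (k : ℂ) ^ 2 • fderiv ℝ f p) p :=
      (HasFDerivAt.fun_sum fun i _ => (hd i).hasFDerivAt).add (hdf.hasFDerivAt.const_mul _)
    rw [h4.fderiv, helm]
    simp only [add_apply, sum_apply, smul_apply, smul_eq_mul]
    congr 1
    exact Finset.sum_congr rfl fun i _ => (h1 i).symm
  rw [← h3, hz]; rfl

theorem HolSeries.helm_tsum {ι : Type} {V : Set ℝ} {f : ℝ → ι → Plane → ℂ} {p₀ : Plane}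
    (h : HolSeries V f p₀) {k : ℝ} (hk : k ∈ V) (κ : ℝ) (hf : ∀ i, helm κ (f k i) p₀ = 0) :
    helm κ (fun p => ∑' i, f k i p) p₀ = 0 := by
  have h1 : ∀ v : Plane, (fun q => fderiv ℝ (fun p => ∑' i, f k i p) q v) =ᶠ[𝓝 p₀]
      fun q => ∑' i, fderiv ℝ (f k i) q v := fun v =>
    h.eventually.mono fun q hq => hq.fderiv_tsum hk v
  have h2 : ∀ v : Plane, fderiv ℝ (fun q => fderiv ℝ (fun p => ∑' i, f k i p) q v) p₀ v =
      ∑' i, fderiv ℝ (fun q => fderiv ℝ (f k i) q v) p₀ v := fun v => by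
    rw [(h1 v).fderiv_eq]
    exact (h.deriv v).fderiv_tsum hk v
  have h3 : ∀ v : Plane, Summable fun i => fderiv ℝ (fun q => fderiv ℝ (f k i) q v) p₀ v :=
    fun v => ((h.deriv v).deriv v).summable hk
  rw [helm]
  simp_rw [h2]
  rw [← tsum_mul_left, ← Summable.tsum_finsetSum fun i _ => h3 _,
    ← Summable.tsum_add (summable_sum fun i _ => h3 _) ((h.summable hk).mul_left _)]
  have : ∀ i, (∑ l : Fin 2, fderiv ℝ (fun q => fderiv ℝ (f k i) q (EuclideanSpace.single l 1)) p₀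
    (EuclideanSpace.single l 1)) + (κ : ℂ) ^ 2 * f k i p₀ = 0 := hf
  simp_rw [this]
  exact tsum_zero

theorem fderiv_apply_eq_of_hasDerivAt {f : Plane → ℂ} {p v : Plane} {d : ℂ}
    (hf : DifferentiableAt ℝ f p) (h : HasDerivAt (fun t : ℝ => f (p + t • v)) d 0) :
    fderiv ℝ f p v = d := by
  have h1 : HasDerivAt (fun t : ℝ => p + t • v) v 0 := by
    simpa using ((hasDerivAt_id (0 : ℝ)).smul_const v).const_add p
  have h2 : HasFDerivAt f (fderiv ℝ f p) (p + (0 : ℝ) • v) := by simpa using hf.hasFDerivAt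
  exact (h2.comp_hasDerivAt 0 h1).unique h

/-! ### The fundamental solution with a shifted singularity -/

/-- `H₀⁽¹⁾(k|p + (a, b)|)`. -/
noncomputable def hankelAt (k a b : ℝ) (p : Plane) : ℂ :=
  hankelD 0 (k * Real.sqrt ((p 0 + a) ^ 2 + (p 1 + b) ^ 2))

theorem continuousAt_hankelD_sqrt_joint (m : ℕ) {k a b : ℝ} (hk : 0 < k) {p : Plane}
    (hp : 0 < (p 0 + a) ^ 2 + (p 1 + b) ^ 2) :
    ContinuousAt (fun q : ℝ × Plane => hankelD m (q.1 * Real.sqrt ((q.2 0 + a) ^ 2 + (q.2 1 + b) ^ 2)))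
      (k, p) := by
  refine ContinuousAt.comp (f := fun q : ℝ × Plane =>
    ((q.1 : ℂ) * Real.sqrt ((q.2 0 + a) ^ 2 + (q.2 1 + b) ^ 2))) (g := hankelD m)
    (hasDerivAt_hankelD m (re_mul_ofReal_pos (by simpa using hk) (Real.sqrt_pos.2 hp))).continuousAt ?_
  fun_prop

theorem continuousAt_hankelAt {k a b : ℝ} (hk : 0 < k) {p : Plane}
    (hp : 0 < (p 0 + a) ^ 2 + (p 1 + b) ^ 2) :
    ContinuousAt (fun q : ℝ × Plane => hankelAt q.1 a b q.2) (k, p) :=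
  continuousAt_hankelD_sqrt_joint 0 hk hp

theorem continuousAt_hankelGrad {k a b : ℝ} (hk : 0 < k) {p : Plane}
    (hp : 0 < (p 0 + a) ^ 2 + (p 1 + b) ^ 2) :
    ContinuousAt (fun q : ℝ × Plane => hankelGrad q.1 (q.2 0 + a) (q.2 1 + b)) (k, p) := by
  unfold hankelGrad
  refine ContinuousAt.mul (ContinuousAt.mul (by fun_prop)
    (Complex.continuous_ofReal.continuousAt.comp ?_)) (continuousAt_hankelD_sqrt_joint 1 hk hp)
  exact ContinuousAt.div (by fun_prop) (by fun_prop) (Real.sqrt_pos.2 hp).ne'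

theorem continuousAt_hankelGrad_swap {k a b : ℝ} (hk : 0 < k) {p : Plane}
    (hp : 0 < (p 0 + a) ^ 2 + (p 1 + b) ^ 2) :
    ContinuousAt (fun q : ℝ × Plane => hankelGrad q.1 (q.2 1 + b) (q.2 0 + a)) (k, p) := by
  unfold hankelGrad
  simp_rw [add_comm ((_ + b) ^ 2)]
  refine ContinuousAt.mul (ContinuousAt.mul (by fun_prop)
    (Complex.continuous_ofReal.continuousAt.comp ?_)) (continuousAt_hankelD_sqrt_joint 1 hk hp)
  exact ContinuousAt.div (by fun_prop) (by fun_prop) (Real.sqrt_pos.2 hp).ne'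

theorem hasFDerivAt_sqrt_shift {a b : ℝ} {p : Plane} (hp : 0 < (p 0 + a) ^ 2 + (p 1 + b) ^ 2) :
    HasFDerivAt (fun p : Plane => Real.sqrt ((p 0 + a) ^ 2 + (p 1 + b) ^ 2))
      (((p 0 + a) / Real.sqrt ((p 0 + a) ^ 2 + (p 1 + b) ^ 2)) •
        (EuclideanSpace.proj (0 : Fin 2) : Plane →L[ℝ] ℝ) +
        ((p 1 + b) / Real.sqrt ((p 0 + a) ^ 2 + (p 1 + b) ^ 2)) •
        (EuclideanSpace.proj (1 : Fin 2) : Plane →L[ℝ] ℝ)) p := by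
  have h0 : HasFDerivAt (fun p : Plane => p 0) (EuclideanSpace.proj (0 : Fin 2) : Plane →L[ℝ] ℝ) p :=
    (EuclideanSpace.proj (0 : Fin 2) : Plane →L[ℝ] ℝ).hasFDerivAt
  have h1 : HasFDerivAt (fun p : Plane => p 1) (EuclideanSpace.proj (1 : Fin 2) : Plane →L[ℝ] ℝ) p :=
    (EuclideanSpace.proj (1 : Fin 2) : Plane →L[ℝ] ℝ).hasFDerivAt
  refine ((((h0.add_const a).pow 2).add ((h1.add_const b).pow 2)).sqrt hp.ne').congr_fderiv ?_
  have : Real.sqrt ((p 0 + a) ^ 2 + (p 1 + b) ^ 2) ≠ 0 := (Real.sqrt_pos.2 hp).ne'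
  ext v
  simp
  field_simp

theorem hasFDerivAt_hankelAt {k a b : ℝ} (hk : 0 < k) {p : Plane}
    (hp : 0 < (p 0 + a) ^ 2 + (p 1 + b) ^ 2) :
    HasFDerivAt (hankelAt k a b)
      (hankelGrad k (p 1 + b) (p 0 + a) •
        (Complex.ofRealCLM.comp (EuclideanSpace.proj (0 : Fin 2) : Plane →L[ℝ] ℝ)) +
       hankelGrad k (p 0 + a) (p 1 + b) •
        (Complex.ofRealCLM.comp (EuclideanSpace.proj (1 : Fin 2) : Plane →L[ℝ] ℝ))) p := by
  have h1 := hasDerivAt_hankelD 0 (re_mul_ofReal_pos (k := (k : ℂ)) (by simpa using hk)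
    (Real.sqrt_pos.2 hp))
  have h2 : HasDerivAt (fun r : ℝ => hankelD 0 (k * r)) (k * hankelD 1 (k *
      Real.sqrt ((p 0 + a) ^ 2 + (p 1 + b) ^ 2))) (Real.sqrt ((p 0 + a) ^ 2 + (p 1 + b) ^ 2)) := by
    have h3 : HasDerivAt (fun r : ℝ => (k : ℂ) * r) k (Real.sqrt ((p 0 + a) ^ 2 + (p 1 + b) ^ 2)) :=
      ((Complex.ofRealCLM.hasDerivAt).const_mul (k : ℂ)).congr_deriv (by simp)
    exact (HasDerivAt.comp (h₂ := hankelD 0) (h := fun r : ℝ => (k : ℂ) * r)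
      (Real.sqrt ((p 0 + a) ^ 2 + (p 1 + b) ^ 2)) h1 h3).congr_deriv (by simp; ring)
  refine (h2.hasFDerivAt.comp p (hasFDerivAt_sqrt_shift hp)).congr_fderiv ?_
  ext v
  simp [hankelGrad, add_comm ((p 1 + b) ^ 2)]
  ring

theorem fderiv_hankelAt_apply {k a b : ℝ} (hk : 0 < k) {p : Plane}
    (hp : 0 < (p 0 + a) ^ 2 + (p 1 + b) ^ 2) (v : Plane) :
    fderiv ℝ (hankelAt k a b) p v =
      hankelGrad k (p 1 + b) (p 0 + a) * v 0 + hankelGrad k (p 0 + a) (p 1 + b) * v 1 := by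
  rw [(hasFDerivAt_hankelAt hk hp).fderiv]
  simp

theorem eventually_pos_shift {a b : ℝ} {p : Plane} (hp : 0 < (p 0 + a) ^ 2 + (p 1 + b) ^ 2) :
    ∀ᶠ q : Plane in 𝓝 p, 0 < (q 0 + a) ^ 2 + (q 1 + b) ^ 2 := by
  have : Continuous fun q : Plane => (q 0 + a) ^ 2 + (q 1 + b) ^ 2 := by fun_prop
  exact this.continuousAt.eventually (lt_mem_nhds hp)

theorem contDiffAt_hankelD {z : ℂ} (m : ℕ) (hz : 0 < z.re) : ContDiffAt ℂ ∞ (hankelD m) z := by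
  have : AnalyticAt ℂ (hankelD m) z := by
    rw [Complex.analyticAt_iff_eventually_differentiableAt]
    have h1 : IsOpen {z : ℂ | 0 < z.re} := isOpen_lt continuous_const Complex.continuous_re
    filter_upwards [h1.mem_nhds hz] with w hw
    exact (hasDerivAt_hankelD m hw).differentiableAt
  exact this.contDiffAt

theorem contDiffAt_hankelAt {k a b : ℝ} (hk : 0 < k) {p : Plane}
    (hp : 0 < (p 0 + a) ^ 2 + (p 1 + b) ^ 2) : ContDiffAt ℝ ∞ (hankelAt k a b) p := by
  have h1 := (contDiffAt_hankelD 0 (re_mul_ofReal_pos (k := (k : ℂ)) (by simpa using hk)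
    (Real.sqrt_pos.2 hp))).restrict_scalars ℝ
  have h2 : ContDiffAt ℝ ∞ (fun p : Plane => Real.sqrt ((p 0 + a) ^ 2 + (p 1 + b) ^ 2)) p := by
    refine ContDiffAt.sqrt ?_ hp.ne'
    fun_prop
  have h3 : ContDiffAt ℝ ∞ (fun p : Plane => (k : ℂ) * (Real.sqrt ((p 0 + a) ^ 2 + (p 1 + b) ^ 2) : ℂ))
      p := contDiffAt_const.mul (Complex.ofRealCLM.contDiff.contDiffAt.comp p h2)
  exact h1.comp p h3

theorem helm_hankelAt {k a b : ℝ} (hk : 0 < k) {p : Plane}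
    (hp : 0 < (p 0 + a) ^ 2 + (p 1 + b) ^ 2) : helm k (hankelAt k a b) p = 0 := by
  have hkc : 0 < (k : ℂ).re := by simpa using hk
  have hev := eventually_pos_shift hp
  have hsm : ContDiffAt ℝ (1 + 1 : ℕ) (hankelAt k a b) p :=
    (contDiffAt_hankelAt hk hp).of_le (WithTop.coe_le_coe.2 le_top)
  have hd : ∀ v : Plane, DifferentiableAt ℝ (fun q => fderiv ℝ (hankelAt k a b) q v) p := fun v =>
    (contDiffAt_fderiv_apply hsm v).differentiableAt (by simp)
  have e0 : fderiv ℝ (fun q => fderiv ℝ (hankelAt k a b) q (EuclideanSpace.single 0 1)) p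
      (EuclideanSpace.single 0 1) = hankelHess k (p 1 + b) (p 0 + a) := by
    refine fderiv_apply_eq_of_hasDerivAt (hd _) ?_
    have h1 : HasDerivAt (fun t : ℝ => hankelGrad k (p 1 + b) (p 0 + t + a))
        (hankelHess k (p 1 + b) (p 0 + a)) 0 := by
      have h2 := hasDerivAt_hankelGrad hkc (x := p 1 + b) (y := p 0 + 0 + a) (by
        rw [add_zero, add_comm]; exact hp)
      have h3 : HasDerivAt (fun t : ℝ => p 0 + t + a) 1 0 :=
        ((hasDerivAt_id (0 : ℝ)).const_add (p 0)).add_const a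
      have h4 := h2.scomp (0 : ℝ) h3
      simpa [Function.comp_def] using h4
    refine h1.congr_of_eventuallyEq ?_
    have hc : Tendsto (fun t : ℝ => p + t • (EuclideanSpace.single 0 1 : Plane)) (𝓝 0) (𝓝 p) := by
      have : Continuous fun t : ℝ => p + t • (EuclideanSpace.single 0 1 : Plane) := by fun_prop
      simpa using this.tendsto 0
    filter_upwards [hc.eventually hev] with t ht
    rw [fderiv_hankelAt_apply hk ht]
    simp
  have e1 : fderiv ℝ (fun q => fderiv ℝ (hankelAt k a b) q (EuclideanSpace.single 1 1)) p
      (EuclideanSpace.single 1 1) = hankelHess k (p 0 + a) (p 1 + b) := by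
    refine fderiv_apply_eq_of_hasDerivAt (hd _) ?_
    have h1 : HasDerivAt (fun t : ℝ => hankelGrad k (p 0 + a) (p 1 + t + b))
        (hankelHess k (p 0 + a) (p 1 + b)) 0 := by
      have h2 := hasDerivAt_hankelGrad hkc (x := p 0 + a) (y := p 1 + 0 + b) (by
        rw [add_zero]; exact hp)
      have h3 : HasDerivAt (fun t : ℝ => p 1 + t + b) 1 0 :=
        ((hasDerivAt_id (0 : ℝ)).const_add (p 1)).add_const b
      have h4 := h2.scomp (0 : ℝ) h3
      simpa [Function.comp_def] using h4
    refine h1.congr_of_eventuallyEq ?_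
    have hc : Tendsto (fun t : ℝ => p + t • (EuclideanSpace.single 1 1 : Plane)) (𝓝 0) (𝓝 p) := by
      have : Continuous fun t : ℝ => p + t • (EuclideanSpace.single 1 1 : Plane) := by fun_prop
      simpa using this.tendsto 0
    filter_upwards [hc.eventually hev] with t ht
    rw [fderiv_hankelAt_apply hk ht]
    simp
  rw [helm, Fin.sum_univ_two, e0, e1, add_comm (hankelHess _ _ _),
    hankelHess_add_hankelHess hkc hp, hankelAt]
  ring

theorem HolSeries.of_eventually {ι : Type} {f : ℝ → ι → Plane → ℂ} {p₀ : Plane} {k₁ : ℝ}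
    {g : ℝ → ι → ℂ × ℂ → ℂ} {u : ι → ℝ} (hu : Summable u)
    (h : ∀ᶠ q : ℝ × (ℂ × ℂ) in 𝓝 (k₁, complexify p₀), ∀ i,
      ContDiffAt ℂ ∞ (g q.1 i) q.2 ∧ ‖g q.1 i q.2‖ ≤ u i)
    (hfg : ∀ k i p, f k i p = g k i (complexify p)) : ∃ V ∈ 𝓝 k₁, HolSeries V f p₀ := by
  rw [nhds_prod_eq] at h
  obtain ⟨V, hV, U', hU', hVU⟩ := mem_prod_iff.1 h
  obtain ⟨U, hUU', hU, hp⟩ := mem_nhds_iff.1 hU'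
  refine ⟨V, hV, U, g, u, hU, hp, hu, fun k hk i z hz => ?_, fun k hk i z hz => ?_,
    fun k _ i p _ => hfg k i p⟩
  · exact (hVU (Set.mk_mem_prod hk (hUU' hz)) i).1.contDiffWithinAt
  · exact (hVU (Set.mk_mem_prod hk (hUU' hz)) i).2

/-! ### The Hankel function of complex arguments -/

/-- The extension of `hankelAt` to complex coordinates. -/
noncomputable def hankelAtC (k a b : ℝ) (z : ℂ × ℂ) : ℂ :=
  hankelSq k ((z.1 + a) ^ 2 + (z.2 + b) ^ 2)

theorem hankelAt_eq_hankelAtC (k a b : ℝ) (p : Plane) :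
    hankelAt k a b p = hankelAtC k a b (complexify p) := by
  have := hankelSq_ofReal k (r := (p 0 + a) ^ 2 + (p 1 + b) ^ 2) (by positivity)
  rw [hankelAt, hankelAtC, ← this]
  simp

theorem contDiffAt_hankelSq {k ζ : ℂ} (h1 : ζ ∈ Complex.slitPlane)
    (h2 : 0 < (k * ζ ^ (1 / 2 : ℂ)).re) : ContDiffAt ℂ ∞ (hankelSq k) ζ := by
  have h3 : ContDiffAt ℂ ∞ (fun ζ : ℂ => k * ζ ^ (1 / 2 : ℂ)) ζ := by
    have : AnalyticAt ℂ (fun ζ : ℂ => k * ζ ^ (1 / 2 : ℂ)) ζ :=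
      analyticAt_const.mul (analyticAt_id.cpow analyticAt_const h1)
    exact this.contDiffAt
  exact (contDiffAt_hankelD 0 h2).comp ζ h3

theorem contDiffAt_hankelAtC {k a b : ℝ} {z : ℂ × ℂ}
    (h1 : (z.1 + a) ^ 2 + (z.2 + b) ^ 2 ∈ Complex.slitPlane)
    (h2 : 0 < (k * ((z.1 + a) ^ 2 + (z.2 + b) ^ 2) ^ (1 / 2 : ℂ)).re) :
    ContDiffAt ℂ ∞ (hankelAtC k a b) z := by
  have h3 : ContDiffAt ℂ ∞ (fun z : ℂ × ℂ => (z.1 + a) ^ 2 + (z.2 + b) ^ 2) z := by fun_prop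
  exact (contDiffAt_hankelSq h1 h2).comp z h3

theorem eventually_hankelAtC {k₁ a b : ℝ} (hk : 0 < k₁) {p₀ : Plane}
    (hp : 0 < (p₀ 0 + a) ^ 2 + (p₀ 1 + b) ^ 2) :
    ∃ C : ℝ, ∀ᶠ q : ℝ × (ℂ × ℂ) in 𝓝 (k₁, complexify p₀),
      ContDiffAt ℂ ∞ (hankelAtC q.1 a b) q.2 ∧ ‖hankelAtC q.1 a b q.2‖ ≤ C := by
  set ζ₀ : ℂ := (((p₀ 0 + a) ^ 2 + (p₀ 1 + b) ^ 2 : ℝ) : ℂ) with hζ₀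
  have hζc : Continuous fun q : ℝ × (ℂ × ℂ) => (q.2.1 + a) ^ 2 + (q.2.2 + b) ^ 2 := by fun_prop
  have hval : ((complexify p₀).1 + a) ^ 2 + ((complexify p₀).2 + b) ^ 2 = ζ₀ := by
    simp [hζ₀]
  have hslit : ζ₀ ∈ Complex.slitPlane := by
    rw [hζ₀, Complex.ofReal_mem_slitPlane]; exact hp
  have hcp : ContinuousAt (fun q : ℝ × (ℂ × ℂ) =>
      (q.1 : ℂ) * ((q.2.1 + a) ^ 2 + (q.2.2 + b) ^ 2) ^ (1 / 2 : ℂ)) (k₁, complexify p₀) := by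
    refine ContinuousAt.mul (by fun_prop) ?_
    refine ContinuousAt.comp (f := fun q : ℝ × (ℂ × ℂ) => (q.2.1 + a) ^ 2 + (q.2.2 + b) ^ 2)
      (g := fun ζ : ℂ => ζ ^ (1 / 2 : ℂ)) ?_ hζc.continuousAt
    change ContinuousAt _ (((complexify p₀).1 + a) ^ 2 + ((complexify p₀).2 + b) ^ 2)
    rw [hval]
    exact continuousAt_id.cpow continuousAt_const hslit
  have hre : 0 < ((k₁ : ℂ) * (((complexify p₀).1 + a) ^ 2 + ((complexify p₀).2 + b) ^ 2) ^
      (1 / 2 : ℂ)).re := by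
    rw [hval, hζ₀, ofReal_cpow_half hp.le]
    exact re_mul_ofReal_pos (by simpa using hk) (Real.sqrt_pos.2 hp)
  have hc : ContinuousAt (fun q : ℝ × (ℂ × ℂ) => hankelAtC q.1 a b q.2) (k₁, complexify p₀) :=
    ContinuousAt.comp (g := hankelD 0) (f := fun q : ℝ × (ℂ × ℂ) =>
      (q.1 : ℂ) * ((q.2.1 + a) ^ 2 + (q.2.2 + b) ^ 2) ^ (1 / 2 : ℂ))
      (hasDerivAt_hankelD 0 hre).continuousAt hcp
  refine ⟨‖hankelAtC k₁ a b (complexify p₀)‖ + 1, ?_⟩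
  have e1 := hζc.continuousAt.eventually_mem (x := (k₁, complexify p₀))
    (Complex.isOpen_slitPlane.mem_nhds (by
      change ((complexify p₀).1 + a) ^ 2 + ((complexify p₀).2 + b) ^ 2 ∈ _
      rw [hval]; exact hslit))
  have e2 := (Complex.continuous_re.continuousAt.comp hcp).eventually (lt_mem_nhds hre)
  have e3 := hc.norm.eventually (gt_mem_nhds (lt_add_one ‖hankelAtC k₁ a b (complexify p₀)‖))
  filter_upwards [e1, e2, e3] with q h1 h2 h3
  exact ⟨contDiffAt_hankelAtC h1 h2, h3.le⟩

theorem finite_setOf_abs_mul_lt {L : ℝ} (hL : 0 < L) (q : ℝ) :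
    {n : ℤ | ¬ q ≤ |(n : ℝ)| * L}.Finite := by
  refine (Set.finite_Icc (-⌈q / L⌉) ⌈q / L⌉).subset fun n hn => ?_
  rw [Set.mem_ofPred_eq, not_le, ← lt_div_iff₀ hL] at hn
  have h1 := Int.le_ceil (q / L)
  have h2 := abs_lt.1 (hn.trans_le h1)
  constructor
  · have : ((-⌈q / L⌉ : ℤ) : ℝ) < n := by push_cast; linarith
    exact_mod_cast this.le
  · exact_mod_cast h2.2.le

namespace ScatteringSetup

variable (P : ScatteringSetup)

/-- The coefficient `(-1)^l (j choose l)` of the `l`-th shift. -/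
noncomputable def shiftCoeff (l : ℕ) : ℂ := (-1) ^ l * (P.j.choose l : ℂ)

theorem sum_shiftCoeff_mul_pow (x : ℂ) :
    ∑ l ∈ Finset.range (P.j + 1), P.shiftCoeff l * x ^ l = (1 - x) ^ P.j := by
  rw [sub_eq_neg_add, add_pow]
  refine Finset.sum_congr rfl fun l _ => ?_
  rw [shiftCoeff, neg_pow x]
  ring

theorem sum_shiftCoeff : ∑ l ∈ Finset.range (P.j + 1), P.shiftCoeff l = 0 := by
  have := P.sum_shiftCoeff_mul_pow 1
  have hj : P.j ≠ 0 := Nat.one_le_iff_ne_zero.1 P.one_le_j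
  simpa [hj] using this

/-- The quasi-periodic phase factor `e^{-iαnL}`. -/
noncomputable def phase (k : ℝ) (n : ℤ) : ℂ := Complex.exp (-Complex.I * P.α k * n * P.L)

theorem norm_phase (k : ℝ) (n : ℤ) : ‖P.phase k n‖ = 1 := by
  rw [phase, Complex.norm_exp]
  simp

theorem continuous_phase (n : ℤ) : Continuous fun k => P.phase k n := by
  unfold phase α; fun_prop

/-- The `n`-th term of the quasi-periodic Green function, with weights on the singularities. -/
noncomputable def greenTerm (w : ℤ → ℕ → ℂ) (k : ℝ) (n : ℤ) (p : Plane) : ℂ :=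
  P.phase k n * (Complex.I / 4 * ∑ l ∈ Finset.range (P.j + 1),
    P.shiftCoeff l * (w n l * hankelAt k (n * P.L) (l * P.h) p))

/-- The extension of `greenTerm` to complex coordinates. -/
noncomputable def greenTermC (w : ℤ → ℕ → ℂ) (k : ℝ) (n : ℤ) (z : ℂ × ℂ) : ℂ :=
  P.phase k n * (Complex.I / 4 * ∑ l ∈ Finset.range (P.j + 1),
    P.shiftCoeff l * (w n l * hankelAtC k (n * P.L) (l * P.h) z))

/-- The points at which no singularity with nonzero weight is located. -/
def regularPoints (w : ℤ → ℕ → ℂ) : Set Plane :=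
  {p | ∀ n : ℤ, ∀ l ∈ Finset.range (P.j + 1), w n l ≠ 0 →
    0 < (p 0 + n * P.L) ^ 2 + (p 1 + l * P.h) ^ 2}

theorem eventually_greenTermC_near {w : ℤ → ℕ → ℂ} {k₁ : ℝ} (hk : 0 < k₁) {p₀ : Plane}
    (hp : p₀ ∈ P.regularPoints w) (n : ℤ) :
    ∃ C : ℝ, ∀ᶠ q : ℝ × (ℂ × ℂ) in 𝓝 (k₁, complexify p₀),
      ContDiffAt ℂ ∞ (P.greenTermC w q.1 n) q.2 ∧ ‖P.greenTermC w q.1 n q.2‖ ≤ C := by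
  have h1 : ∀ l ∈ Finset.range (P.j + 1), ∃ C : ℝ, ∀ᶠ q : ℝ × (ℂ × ℂ) in 𝓝 (k₁, complexify p₀),
      ContDiffAt ℂ ∞ (fun z => w n l * hankelAtC q.1 (n * P.L) (l * P.h) z) q.2 ∧
        ‖w n l * hankelAtC q.1 (n * P.L) (l * P.h) q.2‖ ≤ C := by
    intro l hl
    by_cases hw : w n l = 0
    · refine ⟨0, Eventually.of_forall fun q => ?_⟩
      simp only [hw, zero_mul, norm_zero, le_refl, and_true]
      exact contDiffAt_const
    · obtain ⟨C, hC⟩ := eventually_hankelAtC hk (hp n l hl hw)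
      refine ⟨‖w n l‖ * C, hC.mono fun q hq => ⟨contDiffAt_const.mul hq.1, ?_⟩⟩
      rw [norm_mul]
      exact mul_le_mul_of_nonneg_left hq.2 (norm_nonneg _)
  choose! C hC using h1
  refine ⟨‖Complex.I / 4‖ * ∑ l ∈ Finset.range (P.j + 1), ‖P.shiftCoeff l‖ * C l, ?_⟩
  filter_upwards [(Finset.eventually_all _).2 hC] with q hq
  constructor
  · exact contDiffAt_const.mul (contDiffAt_const.mul (ContDiffAt.sum fun l hl =>
      contDiffAt_const.mul (hq l hl).1))
  · rw [greenTermC, norm_mul, norm_phase, one_mul, norm_mul]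
    refine mul_le_mul_of_nonneg_left ((norm_sum_le _ _).trans (Finset.sum_le_sum fun l hl => ?_))
      (norm_nonneg _)
    rw [norm_mul]
    exact mul_le_mul_of_nonneg_left (hq l hl).2 (norm_nonneg _)

theorem eventually_greenTermC_far {w : ℤ → ℕ → ℂ} {k₁ : ℝ} (hk : 0 < k₁) (p₀ : Plane) :
    ∃ C q₀ : ℝ, ∀ᶠ q : ℝ × (ℂ × ℂ) in 𝓝 (k₁, complexify p₀), ∀ n : ℤ, q₀ ≤ |(n : ℝ)| * P.L →
      (∀ l, w n l = 1) →
      ContDiffAt ℂ ∞ (P.greenTermC w q.1 n) q.2 ∧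
        ‖P.greenTermC w q.1 n q.2‖ ≤ C * |(n : ℝ)| ^ (-(3 / 2) : ℝ) := by
  set R : ℝ := ‖complexify p₀‖ + 1 with hR
  have hR0 : 0 < R := by positivity
  set B : ℝ := 2 * R + R ^ 2 + (R + P.j * |P.h|) ^ 2 with hB
  have hB0 : 0 < B := by positivity
  obtain ⟨C, q₀, hC, hq₀, H⟩ := hankelSq_far (ka := k₁ / 2) (kb := 2 * k₁) (by positivity)
    (by linarith) hB0
  refine ⟨‖Complex.I / 4‖ * ∑ l ∈ Finset.range (P.j + 1),
    ‖P.shiftCoeff l‖ * (C * P.L ^ (-(3 / 2) : ℝ) * (2 * (R + P.j * |P.h|) ^ 2)), q₀, ?_⟩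
  have hV : ∀ᶠ k : ℝ in 𝓝 k₁, k ∈ Icc (k₁ / 2) (2 * k₁) := Icc_mem_nhds (by linarith) (by linarith)
  have hU : ∀ᶠ z : ℂ × ℂ in 𝓝 (complexify p₀), ‖z‖ < R :=
    continuous_norm.continuousAt.eventually (gt_mem_nhds (lt_add_one _))
  rw [nhds_prod_eq]
  filter_upwards [hV.prod_mk hU] with ⟨k, z⟩ ⟨hkV, hz⟩ n hn hw
  simp only at hkV hz
  have hz1 : ‖z.1‖ ≤ R := (norm_fst_le z).trans hz.le
  have hz2 : ‖z.2‖ ≤ R := (norm_snd_le z).trans hz.le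
  have hq1 : 1 ≤ |(n : ℝ)| * P.L := hq₀.trans hn
  have hlh : ∀ l ∈ Finset.range (P.j + 1), ‖z.2 + ((l * P.h : ℝ) : ℂ)‖ ≤ R + P.j * |P.h| := by
    intro l hl
    have : (l : ℝ) ≤ P.j := by exact_mod_cast Nat.lt_succ_iff.1 (Finset.mem_range.1 hl)
    refine (norm_add_le _ _).trans (add_le_add hz2 ?_)
    rw [Complex.norm_real, Real.norm_eq_abs, abs_mul, Nat.abs_cast]
    gcongr
  have hball : ∀ l ∈ Finset.range (P.j + 1),
      (z.1 + ((n * P.L : ℝ) : ℂ)) ^ 2 + (z.2 + ((l * P.h : ℝ) : ℂ)) ^ 2 ∈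
        Metric.closedBall (((|(n : ℝ)| * P.L : ℝ) : ℂ) ^ 2) (B * (|(n : ℝ)| * P.L)) := by
    intro l hl
    have h1 : (((|(n : ℝ)| * P.L : ℝ) : ℂ)) ^ 2 = ((n * P.L : ℝ) : ℂ) ^ 2 := by
      rw [← Complex.ofReal_pow, ← Complex.ofReal_pow, mul_pow, sq_abs, mul_pow]
    have h2 : (z.1 + ((n * P.L : ℝ) : ℂ)) ^ 2 + (z.2 + ((l * P.h : ℝ) : ℂ)) ^ 2 -
        ((n * P.L : ℝ) : ℂ) ^ 2 =
        z.1 ^ 2 + 2 * z.1 * ((n * P.L : ℝ) : ℂ) + (z.2 + ((l * P.h : ℝ) : ℂ)) ^ 2 := by ring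
    rw [mem_closedBall_iff_norm, h1, h2]
    have h3 : ‖((n * P.L : ℝ) : ℂ)‖ = |(n : ℝ)| * P.L := by
      rw [Complex.norm_real, Real.norm_eq_abs, abs_mul, abs_of_pos P.L_pos]
    calc _ ≤ ‖z.1‖ ^ 2 + 2 * ‖z.1‖ * ‖((n * P.L : ℝ) : ℂ)‖ + ‖z.2 + ((l * P.h : ℝ) : ℂ)‖ ^ 2 := by
            refine (norm_add₃_le).trans ?_
            simp
      _ ≤ R ^ 2 * (|(n : ℝ)| * P.L) + 2 * R * (|(n : ℝ)| * P.L) +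
          (R + P.j * |P.h|) ^ 2 * (|(n : ℝ)| * P.L) := by
            rw [h3]
            have e1 : ‖z.1‖ ^ 2 ≤ R ^ 2 * (|(n : ℝ)| * P.L) :=
              (pow_le_pow_left₀ (norm_nonneg _) hz1 2).trans
                (le_mul_of_one_le_right (by positivity) hq1)
            have e2 : ‖z.2 + ((l * P.h : ℝ) : ℂ)‖ ^ 2 ≤ (R + P.j * |P.h|) ^ 2 * (|(n : ℝ)| * P.L) :=
              (pow_le_pow_left₀ (norm_nonneg _) (hlh l hl) 2).trans
                (le_mul_of_one_le_right (by positivity) hq1)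
            gcongr
      _ = _ := by rw [hB]; ring
  have Hk := fun ζ hζ => H k (by simpa using hkV.1) (by simpa using hkV.2) (by simp) (by simp)
    (|(n : ℝ)| * P.L) hn ζ hζ
  constructor
  · unfold greenTermC
    refine contDiffAt_const.mul (contDiffAt_const.mul (ContDiffAt.sum fun l hl =>
      contDiffAt_const.mul (contDiffAt_const.mul ?_)))
    obtain ⟨h1, h2, -⟩ := Hk _ (hball l hl)
    exact contDiffAt_hankelAtC h1 h2
  · rw [greenTermC, norm_mul, norm_phase, one_mul, norm_mul, mul_assoc]
    refine mul_le_mul_of_nonneg_left ?_ (norm_nonneg _)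
    have h0 : (0 : ℕ) ∈ Finset.range (P.j + 1) := by simp
    have e1 : ∑ l ∈ Finset.range (P.j + 1), P.shiftCoeff l *
        (w n l * hankelAtC k (n * P.L) (l * P.h) z) = ∑ l ∈ Finset.range (P.j + 1), P.shiftCoeff l *
        (hankelAtC k (n * P.L) (l * P.h) z - hankelAtC k (n * P.L) ((0 : ℕ) * P.h) z) := by
      simp_rw [mul_sub, hw, one_mul]
      rw [Finset.sum_sub_distrib, ← Finset.sum_mul, P.sum_shiftCoeff, zero_mul, sub_zero]
    rw [e1, Finset.sum_mul]
    refine (norm_sum_le _ _).trans (Finset.sum_le_sum fun l hl => ?_)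
    rw [norm_mul, mul_assoc ‖P.shiftCoeff l‖]
    refine mul_le_mul_of_nonneg_left ?_ (norm_nonneg _)
    refine (norm_hankelSq_sub_le_of_far (fun ζ hζ => (Hk ζ hζ).2.2) (hball 0 h0) (hball l hl)).trans ?_
    rw [Real.mul_rpow (abs_nonneg _) P.L_pos.le]
    have e2 : ‖(z.1 + ((n * P.L : ℝ) : ℂ)) ^ 2 + (z.2 + ((l * P.h : ℝ) : ℂ)) ^ 2 -
        ((z.1 + ((n * P.L : ℝ) : ℂ)) ^ 2 + (z.2 + (((0 : ℕ) * P.h : ℝ) : ℂ)) ^ 2)‖ ≤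
        2 * (R + P.j * |P.h|) ^ 2 := by
      rw [add_sub_add_left_eq_sub, two_mul]
      refine (norm_sub_le _ _).trans (add_le_add ?_ ?_) <;> rw [norm_pow]
      · exact pow_le_pow_left₀ (norm_nonneg _) (hlh l hl) 2
      · exact pow_le_pow_left₀ (norm_nonneg _) (hlh 0 h0) 2
    calc _ ≤ C * (|(n : ℝ)| ^ (-(3 / 2) : ℝ) * P.L ^ (-(3 / 2) : ℝ)) * (2 * (R + P.j * |P.h|) ^ 2) := by
          have := P.L_pos
          exact mul_le_mul_of_nonneg_left e2 (by positivity)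
      _ = _ := by ring

theorem greenTerm_eq_greenTermC (w : ℤ → ℕ → ℂ) (k : ℝ) (n : ℤ) (p : Plane) :
    P.greenTerm w k n p = P.greenTermC w k n (complexify p) := by
  simp_rw [greenTerm, greenTermC, hankelAt_eq_hankelAtC]

theorem holSeries_greenTerm {w : ℤ → ℕ → ℂ} (hw : {n : ℤ | ¬ ∀ l, w n l = 1}.Finite) {k₁ : ℝ}
    (hk : 0 < k₁) {p₀ : Plane} (hp : p₀ ∈ P.regularPoints w) :
    ∃ V ∈ 𝓝 k₁, HolSeries V (P.greenTerm w) p₀ := by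
  classical
  obtain ⟨C, q₀, hfar⟩ := P.eventually_greenTermC_far (w := w) hk p₀
  choose c hc using P.eventually_greenTermC_near hk hp
  set s : Set ℤ := {n : ℤ | ¬ q₀ ≤ |(n : ℝ)| * P.L} ∪ {n : ℤ | ¬ ∀ l, w n l = 1} with hs
  have hsf : s.Finite := (finite_setOf_abs_mul_lt P.L_pos q₀).union hw
  refine HolSeries.of_eventually (g := P.greenTermC w)
    (u := fun n => if n ∈ s then c n else C * |(n : ℝ)| ^ (-(3 / 2) : ℝ)) ?_ ?_
    (P.greenTerm_eq_greenTermC w)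
  · refine ((Real.summable_abs_int_rpow (b := 3 / 2) (by norm_num)).mul_left C).congr_cofinite ?_
    filter_upwards [hsf.compl_mem_cofinite] with n hn
    rw [if_neg hn]
  · filter_upwards [hfar, (hsf.eventually_all).2 fun n _ => hc n] with q h1 h2 n
    by_cases hn : n ∈ s
    · simpa [hn] using h2 n hn
    · simp only [hn, if_false]
      rw [hs, Set.mem_union, not_or, Set.mem_ofPred_eq, Set.mem_ofPred_eq, not_not, not_not] at hn
      exact h1 n hn.1 hn.2

end ScatteringSetup

theorem helm_add {k : ℝ} {f g : Plane → ℂ} {p : Plane} (hf : ContDiffAt ℝ 2 f p)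
    (hg : ContDiffAt ℝ 2 g p) : helm k (fun q => f q + g q) p = helm k f p + helm k g p := by
  rw [helm_eq_laplacian hf, helm_eq_laplacian hg, helm_eq_laplacian (hf.add hg)]
  have := hf.laplacian_add hg
  rw [show (fun q => f q + g q) = f + g from rfl, this]
  ring

theorem helm_const_mul {k : ℝ} {f : Plane → ℂ} {p : Plane} (c : ℂ) (hf : ContDiffAt ℝ 2 f p) :
    helm k (fun q => c * f q) p = c * helm k f p := by
  rw [helm_eq_laplacian hf, helm_eq_laplacian (contDiffAt_const.mul hf)]
  have := InnerProductSpace.laplacian_smul c hf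
  rw [show (fun q => c * f q) = c • f from rfl, this]
  simp only [smul_eq_mul]
  ring

theorem helm_zero (k : ℝ) (p : Plane) : helm k (fun _ => 0) p = 0 := by simp [helm]

theorem helm_sum {ι : Type} {k : ℝ} {f : ι → Plane → ℂ} {p : Plane} (s : Finset ι)
    (hf : ∀ i ∈ s, ContDiffAt ℝ 2 (f i) p) :
    helm k (fun q => ∑ i ∈ s, f i q) p = ∑ i ∈ s, helm k (f i) p := by
  classical
  induction s using Finset.induction_on with
  | empty => simpa using helm_zero k p
  | insert a s ha ih =>
    have h1 := ih fun i hi => hf i (Finset.mem_insert_of_mem hi)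
    rw [Finset.sum_insert ha, ← h1, ← helm_add (hf a (Finset.mem_insert_self a s))
      (ContDiffAt.sum fun i hi => hf i (Finset.mem_insert_of_mem hi))]
    simp_rw [Finset.sum_insert ha]

namespace ScatteringSetup

variable (P : ScatteringSetup)

/-! ### The quasi-periodic Green function and its regular part -/

theorem eventually_mem_regularPoints {w : ℤ → ℕ → ℂ} {p₀ : Plane} (hp : p₀ ∈ P.regularPoints w) :
    ∀ᶠ p in 𝓝 p₀, p ∈ P.regularPoints w := by
  have h1 : ∀ n : ℤ, ∀ᶠ p : Plane in 𝓝 p₀, ∀ l ∈ Finset.range (P.j + 1), w n l ≠ 0 →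
      0 < (p 0 + n * P.L) ^ 2 + (p 1 + l * P.h) ^ 2 := by
    intro n
    refine (Finset.eventually_all _).2 fun l hl => ?_
    by_cases hw : w n l = 0
    · exact Eventually.of_forall fun _ h => absurd hw h
    · exact (eventually_pos_shift (hp n l hl hw)).mono fun _ h _ => h
  have h2 := ((finite_setOf_abs_mul_lt P.L_pos (|p₀ 0| + 2)).eventually_all).2 fun n _ => h1 n
  have h3 : ∀ᶠ p : Plane in 𝓝 p₀, |p 0 - p₀ 0| < 1 := by
    have : Continuous fun p : Plane => |p 0 - p₀ 0| := by fun_prop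
    exact this.continuousAt.eventually (gt_mem_nhds (by simp))
  filter_upwards [h2, h3] with p h4 h5 n l hl hw
  by_cases hn : |p₀ 0| + 2 ≤ |(n : ℝ)| * P.L
  · have h6 : |p 0| < |p₀ 0| + 1 := by
      have := abs_sub_abs_le_abs_sub (p 0) (p₀ 0)
      linarith
    have h7 : 0 < |p 0 + n * P.L| := by
      have h8 := abs_sub_abs_le_abs_sub (n * P.L) (-(p 0))
      rw [abs_neg, abs_mul, abs_of_pos P.L_pos, sub_neg_eq_add, add_comm _ (p 0)] at h8
      linarith
    have := pow_pos h7 2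
    rw [sq_abs] at this
    positivity
  · exact h4 n hn l hl hw

/-- The sum of the terms `greenTerm`. -/
noncomputable def greenSum (w : ℤ → ℕ → ℂ) (k : ℝ) (p : Plane) : ℂ := ∑' n : ℤ, P.greenTerm w k n p

section

variable {P} {w : ℤ → ℕ → ℂ} {k : ℝ} (hk : 0 < k) {p : Plane} (hp : p ∈ P.regularPoints w)

include hk hp

theorem fderiv_greenTerm_apply (n : ℤ) (v : Plane) :
    fderiv ℝ (P.greenTerm w k n) p v = P.phase k n * (Complex.I / 4 *
      ∑ l ∈ Finset.range (P.j + 1), P.shiftCoeff l * (w n l *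
        (hankelGrad k (p 1 + l * P.h) (p 0 + n * P.L) * v 0 +
          hankelGrad k (p 0 + n * P.L) (p 1 + l * P.h) * v 1))) := by
  have h1 : ∀ l ∈ Finset.range (P.j + 1), HasFDerivAt (fun q => P.shiftCoeff l * (w n l *
      hankelAt k (n * P.L) (l * P.h) q)) (P.shiftCoeff l • (w n l •
        (hankelGrad k (p 1 + l * P.h) (p 0 + n * P.L) •
        (Complex.ofRealCLM.comp (EuclideanSpace.proj (0 : Fin 2) : Plane →L[ℝ] ℝ)) +
       hankelGrad k (p 0 + n * P.L) (p 1 + l * P.h) •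
        (Complex.ofRealCLM.comp (EuclideanSpace.proj (1 : Fin 2) : Plane →L[ℝ] ℝ))))) p := by
    intro l hl
    refine HasFDerivAt.const_mul ?_ _
    by_cases hw' : w n l = 0
    · simp only [hw', zero_mul]
      exact (hasFDerivAt_const (0 : ℂ) p).congr_fderiv (by ext v; simp)
    · exact (hasFDerivAt_hankelAt hk (hp n l hl hw')).const_mul _
  have h2 := ((HasFDerivAt.fun_sum h1).const_mul (Complex.I / 4)).const_mul (P.phase k n)
  unfold greenTerm
  rw [h2.fderiv]
  simp [mul_add]

theorem helm_greenTerm (n : ℤ) : helm k (P.greenTerm w k n) p = 0 := by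
  have hterm : ∀ l ∈ Finset.range (P.j + 1),
      ContDiffAt ℝ 2 (fun q => w n l * hankelAt k (n * P.L) (l * P.h) q) p := fun l hl => by
    by_cases hw' : w n l = 0
    · simp only [hw', zero_mul]; exact contDiffAt_const
    · exact contDiffAt_const.mul
        ((contDiffAt_hankelAt hk (hp n l hl hw')).of_le (WithTop.coe_le_coe.2 le_top))
  unfold greenTerm
  rw [helm_const_mul _ (contDiffAt_const.mul (ContDiffAt.sum fun l hl =>
      contDiffAt_const.mul (hterm l hl))),
    helm_const_mul _ (ContDiffAt.sum fun l hl => contDiffAt_const.mul (hterm l hl)),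
    helm_sum _ fun l hl => contDiffAt_const.mul (hterm l hl),
    Finset.sum_eq_zero, mul_zero, mul_zero]
  intro l hl
  rw [helm_const_mul _ (hterm l hl)]
  by_cases hw' : w n l = 0
  · simp [hw', helm_zero]
  · rw [helm_const_mul _ ((contDiffAt_hankelAt hk (hp n l hl hw')).of_le
      (WithTop.coe_le_coe.2 le_top)), helm_hankelAt hk (hp n l hl hw'), mul_zero, mul_zero]

variable (hw : {n : ℤ | ¬ ∀ l, w n l = 1}.Finite)

include hw

theorem contDiffAt_greenSum (m : ℕ) : ContDiffAt ℝ m (P.greenSum w k) p := by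
  obtain ⟨V, hV, h⟩ := P.holSeries_greenTerm hw hk hp
  exact h.contDiffAt_tsum (mem_of_mem_nhds hV) m

theorem summable_greenTerm : Summable fun n => P.greenTerm w k n p := by
  obtain ⟨V, hV, h⟩ := P.holSeries_greenTerm hw hk hp
  exact h.summable (mem_of_mem_nhds hV)

theorem continuousAt_greenSum :
    ContinuousAt (fun q : ℝ × Plane => P.greenSum w q.1 q.2) (k, p) := by
  obtain ⟨V, hV, h⟩ := P.holSeries_greenTerm hw hk hp
  refine h.continuousAt_tsum hV fun n => ?_
  unfold greenTerm
  refine ContinuousAt.mul ((P.continuous_phase n).comp continuous_fst).continuousAt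
    (continuousAt_const.mul ?_)
  refine tendsto_finsetSum _ fun l hl => ?_
  refine (ContinuousAt.mul continuousAt_const ?_)
  by_cases hw' : w n l = 0
  · simp only [hw', zero_mul]; exact continuousAt_const
  · exact continuousAt_const.mul (continuousAt_hankelAt hk (hp n l hl hw'))

theorem helm_greenSum : helm k (P.greenSum w k) p = 0 := by
  obtain ⟨V, hV, h⟩ := P.holSeries_greenTerm hw hk hp
  exact h.helm_tsum (mem_of_mem_nhds hV) k fun n => helm_greenTerm hk hp n

theorem continuousAt_fderiv_greenSum (v : Plane) :
    ContinuousAt (fun q : ℝ × Plane => fderiv ℝ (P.greenSum w q.1) q.2 v) (k, p) := by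
  obtain ⟨V, hV, h⟩ := P.holSeries_greenTerm hw hk hp
  have hev : ∀ᶠ q : ℝ × Plane in 𝓝 (k, p), (q.1 ∈ V ∧ 0 < q.1) ∧
      HolSeries V (P.greenTerm w) q.2 ∧ q.2 ∈ P.regularPoints w := by
    rw [nhds_prod_eq]
    have h1 : ∀ᶠ κ in 𝓝 k, κ ∈ V ∧ 0 < κ := (Filter.Eventually.and hV (lt_mem_nhds hk))
    exact h1.prod_mk (h.eventually.and (P.eventually_mem_regularPoints hp))
  have h2 : ContinuousAt (fun q : ℝ × Plane => ∑' n, fderiv ℝ (P.greenTerm w q.1 n) q.2 v) (k, p) := by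
    refine (h.deriv v).continuousAt_tsum hV fun n => ?_
    have h3 : ContinuousAt (fun q : ℝ × Plane => P.phase q.1 n * (Complex.I / 4 *
      ∑ l ∈ Finset.range (P.j + 1), P.shiftCoeff l * (w n l *
        (hankelGrad q.1 (q.2 1 + l * P.h) (q.2 0 + n * P.L) * v 0 +
          hankelGrad q.1 (q.2 0 + n * P.L) (q.2 1 + l * P.h) * v 1)))) (k, p) := by
      refine ContinuousAt.mul ((P.continuous_phase n).comp continuous_fst).continuousAt
        (continuousAt_const.mul ?_)
      refine tendsto_finsetSum _ fun l hl => ?_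
      refine (ContinuousAt.mul continuousAt_const ?_)
      by_cases hw' : w n l = 0
      · simp only [hw', zero_mul]; exact continuousAt_const
      · exact continuousAt_const.mul (((continuousAt_hankelGrad_swap hk (hp n l hl hw')).mul
          continuousAt_const).add ((continuousAt_hankelGrad hk (hp n l hl hw')).mul
          continuousAt_const))
    refine h3.congr ?_
    filter_upwards [hev] with q hq
    exact (fderiv_greenTerm_apply hq.1.2 hq.2.2 n v).symm
  refine h2.congr ?_
  filter_upwards [hev] with q hq
  exact (hq.2.1.fderiv_tsum hq.1.1 v).symm

end

/-- The weights of the quasi-periodic Green function. -/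
def fullWeight (_ : ℤ) (_ : ℕ) : ℂ := 1

/-- The weights that remove the singularity at the origin. -/
noncomputable def regWeight (n : ℤ) (l : ℕ) : ℂ := if n = 0 ∧ l = 0 then 0 else 1

theorem finite_fullWeight : {n : ℤ | ¬ ∀ l, fullWeight n l = 1}.Finite := by
  simp [fullWeight]

theorem finite_regWeight : {n : ℤ | ¬ ∀ l, regWeight n l = 1}.Finite := by
  refine (Set.finite_singleton 0).subset fun n hn => ?_
  by_contra h0
  exact hn fun l => if_neg fun h => h0 h.1

variable {P}

theorem regularPoints_full_subset {p : Plane} (hp : p ∈ P.regularPoints fullWeight) (w : ℤ → ℕ → ℂ) :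
    p ∈ P.regularPoints w := fun n l hl _ => hp n l hl one_ne_zero

theorem quasiGreen_eq_greenSum {k : ℝ} (hk : 0 < k) {p : Plane} (hp : p ∈ P.regularPoints fullWeight) :
    P.quasiGreen k p = P.greenSum fullWeight k p := by
  refine tsum_congr fun n => ?_
  rw [greenTerm, shiftedGreen, phase]
  congr 2
  refine Finset.sum_congr rfl fun l hl => ?_
  rw [shiftCoeff, fullWeight, one_mul, hankelAt, hankelH0_eq]
  · simp
  · refine mul_pos hk (Real.sqrt_pos.2 ?_)
    simpa using hp n l hl one_ne_zero

theorem quasiGreen_eventuallyEq {k : ℝ} (hk : 0 < k) {p : Plane}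
    (hp : p ∈ P.regularPoints fullWeight) : P.quasiGreen k =ᶠ[𝓝 p] P.greenSum fullWeight k :=
  (P.eventually_mem_regularPoints hp).mono fun _ hq => quasiGreen_eq_greenSum hk hq

theorem greenSum_full_eq {k : ℝ} (hk : 0 < k) {p : Plane} (hp : p ∈ P.regularPoints fullWeight) :
    P.greenSum fullWeight k p = Complex.I / 4 * hankelAt k 0 0 p + P.greenSum regWeight k p := by
  have h1 : ∀ n, P.greenTerm fullWeight k n p =
      (if n = 0 then Complex.I / 4 * hankelAt k 0 0 p else 0) + P.greenTerm regWeight k n p := by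
    intro n
    by_cases hn : n = 0
    · subst hn
      rw [if_pos rfl, greenTerm, greenTerm, ← sub_eq_iff_eq_add, ← mul_sub, ← mul_sub,
        ← Finset.sum_sub_distrib, Finset.sum_eq_single 0]
      · simp [fullWeight, regWeight, phase, shiftCoeff]
      · intro l _ hl
        simp [fullWeight, regWeight, hl]
      · simp
    · rw [if_neg hn, zero_add, greenTerm, greenTerm]
      simp [fullWeight, regWeight, hn]
  rw [greenSum, tsum_congr h1, Summable.tsum_add (summable_of_hasFiniteSupport
    ((Set.finite_singleton (0 : ℤ)).subset fun n hn => by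
      by_contra h; exact hn (if_neg h)))
    (summable_greenTerm hk (regularPoints_full_subset hp _) finite_regWeight), tsum_ite_eq]
  rfl

theorem regularPoints_full_add {p : Plane} (hp : p ∈ P.regularPoints fullWeight) (m : ℤ) :
    p + !₂[(m : ℝ) * P.L, 0] ∈ P.regularPoints fullWeight := by
  intro n l hl _
  have := hp (n + m) l hl one_ne_zero
  simp only [PiLp.add_apply, Matrix.cons_val_zero, Matrix.cons_val_one]
  push_cast at this
  simpa [add_mul, add_assoc, add_comm, add_left_comm] using this

theorem quasiGreen_add (k : ℝ) (p : Plane) (m : ℤ) :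
    P.quasiGreen k (p + !₂[(m : ℝ) * P.L, 0]) =
      Complex.exp (Complex.I * P.α k * m * P.L) * P.quasiGreen k p := by
  rw [quasiGreen, quasiGreen, ← tsum_mul_left, ← (Equiv.addRight (-m)).tsum_eq]
  refine tsum_congr fun n => ?_
  rw [← mul_assoc, ← Complex.exp_add]
  congr 1
  · congr 1
    simp
    ring
  · congr 1
    ext i
    fin_cases i <;> simp
    ring

end ScatteringSetup

namespace HolSeries

variable {ι : Type} {V : Set ℝ} {f g : ℝ → ι → Plane → ℂ} {p₀ : Plane}

theorem add (hf : HolSeries V f p₀) (hg : HolSeries V g p₀) :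
    HolSeries V (fun k i p => f k i p + g k i p) p₀ := by
  obtain ⟨U, F, u, hU, hp, hu, h1, h2, h3⟩ := hf
  obtain ⟨U', F', u', hU', hp', hu', h1', h2', h3'⟩ := hg
  refine ⟨U ∩ U', fun k i z => F k i z + F' k i z, fun i => u i + u' i, hU.inter hU', ⟨hp, hp'⟩,
    hu.add hu', fun k hk i => ?_, fun k hk i z hz => ?_, fun k hk i p hz => ?_⟩
  · exact ((h1 k hk i).mono inter_subset_left).add ((h1' k hk i).mono inter_subset_right)
  · exact (norm_add_le _ _).trans (add_le_add (h2 k hk i z hz.1) (h2' k hk i z hz.2))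
  · exact congrArg₂ (· + ·) (h3 k hk i p hz.1) (h3' k hk i p hz.2)

theorem const_sub {q : Plane} (hf : HolSeries V f (q - p₀)) :
    HolSeries V (fun k i p => f k i (q - p)) p₀ := by
  obtain ⟨U, F, u, hU, hp, hu, h1, h2, h3⟩ := hf
  have hc : ContDiff ℂ ∞ fun z : ℂ × ℂ => complexify q - z := by fun_prop
  refine ⟨(fun z => complexify q - z) ⁻¹' U, fun k i z => F k i (complexify q - z), u,
    hU.preimage hc.continuous, ?_, hu, fun k hk i => ?_, fun k hk i z hz => h2 k hk i _ hz,
    fun k hk i p hz => ?_⟩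
  · rw [mem_preimage, ← map_sub]; exact hp
  · exact (h1 k hk i).comp hc.contDiffOn fun z hz => hz
  · rw [mem_preimage, ← map_sub] at hz
    exact (h3 k hk i _ hz).trans (by rw [map_sub])

theorem congr (hf : HolSeries V f p₀) (h : ∀ k ∈ V, ∀ i p, f k i p = g k i p) :
    HolSeries V g p₀ := by
  obtain ⟨U, F, u, hU, hp, hu, h1, h2, h3⟩ := hf
  exact ⟨U, F, u, hU, hp, hu, h1, h2, fun k hk i p hz => by rw [← h k hk, h3 k hk i p hz]⟩

theorem of_finite {k₁ : ℝ} {F : ι → ℂ × ℂ → ℂ} {s : Set ι} (hs : s.Finite)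
    (hF : ∀ i, ContDiff ℂ ∞ (F i)) (h0 : ∀ i ∉ s, ∀ z, F i z = 0)
    (hfF : ∀ i p, f k₁ i p = F i (complexify p)) : HolSeries {k₁} f p₀ := by
  classical
  have h1 : ∃ V ∈ 𝓝 k₁, HolSeries V (fun _ i p => F i (complexify p)) p₀ := by
    refine HolSeries.of_eventually (g := fun _ => F)
      (u := fun i => if i ∈ s then ‖F i (complexify p₀)‖ + 1 else 0) ?_ ?_ fun _ _ _ => rfl
    · exact summable_of_hasFiniteSupport (hs.subset fun i hi => by
        by_contra h; exact hi (if_neg h))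
    · have h2 : ∀ i, ∀ᶠ q : ℝ × (ℂ × ℂ) in 𝓝 (k₁, complexify p₀),
          ‖F i q.2‖ < ‖F i (complexify p₀)‖ + 1 := fun i => by
        have : Continuous fun q : ℝ × (ℂ × ℂ) => ‖F i q.2‖ :=
          ((hF i).continuous.comp continuous_snd).norm
        exact this.continuousAt.eventually (gt_mem_nhds (lt_add_one _))
      filter_upwards [hs.eventually_all.2 fun i _ => h2 i] with q hq i
      refine ⟨(hF i).contDiffAt, ?_⟩
      by_cases hi : i ∈ s
      · simpa [hi] using (hq i hi).le
      · simp [hi, h0 i hi]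
  obtain ⟨V, hV, h⟩ := h1
  refine (h.mono (singleton_subset_iff.2 (mem_of_mem_nhds hV))).congr fun k hk i p => ?_
  rw [mem_singleton_iff.1 hk, hfF]

theorem exists_bound_of_isCompact {K : Set Plane} (hK : IsCompact K) (h : ∀ p ∈ K, HolSeries V f p) :
    ∃ u : ι → ℝ, Summable u ∧ ∀ k ∈ V, ∀ p ∈ K, ∀ i, ‖f k i p‖ ≤ u i := by
  refine hK.induction_on (p := fun S => ∃ u : ι → ℝ, Summable u ∧ ∀ k ∈ V, ∀ p ∈ S, ∀ i,
    ‖f k i p‖ ≤ u i) ⟨0, summable_zero, by simp⟩ ?_ ?_ ?_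
  · rintro S T hST ⟨u, hu, h⟩
    exact ⟨u, hu, fun k hk p hp => h k hk p (hST hp)⟩
  · rintro S T ⟨u, hu, h1⟩ ⟨u', hu', h2⟩
    refine ⟨fun i => |u i| + |u' i|, hu.abs.add hu'.abs, fun k hk p hp i => ?_⟩
    rcases hp with hp | hp
    · exact ((h1 k hk p hp i).trans (le_abs_self _)).trans (le_add_of_nonneg_right (abs_nonneg _))
    · exact ((h2 k hk p hp i).trans (le_abs_self _)).trans (le_add_of_nonneg_left (abs_nonneg _))
  · intro p hp
    obtain ⟨u, hu, h1⟩ := (h p hp).uniform_bound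
    exact ⟨_, mem_nhdsWithin_of_mem_nhds h1, u, hu, fun k hk q hq i => hq k hk i⟩

end HolSeries

theorem summable_one_add_abs_mul_exp {c : ℝ} (hc : 0 < c) :
    Summable fun n : ℤ => (1 + |(n : ℝ)|) * Real.exp (-c * |(n : ℝ)|) := by
  have h0 : Summable fun n : ℕ => (1 + (n : ℝ)) * Real.exp (-c * n) := by
    have h1 := Real.summable_pow_mul_exp_neg_nat_mul 0 hc
    have h2 := Real.summable_pow_mul_exp_neg_nat_mul 1 hc
    refine (h1.add h2).congr fun n => ?_
    simp; ring
  refine Summable.of_nat_of_neg ?_ ?_ <;> simpa using h0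

theorem sqrt_add_I_mul_sqrt_sq (k a : ℝ) :
    ((Real.sqrt (k ^ 2 - a ^ 2) : ℂ) + Complex.I * (Real.sqrt (a ^ 2 - k ^ 2) : ℂ)) ^ 2 =
      (k : ℂ) ^ 2 - (a : ℂ) ^ 2 := by
  have h1 : ((Real.sqrt (k ^ 2 - a ^ 2) : ℝ) : ℂ) ^ 2 -
      ((Real.sqrt (a ^ 2 - k ^ 2) : ℝ) : ℂ) ^ 2 +
      2 * Complex.I * ((Real.sqrt (k ^ 2 - a ^ 2) * Real.sqrt (a ^ 2 - k ^ 2) : ℝ) : ℂ) =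
      ((k ^ 2 - a ^ 2 : ℝ) : ℂ) := by
    rcases le_total 0 (k ^ 2 - a ^ 2) with h | h
    · rw [Real.sqrt_eq_zero'.2 (by linarith : a ^ 2 - k ^ 2 ≤ 0), ← Complex.ofReal_pow,
        Real.sq_sqrt h]
      simp
    · rw [Real.sqrt_eq_zero'.2 h, ← Complex.ofReal_pow (Real.sqrt (a ^ 2 - k ^ 2)),
        Real.sq_sqrt (by linarith)]
      simp
  push_cast at h1
  rw [← h1]
  linear_combination ((Real.sqrt (a ^ 2 - k ^ 2) : ℝ) : ℂ) ^ 2 * Complex.I_sq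

namespace ScatteringSetup

variable (P : ScatteringSetup)

/-! ### The wave numbers `β_n` -/

theorem βn_re (n : ℤ) (k : ℝ) : (P.βn n k).re = Real.sqrt (k ^ 2 - P.αn n k ^ 2) := by simp [βn]

theorem βn_im (n : ℤ) (k : ℝ) : (P.βn n k).im = Real.sqrt (P.αn n k ^ 2 - k ^ 2) := by simp [βn]

theorem βn_im_nonneg (n : ℤ) (k : ℝ) : 0 ≤ (P.βn n k).im := by
  rw [βn_im]; exact Real.sqrt_nonneg _

theorem βn_re_nonneg (n : ℤ) (k : ℝ) : 0 ≤ (P.βn n k).re := by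
  rw [βn_re]; exact Real.sqrt_nonneg _

theorem βn_re_le (n : ℤ) (k : ℝ) : (P.βn n k).re ≤ |k| := by
  rw [βn_re]
  exact Real.sqrt_le_iff.2 ⟨abs_nonneg _, by rw [sq_abs]; linarith [sq_nonneg (P.αn n k)]⟩

theorem βn_sq (n : ℤ) (k : ℝ) : P.βn n k ^ 2 = (k : ℂ) ^ 2 - (P.αn n k : ℂ) ^ 2 :=
  sqrt_add_I_mul_sqrt_sq k (P.αn n k)

theorem βn_eq_zero_iff (n : ℤ) (k : ℝ) : P.βn n k = 0 ↔ k ^ 2 = P.αn n k ^ 2 := by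
  rw [← sq_eq_zero_iff, βn_sq, sub_eq_zero]
  norm_cast

theorem continuous_αn (n : ℤ) : Continuous (P.αn n) := by
  unfold αn α; fun_prop

theorem continuous_βn (n : ℤ) : Continuous (P.βn n) := by
  have := P.continuous_αn n
  unfold βn
  fun_prop

theorem abs_αn_le (n : ℤ) (k : ℝ) : |P.αn n k| ≤ |k| + 2 * Real.pi / P.L * |(n : ℝ)| := by
  have := P.L_pos
  rw [αn, α]
  refine (abs_add_le _ _).trans (add_le_add ?_ ?_)
  · rw [abs_mul]
    exact mul_le_of_le_one_right (abs_nonneg _) (Real.abs_sin_le_one _)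
  · rw [abs_mul, abs_of_nonneg (by positivity)]

theorem le_βn_im (n : ℤ) (k : ℝ) : 2 * Real.pi / P.L * |(n : ℝ)| - 2 * |k| ≤ (P.βn n k).im := by
  have hL := P.L_pos
  have h1 : 2 * Real.pi / P.L * |(n : ℝ)| - |k| ≤ |P.αn n k| := by
    have h2 : |2 * Real.pi / P.L * (n : ℝ)| ≤ |P.αn n k| + |P.α k| := by
      have := abs_sub (P.αn n k) (P.α k)
      rwa [αn, add_sub_cancel_left] at this
    have h3 : |P.α k| ≤ |k| := by
      rw [α, abs_mul]
      exact mul_le_of_le_one_right (abs_nonneg _) (Real.abs_sin_le_one _)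
    rw [abs_mul, abs_of_nonneg (by positivity : 0 ≤ 2 * Real.pi / P.L)] at h2
    linarith
  rw [βn_im]
  rcases le_total |P.αn n k| |k| with h | h
  · exact le_trans (by linarith) (Real.sqrt_nonneg _)
  · refine le_trans (by linarith : _ ≤ |P.αn n k| - |k|) (Real.le_sqrt_of_sq_le ?_)
    rw [← sq_abs (P.αn n k), ← sq_abs k]
    nlinarith [abs_nonneg k]

theorem finite_setOf_βn_im_lt (K R : ℝ) : {n : ℤ | ¬ ∀ k, |k| ≤ K → R ≤ (P.βn n k).im}.Finite := by
  refine (finite_setOf_abs_mul_lt (L := 2 * Real.pi / P.L) (by have := P.L_pos; positivity)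
    (R + 2 * K)).subset fun n hn h => hn fun k hk => ?_
  have := P.le_βn_im n k
  linarith

theorem exists_le_norm_βn (k₀ : ℝ) :
    ∃ m : ℝ, 0 < m ∧ ∀ᶠ k in 𝓝 k₀, ∀ n ∉ P.Nwa k₀, m ≤ ‖P.βn n k‖ := by
  have hf := P.finite_setOf_βn_im_lt (|k₀| + 1) 1
  have h1 : ∀ n, ∃ m : ℝ, 0 < m ∧ ∀ᶠ k in 𝓝 k₀, n ∉ P.Nwa k₀ → m ≤ ‖P.βn n k‖ := by
    intro n
    by_cases hn : n ∈ P.Nwa k₀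
    · exact ⟨1, one_pos, Eventually.of_forall fun _ h => absurd hn h⟩
    · have h2 : 0 < ‖P.βn n k₀‖ := norm_pos_iff.2 hn
      refine ⟨‖P.βn n k₀‖ / 2, by positivity, ?_⟩
      filter_upwards [(P.continuous_βn n).norm.continuousAt.eventually
        (lt_mem_nhds (by linarith : ‖P.βn n k₀‖ / 2 < ‖P.βn n k₀‖))] with k hk _
      exact hk.le
  choose m hm hm' using h1
  obtain ⟨m', hm0, hmle⟩ : ∃ m' : ℝ, 0 < m' ∧ ∀ n ∈ {n : ℤ | ¬ ∀ k, |k| ≤ |k₀| + 1 → 1 ≤ (P.βn n k).im},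
      m' ≤ m n := by
    rcases hf.toFinset.eq_empty_or_nonempty with he | he
    · refine ⟨1, one_pos, fun n hn => ?_⟩
      have := hf.mem_toFinset.2 hn
      rw [he] at this
      exact absurd this (Finset.notMem_empty n)
    · obtain ⟨n₀, -, h⟩ := hf.toFinset.exists_min_image m he
      exact ⟨m n₀, hm n₀, fun n hn => h n (hf.mem_toFinset.2 hn)⟩
  refine ⟨min 1 m', by positivity, ?_⟩
  have hk : ∀ᶠ k in 𝓝 k₀, |k| ≤ |k₀| + 1 :=
    (continuous_abs.continuousAt.eventually (gt_mem_nhds (lt_add_one |k₀|))).mono fun _ h => h.le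
  filter_upwards [hk, hf.eventually_all.2 fun n _ => hm' n] with k hk h n hn
  by_cases h3 : ∀ k, |k| ≤ |k₀| + 1 → 1 ≤ (P.βn n k).im
  · exact (min_le_left _ _).trans ((h3 k hk).trans
      ((le_abs_self _).trans (Complex.abs_im_le_norm _)))
  · exact (min_le_right _ _).trans ((hmle n h3).trans (h n h3 hn))

theorem norm_exp_βn_le (n : ℤ) (k : ℝ) {y : ℝ} :
    ‖Complex.exp (Complex.I * P.βn n k * y)‖ = Real.exp (-((P.βn n k).im * y)) := by
  rw [Complex.norm_exp]
  simp

theorem h_pos : 0 < P.h := by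
  have hne : (frontier P.D₀).Nonempty := by
    by_contra h
    rw [not_nonempty_iff_eq_empty] at h
    rcases frontier_eq_empty_iff.1 h with h1 | h1
    · exact P.nonempty_D₀.ne_empty h1
    · have := P.compact_D₀
      rw [h1] at this
      exact noncompact_univ Plane this
  obtain ⟨p, hp⟩ := hne
  have := P.h_large p hp p hp
  simpa using this

theorem σn_eq (n : ℤ) (k : ℝ) : P.σn n k = ∑ l ∈ Finset.range P.j,
    P.shiftCoeff (l + 1) * Complex.exp (Complex.I * P.βn n k * P.h) ^ (l + 1) := by
  rw [σn, ← sum_shiftCoeff_mul_pow, Finset.sum_range_succ']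
  simp [shiftCoeff]

theorem norm_σn_le (n : ℤ) (k : ℝ) : ‖P.σn n k‖ ≤
    (∑ l ∈ Finset.range P.j, ‖P.shiftCoeff (l + 1)‖) * Real.exp (-((P.βn n k).im * P.h)) := by
  rw [σn_eq, Finset.sum_mul]
  refine (norm_sum_le _ _).trans (Finset.sum_le_sum fun l _ => ?_)
  rw [norm_mul, norm_pow, norm_exp_βn_le]
  refine mul_le_mul_of_nonneg_left (pow_le_of_le_one (Real.exp_pos _).le ?_ (by simp))
    (norm_nonneg _)
  rw [Real.exp_le_one_iff]
  have := P.h_pos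
  have := P.βn_im_nonneg n k
  simp; positivity

theorem norm_σn_add_one_le (n : ℤ) (k : ℝ) : ‖P.σn n k + 1‖ ≤ 2 ^ P.j := by
  rw [σn, sub_add_cancel, norm_pow]
  refine pow_le_pow_left₀ (norm_nonneg _) ((norm_sub_le _ _).trans ?_) _
  rw [norm_exp_βn_le, norm_one]
  have : Real.exp (-((P.βn n k).im * P.h)) ≤ 1 := by
    rw [Real.exp_le_one_iff]
    have := P.h_pos
    have := P.βn_im_nonneg n k
    simp; positivity
  linarith

/-! ### Plane waves -/

/-- The mode `e^{iα_n x + isβ_n y}`, `s = ±1`. -/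
noncomputable def planeWave (s : ℝ) (k : ℝ) (n : ℤ) (p : Plane) : ℂ :=
  Complex.exp (Complex.I * P.αn n k * p 0 + s * Complex.I * P.βn n k * p 1)

theorem contDiff_planeWave (s k : ℝ) (n : ℤ) : ContDiff ℝ ∞ (P.planeWave s k n) := by
  have : ContDiff ℝ ∞ fun p : Plane => (complexify p) := complexify.contDiff
  have h0 : ContDiff ℝ ∞ fun p : Plane => (p 0 : ℂ) := this.fst
  have h1 : ContDiff ℝ ∞ fun p : Plane => (p 1 : ℂ) := this.snd
  unfold planeWave
  exact ((contDiff_const.mul h0).add (contDiff_const.mul h1)).cexp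

theorem hasFDerivAt_planeWave (s k : ℝ) (n : ℤ) (p : Plane) : HasFDerivAt (P.planeWave s k n)
    (P.planeWave s k n p • ((Complex.I * P.αn n k) •
      (Complex.ofRealCLM.comp (EuclideanSpace.proj (0 : Fin 2) : Plane →L[ℝ] ℝ)) +
      (s * Complex.I * P.βn n k) •
      (Complex.ofRealCLM.comp (EuclideanSpace.proj (1 : Fin 2) : Plane →L[ℝ] ℝ)))) p := by
  have h0 := (Complex.ofRealCLM.comp (EuclideanSpace.proj (0 : Fin 2) : Plane →L[ℝ] ℝ)).hasFDerivAt
    (x := p)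
  have h1 := (Complex.ofRealCLM.comp (EuclideanSpace.proj (1 : Fin 2) : Plane →L[ℝ] ℝ)).hasFDerivAt
    (x := p)
  exact ((h0.const_mul (Complex.I * P.αn n k)).add (h1.const_mul (s * Complex.I * P.βn n k))).cexp

theorem fderiv_planeWave_apply (s k : ℝ) (n : ℤ) (p v : Plane) :
    fderiv ℝ (P.planeWave s k n) p v =
      (Complex.I * P.αn n k * v 0 + s * Complex.I * P.βn n k * v 1) * P.planeWave s k n p := by
  rw [(P.hasFDerivAt_planeWave s k n p).fderiv]
  simp
  ring

theorem helm_planeWave {s : ℝ} (hs : s ^ 2 = 1) (k : ℝ) (n : ℤ) (p : Plane) :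
    helm k (P.planeWave s k n) p = 0 := by
  have hd : DifferentiableAt ℝ (P.planeWave s k n) p :=
    (P.contDiff_planeWave s k n).contDiffAt.differentiableAt (by simp)
  rw [helm]
  simp_rw [fderiv_planeWave_apply, fderiv_const_mul hd]
  simp only [smul_apply, fderiv_planeWave_apply, Fin.sum_univ_two]
  simp
  have h1 := P.βn_sq n k
  have h2 : (s : ℂ) ^ 2 = 1 := by exact_mod_cast hs
  linear_combination (P.planeWave s k n p) * ((P.αn n k : ℂ) ^ 2 * Complex.I_sq +
    P.βn n k ^ 2 * Complex.I_sq * (s : ℂ) ^ 2 - h1 - P.βn n k ^ 2 * h2)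

theorem holSeries_planeWave {k s y M : ℝ} (hs : |s| = 1) {c : ℤ → ℂ}
    (hc : ∀ n, ‖c n‖ * Real.exp (-(s * y * (P.βn n k).im)) ≤ M * (1 + |(n : ℝ)|)) {p₀ : Plane}
    (hy : s * y < s * p₀ 1) : HolSeries {k} (fun k n p => c n * P.planeWave s k n p) p₀ := by
  have hL := P.L_pos
  set κ : ℝ := 2 * Real.pi / P.L with hκ
  have hκ0 : 0 < κ := by positivity
  set d : ℝ := s * p₀ 1 - s * y with hd
  have hd0 : 0 < d := by linarith
  have hM : 0 ≤ M := by
    have := (mul_nonneg (norm_nonneg _) (Real.exp_pos _).le).trans (hc 0)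
    simpa using this
  refine ⟨Metric.ball (complexify p₀) (d / 4), fun k n z => c n *
    Complex.exp (Complex.I * P.αn n k * z.1 + s * Complex.I * P.βn n k * z.2),
    fun n => M * Real.exp (2 * |k| * d) * ((1 + |(n : ℝ)|) * Real.exp (-(κ * d / 2) * |(n : ℝ)|)),
    Metric.isOpen_ball, Metric.mem_ball_self (by positivity),
    (summable_one_add_abs_mul_exp (by positivity)).mul_left _, fun k' _ n => ?_, ?_, fun k' _ n p _ => rfl⟩
  · have : ContDiff ℂ ∞ fun z : ℂ × ℂ =>
        c n * Complex.exp (Complex.I * P.αn n k' * z.1 + s * Complex.I * P.βn n k' * z.2) := by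
      fun_prop
    exact this.contDiffOn
  · rintro k' rfl n z hz
    rw [mem_ball_iff_norm] at hz
    have hz1 : ‖z.1 - p₀ 0‖ < d / 4 := (norm_fst_le _).trans_lt hz
    have hz2 : ‖z.2 - p₀ 1‖ < d / 4 := (norm_snd_le _).trans_lt hz
    have i1 : |z.1.im| ≤ d / 4 := by
      have := Complex.abs_im_le_norm (z.1 - p₀ 0)
      simp at this; linarith
    have i2 : |z.2.im| ≤ d / 4 := by
      have := Complex.abs_im_le_norm (z.2 - p₀ 1)
      simp at this; linarith
    have r2 : |z.2.re - p₀ 1| ≤ d / 4 := by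
      have := Complex.abs_re_le_norm (z.2 - p₀ 1)
      simp at this; linarith
    rw [norm_mul, Complex.norm_exp]
    have hre : (Complex.I * P.αn n k' * z.1 + s * Complex.I * P.βn n k' * z.2).re =
        -(P.αn n k' * z.1.im) - s * ((P.βn n k').re * z.2.im + (P.βn n k').im * z.2.re) := by
      simp; ring
    rw [hre]
    have a1 := P.abs_αn_le n k'
    have b1 := P.βn_re_le n k'
    have b2 := P.le_βn_im n k'
    have b3 := P.βn_im_nonneg n k'
    have b4 := P.βn_re_nonneg n k'
    rw [← hκ] at a1 b2
    have t1 : -(P.αn n k' * z.1.im) ≤ (|k'| + κ * |(n : ℝ)|) * (d / 4) := by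
      refine (neg_le_abs _).trans ?_
      rw [abs_mul]
      exact mul_le_mul a1 i1 (abs_nonneg _) (by positivity)
    have t2 : -(s * ((P.βn n k').re * z.2.im)) ≤ |k'| * (d / 4) := by
      refine (neg_le_abs _).trans ?_
      rw [abs_mul, hs, one_mul, abs_mul, abs_of_nonneg b4]
      exact mul_le_mul b1 i2 (abs_nonneg _) (abs_nonneg _)
    have t3 : s * y + 3 / 4 * d ≤ s * z.2.re := by
      have : -(s * (z.2.re - p₀ 1)) ≤ d / 4 := by
        refine (neg_le_abs _).trans ?_
        rw [abs_mul, hs, one_mul]; exact r2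
      rw [hd] at *
      linarith
    have t4 : (P.βn n k').im * (s * y + 3 / 4 * d) ≤ (P.βn n k').im * (s * z.2.re) :=
      mul_le_mul_of_nonneg_left t3 b3
    have t5 : (κ * |(n : ℝ)| - 2 * |k'|) * (3 / 4 * d) ≤ (P.βn n k').im * (3 / 4 * d) :=
      mul_le_mul_of_nonneg_right b2 (by positivity)
    have key : -(P.αn n k' * z.1.im) - s * ((P.βn n k').re * z.2.im + (P.βn n k').im * z.2.re) ≤
        -(s * y * (P.βn n k').im) + (2 * |k'| * d + -(κ * d / 2) * |(n : ℝ)|) := by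
      nlinarith [abs_nonneg k']
    calc _ ≤ ‖c n‖ * Real.exp (-(s * y * (P.βn n k').im) +
          (2 * |k'| * d + -(κ * d / 2) * |(n : ℝ)|)) := by gcongr
      _ = ‖c n‖ * Real.exp (-(s * y * (P.βn n k').im)) * (Real.exp (2 * |k'| * d) *
          Real.exp (-(κ * d / 2) * |(n : ℝ)|)) := by rw [Real.exp_add, Real.exp_add]; ring
      _ ≤ M * (1 + |(n : ℝ)|) * (Real.exp (2 * |k'| * d) *
          Real.exp (-(κ * d / 2) * |(n : ℝ)|)) := mul_le_mul_of_nonneg_right (hc n) (by positivity)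
      _ = _ := by ring

end ScatteringSetup

namespace ScatteringSetup

variable (P : ScatteringSetup)

/-! ### The boundary curves and combined integrals -/

theorem continuous_z (i : Fin P.m) : Continuous (P.z i) := (P.z_smooth i).continuous

theorem continuous_deriv_z (i : Fin P.m) : Continuous (deriv (P.z i)) :=
  (P.z_smooth i).continuous_deriv (by norm_num)

theorem hasDerivAt_z (i : Fin P.m) (t : ℝ) : HasDerivAt (P.z i) (deriv (P.z i) t) t :=
  ((P.z_smooth i).differentiable (by norm_num) t).hasDerivAt

theorem norm_deriv_z_pos (i : Fin P.m) (t : ℝ) : 0 < ‖deriv (P.z i) t‖ :=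
  norm_pos_iff.2 (P.z_regular i t)

theorem continuous_normal (i : Fin P.m) : Continuous (P.normal i) := by
  have h := P.continuous_deriv_z i
  have h2 : Continuous fun t => (!₂[deriv (P.z i) t 1, -(deriv (P.z i) t 0)] : Plane) := by
    refine (PiLp.continuous_toLp 2 _).comp (continuous_pi fun l => ?_)
    fin_cases l <;> simp <;> fun_prop
  exact (h.norm.inv₀ fun t => (P.norm_deriv_z_pos i t).ne').smul h2

theorem norm_rotate (v : Plane) : ‖(!₂[v 1, -(v 0)] : Plane)‖ = ‖v‖ := by
  rw [EuclideanSpace.norm_eq, EuclideanSpace.norm_eq]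
  simp [Fin.sum_univ_two, add_comm]

theorem norm_normal (i : Fin P.m) (t : ℝ) : ‖P.normal i t‖ = 1 := by
  rw [normal, norm_smul, norm_rotate, norm_inv, norm_norm,
    inv_mul_cancel₀ (P.norm_deriv_z_pos i t).ne']

theorem continuous_bdryPoint (i : Fin P.m) : Continuous (P.bdryPoint i) :=
  (P.continuous_z i).subtype_mk _

theorem z_mem_frontier (i : Fin P.m) (t : ℝ) : P.z i t ∈ frontier P.D₀ := (P.bdryPoint i t).2

theorem isCompact_frontier : IsCompact (frontier P.D₀) :=
  isCompact_iff_compactSpace.2 P.instCompactBoundary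

/-- The kernel of a combined integral with respect to the parameter. -/
noncomputable def combinedKernel (F : Plane → ℂ) (i : Fin P.m) (t : ℝ) : ℂ :=
  (fderiv ℝ F (P.z i t) (P.normal i t) - Complex.I * P.γ * F (P.z i t)) * ‖deriv (P.z i) t‖

/-- The functional on densities given by a kernel on the parameter intervals. -/
noncomputable def kernelIntegral (K : Fin P.m → ℝ → ℂ) (ψ : P.Density) : ℂ :=
  ∑ i, ∫ t in (0 : ℝ)..(2 * Real.pi), K i t * ψ (P.bdryPoint i t)

theorem combinedIntegral_eq (F : Plane → ℂ) (ψ : P.Density) :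
    P.combinedIntegral F ψ = P.kernelIntegral (P.combinedKernel F) ψ := by
  unfold combinedIntegral kernelIntegral combinedKernel
  refine Finset.sum_congr rfl fun i _ => intervalIntegral.integral_congr fun t _ => ?_
  ring

/-- Integrability of a kernel on the parameter intervals. -/
def KernelIntegrable (K : Fin P.m → ℝ → ℂ) : Prop :=
  ∀ i, IntervalIntegrable (K i) volume 0 (2 * Real.pi)

variable {P}

theorem KernelIntegrable.mul_density {K : Fin P.m → ℝ → ℂ} (hK : P.KernelIntegrable K)
    (ψ : P.Density) (i : Fin P.m) :
    IntervalIntegrable (fun t => K i t * ψ (P.bdryPoint i t)) volume 0 (2 * Real.pi) :=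
  (hK i).mul_continuousOn (ψ.continuous.comp (P.continuous_bdryPoint i)).continuousOn

theorem kernelIntegral_add {K : Fin P.m → ℝ → ℂ} (hK : P.KernelIntegrable K) (φ ψ : P.Density) :
    P.kernelIntegral K (φ + ψ) = P.kernelIntegral K φ + P.kernelIntegral K ψ := by
  unfold kernelIntegral
  rw [← Finset.sum_add_distrib]
  refine Finset.sum_congr rfl fun i _ => ?_
  rw [← intervalIntegral.integral_add (hK.mul_density φ i) (hK.mul_density ψ i)]
  simp [mul_add]

theorem kernelIntegral_smul (K : Fin P.m → ℝ → ℂ) (c : ℂ) (ψ : P.Density) :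
    P.kernelIntegral K (c • ψ) = c * P.kernelIntegral K ψ := by
  unfold kernelIntegral
  rw [Finset.mul_sum]
  refine Finset.sum_congr rfl fun i _ => ?_
  rw [← intervalIntegral.integral_const_mul]
  refine intervalIntegral.integral_congr fun t _ => ?_
  simp; ring

theorem norm_kernelIntegral_le {K : Fin P.m → ℝ → ℂ} (hK : P.KernelIntegrable K) (ψ : P.Density) :
    ‖P.kernelIntegral K ψ‖ ≤ (∑ i, ∫ t in (0 : ℝ)..(2 * Real.pi), ‖K i t‖) * ‖ψ‖ := by
  unfold kernelIntegral
  rw [Finset.sum_mul]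
  refine (norm_sum_le _ _).trans (Finset.sum_le_sum fun i _ => ?_)
  rw [← intervalIntegral.integral_mul_const]
  refine (intervalIntegral.norm_integral_le_integral_norm (by positivity)).trans
    (intervalIntegral.integral_mono_on (by positivity) (hK.mul_density ψ i).norm
      ((hK i).norm.mul_const _) fun t _ => ?_)
  rw [norm_mul]
  exact mul_le_mul_of_nonneg_left (ψ.norm_coe_le_norm _) (norm_nonneg _)

theorem kernelIntegral_sub_kernel {K K' : Fin P.m → ℝ → ℂ} (hK : P.KernelIntegrable K)
    (hK' : P.KernelIntegrable K') (ψ : P.Density) :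
    P.kernelIntegral (fun i t => K i t - K' i t) ψ = P.kernelIntegral K ψ - P.kernelIntegral K' ψ := by
  unfold kernelIntegral
  rw [← Finset.sum_sub_distrib]
  refine Finset.sum_congr rfl fun i _ => ?_
  rw [← intervalIntegral.integral_sub (hK.mul_density ψ i) (hK'.mul_density ψ i)]
  simp [sub_mul]

theorem kernelIntegral_add_kernel {K K' : Fin P.m → ℝ → ℂ} (hK : P.KernelIntegrable K)
    (hK' : P.KernelIntegrable K') (ψ : P.Density) :
    P.kernelIntegral (fun i t => K i t + K' i t) ψ = P.kernelIntegral K ψ + P.kernelIntegral K' ψ := by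
  unfold kernelIntegral
  rw [← Finset.sum_add_distrib]
  refine Finset.sum_congr rfl fun i _ => ?_
  rw [← intervalIntegral.integral_add (hK.mul_density ψ i) (hK'.mul_density ψ i)]
  simp [add_mul]

theorem kernelIntegral_const_mul_kernel (c : ℂ) (K : Fin P.m → ℝ → ℂ) (ψ : P.Density) :
    P.kernelIntegral (fun i t => c * K i t) ψ = c * P.kernelIntegral K ψ := by
  unfold kernelIntegral
  rw [Finset.mul_sum]
  refine Finset.sum_congr rfl fun i _ => ?_
  rw [← intervalIntegral.integral_const_mul]
  simp [mul_assoc]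

theorem continuous_combinedKernel {F : Plane → ℂ} (hF : ∀ p ∈ frontier P.D₀, ContDiffAt ℝ 1 F p)
    (i : Fin P.m) : Continuous (P.combinedKernel F i) := by
  have h1 : Continuous fun t => fderiv ℝ F (P.z i t) := by
    rw [continuous_iff_continuousAt]
    intro t
    have h2 : ContinuousAt (fderiv ℝ F) (P.z i t) :=
      ((hF _ (P.z_mem_frontier i t)).fderiv_right (m := 0) (by norm_num)).continuousAt
    exact ContinuousAt.comp (g := fderiv ℝ F) h2 (P.continuous_z i).continuousAt
  have h2 : Continuous fun t => F (P.z i t) := by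
    rw [continuous_iff_continuousAt]
    intro t
    exact ContinuousAt.comp (g := F) (hF _ (P.z_mem_frontier i t)).continuousAt
      (P.continuous_z i).continuousAt
  have h3 := P.continuous_normal i
  have h4 := P.continuous_deriv_z i
  unfold combinedKernel
  exact ((h1.clm_apply h3).sub (continuous_const.mul h2)).mul
    (Complex.continuous_ofReal.comp h4.norm)

theorem kernelIntegrable_combinedKernel {F : Plane → ℂ}
    (hF : ∀ p ∈ frontier P.D₀, ContDiffAt ℝ 1 F p) : P.KernelIntegrable (P.combinedKernel F) :=
  fun i => (continuous_combinedKernel hF i).intervalIntegrable _ _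

theorem combinedIntegral_congr {F G : Plane → ℂ} (h : ∀ p ∈ frontier P.D₀, F =ᶠ[𝓝 p] G)
    (ψ : P.Density) : P.combinedIntegral F ψ = P.combinedIntegral G ψ := by
  unfold combinedIntegral
  refine Finset.sum_congr rfl fun i _ => intervalIntegral.integral_congr fun t _ => ?_
  have := h _ (P.z_mem_frontier i t)
  simp only [this.fderiv_eq, this.self_of_nhds]

theorem combinedIntegral_add {F G : Plane → ℂ} (hF : ∀ p ∈ frontier P.D₀, ContDiffAt ℝ 1 F p)
    (hG : ∀ p ∈ frontier P.D₀, ContDiffAt ℝ 1 G p) (ψ : P.Density) :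
    P.combinedIntegral (fun p => F p + G p) ψ = P.combinedIntegral F ψ + P.combinedIntegral G ψ := by
  rw [combinedIntegral_eq, combinedIntegral_eq, combinedIntegral_eq,
    ← kernelIntegral_add_kernel (kernelIntegrable_combinedKernel hF)
      (kernelIntegrable_combinedKernel hG)]
  congr 1
  ext i t
  have hz := P.z_mem_frontier i t
  unfold combinedKernel
  rw [fderiv_fun_add ((hF _ hz).differentiableAt (by norm_num))
    ((hG _ hz).differentiableAt (by norm_num))]
  simp only [add_apply]
  ring

theorem combinedIntegral_const_mul (c : ℂ) {F : Plane → ℂ}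
    (hF : ∀ p ∈ frontier P.D₀, ContDiffAt ℝ 1 F p) (ψ : P.Density) :
    P.combinedIntegral (fun p => c * F p) ψ = c * P.combinedIntegral F ψ := by
  rw [combinedIntegral_eq, combinedIntegral_eq, ← kernelIntegral_const_mul_kernel]
  congr 1
  ext i t
  unfold combinedKernel
  rw [fderiv_const_mul ((hF _ (P.z_mem_frontier i t)).differentiableAt (by norm_num))]
  simp only [smul_apply, smul_eq_mul]
  ring

variable (P) in
/-- The length of the boundary. -/
noncomputable def boundaryLength : ℝ := ∑ i, ∫ t in (0 : ℝ)..(2 * Real.pi), ‖deriv (P.z i) t‖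

theorem boundaryLength_nonneg : 0 ≤ P.boundaryLength :=
  Finset.sum_nonneg fun i _ => intervalIntegral.integral_nonneg (by positivity)
    fun t _ => norm_nonneg _

theorem norm_combinedIntegral_le {F : Plane → ℂ} (hF : ∀ p ∈ frontier P.D₀, ContDiffAt ℝ 1 F p)
    {B : ℝ} (hB : ∀ i t, ‖fderiv ℝ F (P.z i t) (P.normal i t) - Complex.I * P.γ * F (P.z i t)‖ ≤ B)
    (ψ : P.Density) : ‖P.combinedIntegral F ψ‖ ≤ B * P.boundaryLength * ‖ψ‖ := by
  rw [combinedIntegral_eq]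
  refine (norm_kernelIntegral_le (kernelIntegrable_combinedKernel hF) ψ).trans
    (mul_le_mul_of_nonneg_right ?_ (norm_nonneg _))
  rw [boundaryLength, Finset.mul_sum]
  refine Finset.sum_le_sum fun i _ => ?_
  rw [← intervalIntegral.integral_const_mul]
  refine intervalIntegral.integral_mono_on (by positivity)
    (kernelIntegrable_combinedKernel hF i).norm
    ((P.continuous_deriv_z i).norm.intervalIntegrable _ _ |>.const_mul _) fun t _ => ?_
  rw [combinedKernel, norm_mul, Complex.norm_real, norm_norm]
  exact mul_le_mul_of_nonneg_right (hB i t) (norm_nonneg _)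

theorem plane_eq_add_smul (v : Plane) :
    v = v 0 • (EuclideanSpace.single 0 1 : Plane) + v 1 • (EuclideanSpace.single 1 1 : Plane) := by
  ext i; fin_cases i <;> simp

theorem fderiv_apply_eq_coord (f : Plane → ℂ) (p v : Plane) :
    fderiv ℝ f p v = v 0 * fderiv ℝ f p (EuclideanSpace.single 0 1) +
      v 1 * fderiv ℝ f p (EuclideanSpace.single 1 1) := by
  conv_lhs => rw [plane_eq_add_smul v]
  rw [map_add, map_smul, map_smul, Complex.real_smul, Complex.real_smul]

theorem abs_apply_le_norm (v : Plane) (i : Fin 2) : |v i| ≤ ‖v‖ := by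
  have := PiLp.norm_apply_le (p := 2) v i
  simpa using this

theorem hasSum_combinedIntegral {k : ℝ} {f : ℤ → Plane → ℂ}
    (h : ∀ p ∈ frontier P.D₀, HolSeries {k} (fun _ => f) p) (ψ : P.Density) :
    HasSum (fun n => P.combinedIntegral (f n) ψ) (P.combinedIntegral (fun p => ∑' n, f n p) ψ) := by
  have hk : k ∈ ({k} : Set ℝ) := rfl
  obtain ⟨u, hu, hub⟩ := HolSeries.exists_bound_of_isCompact P.isCompact_frontier h
  obtain ⟨u0, hu0, hub0⟩ := HolSeries.exists_bound_of_isCompact P.isCompact_frontier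
    fun p hp => (h p hp).deriv (EuclideanSpace.single 0 1)
  obtain ⟨u1, hu1, hub1⟩ := HolSeries.exists_bound_of_isCompact P.isCompact_frontier
    fun p hp => (h p hp).deriv (EuclideanSpace.single 1 1)
  simp_rw [combinedIntegral_eq]
  refine hasSum_sum fun i _ => ?_
  have hcd : ∀ n, ∀ p ∈ frontier P.D₀, ContDiffAt ℝ 1 (f n) p := fun n p hp =>
    ((h p hp).contDiffAt hk n).of_le (WithTop.coe_le_coe.2 le_top)
  have hψ : Continuous fun t => ψ (P.bdryPoint i t) := ψ.continuous.comp (P.continuous_bdryPoint i)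
  refine intervalIntegral.hasSum_integral_of_dominated_convergence
    (fun n t => (u0 n + u1 n + P.γ * u n) * ‖deriv (P.z i) t‖ * ‖ψ‖) (fun n => ?_) (fun n => ?_) ?_ ?_ ?_
  · exact ((continuous_combinedKernel (hcd n) i).mul hψ).aestronglyMeasurable
  · refine Eventually.of_forall fun t _ => ?_
    have hz := P.z_mem_frontier i t
    rw [norm_mul, combinedKernel, norm_mul, Complex.norm_real, norm_norm]
    refine mul_le_mul (mul_le_mul_of_nonneg_right ?_ (norm_nonneg _)) (ψ.norm_coe_le_norm _)
      (norm_nonneg _) ?_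
    · refine (norm_sub_le _ _).trans (add_le_add ?_ ?_)
      · rw [fderiv_apply_eq_coord]
        refine (norm_add_le _ _).trans (add_le_add ?_ ?_)
        · rw [norm_mul, Complex.norm_real, Real.norm_eq_abs]
          refine (mul_le_of_le_one_left (norm_nonneg _) ?_).trans (hub0 k hk _ hz n)
          exact (abs_apply_le_norm _ _).trans (P.norm_normal i t).le
        · rw [norm_mul, Complex.norm_real, Real.norm_eq_abs]
          refine (mul_le_of_le_one_left (norm_nonneg _) ?_).trans (hub1 k hk _ hz n)
          exact (abs_apply_le_norm _ _).trans (P.norm_normal i t).le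
      · rw [norm_mul, norm_mul, Complex.norm_I, one_mul, Complex.norm_real, Real.norm_eq_abs,
          abs_of_nonneg P.γ_nonneg]
        exact mul_le_mul_of_nonneg_left (hub k hk _ hz n) P.γ_nonneg
    · refine mul_nonneg (add_nonneg (add_nonneg ?_ ?_) (mul_nonneg P.γ_nonneg ?_)) (norm_nonneg _)
      · exact (norm_nonneg _).trans (hub0 k hk _ hz n)
      · exact (norm_nonneg _).trans (hub1 k hk _ hz n)
      · exact (norm_nonneg _).trans (hub k hk _ hz n)
  · exact Eventually.of_forall fun t _ =>
      (((hu0.add hu1).add (hu.mul_left _)).mul_right _).mul_right _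
  · simp_rw [tsum_mul_right]
    exact ((continuous_const.mul (P.continuous_deriv_z i).norm).mul
      continuous_const).intervalIntegrable _ _
  · refine Eventually.of_forall fun t _ => ?_
    have hz := P.z_mem_frontier i t
    refine HasSum.mul_right _ ?_
    unfold combinedKernel
    refine HasSum.mul_right _ (HasSum.sub ?_ (HasSum.mul_left _ ((h _ hz).summable hk).hasSum))
    rw [(h _ hz).fderiv_tsum hk]
    exact (((h _ hz).deriv _).summable hk).hasSum

/-! ### The vertical extent of the obstacle -/

variable (P) in
theorem exists_yMax : ∃ p ∈ frontier P.D₀, ∀ q ∈ P.D₀, q 1 ≤ p 1 := by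
  have hc : Continuous fun q : Plane => q 1 := by fun_prop
  obtain ⟨p, hp, hmax⟩ := P.compact_D₀.exists_isMaxOn P.nonempty_D₀ hc.continuousOn
  refine ⟨p, ?_, fun q hq => hmax hq⟩
  rw [P.compact_D₀.isClosed.frontier_eq]
  refine ⟨hp, fun hi => ?_⟩
  have hl : Tendsto (fun s : ℝ => p + s • (EuclideanSpace.single 1 1 : Plane)) (𝓝[>] 0) (𝓝 p) := by
    have : Continuous fun s : ℝ => p + s • (EuclideanSpace.single 1 1 : Plane) := by fun_prop
    simpa using (this.tendsto 0).mono_left nhdsWithin_le_nhds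
  obtain ⟨s, hs, hs0⟩ := ((hl.eventually (mem_interior_iff_mem_nhds.1 hi)).and
    self_mem_nhdsWithin).exists
  have := hmax hs
  simp at this
  exact absurd this (not_le.2 hs0)

variable (P) in
theorem exists_yMin : ∃ p ∈ frontier P.D₀, ∀ q ∈ P.D₀, p 1 ≤ q 1 := by
  have hc : Continuous fun q : Plane => q 1 := by fun_prop
  obtain ⟨p, hp, hmin⟩ := P.compact_D₀.exists_isMinOn P.nonempty_D₀ hc.continuousOn
  refine ⟨p, ?_, fun q hq => hmin hq⟩
  rw [P.compact_D₀.isClosed.frontier_eq]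
  refine ⟨hp, fun hi => ?_⟩
  have hl : Tendsto (fun s : ℝ => p - s • (EuclideanSpace.single 1 1 : Plane)) (𝓝[>] 0) (𝓝 p) := by
    have : Continuous fun s : ℝ => p - s • (EuclideanSpace.single 1 1 : Plane) := by fun_prop
    simpa using (this.tendsto 0).mono_left nhdsWithin_le_nhds
  obtain ⟨s, hs, hs0⟩ := ((hl.eventually (mem_interior_iff_mem_nhds.1 hi)).and
    self_mem_nhdsWithin).exists
  have := hmin hs
  simp at this
  exact absurd this (not_le.2 hs0)

variable (P) in
/-- The largest ordinate of the obstacle. -/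
noncomputable def yMax : ℝ := P.exists_yMax.choose 1

variable (P) in
/-- The smallest ordinate of the obstacle. -/
noncomputable def yMin : ℝ := P.exists_yMin.choose 1

theorem le_yMax {q : Plane} (hq : q ∈ P.D₀) : q 1 ≤ P.yMax := P.exists_yMax.choose_spec.2 q hq

theorem yMin_le {q : Plane} (hq : q ∈ P.D₀) : P.yMin ≤ q 1 := P.exists_yMin.choose_spec.2 q hq

theorem frontier_subset : frontier P.D₀ ⊆ P.D₀ := P.compact_D₀.isClosed.frontier_subset

theorem yMax_sub_lt {q : Plane} (hq : q ∈ frontier P.D₀) : P.yMax - P.h < q 1 := by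
  have := (abs_lt.1 (P.h_large _ P.exists_yMax.choose_spec.1 q hq)).2
  rw [yMax]; linarith

theorem yMax_sub_lt_yMin : P.yMax - P.h < P.yMin := yMax_sub_lt P.exists_yMin.choose_spec.1

theorem above_iff {p : Plane} : (∀ q ∈ P.D₀, q 1 < p 1) ↔ P.yMax < p 1 :=
  ⟨fun h => h _ (frontier_subset P.exists_yMax.choose_spec.1), fun h _ hq => (le_yMax hq).trans_lt h⟩

theorem below_iff {p : Plane} : (∀ q ∈ P.D₀, p 1 < q 1) ↔ p 1 < P.yMin :=
  ⟨fun h => h _ (frontier_subset P.exists_yMin.choose_spec.1), fun h _ hq => h.trans_le (yMin_le hq)⟩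

end ScatteringSetup

namespace ScatteringSetup

variable (P : ScatteringSetup)

/-! ### Modal expansions of the quasi-periodic Green function -/

/-- The coefficient of the `n`-th mode of the Green function above all singularities. -/
noncomputable def upperCoeff (k : ℝ) (n : ℤ) : ℂ :=
  if P.βn n k = 0 then -(P.h * ∑ l ∈ Finset.range (P.j + 1), P.shiftCoeff l * l) / (2 * P.L)
  else Complex.I / (2 * P.L * P.βn n k) * (P.σn n k + 1)

/-- The coefficient of the downward `n`-th mode between the singularities. -/
noncomputable def lowerCoeff (k : ℝ) (n : ℤ) : ℂ :=
  if P.βn n k = 0 then -(P.h * ∑ l ∈ Finset.range (P.j + 1), P.shiftCoeff l * l) / (2 * P.L)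
  else Complex.I / (2 * P.L * P.βn n k)

/-- The coefficient of the upward `n`-th mode between the singularities. -/
noncomputable def reflectedCoeff (k : ℝ) (n : ℤ) : ℂ :=
  if P.βn n k = 0 then 0 else Complex.I / (2 * P.L * P.βn n k) * P.σn n k

/-- The coefficient of the linear `n`-th mode between the singularities. -/
noncomputable def linearCoeff (k : ℝ) (n : ℤ) : ℂ := if P.βn n k = 0 then 1 / (P.L : ℂ) else 0

/-- The `n`-th coefficient of the Green function in its modal expansion at the ordinate `y`. -/
noncomputable def greenProfile (k : ℝ) (n : ℤ) (y : ℝ) : ℂ :=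
  1 / (2 * P.L) * shiftProfile (Finset.range (P.j + 1)) P.shiftCoeff (fun l => y + l * P.h)
    (-(Complex.I * P.βn n k))

variable {P}

theorem sum_shiftCoeff_mul_abs_upper {y : ℝ} (hy : 0 < y) :
    ∑ l ∈ Finset.range (P.j + 1), P.shiftCoeff l * ((|y + l * P.h| : ℝ) : ℂ) =
      P.h * ∑ l ∈ Finset.range (P.j + 1), P.shiftCoeff l * l := by
  have h1 : ∀ l ∈ Finset.range (P.j + 1), P.shiftCoeff l * ((|y + l * P.h| : ℝ) : ℂ) =
      P.shiftCoeff l * y + P.h * (P.shiftCoeff l * l) := fun l _ => by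
    have := P.h_pos
    rw [abs_of_pos (by positivity)]
    push_cast; ring
  rw [Finset.sum_congr rfl h1, Finset.sum_add_distrib, ← Finset.sum_mul, P.sum_shiftCoeff, zero_mul,
    zero_add, Finset.mul_sum]

theorem greenProfile_upper (k : ℝ) (n : ℤ) {p : Plane} (hp : 0 < p 1) :
    P.greenProfile k n (p 1) * Complex.exp (Complex.I * P.αn n k * p 0) =
      P.upperCoeff k n * P.planeWave 1 k n p := by
  have hh := P.h_pos
  have hL : (P.L : ℂ) ≠ 0 := by exact_mod_cast P.L_pos.ne'
  rw [greenProfile, shiftProfile, upperCoeff, planeWave]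
  by_cases hβ : P.βn n k = 0
  · rw [if_pos (by simp [hβ]), if_pos hβ, sum_shiftCoeff_mul_abs_upper hp]
    simp [hβ]
    ring
  · rw [if_neg (by simp [hβ]), if_neg hβ, σn, sub_add_cancel, ← sum_shiftCoeff_mul_pow]
    have h1 : ∀ l ∈ Finset.range (P.j + 1), P.shiftCoeff l *
        Complex.exp (-(-(Complex.I * P.βn n k) * ((|p 1 + l * P.h| : ℝ) : ℂ))) =
        Complex.exp (Complex.I * P.βn n k * p 1) *
          (P.shiftCoeff l * Complex.exp (Complex.I * P.βn n k * P.h) ^ l) := fun l _ => by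
      rw [abs_of_pos (by positivity), ← Complex.exp_nat_mul, mul_left_comm, ← Complex.exp_add]
      congr 2
      push_cast; ring
    rw [Finset.sum_congr rfl h1, ← Finset.mul_sum, Complex.ofReal_one, one_mul, Complex.exp_add]
    field_simp
    rw [Complex.I_sq]
    ring

theorem greenProfile_middle (k : ℝ) (n : ℤ) {p : Plane} (hp : p 1 < 0) (hp' : -P.h < p 1) :
    P.greenProfile k n (p 1) * Complex.exp (Complex.I * P.αn n k * p 0) =
      P.lowerCoeff k n * P.planeWave (-1) k n p + P.reflectedCoeff k n * P.planeWave 1 k n p +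
        P.linearCoeff k n * p 1 * P.planeWave 1 k n p := by
  have hh := P.h_pos
  have hL : (P.L : ℂ) ≠ 0 := by exact_mod_cast P.L_pos.ne'
  have hpos : ∀ l : ℕ, 0 < p 1 + ((l + 1 : ℕ) : ℝ) * P.h := fun l => by
    have : 0 ≤ (l : ℝ) * P.h := by positivity
    push_cast; linarith
  have hc0 : P.shiftCoeff 0 = 1 := by simp [shiftCoeff]
  rw [greenProfile, shiftProfile, lowerCoeff, reflectedCoeff, linearCoeff, planeWave, planeWave]
  by_cases hβ : P.βn n k = 0
  · rw [if_pos (by simp [hβ]), if_pos hβ, if_pos hβ, if_pos hβ]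
    have h2 : ∑ l ∈ Finset.range (P.j + 1), P.shiftCoeff l * ((|p 1 + l * P.h| : ℝ) : ℂ) =
        P.h * (∑ l ∈ Finset.range (P.j + 1), P.shiftCoeff l * l) - 2 * p 1 := by
      have h3 := P.sum_shiftCoeff
      rw [Finset.sum_range_succ', hc0] at h3
      rw [Finset.sum_range_succ', Finset.sum_range_succ' (fun l => P.shiftCoeff l * (l : ℂ))]
      have h1 : ∀ l ∈ Finset.range P.j, P.shiftCoeff (l + 1) * ((|p 1 + (l + 1 : ℕ) * P.h| : ℝ) : ℂ) =
          P.shiftCoeff (l + 1) * p 1 + P.h * (P.shiftCoeff (l + 1) * (l + 1 : ℕ)) := fun l _ => by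
        rw [abs_of_pos (hpos l)]
        push_cast; ring
      rw [Finset.sum_congr rfl h1, Finset.sum_add_distrib, ← Finset.sum_mul, ← Finset.mul_sum, hc0]
      simp only [Nat.cast_zero, zero_mul, add_zero, mul_zero]
      rw [abs_of_neg hp]
      push_cast
      linear_combination (p 1 : ℂ) * h3
    rw [h2]
    simp [hβ]
    field_simp
    ring
  · rw [if_neg (by simp [hβ]), if_neg hβ, if_neg hβ, if_neg hβ]
    have h1 : ∀ l ∈ Finset.range P.j, P.shiftCoeff (l + 1) *
        Complex.exp (-(-(Complex.I * P.βn n k) * ((|p 1 + (l + 1 : ℕ) * P.h| : ℝ) : ℂ))) =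
        Complex.exp (Complex.I * P.βn n k * p 1) *
          (P.shiftCoeff (l + 1) * Complex.exp (Complex.I * P.βn n k * P.h) ^ (l + 1)) := fun l _ => by
      rw [abs_of_pos (hpos l), ← Complex.exp_nat_mul, mul_left_comm, ← Complex.exp_add]
      congr 2
      push_cast; ring
    rw [Finset.sum_range_succ', Finset.sum_congr rfl h1, ← Finset.mul_sum, ← σn_eq, hc0]
    have h4 : -(-(Complex.I * P.βn n k) * ((|p 1 + (0 : ℕ) * P.h| : ℝ) : ℂ)) =
        ((-1 : ℝ) : ℂ) * Complex.I * P.βn n k * p 1 := by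
      rw [Nat.cast_zero, zero_mul, add_zero, abs_of_neg hp]; push_cast; ring
    rw [h4, Complex.exp_add, Complex.exp_add, Complex.ofReal_one, one_mul, one_mul]
    field_simp
    linear_combination (-1 : ℂ) * (Complex.exp (Complex.I * P.βn n k * (p 1 : ℂ)) * P.σn n k +
      Complex.exp (Complex.I * P.βn n k * (p 1 : ℂ) * ((-1 : ℝ) : ℂ))) * Complex.I_sq

theorem greenSum_eq_tsum_greenProfile {k : ℝ} (hk : 0 < k) {p : Plane}
    (hp : ∀ l ∈ Finset.range (P.j + 1), p 1 + l * P.h ≠ 0)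
    (hs : Summable fun n => P.greenProfile k n (p 1)) :
    P.greenSum fullWeight k p =
      ∑' n : ℤ, P.greenProfile k n (p 1) * Complex.exp (Complex.I * P.αn n k * p 0) := by
  have hL : (P.L : ℂ) ≠ 0 := by exact_mod_cast P.L_pos.ne'
  have hkc : 0 < (k : ℂ).re := by simpa using hk
  set Y : ℕ → ℝ := fun l => p 1 + l * P.h with hY
  obtain ⟨M, hM⟩ := exists_bound_hankel_combination hk le_rfl (Finset.range (P.j + 1)) P.shiftCoeff
    P.sum_shiftCoeff Y hp
  set f : ℝ → ℂ := fun x => Complex.I / 4 * ∑ l ∈ Finset.range (P.j + 1), P.shiftCoeff l *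
    hankelD 0 (k * Real.sqrt (x ^ 2 + Y l ^ 2)) with hf
  set b : ℝ → ℂ := fun a => -(Complex.I * ((Real.sqrt (k ^ 2 - a ^ 2) : ℂ) +
    Complex.I * (Real.sqrt (a ^ 2 - k ^ 2) : ℂ))) with hb
  have hfc : Continuous f := by
    refine continuous_const.mul (continuous_finsetSum _ fun l hl => continuous_const.mul ?_)
    rw [continuous_iff_continuousAt]
    intro x
    have hpos : 0 < x ^ 2 + Y l ^ 2 := by
      have := hp l hl
      positivity
    refine ContinuousAt.comp (g := hankelD 0) (f := fun x : ℝ => (k : ℂ) * Real.sqrt (x ^ 2 + Y l ^ 2))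
      (hasDerivAt_hankelD 0 (re_mul_ofReal_pos hkc (Real.sqrt_pos.2 hpos))).continuousAt ?_
    fun_prop
  have hb2 : ∀ a, b a ^ 2 = (a : ℂ) ^ 2 - (k : ℂ) ^ 2 := fun a => by
    have := sqrt_add_I_mul_sqrt_sq k a
    rw [hb]
    simp only
    rw [neg_sq, mul_pow, this, Complex.I_sq]
    ring
  have key := tsum_quasiperiodic_eq (f := f) (F := fun a => 1 / 2 * shiftProfile
    (Finset.range (P.j + 1)) P.shiftCoeff Y (b a)) hfc (M := M / 4) (fun x => ?_) P.L_pos (P.α k)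
    (fun a => ?_) ?_ (p 0)
  · rw [greenSum]
    refine Eq.trans (tsum_congr fun n => ?_) (key.trans (tsum_congr fun n => ?_))
    · rw [greenTerm, phase]
      congr 1
      simp only [hf, fullWeight, one_mul, hankelAt, hY]
    · rw [greenProfile]
      change (1 / (P.L : ℂ)) * (1 / 2 * shiftProfile _ _ _ (-(Complex.I * P.βn n k))) *
        Complex.exp (Complex.I * P.αn n k * p 0) = _
      field_simp
      rfl
  · rw [hf]
    simp only
    rw [norm_mul]
    have h4 : ‖Complex.I / 4‖ = 1 / 4 := by simp
    rw [h4]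
    have := hM k (by simp) (by simp) (by simp) (by simp) x
    linarith
  · rw [hf]
    simp_rw [mul_assoc (Complex.I / 4)]
    rw [integral_const_mul, integral_hankel_combination_mul_cexp hk a (hb2 a) (by simp [hb])
      (by simp [hb]) _ _ P.sum_shiftCoeff Y hp]
    linear_combination (-1 / 2) * shiftProfile (Finset.range (P.j + 1)) P.shiftCoeff Y (b a) * Complex.I_sq
  · refine (hs.mul_left (P.L : ℂ)).congr fun n => ?_
    change _ = 1 / 2 * shiftProfile _ _ _ (-(Complex.I * P.βn n k))
    rw [greenProfile]
    field_simp
    rfl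

theorem exists_norm_inv_βn_le (k : ℝ) : ∃ M : ℝ, 0 < M ∧ ∀ n, P.βn n k ≠ 0 →
    ‖Complex.I / (2 * P.L * P.βn n k)‖ ≤ M := by
  have hL := P.L_pos
  obtain ⟨m, hm, h⟩ := P.exists_le_norm_βn k
  refine ⟨1 / (2 * P.L * m), by positivity, fun n hn => ?_⟩
  rw [norm_div, norm_mul, norm_mul, Complex.norm_I, Complex.norm_real, Real.norm_of_nonneg hL.le,
    Complex.norm_ofNat]
  have := h.self_of_nhds n hn
  gcongr

theorem exists_norm_upperCoeff_le (k : ℝ) : ∃ M : ℝ, 0 < M ∧ ∀ n, ‖P.upperCoeff k n‖ ≤ M := by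
  obtain ⟨M, hM, h⟩ := P.exists_norm_inv_βn_le k
  refine ⟨‖-(P.h * ∑ l ∈ Finset.range (P.j + 1), P.shiftCoeff l * l : ℂ) / (2 * P.L)‖ + M * 2 ^ P.j,
    by positivity, fun n => ?_⟩
  rw [upperCoeff]
  split_ifs with hβ
  · exact le_add_of_nonneg_right (by positivity)
  · refine le_add_of_nonneg_of_le (norm_nonneg _) ?_
    rw [norm_mul]
    exact mul_le_mul (h n hβ) (P.norm_σn_add_one_le n k) (norm_nonneg _) hM.le

theorem exists_norm_lowerCoeff_le (k : ℝ) : ∃ M : ℝ, 0 < M ∧ ∀ n, ‖P.lowerCoeff k n‖ ≤ M := by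
  obtain ⟨M, hM, h⟩ := P.exists_norm_inv_βn_le k
  refine ⟨‖-(P.h * ∑ l ∈ Finset.range (P.j + 1), P.shiftCoeff l * l : ℂ) / (2 * P.L)‖ + M,
    by positivity, fun n => ?_⟩
  rw [lowerCoeff]
  split_ifs with hβ
  · exact le_add_of_nonneg_right hM.le
  · exact le_add_of_nonneg_of_le (norm_nonneg _) (h n hβ)

theorem exists_norm_reflectedCoeff_le (k : ℝ) : ∃ M : ℝ, 0 < M ∧ ∀ n,
    ‖P.reflectedCoeff k n‖ ≤ M * Real.exp (-((P.βn n k).im * P.h)) := by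
  obtain ⟨M, hM, h⟩ := P.exists_norm_inv_βn_le k
  have hnn : 0 ≤ ∑ l ∈ Finset.range P.j, ‖P.shiftCoeff (l + 1)‖ :=
    Finset.sum_nonneg fun _ _ => norm_nonneg _
  refine ⟨M * (1 + ∑ l ∈ Finset.range P.j, ‖P.shiftCoeff (l + 1)‖), by positivity, fun n => ?_⟩
  rw [reflectedCoeff]
  split_ifs with hβ
  · rw [norm_zero]; positivity
  · rw [norm_mul, mul_assoc M]
    refine mul_le_mul (h n hβ) ((P.norm_σn_le n k).trans ?_) (norm_nonneg _) hM.le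
    gcongr
    linarith

theorem finite_setOf_βn_eq_zero (k : ℝ) : {n : ℤ | P.βn n k = 0}.Finite := P.finite_Nwa k

theorem holSeries_upper (k : ℝ) {p : Plane} (hp : 0 < p 1) :
    HolSeries {k} (fun k' n p => P.upperCoeff k n * P.planeWave 1 k' n p) p := by
  obtain ⟨M, hM, h⟩ := P.exists_norm_upperCoeff_le k
  refine P.holSeries_planeWave (s := 1) (y := 0) (M := M) (by simp) (fun n => ?_) (by simpa using hp)
  simp only [mul_zero, zero_mul, neg_zero, Real.exp_zero, mul_one]
  exact (h n).trans (le_mul_of_one_le_right hM.le (by simp))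

/-- The terms of the modal expansion of the Green function between the singularities. -/
noncomputable def middleTerm (P : ScatteringSetup) (k : ℝ) (n : ℤ) (p : Plane) : ℂ :=
  P.lowerCoeff k n * P.planeWave (-1) k n p + P.reflectedCoeff k n * P.planeWave 1 k n p +
    P.linearCoeff k n * p 1 * P.planeWave 1 k n p

theorem holSeries_middle (k : ℝ) {p : Plane} (hp : p 1 < 0) (hp' : -P.h < p 1) :
    HolSeries {k} (fun k' => P.middleTerm k') p := by
  obtain ⟨M, hM, h⟩ := P.exists_norm_lowerCoeff_le k
  obtain ⟨M', hM', h'⟩ := P.exists_norm_reflectedCoeff_le k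
  have h1 : HolSeries {k} (fun k' n p => P.lowerCoeff k n * P.planeWave (-1) k' n p) p := by
    refine P.holSeries_planeWave (s := -1) (y := 0) (M := M) (by simp) (fun n => ?_) (by simpa using hp)
    simp only [mul_zero, zero_mul, neg_zero, Real.exp_zero, mul_one]
    exact (h n).trans (le_mul_of_one_le_right hM.le (by simp))
  have h2 : HolSeries {k} (fun k' n p => P.reflectedCoeff k n * P.planeWave 1 k' n p) p := by
    refine P.holSeries_planeWave (s := 1) (y := -P.h) (M := M') (by simp) (fun n => ?_) (by simpa using hp')
    calc _ ≤ M' * Real.exp (-((P.βn n k).im * P.h)) * Real.exp (-(1 * -P.h * (P.βn n k).im)) := by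
          gcongr; exact h' n
      _ = M' := by rw [mul_assoc, ← Real.exp_add]; ring_nf; simp
      _ ≤ _ := le_mul_of_one_le_right hM'.le (by simp)
  have h3 : HolSeries {k} (fun _ n p => P.linearCoeff k n * p 1 * P.planeWave 1 k n p) p := by
    refine HolSeries.of_finite (P.finite_setOf_βn_eq_zero k) (F := fun n z => P.linearCoeff k n * z.2 *
      Complex.exp (Complex.I * P.αn n k * z.1 + (1 : ℝ) * Complex.I * P.βn n k * z.2))
      (fun n => by fun_prop) (fun n hn z => ?_) fun n p => rfl
    have : P.linearCoeff k n = 0 := if_neg hn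
    simp [this]
  refine ((h1.add h2).add h3).congr fun k' hk' n p => ?_
  rw [mem_singleton_iff.1 hk', middleTerm]

theorem greenSum_eq_upper {k : ℝ} (hk : 0 < k) {p : Plane} (hp : 0 < p 1) :
    P.greenSum fullWeight k p = ∑' n : ℤ, P.upperCoeff k n * P.planeWave 1 k n p := by
  have hs : Summable fun n => P.greenProfile k n (p 1) := by
    have h1 := (P.holSeries_upper k (p := !₂[0, p 1]) (by simpa using hp)).summable (mem_singleton k)
    refine h1.congr fun n => ?_
    rw [← greenProfile_upper k n (p := !₂[0, p 1]) (by simpa using hp)]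
    simp
  rw [greenSum_eq_tsum_greenProfile hk (fun l _ => ?_) hs]
  · exact tsum_congr fun n => greenProfile_upper k n hp
  · have := P.h_pos
    positivity

theorem greenSum_eq_middle {k : ℝ} (hk : 0 < k) {p : Plane} (hp : p 1 < 0) (hp' : -P.h < p 1) :
    P.greenSum fullWeight k p = ∑' n : ℤ, P.middleTerm k n p := by
  have hs : Summable fun n => P.greenProfile k n (p 1) := by
    have h1 := (P.holSeries_middle k (p := !₂[0, p 1]) (by simpa using hp)
      (by simpa using hp')).summable (mem_singleton k)
    refine h1.congr fun n => ?_
    rw [middleTerm, ← greenProfile_middle k n (p := !₂[0, p 1]) (by simpa using hp) (by simpa using hp')]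
    simp
  rw [greenSum_eq_tsum_greenProfile hk (fun l _ => ?_) hs]
  · exact tsum_congr fun n => greenProfile_middle k n hp hp'
  · rcases l with _ | l
    · simpa using hp.ne
    · have := P.h_pos
      have : 0 ≤ (l : ℝ) * P.h := by positivity
      push_cast
      have : 0 < p 1 + (l + 1) * P.h := by linarith
      exact this.ne'

end ScatteringSetup

/-! ### Potentials of smooth kernels -/

theorem exists_tube {O : Set Plane} (hO : IsOpen O) {z : ℝ → Plane} (hz : Continuous z) {a b : ℝ}
    {p : Plane} (hp : ∀ t ∈ uIcc a b, p - z t ∈ O) :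
    ∃ (δ : ℝ) (S : Set Plane), 0 < δ ∧ IsCompact S ∧ S ⊆ O ∧
      ∀ q ∈ Metric.ball p δ, ∀ t ∈ uIcc a b, q - z t ∈ S := by
  have hc : IsCompact ((fun t => p - z t) '' uIcc a b) :=
    isCompact_uIcc.image (continuous_const.sub hz)
  obtain ⟨δ, hδ, h⟩ := hc.exists_cthickening_subset_open hO (by rintro _ ⟨t, ht, rfl⟩; exact hp t ht)
  refine ⟨δ, _, hδ, hc.cthickening, h, fun q hq t ht => ?_⟩
  refine Metric.mem_cthickening_of_dist_le _ (p - z t) _ _ ⟨t, ht, rfl⟩ ?_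
  rw [dist_sub_right]
  exact (Metric.mem_ball.1 hq).le

theorem continuousOn_smul_kernel {F : Type} [NormedAddCommGroup F] [NormedSpace ℂ F] {K : Plane → F}
    {O : Set Plane} (hK : ContinuousOn K O) {c : ℝ → ℂ} {z : ℝ → Plane} (hc : Continuous c)
    (hz : Continuous z) {a b : ℝ} {q : Plane} (hq : ∀ t ∈ uIcc a b, q - z t ∈ O) :
    ContinuousOn (fun t => c t • K (q - z t)) (uIcc a b) :=
  hc.continuousOn.smul (hK.comp (continuous_const.sub hz).continuousOn hq)

theorem hasFDerivAt_potential {F : Type} [NormedAddCommGroup F] [NormedSpace ℂ F]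
    {K : Plane → F} {O : Set Plane} (hO : IsOpen O)
    (hK : ContDiffOn ℝ 1 K O) {c : ℝ → ℂ} {z : ℝ → Plane} (hc : Continuous c) (hz : Continuous z)
    {a b : ℝ} {p : Plane} (hp : ∀ t ∈ uIcc a b, p - z t ∈ O) :
    HasFDerivAt (fun q => ∫ t in a..b, c t • K (q - z t))
      (∫ t in a..b, c t • fderiv ℝ K (p - z t)) p := by
  obtain ⟨δ, S, hδ, hS, hSO, hball⟩ := exists_tube hO hz hp
  have hfd : ContinuousOn (fderiv ℝ K) O := hK.continuousOn_fderiv_of_isOpen hO (by norm_num)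
  obtain ⟨M, hM⟩ := hS.exists_bound_of_continuousOn (hfd.mono hSO)
  have hmeas : ∀ q ∈ Metric.ball p δ, ContinuousOn (fun t => c t • K (q - z t)) (uIcc a b) :=
    fun q hq => continuousOn_smul_kernel hK.continuousOn hc hz fun t ht => hSO (hball q hq t ht)
  have hp0 := Metric.mem_ball_self (x := p) hδ
  refine intervalIntegral.hasFDerivAt_integral_of_dominated_of_fderiv_le
    (F := fun q t => c t • K (q - z t)) (F' := fun q t => c t • fderiv ℝ K (q - z t))
    (bound := fun t => ‖c t‖ * M) (Metric.ball_mem_nhds p hδ) ?_ ?_ ?_ ?_ ?_ ?_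
  · filter_upwards [Metric.ball_mem_nhds p hδ] with q hq
    exact ((hmeas q hq).mono uIoc_subset_uIcc).aestronglyMeasurable measurableSet_uIoc
  · exact (hmeas p hp0).intervalIntegrable
  · exact ((continuousOn_smul_kernel hfd hc hz hp).mono uIoc_subset_uIcc).aestronglyMeasurable
      measurableSet_uIoc
  · refine Eventually.of_forall fun t ht q hq => ?_
    rw [norm_smul]
    exact mul_le_mul_of_nonneg_left (hM _ (hball q hq t (uIoc_subset_uIcc ht))) (norm_nonneg _)
  · exact (hc.norm.mul continuous_const).intervalIntegrable _ _
  · refine Eventually.of_forall fun t ht q hq => ?_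
    have h1 : DifferentiableAt ℝ K (q - z t) :=
      (hK.differentiableOn (by norm_num)).differentiableAt
        (hO.mem_nhds (hSO (hball q hq t (uIoc_subset_uIcc ht))))
    have h2 : HasFDerivAt (fun q => K (q - z t)) (fderiv ℝ K (q - z t)) q := by
      have := h1.hasFDerivAt.comp q ((hasFDerivAt_id q).sub_const (z t))
      simpa [Function.comp_def] using this
    exact h2.const_smul (c t)

theorem contDiffAt_potential (m : ℕ) : ∀ {F : Type} [NormedAddCommGroup F] [NormedSpace ℂ F]
    {K : Plane → F} {O : Set Plane} (_ : IsOpen O)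
    (_ : ContDiffOn ℝ ∞ K O) {c : ℝ → ℂ} {z : ℝ → Plane} (_ : Continuous c) (_ : Continuous z)
    {a b : ℝ} {p : Plane} (_ : ∀ t ∈ uIcc a b, p - z t ∈ O),
    ContDiffAt ℝ m (fun q => ∫ t in a..b, c t • K (q - z t)) p := by
  induction m with
  | zero =>
    intro F _ _ K O hO hK c z hc hz a b p hp
    obtain ⟨δ, S, hδ, hS, hSO, hball⟩ := exists_tube hO hz hp
    refine contDiffAt_zero.2 ⟨Metric.ball p δ, Metric.ball_mem_nhds p hδ, fun q hq => ?_⟩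
    exact (hasFDerivAt_potential hO (hK.of_le (WithTop.coe_le_coe.2 le_top)) hc hz
      fun t ht => hSO (hball q hq t ht)).continuousAt.continuousWithinAt
  | succ m ih =>
    intro F _ _ K O hO hK c z hc hz a b p hp
    obtain ⟨δ, S, hδ, hS, hSO, hball⟩ := exists_tube hO hz hp
    have : ((m + 1 : ℕ) : WithTop ℕ∞) = (m : WithTop ℕ∞) + 1 := by push_cast; rfl
    rw [this]
    refine contDiffAt_succ_iff_hasFDerivAt.2 ⟨_, ⟨Metric.ball p δ, Metric.ball_mem_nhds p hδ,
      fun q hq => hasFDerivAt_potential hO (hK.of_le (WithTop.coe_le_coe.2 le_top)) hc hz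
      fun t ht => hSO (hball q hq t ht)⟩, ?_⟩
    exact ih hO (hK.fderiv_of_isOpen hO (by simp)) hc hz hp

theorem helm_potential {k : ℝ} {K : Plane → ℂ} {O : Set Plane} (hO : IsOpen O)
    (hK : ContDiffOn ℝ ∞ K O) (hh : ∀ q ∈ O, helm k K q = 0) {c : ℝ → ℂ} {z : ℝ → Plane}
    (hc : Continuous c) (hz : Continuous z) {a b : ℝ} {p : Plane}
    (hp : ∀ t ∈ uIcc a b, p - z t ∈ O) :
    helm k (fun q => ∫ t in a..b, c t • K (q - z t)) p = 0 := by
  obtain ⟨δ, S, hδ, hS, hSO, hball⟩ := exists_tube hO hz hp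
  have key : ∀ {K : Plane → ℂ} (_ : ContDiffOn ℝ ∞ K O) (v : Plane), ∀ q ∈ Metric.ball p δ,
      fderiv ℝ (fun q => ∫ t in a..b, c t • K (q - z t)) q v =
        ∫ t in a..b, c t • fderiv ℝ K (q - z t) v := by
    intro K hK v q hq
    have hq' := fun t ht => hSO (hball q hq t ht)
    rw [(hasFDerivAt_potential hO (hK.of_le (WithTop.coe_le_coe.2 le_top)) hc hz hq').fderiv]
    rw [ContinuousLinearMap.intervalIntegral_apply]
    · rfl
    · exact (continuousOn_smul_kernel (hK.continuousOn_fderiv_of_isOpen hO (by simp)) hc hz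
        hq').intervalIntegrable
  have hD : ∀ v : Plane, ContDiffOn ℝ ∞ (fun q => fderiv ℝ K q v) O := fun v =>
    (hK.fderiv_of_isOpen hO (by simp)).clm_apply contDiffOn_const
  have hp0 := Metric.mem_ball_self (x := p) hδ
  have h2 : ∀ v : Plane, fderiv ℝ (fun q => fderiv ℝ (fun q => ∫ t in a..b, c t • K (q - z t)) q v) p v =
      ∫ t in a..b, c t • fderiv ℝ (fun q => fderiv ℝ K q v) (p - z t) v := fun v => by
    have : (fun q => fderiv ℝ (fun q => ∫ t in a..b, c t • K (q - z t)) q v) =ᶠ[𝓝 p]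
        fun q => ∫ t in a..b, c t • fderiv ℝ K (q - z t) v :=
      eventually_of_mem (Metric.ball_mem_nhds p hδ) fun q hq => key hK v q hq
    rw [this.fderiv_eq, key (hD v) v p hp0]
  have hi : ∀ {K : Plane → ℂ} (_ : ContDiffOn ℝ ∞ K O),
      IntervalIntegrable (fun t => c t • K (p - z t)) volume a b := fun hK =>
    (continuousOn_smul_kernel hK.continuousOn hc hz hp).intervalIntegrable
  have hDD : ∀ v : Plane, ContDiffOn ℝ ∞ (fun q => fderiv ℝ (fun q => fderiv ℝ K q v) q v) O :=
    fun v => ((hD v).fderiv_of_isOpen hO (by simp)).clm_apply contDiffOn_const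
  rw [helm, Fin.sum_univ_two, h2, h2, ← intervalIntegral.integral_add (hi (hDD _)) (hi (hDD _)),
    ← intervalIntegral.integral_const_mul, ← intervalIntegral.integral_add
      ((hi (hDD _)).add (hi (hDD _))) ((hi hK).const_mul _)]
  rw [intervalIntegral.integral_congr (g := fun _ => (0 : ℂ)), intervalIntegral.integral_zero]
  intro t ht
  have := hh _ (hp t ht)
  rw [helm, Fin.sum_univ_two] at this
  simp only [smul_eq_mul]
  linear_combination (c t) * this

namespace ScatteringSetup

variable {P : ScatteringSetup}

/-! ### Combined potentials -/

theorem isOpen_regularPoints (w : ℤ → ℕ → ℂ) : IsOpen (P.regularPoints w) :=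
  isOpen_iff_mem_nhds.2 fun _ hp => P.eventually_mem_regularPoints hp

theorem contDiffOn_greenSum {w : ℤ → ℕ → ℂ} (hw : {n : ℤ | ¬ ∀ l, w n l = 1}.Finite) {k : ℝ}
    (hk : 0 < k) : ContDiffOn ℝ ∞ (P.greenSum w k) (P.regularPoints w) := by
  refine contDiffOn_infty.2 fun m p hp => ?_
  exact (contDiffAt_greenSum hk hp hw m).contDiffWithinAt

theorem fderiv_comp_const_sub {F : Plane → ℂ} {p s : Plane} (hF : DifferentiableAt ℝ F (p - s))
    (v : Plane) : fderiv ℝ (fun s => F (p - s)) s v = -fderiv ℝ F (p - s) v := by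
  have h1 : HasFDerivAt (fun s : Plane => p - s) (-ContinuousLinearMap.id ℝ Plane) s :=
    (hasFDerivAt_id s).const_sub p
  have h2 : HasFDerivAt (fun s => F (p - s)) _ s := hF.hasFDerivAt.comp s h1
  rw [h2.fderiv]
  simp

theorem continuous_doubleLayerCoeff (ψ : P.Density) (i : Fin P.m) (l : Fin 2) :
    Continuous fun t => (-(P.normal i t l) * ‖deriv (P.z i) t‖ * ψ (P.bdryPoint i t) : ℂ) := by
  have h1 : Continuous fun t => P.normal i t l :=
    (continuous_apply l).comp ((PiLp.continuous_ofLp 2 _).comp (P.continuous_normal i))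
  exact ((Complex.continuous_ofReal.comp h1).neg.mul
    (Complex.continuous_ofReal.comp (P.continuous_deriv_z i).norm)).mul
    (ψ.continuous.comp (P.continuous_bdryPoint i))

theorem continuous_singleLayerCoeff (ψ : P.Density) (i : Fin P.m) :
    Continuous fun t => (-(Complex.I * P.γ) * ‖deriv (P.z i) t‖ * ψ (P.bdryPoint i t) : ℂ) :=
  (continuous_const.mul (Complex.continuous_ofReal.comp (P.continuous_deriv_z i).norm)).mul
    (ψ.continuous.comp (P.continuous_bdryPoint i))

theorem combinedIntegral_sub_eq {F : Plane → ℂ} {O : Set Plane} (hO : IsOpen O)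
    (hF : ContDiffOn ℝ ∞ F O) {p : Plane} (hp : ∀ s ∈ frontier P.D₀, p - s ∈ O) (ψ : P.Density) :
    P.combinedIntegral (fun s => F (p - s)) ψ =
      ∑ i, ((∫ t in (0 : ℝ)..(2 * Real.pi),
          (-(P.normal i t 0) * ‖deriv (P.z i) t‖ * ψ (P.bdryPoint i t) : ℂ) •
            fderiv ℝ F (p - P.z i t) (EuclideanSpace.single 0 1)) +
        (∫ t in (0 : ℝ)..(2 * Real.pi),
          (-(P.normal i t 1) * ‖deriv (P.z i) t‖ * ψ (P.bdryPoint i t) : ℂ) •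
            fderiv ℝ F (p - P.z i t) (EuclideanSpace.single 1 1)) +
        ∫ t in (0 : ℝ)..(2 * Real.pi),
          (-(Complex.I * P.γ) * ‖deriv (P.z i) t‖ * ψ (P.bdryPoint i t) : ℂ) • F (p - P.z i t)) := by
  unfold combinedIntegral
  refine Finset.sum_congr rfl fun i _ => ?_
  have hz := P.continuous_z i
  have hpz : ∀ t ∈ uIcc (0 : ℝ) (2 * Real.pi), p - P.z i t ∈ O := fun t _ =>
    hp _ (P.z_mem_frontier i t)
  have hD : ∀ v : Plane, ContinuousOn (fun q => fderiv ℝ F q v) O := fun v =>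
    (hF.continuousOn_fderiv_of_isOpen hO (by simp)).clm_apply continuousOn_const
  have i0 : ∀ l : Fin 2, IntervalIntegrable (fun t => (-(P.normal i t l) * ‖deriv (P.z i) t‖ *
      ψ (P.bdryPoint i t) : ℂ) • fderiv ℝ F (p - P.z i t) (EuclideanSpace.single l 1)) volume 0
        (2 * Real.pi) := fun l =>
    (continuousOn_smul_kernel (hD _) (continuous_doubleLayerCoeff ψ i l) hz hpz).intervalIntegrable
  have i2 : IntervalIntegrable (fun t => (-(Complex.I * P.γ) * ‖deriv (P.z i) t‖ *
      ψ (P.bdryPoint i t) : ℂ) • F (p - P.z i t)) volume 0 (2 * Real.pi) :=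
    (continuousOn_smul_kernel hF.continuousOn (continuous_singleLayerCoeff ψ i) hz hpz).intervalIntegrable
  rw [← intervalIntegral.integral_add (i0 0) (i0 1), ← intervalIntegral.integral_add
    ((i0 0).add (i0 1)) i2]
  refine intervalIntegral.integral_congr fun t ht => ?_
  have h1 : DifferentiableAt ℝ F (p - P.z i t) :=
    (hF.differentiableOn (by simp)).differentiableAt (hO.mem_nhds (hpz t ht))
  simp only
  rw [fderiv_comp_const_sub h1, fderiv_apply_eq_coord]
  simp only [smul_eq_mul]
  ring

theorem eventually_sub_mem {O : Set Plane} (hO : IsOpen O) {p : Plane}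
    (hp : ∀ s ∈ frontier P.D₀, p - s ∈ O) : ∀ᶠ q in 𝓝 p, ∀ s ∈ frontier P.D₀, q - s ∈ O := by
  have := P.isCompact_frontier.eventually_forall_of_forall_eventually (x₀ := p)
    (P := fun q s => q - s ∈ O) fun s hs => by
      have hc : Continuous fun x : Plane × Plane => x.1 - x.2 := by fun_prop
      exact hc.continuousAt.eventually_mem (hO.mem_nhds (hp s hs))
  exact this

section

variable {F : Plane → ℂ} {O : Set Plane} (hO : IsOpen O) (hF : ContDiffOn ℝ ∞ F O) {p : Plane}
  (hp : ∀ s ∈ frontier P.D₀, p - s ∈ O) (ψ : P.Density)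

include hO hF hp

theorem contDiffAt_combinedIntegral_sub (m : ℕ) :
    ContDiffAt ℝ m (fun p => P.combinedIntegral (fun s => F (p - s)) ψ) p := by
  have h := (eventually_sub_mem hO hp).mono fun q hq =>
    combinedIntegral_sub_eq hO hF hq ψ
  refine ContDiffAt.congr_of_eventuallyEq ?_ h
  have hD : ∀ v : Plane, ContDiffOn ℝ ∞ (fun q => fderiv ℝ F q v) O := fun v =>
    (hF.fderiv_of_isOpen hO (by simp)).clm_apply contDiffOn_const
  refine ContDiffAt.sum fun i _ => ?_
  have hz := P.continuous_z i
  have hpz : ∀ t ∈ uIcc (0 : ℝ) (2 * Real.pi), p - P.z i t ∈ O := fun t _ =>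
    hp _ (P.z_mem_frontier i t)
  exact ((contDiffAt_potential m hO (hD _) (continuous_doubleLayerCoeff ψ i 0) hz hpz).add
    (contDiffAt_potential m hO (hD _) (continuous_doubleLayerCoeff ψ i 1) hz hpz)).add
    (contDiffAt_potential m hO hF (continuous_singleLayerCoeff ψ i) hz hpz)

theorem helm_combinedIntegral_sub {k : ℝ} (hh : ∀ q ∈ O, helm k F q = 0) :
    helm k (fun p => P.combinedIntegral (fun s => F (p - s)) ψ) p = 0 := by
  have h := (eventually_sub_mem hO hp).mono fun q hq =>
    combinedIntegral_sub_eq hO hF hq ψ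
  rw [helm_congr h]
  have hD : ∀ v : Plane, ContDiffOn ℝ ∞ (fun q => fderiv ℝ F q v) O := fun v =>
    (hF.fderiv_of_isOpen hO (by simp)).clm_apply contDiffOn_const
  have hhD : ∀ v : Plane, ∀ q ∈ O, helm k (fun q => fderiv ℝ F q v) q = 0 := fun v q hq =>
    helm_fderiv_apply ((hF.contDiffAt (hO.mem_nhds hq)).of_le (WithTop.coe_le_coe.2 le_top))
      (eventually_of_mem (hO.mem_nhds hq) hh) v
  have hpz : ∀ i, ∀ t ∈ uIcc (0 : ℝ) (2 * Real.pi), p - P.z i t ∈ O := fun i t _ =>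
    hp _ (P.z_mem_frontier i t)
  have c0 := continuous_doubleLayerCoeff ψ
  have c2 := continuous_singleLayerCoeff ψ
  have s0 : ∀ i, ∀ l : Fin 2, ContDiffAt ℝ 2 (fun q : Plane => ∫ t in (0 : ℝ)..(2 * Real.pi),
      (-(P.normal i t l) * ‖deriv (P.z i) t‖ * ψ (P.bdryPoint i t) : ℂ) •
        fderiv ℝ F (q - P.z i t) (EuclideanSpace.single l 1)) p := fun i l =>
    contDiffAt_potential 2 hO (hD (EuclideanSpace.single l 1)) (c0 i l) (P.continuous_z i) (hpz i)
  have s2 : ∀ i, ContDiffAt ℝ 2 (fun q : Plane => ∫ t in (0 : ℝ)..(2 * Real.pi),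
      (-(Complex.I * P.γ) * ‖deriv (P.z i) t‖ * ψ (P.bdryPoint i t) : ℂ) • F (q - P.z i t)) p :=
    fun i => contDiffAt_potential 2 hO hF (c2 i) (P.continuous_z i) (hpz i)
  rw [helm_sum _ fun i _ => ((s0 i 0).add (s0 i 1)).add (s2 i), Finset.sum_eq_zero]
  intro i _
  rw [helm_add ((s0 i 0).add (s0 i 1)) (s2 i), helm_add (s0 i 0) (s0 i 1),
    helm_potential hO (hD (EuclideanSpace.single 0 1)) (hhD _) (c0 i 0) (P.continuous_z i) (hpz i),
    helm_potential hO (hD (EuclideanSpace.single 1 1)) (hhD _) (c0 i 1) (P.continuous_z i) (hpz i),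
    helm_potential hO hF hh (c2 i) (P.continuous_z i) (hpz i)]
  simp

end

/-! ### Modal integrals -/

theorem planeWave_sub (s k : ℝ) (n : ℤ) (p q : Plane) :
    P.planeWave s k n (p - q) = P.planeWave s k n p * P.planeWave s k n (-q) := by
  rw [planeWave, planeWave, planeWave, ← Complex.exp_add]
  congr 1
  simp
  ring

theorem norm_planeWave (s k : ℝ) (n : ℤ) (p : Plane) :
    ‖P.planeWave s k n p‖ = Real.exp (-(s * p 1 * (P.βn n k).im)) := by
  rw [planeWave, Complex.norm_exp]
  congr 1
  simp
  ring

variable (P) in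
/-- The combined integral of the `n`-th mode `e^{-iα_n x - isβ_n y}`. -/
noncomputable def modeIntegral (s k : ℝ) (n : ℤ) (ψ : P.Density) : ℂ :=
  P.combinedIntegral (fun q => P.planeWave s k n (-q)) ψ

theorem Iplus_eq (n : ℤ) (k : ℝ) (ψ : P.Density) : P.Iplus n k ψ = P.modeIntegral 1 k n ψ := by
  rw [Iplus, modeIntegral]
  congr 1
  ext q
  rw [planeWave]
  congr 1
  simp
  ring

theorem contDiff_planeWave_neg (s k : ℝ) (n : ℤ) :
    ContDiff ℝ ∞ fun q => P.planeWave s k n (-q) :=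
  (P.contDiff_planeWave s k n).comp contDiff_neg

theorem contDiffAt_planeWave_neg (s k : ℝ) (n : ℤ) (q : Plane) :
    ContDiffAt ℝ 1 (fun q => P.planeWave s k n (-q)) q :=
  (contDiff_planeWave_neg s k n).contDiffAt.of_le (WithTop.coe_le_coe.2 le_top)

theorem norm_βn_le (n : ℤ) (k : ℝ) : ‖P.βn n k‖ ≤ |k| + |P.αn n k| := by
  have h1 : ‖P.βn n k‖ ^ 2 ≤ |k| ^ 2 + |P.αn n k| ^ 2 := by
    rw [← norm_pow, βn_sq]
    refine (norm_sub_le _ _).trans (by simp)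
  refine le_of_sq_le_sq (h1.trans ?_) (by positivity)
  nlinarith [abs_nonneg k, abs_nonneg (P.αn n k)]

theorem fderiv_planeWave_neg_apply (s k : ℝ) (n : ℤ) (q v : Plane) :
    fderiv ℝ (fun q => P.planeWave s k n (-q)) q v =
      -((Complex.I * P.αn n k * v 0 + s * Complex.I * P.βn n k * v 1) * P.planeWave s k n (-q)) := by
  have := fderiv_comp_const_sub (F := P.planeWave s k n) (p := 0) (s := q)
    ((P.contDiff_planeWave s k n).contDiffAt.differentiableAt (by simp)) v
  simp only [zero_sub] at this
  rw [this, fderiv_planeWave_apply]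

theorem norm_modeIntegral_le {s k Y : ℝ} (hs : |s| = 1) (hY : ∀ q ∈ frontier P.D₀, s * q 1 ≤ Y)
    (n : ℤ) (ψ : P.Density) : ‖P.modeIntegral s k n ψ‖ ≤
      ((3 * |k| + 2 * (2 * Real.pi / P.L) + P.γ) * (1 + |(n : ℝ)|) *
        Real.exp (Y * (P.βn n k).im)) * P.boundaryLength * ‖ψ‖ := by
  refine norm_combinedIntegral_le (fun q _ => contDiffAt_planeWave_neg s k n q) (fun i t => ?_) ψ
  have hL := P.L_pos
  have hγ := P.γ_nonneg
  have hz := P.z_mem_frontier i t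
  have hκ : 0 ≤ 2 * Real.pi / P.L := by positivity
  have hw : ‖P.planeWave s k n (-(P.z i t))‖ ≤ Real.exp (Y * (P.βn n k).im) := by
    rw [norm_planeWave]
    refine Real.exp_le_exp.2 ?_
    have := mul_le_mul_of_nonneg_right (hY _ hz) (P.βn_im_nonneg n k)
    simp only [PiLp.neg_apply]
    linarith
  have hα := P.abs_αn_le n k
  have hβ := P.norm_βn_le n k
  have hv : ∀ l, |P.normal i t l| ≤ 1 := fun l =>
    (abs_apply_le_norm _ _).trans (P.norm_normal i t).le
  rw [fderiv_planeWave_neg_apply]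
  have e : -((Complex.I * P.αn n k * P.normal i t 0 + s * Complex.I * P.βn n k * P.normal i t 1) *
      P.planeWave s k n (-(P.z i t))) - Complex.I * P.γ * P.planeWave s k n (-(P.z i t)) =
      -(Complex.I * P.αn n k * P.normal i t 0 + s * Complex.I * P.βn n k * P.normal i t 1 +
        Complex.I * P.γ) * P.planeWave s k n (-(P.z i t)) := by ring
  rw [e, norm_mul, norm_neg]
  refine mul_le_mul ((norm_add₃_le).trans ?_) hw (norm_nonneg _) (by positivity)
  simp only [norm_mul, Complex.norm_I, one_mul, Complex.norm_real, Real.norm_eq_abs, hs,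
    abs_of_nonneg hγ]
  have h1 : |P.αn n k| * |P.normal i t 0| ≤ |P.αn n k| :=
    mul_le_of_le_one_right (abs_nonneg _) (hv 0)
  have h2 : ‖P.βn n k‖ * |P.normal i t 1| ≤ ‖P.βn n k‖ :=
    mul_le_of_le_one_right (norm_nonneg _) (hv 1)
  have h3 : 0 ≤ |(n : ℝ)| * |k| := by positivity
  have h4 : 0 ≤ |(n : ℝ)| * P.γ := by positivity
  nlinarith

theorem norm_Iplus_le (n : ℤ) (k : ℝ) (ψ : P.Density) : ‖P.Iplus n k ψ‖ ≤
      ((3 * |k| + 2 * (2 * Real.pi / P.L) + P.γ) * (1 + |(n : ℝ)|) *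
        Real.exp (P.yMax * (P.βn n k).im)) * P.boundaryLength * ‖ψ‖ := by
  rw [Iplus_eq]
  exact norm_modeIntegral_le (by simp) (fun q hq => by simpa using le_yMax (frontier_subset hq)) n ψ

end ScatteringSetup

namespace ScatteringSetup

variable {P : ScatteringSetup}

/-! ### The hybrid potential and its modal expansions -/

variable (P) in
/-- The potential of the hybrid equation without the Wood modes. -/
noncomputable def hybridPotential (k : ℝ) (ψ : P.Density) (p : Plane) : ℂ :=
  P.combinedIntegral (fun s => P.greenSum fullWeight k (p - s)) ψ -
    ∑' n : ℤ, P.reflectedCoeff k n * P.Iplus n k ψ * P.planeWave 1 k n p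

theorem sub_mem_regularPoints {p s : Plane} (hp : p ∈ P.arrayᶜ) (hp1 : P.yMax - P.h < p 1)
    (hs : s ∈ frontier P.D₀) : p - s ∈ P.regularPoints fullWeight := by
  intro n l _ _
  rcases l with _ | l
  · by_contra h
    have h0 : ((p - s) 0 + n * P.L) ^ 2 + ((p - s) 1 + (0 : ℕ) * P.h) ^ 2 = 0 :=
      le_antisymm (not_lt.1 h) (by positivity)
    have h1 : (p - s) 0 + n * P.L = 0 := by
      nlinarith [sq_nonneg ((p - s) 0 + n * P.L), sq_nonneg ((p - s) 1 + (0 : ℕ) * P.h)]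
    have h2 : (p - s) 1 = 0 := by
      rw [h1] at h0
      simpa using h0
    refine hp ⟨n, ?_⟩
    have : p + !₂[n * P.L, 0] = s := by
      ext i
      fin_cases i
      · simp at h1 ⊢; linarith
      · simp at h2 ⊢; linarith
    rw [this]
    exact frontier_subset hs
  · have h1 := le_yMax (frontier_subset hs)
    have h2 : 0 ≤ (l : ℝ) * P.h := by have := P.h_pos; positivity
    have h3 : 0 < (p - s) 1 + ((l + 1 : ℕ) : ℝ) * P.h := by
      push_cast
      simp only [PiLp.sub_apply]
      linarith
    positivity

theorem norm_reflectedCoeff_mul_Iplus_le (k : ℝ) (ψ : P.Density) : ∃ M : ℝ, ∀ n,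
    ‖P.reflectedCoeff k n * P.Iplus n k ψ‖ *
      Real.exp (-(1 * (P.yMax - P.h) * (P.βn n k).im)) ≤ M * (1 + |(n : ℝ)|) := by
  obtain ⟨M, hM, h⟩ := P.exists_norm_reflectedCoeff_le k
  refine ⟨M * (3 * |k| + 2 * (2 * Real.pi / P.L) + P.γ) * P.boundaryLength * ‖ψ‖, fun n => ?_⟩
  rw [norm_mul]
  have h2 := P.norm_Iplus_le n k ψ
  calc _ ≤ (M * Real.exp (-((P.βn n k).im * P.h))) *
        (((3 * |k| + 2 * (2 * Real.pi / P.L) + P.γ) * (1 + |(n : ℝ)|) *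
        Real.exp (P.yMax * (P.βn n k).im)) * P.boundaryLength * ‖ψ‖) *
        Real.exp (-(1 * (P.yMax - P.h) * (P.βn n k).im)) := by gcongr; exact h n
    _ = (M * (3 * |k| + 2 * (2 * Real.pi / P.L) + P.γ) * P.boundaryLength * ‖ψ‖) * (1 + |(n : ℝ)|) *
        (Real.exp (-((P.βn n k).im * P.h)) * Real.exp (P.yMax * (P.βn n k).im) *
          Real.exp (-(1 * (P.yMax - P.h) * (P.βn n k).im))) := by ring
    _ = _ := by
        rw [← Real.exp_add, ← Real.exp_add]
        ring_nf
        simp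
        ring

theorem holSeries_reflected (k : ℝ) (ψ : P.Density) {p : Plane} (hp : P.yMax - P.h < p 1) :
    HolSeries {k} (fun k' n p => P.reflectedCoeff k n * P.Iplus n k ψ * P.planeWave 1 k' n p) p := by
  obtain ⟨M, hM⟩ := norm_reflectedCoeff_mul_Iplus_le k ψ
  exact P.holSeries_planeWave (by simp) hM (by simpa using hp)

section

variable {k : ℝ} (hk : 0 < k) (ψ : P.Density) {p : Plane} (hp : p ∈ P.arrayᶜ)
  (hp1 : P.yMax - P.h < p 1)

include hk hp hp1

theorem contDiffAt_hybridPotential : ContDiffAt ℝ 2 (P.hybridPotential k ψ) p :=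
  (contDiffAt_combinedIntegral_sub (isOpen_regularPoints _) (contDiffOn_greenSum finite_fullWeight hk)
    (fun _ hs => sub_mem_regularPoints hp hp1 hs) ψ 2).sub
    ((holSeries_reflected k ψ hp1).contDiffAt_tsum (mem_singleton k) 2)

theorem helm_hybridPotential : helm k (P.hybridPotential k ψ) p = 0 := by
  have h1 := contDiffAt_combinedIntegral_sub (isOpen_regularPoints _)
    (contDiffOn_greenSum finite_fullWeight hk) (fun _ hs => sub_mem_regularPoints hp hp1 hs) ψ 2
  have h2 := (holSeries_reflected k ψ hp1).contDiffAt_tsum (mem_singleton k) 2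
  have h3 : helm k (fun p => P.combinedIntegral (fun s => P.greenSum fullWeight k (p - s)) ψ) p = 0 :=
    helm_combinedIntegral_sub (isOpen_regularPoints _) (contDiffOn_greenSum finite_fullWeight hk)
      (fun _ hs => sub_mem_regularPoints hp hp1 hs) ψ fun q hq =>
        helm_greenSum hk hq finite_fullWeight
  have h4 := (holSeries_reflected k ψ hp1).helm_tsum (mem_singleton k) k fun n => by
    rw [helm_const_mul _ ((P.contDiff_planeWave 1 k n).contDiffAt.of_le (WithTop.coe_le_coe.2 le_top)),
      P.helm_planeWave (by norm_num), mul_zero]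
  have h5 : P.hybridPotential k ψ = fun p => P.combinedIntegral
      (fun s => P.greenSum fullWeight k (p - s)) ψ +
      (-1) * ∑' n : ℤ, P.reflectedCoeff k n * P.Iplus n k ψ * P.planeWave 1 k n p := by
    ext q; rw [hybridPotential]; ring
  rw [h5, helm_add h1 (contDiffAt_const.mul h2), helm_const_mul _ h2, h3, h4, mul_zero, add_zero]

end

theorem combinedIntegral_planeWave_sub (c : ℂ) (s k : ℝ) (n : ℤ) (p : Plane) (ψ : P.Density) :
    P.combinedIntegral (fun q => c * P.planeWave s k n (p - q)) ψ =
      c * P.planeWave s k n p * P.modeIntegral s k n ψ := by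
  simp_rw [planeWave_sub, ← mul_assoc]
  exact combinedIntegral_const_mul _ (fun q _ => contDiffAt_planeWave_neg s k n q) ψ

section

variable {k : ℝ} (hk : 0 < k) {ψ : P.Density}

include hk

theorem hasSum_hybridPotential_above {p : Plane} (hp : P.yMax < p 1) :
    HasSum (fun n => (P.upperCoeff k n - P.reflectedCoeff k n) * P.Iplus n k ψ *
      P.planeWave 1 k n p) (P.hybridPotential k ψ p) := by
  have hs : ∀ q ∈ frontier P.D₀, 0 < (p - q) 1 := fun q hq => by
    have := le_yMax (frontier_subset hq)
    simp only [PiLp.sub_apply]; linarith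
  have h1 := hasSum_combinedIntegral (P := P) (k := k)
    (f := fun n q => P.upperCoeff k n * P.planeWave 1 k n (p - q))
    (fun q hq => (HolSeries.const_sub (holSeries_upper k (hs q hq))).congr fun k' hk' n q => by
      rw [mem_singleton_iff.1 hk']) ψ
  have h2 : P.combinedIntegral (fun q => ∑' n, P.upperCoeff k n * P.planeWave 1 k n (p - q)) ψ =
      P.combinedIntegral (fun s => P.greenSum fullWeight k (p - s)) ψ := by
    refine combinedIntegral_congr (fun q hq => ?_) ψ
    have : Continuous fun q : Plane => (p - q) 1 := by fun_prop
    filter_upwards [this.continuousAt.eventually (lt_mem_nhds (hs q hq))] with q' hq'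
    exact (greenSum_eq_upper hk hq').symm
  rw [h2] at h1
  have h3 := ((holSeries_reflected k ψ (p := p) (by have := P.h_pos; linarith)).summable
    (mem_singleton k)).hasSum
  refine (h1.sub h3).congr_fun fun n => ?_
  rw [combinedIntegral_planeWave_sub, ← Iplus_eq]
  ring

variable (P) in
omit hk in
/-- The coefficient of the `n`-th mode of the hybrid potential below the obstacle. -/
noncomputable def belowCoeff (k : ℝ) (ψ : P.Density) (n : ℤ) : ℂ :=
  if P.βn n k = 0 then
    -(1 / P.L) * P.combinedIntegral (fun q => q 1 * P.planeWave 1 k n (-q)) ψ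
  else P.lowerCoeff k n * P.modeIntegral (-1) k n ψ

theorem hasSum_hybridPotential_below (hI : ∀ n, P.βn n k = 0 → P.Iplus n k ψ = 0) {p : Plane} (hp : P.yMax - P.h < p 1) (hp' : p 1 < P.yMin) :
    HasSum (fun n => P.belowCoeff k ψ n * P.planeWave (-1) k n p) (P.hybridPotential k ψ p) := by
  have hs : ∀ q ∈ frontier P.D₀, (p - q) 1 < 0 ∧ -P.h < (p - q) 1 := fun q hq => by
    have h1 := le_yMax (frontier_subset hq)
    have h2 := yMin_le (frontier_subset hq)
    simp only [PiLp.sub_apply]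
    constructor <;> linarith
  have h1 := hasSum_combinedIntegral (P := P) (k := k)
    (f := fun n q => P.middleTerm k n (p - q))
    (fun q hq => (HolSeries.const_sub (holSeries_middle k (hs q hq).1 (hs q hq).2)).congr
      fun k' hk' n q => by rw [mem_singleton_iff.1 hk']) ψ
  have h2 : P.combinedIntegral (fun q => ∑' n, P.middleTerm k n (p - q)) ψ =
      P.combinedIntegral (fun s => P.greenSum fullWeight k (p - s)) ψ := by
    refine combinedIntegral_congr (fun q hq => ?_) ψ
    have : Continuous fun q : Plane => (p - q) 1 := by fun_prop
    filter_upwards [this.continuousAt.eventually (gt_mem_nhds (hs q hq).1),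
      this.continuousAt.eventually (lt_mem_nhds (hs q hq).2)] with q' hq' hq''
    exact (greenSum_eq_middle hk hq' hq'').symm
  rw [h2] at h1
  have h3 := ((holSeries_reflected k ψ hp).summable (mem_singleton k)).hasSum
  refine (h1.sub h3).congr_fun fun n => ?_
  have c1 : ∀ (s : ℝ) (q : Plane), ContDiffAt ℝ 1 (fun q => P.planeWave s k n (-q)) q := fun s q =>
    contDiffAt_planeWave_neg s k n q
  have c2 : ∀ q : Plane, ContDiffAt ℝ 1 (fun q : Plane => (q 1 : ℂ)) q := fun q =>
    (complexify.contDiff.snd : ContDiff ℝ 1 fun q : Plane => (q 1 : ℂ)).contDiffAt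
  have e : (fun q => P.middleTerm k n (p - q)) = fun q =>
      P.lowerCoeff k n * P.planeWave (-1) k n p * P.planeWave (-1) k n (-q) +
      ((P.reflectedCoeff k n + P.linearCoeff k n * p 1) * P.planeWave 1 k n p *
        P.planeWave 1 k n (-q) + -(P.linearCoeff k n * P.planeWave 1 k n p) *
        (q 1 * P.planeWave 1 k n (-q))) := by
    ext q
    rw [middleTerm, planeWave_sub, planeWave_sub]
    simp only [PiLp.sub_apply]
    push_cast
    ring
  rw [e, combinedIntegral_add (fun q _ => contDiffAt_const.mul (c1 _ q))
      (fun q _ => (contDiffAt_const.mul (c1 _ q)).add (contDiffAt_const.mul ((c2 q).mul (c1 _ q)))),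
    combinedIntegral_add (fun q _ => contDiffAt_const.mul (c1 _ q))
      (fun q _ => contDiffAt_const.mul ((c2 q).mul (c1 _ q))),
    combinedIntegral_const_mul _ (fun q _ => c1 _ q), combinedIntegral_const_mul _ (fun q _ => c1 _ q),
    combinedIntegral_const_mul _ (fun q _ => (c2 q).mul (c1 _ q)), belowCoeff]
  have e1 : P.combinedIntegral (fun q => P.planeWave 1 k n (-q)) ψ = P.Iplus n k ψ :=
    (Iplus_eq n k ψ).symm
  by_cases hβ : P.βn n k = 0
  · have hw : P.planeWave (-1) k n = P.planeWave 1 k n := by ext q; simp [planeWave, hβ]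
    rw [if_pos hβ, hw, e1, hI n hβ, linearCoeff, if_pos hβ]
    ring
  · rw [if_neg hβ, linearCoeff, if_neg hβ, e1, modeIntegral]
    ring

end

theorem holSeries_below (k : ℝ) (ψ : P.Density) {p : Plane} (hp : p 1 < P.yMin) :
    HolSeries {k} (fun k' n p => P.belowCoeff k ψ n * P.planeWave (-1) k' n p) p := by
  obtain ⟨M, hM, h⟩ := P.exists_norm_lowerCoeff_le k
  have h1 : HolSeries {k} (fun k' n p => (P.lowerCoeff k n * P.modeIntegral (-1) k n ψ) *
      P.planeWave (-1) k' n p) p := by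
    refine P.holSeries_planeWave (y := P.yMin) (M := M * ((3 * |k| + 2 * (2 * Real.pi / P.L) + P.γ) *
      P.boundaryLength * ‖ψ‖)) (by simp) (fun n => ?_) (by linarith)
    have h2 := norm_modeIntegral_le (P := P) (s := -1) (k := k) (Y := -P.yMin) (by simp)
      (fun q hq => by have := yMin_le (frontier_subset hq); linarith) n ψ
    rw [norm_mul]
    calc _ ≤ M * (((3 * |k| + 2 * (2 * Real.pi / P.L) + P.γ) * (1 + |(n : ℝ)|) *
          Real.exp (-P.yMin * (P.βn n k).im)) * P.boundaryLength * ‖ψ‖) *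
          Real.exp (-(-1 * P.yMin * (P.βn n k).im)) := by gcongr; exact h n
      _ = M * ((3 * |k| + 2 * (2 * Real.pi / P.L) + P.γ) * P.boundaryLength * ‖ψ‖) *
          (1 + |(n : ℝ)|) * (Real.exp (-P.yMin * (P.βn n k).im) *
            Real.exp (-(-1 * P.yMin * (P.βn n k).im))) := by ring
      _ = _ := by
          rw [← Real.exp_add]
          ring_nf
          simp
          ring
  have h2 : HolSeries {k} (fun _ n p => (P.belowCoeff k ψ n -
      P.lowerCoeff k n * P.modeIntegral (-1) k n ψ) * P.planeWave (-1) k n p) p := by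
    refine HolSeries.of_finite (P.finite_setOf_βn_eq_zero k) (F := fun n z =>
      (P.belowCoeff k ψ n - P.lowerCoeff k n * P.modeIntegral (-1) k n ψ) *
      Complex.exp (Complex.I * P.αn n k * z.1 + (-1 : ℝ) * Complex.I * P.βn n k * z.2))
      (fun n => by fun_prop) (fun n hn z => ?_) fun n p => rfl
    have : P.belowCoeff k ψ n = P.lowerCoeff k n * P.modeIntegral (-1) k n ψ := if_neg hn
    simp [this]
  refine (h1.add h2).congr fun k' hk' n p => ?_
  rw [mem_singleton_iff.1 hk']
  ring

end ScatteringSetup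

/-- The determinant of two vectors of the plane. -/
def wedge (x v : Plane) : ℝ := x 0 * v 1 - x 1 * v 0

theorem plane_norm_sq (x : Plane) : ‖x‖ ^ 2 = x 0 ^ 2 + x 1 ^ 2 := by
  rw [EuclideanSpace.real_norm_sq_eq, Fin.sum_univ_two]

theorem abs_wedge_le (x v : Plane) : |wedge x v| ≤ ‖x‖ * ‖v‖ := by
  refine abs_le_of_sq_le_sq ?_ (by positivity)
  rw [mul_pow, plane_norm_sq, plane_norm_sq, wedge]
  nlinarith [sq_nonneg (x 0 * v 0 + x 1 * v 1)]

theorem norm_add_smul_sq (x v : Plane) (s : ℝ) :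
    ‖x + s • v‖ ^ 2 = ‖x‖ ^ 2 + 2 * s * (x 0 * v 0 + x 1 * v 1) + s ^ 2 * ‖v‖ ^ 2 := by
  rw [plane_norm_sq, plane_norm_sq, plane_norm_sq]
  simp
  ring

theorem continuous_periodic_exists_bound {f : ℝ → ℝ} (hf : Continuous f) {T : ℝ} (hT : 0 < T)
    (hp : Function.Periodic f T) : ∃ t₀, ∀ t, f t ≤ f t₀ := by
  obtain ⟨t₀, -, h⟩ := isCompact_Icc.exists_isMaxOn (nonempty_Icc.2 hT.le) hf.continuousOn
  refine ⟨t₀, fun t => ?_⟩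
  obtain ⟨y, hy, hyt⟩ := hp.exists_mem_Ico₀ hT t
  rw [hyt]
  exact h (Ico_subset_Icc_self hy)

namespace ScatteringSetup

variable {P : ScatteringSetup}

/-! ### Geometry of the boundary curves -/

theorem periodic_deriv_z (i : Fin P.m) : Function.Periodic (deriv (P.z i)) (2 * Real.pi) := fun t => by
  rw [← deriv_comp_add_const]
  congr 1
  ext1 s
  exact P.z_periodic i s

theorem periodic_normal (i : Fin P.m) : Function.Periodic (P.normal i) (2 * Real.pi) := fun t => by
  rw [normal, normal, periodic_deriv_z i t]

theorem periodic_bdryPoint (i : Fin P.m) : Function.Periodic (P.bdryPoint i) (2 * Real.pi) := fun t =>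
  Subtype.ext (P.z_periodic i t)

variable (P) in
theorem exists_norm_deriv_z_le : ∃ B : ℝ, 0 < B ∧ ∀ i t, ‖deriv (P.z i) t‖ ≤ B := by
  have h := fun i => continuous_periodic_exists_bound (P.continuous_deriv_z i).norm Real.two_pi_pos
    fun t => congrArg norm (periodic_deriv_z i t)
  choose t₀ ht using h
  refine ⟨1 + ∑ i, ‖deriv (P.z i) (t₀ i)‖, by positivity, fun i t => (ht i t).trans ?_⟩
  have := Finset.single_le_sum (f := fun i => ‖deriv (P.z i) (t₀ i)‖) (fun i _ => norm_nonneg _)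
    (Finset.mem_univ i)
  linarith

variable (P) in
theorem exists_le_norm_deriv_z : ∃ b : ℝ, 0 < b ∧ ∀ i t, b ≤ ‖deriv (P.z i) t‖ := by
  have h := fun i => continuous_periodic_exists_bound
    ((P.continuous_deriv_z i).norm.inv₀ fun t => (P.norm_deriv_z_pos i t).ne') Real.two_pi_pos
    fun t => congrArg (fun v : Plane => ‖v‖⁻¹) (periodic_deriv_z i t)
  choose t₀ ht using h
  refine ⟨(1 + ∑ i, ‖deriv (P.z i) (t₀ i)‖⁻¹)⁻¹, by positivity, fun i t => ?_⟩
  rw [inv_le_comm₀ (by positivity) (P.norm_deriv_z_pos i t)]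
  have h1 : ‖deriv (P.z i) t‖⁻¹ ≤ ‖deriv (P.z i) (t₀ i)‖⁻¹ := ht i t
  have := Finset.single_le_sum (f := fun i => ‖deriv (P.z i) (t₀ i)‖⁻¹)
    (fun i _ => inv_nonneg.2 (norm_nonneg _)) (Finset.mem_univ i)
  linarith

variable (P) in
theorem exists_taylor_z : ∃ C : ℝ, 0 < C ∧ ∀ i t τ,
    ‖P.z i (t + τ) - P.z i t - τ • deriv (P.z i) t‖ ≤ C * τ ^ 2 := by
  have hcd : ∀ i, ContDiff ℝ 1 (deriv (P.z i)) := fun i =>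
    ((contDiff_succ_iff_deriv (n := 1)).1 (P.z_smooth i)).2.2
  have h := fun i => continuous_periodic_exists_bound ((hcd i).continuous_deriv le_rfl).norm
    Real.two_pi_pos fun t => by
      rw [← deriv_comp_add_const]
      congr 2
      ext1 s
      exact periodic_deriv_z i s
  choose t₀ ht using h
  have hC : ∀ i t, ‖deriv (deriv (P.z i)) t‖ ≤ 1 + ∑ i, ‖deriv (deriv (P.z i)) (t₀ i)‖ := fun i t => by
    have := Finset.single_le_sum (f := fun i => ‖deriv (deriv (P.z i)) (t₀ i)‖)
      (fun i _ => norm_nonneg _) (Finset.mem_univ i)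
    have := ht i t
    linarith
  refine ⟨1 + ∑ i, ‖deriv (deriv (P.z i)) (t₀ i)‖, by positivity, fun i t τ => ?_⟩
  set C := 1 + ∑ i, ‖deriv (deriv (P.z i)) (t₀ i)‖
  have h1 : ∀ σ, ‖deriv (P.z i) (t + σ) - deriv (P.z i) t‖ ≤ C * |σ| := fun σ => by
    have := convex_univ.norm_image_sub_le_of_norm_deriv_le (f := deriv (P.z i)) (C := C)
      (fun x _ => (hcd i).differentiable (by norm_num) x) (fun x _ => hC i x) (mem_univ t)
      (mem_univ (t + σ))
    simpa using this
  have h2 : ∀ σ, HasDerivAt (fun σ => P.z i (t + σ) - σ • deriv (P.z i) t)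
      (deriv (P.z i) (t + σ) - deriv (P.z i) t) σ := fun σ => by
    have h3 := (P.hasDerivAt_z i (t + σ)).comp_const_add t σ
    exact (h3.sub ((hasDerivAt_id σ).smul_const (deriv (P.z i) t))).congr_deriv (by rw [one_smul])
  have h4 := (convex_uIcc (0 : ℝ) τ).norm_image_sub_le_of_norm_hasDerivWithin_le (C := C * |τ|)
    (fun σ _ => (h2 σ).hasDerivWithinAt) (fun σ hσ => (h1 σ).trans ?_) left_mem_uIcc right_mem_uIcc
  · simp only [add_zero, zero_smul, sub_zero, Real.norm_eq_abs] at h4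
    calc _ = ‖P.z i (t + τ) - τ • deriv (P.z i) t - P.z i t‖ := by congr 1; abel
      _ ≤ C * |τ| * |τ| := h4
      _ = C * τ ^ 2 := by rw [mul_assoc, abs_mul_abs_self, sq]
  · refine mul_le_mul_of_nonneg_left ?_ (by positivity)
    have := abs_sub_left_of_mem_uIcc hσ
    simpa using this

theorem z_ne {i : Fin P.m} {t τ : ℝ} (h0 : τ ≠ 0) (hτ : |τ| < 2 * Real.pi) :
    P.z i (t + τ) ≠ P.z i t := fun h => by
  obtain ⟨-, n, hn⟩ := P.z_simple i i _ _ h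
  have h1 : τ = n * (2 * Real.pi) := by linarith
  rcases eq_or_ne n 0 with rfl | hn0
  · exact h0 (by simpa using h1)
  · rw [h1, abs_mul, abs_of_pos Real.two_pi_pos] at hτ
    have : (1 : ℝ) ≤ |(n : ℝ)| := by exact_mod_cast Int.one_le_abs hn0
    nlinarith [Real.two_pi_pos]

variable (P) in
theorem exists_chord_arc : ∃ m : ℝ, 0 < m ∧ ∀ i t τ, |τ| ≤ Real.pi →
    m * |τ| ≤ ‖P.z i (t + τ) - P.z i t‖ := by
  obtain ⟨b, hb, hbz⟩ := P.exists_le_norm_deriv_z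
  obtain ⟨C, hC, hT⟩ := P.exists_taylor_z
  have hpi := Real.pi_pos
  have hnear : ∀ i t τ, |τ| ≤ b / (2 * C) → b / 2 * |τ| ≤ ‖P.z i (t + τ) - P.z i t‖ := by
    intro i t τ hτ
    have h1 := norm_sub_norm_le (τ • deriv (P.z i) t) (τ • deriv (P.z i) t - (P.z i (t + τ) - P.z i t))
    rw [sub_sub_cancel, norm_sub_rev _ (P.z i (t + τ) - P.z i t), norm_smul, Real.norm_eq_abs] at h1
    have h2 := hT i t τ
    have h3 : C * τ ^ 2 ≤ b / 2 * |τ| := by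
      rw [← sq_abs, sq, ← mul_assoc]
      refine mul_le_mul_of_nonneg_right ?_ (abs_nonneg _)
      rw [le_div_iff₀ (by positivity)] at hτ
      linarith
    have h4 := mul_le_mul_of_nonneg_left (hbz i t) (abs_nonneg τ)
    linarith
  have hfar : ∀ i, ∃ m : ℝ, 0 < m ∧ ∀ t τ, b / (2 * C) ≤ |τ| → |τ| ≤ Real.pi →
      m * |τ| ≤ ‖P.z i (t + τ) - P.z i t‖ := by
    intro i
    set S : Set (ℝ × ℝ) := Icc 0 (2 * Real.pi) ×ˢ {τ | b / (2 * C) ≤ |τ| ∧ |τ| ≤ Real.pi} with hS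
    have hSc : IsCompact S := by
      refine isCompact_Icc.prod ?_
      refine (isCompact_Icc (a := -Real.pi) (b := Real.pi)).of_isClosed_subset ?_
        fun τ hτ => abs_le.1 hτ.2
      exact (isClosed_le continuous_const continuous_abs).inter
        (isClosed_le continuous_abs continuous_const)
    have hcont : Continuous fun q : ℝ × ℝ => ‖P.z i (q.1 + q.2) - P.z i q.1‖ := by
      have := P.continuous_z i
      fun_prop
    rcases S.eq_empty_or_nonempty with he | hne
    · refine ⟨1, one_pos, fun t τ h1 h2 => ?_⟩
      have : ((0 : ℝ), τ) ∈ S := ⟨⟨le_rfl, by positivity⟩, h1, h2⟩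
      rw [he] at this
      exact this.elim
    · obtain ⟨q, hq, hmin⟩ := hSc.exists_isMinOn hne hcont.continuousOn
      have hbC : 0 < b / (2 * C) := by positivity
      have hpos : 0 < ‖P.z i (q.1 + q.2) - P.z i q.1‖ :=
        norm_pos_iff.2 (sub_ne_zero.2 (z_ne (abs_pos.1 (hbC.trans_le hq.2.1)) (by
          have := hq.2.2; linarith)))
      refine ⟨‖P.z i (q.1 + q.2) - P.z i q.1‖ / Real.pi, by positivity, fun t τ h1 h2 => ?_⟩
      obtain ⟨y, hy, hyt⟩ := (show Function.Periodic (fun t => P.z i (t + τ) - P.z i t) (2 * Real.pi) from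
        fun t => by
          have h3 := P.z_periodic i (t + τ)
          have h4 := P.z_periodic i t
          simp only [add_right_comm t (2 * Real.pi) τ, h3, h4]).exists_mem_Ico₀ Real.two_pi_pos t
      rw [hyt]
      have h5 : ‖P.z i (q.1 + q.2) - P.z i q.1‖ ≤ ‖P.z i (y + τ) - P.z i y‖ :=
        isMinOn_iff.1 hmin (y, τ) ⟨Ico_subset_Icc_self hy, h1, h2⟩
      calc _ ≤ ‖P.z i (q.1 + q.2) - P.z i q.1‖ / Real.pi * Real.pi := by gcongr
        _ = ‖P.z i (q.1 + q.2) - P.z i q.1‖ := by field_simp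
        _ ≤ _ := h5
  choose m hm hmz using hfar
  refine ⟨(2 / b + ∑ i, (m i)⁻¹)⁻¹, by
    have : 0 ≤ ∑ i, (m i)⁻¹ := Finset.sum_nonneg fun i _ => (inv_pos.2 (hm i)).le
    positivity, fun i t τ hτ => ?_⟩
  have hs : (m i)⁻¹ ≤ ∑ i, (m i)⁻¹ := Finset.single_le_sum (f := fun i => (m i)⁻¹)
    (fun i _ => (inv_pos.2 (hm i)).le) (Finset.mem_univ i)
  have hi := inv_pos.2 (hm i)
  have hb2 : 0 < 2 / b := by positivity
  rcases le_total |τ| (b / (2 * C)) with h | h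
  · refine le_trans (mul_le_mul_of_nonneg_right ?_ (abs_nonneg _)) (hnear i t τ h)
    rw [inv_le_comm₀ (by linarith) (by positivity), inv_div]
    linarith
  · refine le_trans (mul_le_mul_of_nonneg_right ?_ (abs_nonneg _)) (hmz i t τ h hτ)
    rw [inv_le_comm₀ (by linarith) (hm i)]
    linarith

variable (P) in
theorem exists_dist_curves : ∃ d : ℝ, 0 < d ∧ ∀ i i', i ≠ i' → ∀ s t, d ≤ ‖P.z i s - P.z i' t‖ := by
  have h : ∀ q : Fin P.m × Fin P.m, ∃ d : ℝ, 0 < d ∧ (q.1 ≠ q.2 → ∀ s t, d ≤ ‖P.z q.1 s - P.z q.2 t‖) := by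
    rintro ⟨i, i'⟩
    by_cases hi : i = i'
    · exact ⟨1, one_pos, fun h => absurd hi h⟩
    have hcont : Continuous fun q : ℝ × ℝ => ‖P.z i q.1 - P.z i' q.2‖ := by
      have := P.continuous_z i
      have := P.continuous_z i'
      fun_prop
    have hpi := Real.two_pi_pos
    set S : Set (ℝ × ℝ) := Icc 0 (2 * Real.pi) ×ˢ Icc 0 (2 * Real.pi) with hS
    have hSc : IsCompact S := isCompact_Icc.prod isCompact_Icc
    obtain ⟨q, -, hmin⟩ := hSc.exists_isMinOn ⟨(0, 0), ⟨le_rfl, hpi.le⟩, ⟨le_rfl, hpi.le⟩⟩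
      hcont.continuousOn
    refine ⟨_, norm_pos_iff.2 (sub_ne_zero.2 fun h => hi (P.z_simple i i' q.1 q.2 h).1), fun _ s t => ?_⟩
    obtain ⟨y, hy, hys⟩ := (P.z_periodic i).exists_mem_Ico₀ hpi s
    obtain ⟨y', hy', hyt⟩ := (P.z_periodic i').exists_mem_Ico₀ hpi t
    have h1 : ‖P.z i q.1 - P.z i' q.2‖ ≤ ‖P.z i y - P.z i' y'‖ :=
      isMinOn_iff.1 hmin (y, y') ⟨Ico_subset_Icc_self hy, Ico_subset_Icc_self hy'⟩
    simpa only [hys, hyt] using h1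
  choose d hd hdz using h
  refine ⟨(1 + ∑ q, (d q)⁻¹)⁻¹, by
    have : 0 ≤ ∑ q, (d q)⁻¹ := Finset.sum_nonneg fun i _ => (inv_pos.2 (hd i)).le
    positivity, fun i i' hi s t => le_trans ?_ (hdz (i, i') hi s t)⟩
  have hs := Finset.single_le_sum (f := fun q => (d q)⁻¹)
    (fun i _ => (inv_pos.2 (hd i)).le) (Finset.mem_univ (i, i'))
  have hi := inv_pos.2 (hd (i, i'))
  rw [inv_le_comm₀ (by linarith) (hd _)]
  linarith

/-- Points close to the boundary from outside have normal coordinates. -/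
theorem eventually_exists_normal_coordinates (i₀ : Fin P.m) (t₀ : ℝ) {W : Set (ℝ × ℝ)}
    (hW : W ∈ 𝓝 t₀ ×ˢ 𝓝[>] (0 : ℝ)) :
    ∀ᶠ p in 𝓝[P.D₀ᶜ] (P.z i₀ t₀), ∃ q ∈ W, p = P.z i₀ q.1 + q.2 • P.normal i₀ q.1 := by
  obtain ⟨m, hm, hma⟩ := P.exists_chord_arc
  obtain ⟨d, hd, hdz⟩ := P.exists_dist_curves
  obtain ⟨A, hA, B, hB, hAB⟩ := mem_prod_iff.1 hW
  obtain ⟨ε, hε, hεA⟩ := Metric.mem_nhds_iff.1 hA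
  obtain ⟨ε', hε', hεB⟩ := mem_nhdsGT_iff_exists_Ioo_subset.1 hB
  have hr : 0 < min (min (d / 2) (m * ε / 2)) ε' := by
    have : 0 < ε' := hε'
    positivity
  filter_upwards [inter_mem_nhdsWithin _ (Metric.ball_mem_nhds _ hr)] with p hp
  have hpd : ‖p - P.z i₀ t₀‖ < min (min (d / 2) (m * ε / 2)) ε' := mem_ball_iff_norm.1 hp.2
  obtain ⟨q, hq, hmin⟩ := P.compact_D₀.exists_infDist_eq_dist P.nonempty_D₀ p
  have hmin' : ∀ y ∈ P.D₀, ‖p - q‖ ≤ ‖p - y‖ := fun y hy => by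
    rw [← dist_eq_norm, ← hmin, ← dist_eq_norm]
    exact Metric.infDist_le_dist_of_mem hy
  have hr0 : ‖p - q‖ ≤ ‖p - P.z i₀ t₀‖ := hmin' _ (frontier_subset (P.z_mem_frontier i₀ t₀))
  have hpq : 0 < ‖p - q‖ := norm_pos_iff.2 (sub_ne_zero.2 fun h => hp.1 (h ▸ hq))
  have hqz : ‖q - P.z i₀ t₀‖ < min (d) (m * ε) := by
    have h1 := norm_sub_le_norm_sub_add_norm_sub q p (P.z i₀ t₀)
    rw [norm_sub_rev q p] at h1
    have h2 := lt_min_iff.1 (lt_min_iff.1 hpd).1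
    exact lt_min (by linarith [h2.1]) (by linarith [h2.2])
  have hqf : q ∈ frontier P.D₀ := by
    rw [P.compact_D₀.isClosed.frontier_eq]
    refine ⟨hq, fun hi => ?_⟩
    have hl : Tendsto (fun s : ℝ => q + s • (p - q)) (𝓝[>] 0) (𝓝 q) := by
      have : Continuous fun s : ℝ => q + s • (p - q) := by fun_prop
      simpa using (this.tendsto 0).mono_left nhdsWithin_le_nhds
    obtain ⟨s, hs, hs0, hs1⟩ := ((hl.eventually (mem_interior_iff_mem_nhds.1 hi)).and
      (Ioo_mem_nhdsGT (zero_lt_one' ℝ))).exists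
    have h1 := hmin' _ hs
    rw [show p - (q + s • (p - q)) = (1 - s) • (p - q) by module, norm_smul, Real.norm_eq_abs,
      abs_of_pos (by linarith)] at h1
    nlinarith
  rw [P.frontier_D₀, mem_iUnion] at hqf
  obtain ⟨i, t', ht'⟩ := hqf
  obtain rfl : i = i₀ := by
    by_contra hne
    have := hdz i i₀ hne t' t₀
    rw [ht'] at this
    exact absurd (hqz.trans_le (min_le_left _ _)) (not_lt.2 this)
  obtain ⟨τ, hτ, hτt⟩ : ∃ τ, |τ| ≤ Real.pi ∧ P.z i (t₀ + τ) = q := by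
    obtain ⟨y, hy, hyt⟩ := (P.z_periodic i).exists_mem_Ico Real.two_pi_pos t' (t₀ - Real.pi)
    refine ⟨y - t₀, abs_le.2 ⟨by linarith [hy.1], by linarith [hy.2]⟩, ?_⟩
    rw [add_sub_cancel, ← hyt, ht']
  have hτε : |τ| < ε := by
    have h1 := hma i t₀ τ hτ
    rw [hτt] at h1
    exact lt_of_mul_lt_mul_left (h1.trans_lt (hqz.trans_le (min_le_right _ _))) hm.le
  -- orthogonality of `p - q` to the tangent
  have horth : (p - q) 0 * deriv (P.z i) (t₀ + τ) 0 + (p - q) 1 * deriv (P.z i) (t₀ + τ) 1 = 0 := by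
    have h0 := P.hasDerivAt_z i (t₀ + τ)
    have h1 : ∀ l : Fin 2, HasDerivAt (fun t => (p - P.z i t) l) (-(deriv (P.z i) (t₀ + τ) l)) (t₀ + τ) :=
      fun l => by
        have := ((EuclideanSpace.proj l : Plane →L[ℝ] ℝ).hasFDerivAt.comp_hasDerivAt (t₀ + τ) h0)
        exact (this.const_sub (p l))
    have h2 : HasDerivAt (fun t => ‖p - P.z i t‖ ^ 2)
        (2 * ((p - P.z i (t₀ + τ)) 0 * -(deriv (P.z i) (t₀ + τ) 0) +
          (p - P.z i (t₀ + τ)) 1 * -(deriv (P.z i) (t₀ + τ) 1))) (t₀ + τ) := by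
      simp_rw [plane_norm_sq]
      refine (((h1 0).pow 2).add ((h1 1).pow 2)).congr_deriv ?_
      simp; ring
    have h3 : IsLocalMin (fun t => ‖p - P.z i t‖ ^ 2) (t₀ + τ) := Eventually.of_forall fun t => by
      have := hmin' _ (frontier_subset (P.z_mem_frontier i t))
      rw [← hτt] at this
      exact pow_le_pow_left₀ (norm_nonneg _) this 2
    have h4 := h3.hasDerivAt_eq_zero h2
    rw [hτt] at h4
    linarith
  set v := deriv (P.z i) (t₀ + τ) with hv
  have hvpos : 0 < ‖v‖ := P.norm_deriv_z_pos i (t₀ + τ)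
  have hv2 := plane_norm_sq v
  set s : ℝ := wedge (p - q) v / ‖v‖ with hs
  have hpqs : p - q = s • P.normal i (t₀ + τ) := by
    have hvv : v 0 ^ 2 + v 1 ^ 2 ≠ 0 := by rw [← hv2]; positivity
    rw [normal, ← hv, smul_smul, hs]
    have e : wedge (p - q) v / ‖v‖ * ‖v‖⁻¹ = wedge (p - q) v / (v 0 ^ 2 + v 1 ^ 2) := by
      rw [← hv2]; field_simp
    have key : ∀ w : Plane, w 0 * v 0 + w 1 * v 1 = 0 →
        w = (wedge w v / (v 0 ^ 2 + v 1 ^ 2)) • !₂[v 1, -(v 0)] := fun w hw => by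
      ext l
      fin_cases l <;> simp [wedge] <;> field_simp
      · linear_combination (v 0) * hw
      · linear_combination (v 1) * hw
    rw [e]
    exact key _ horth
  have hsn : |s| = ‖p - q‖ := by
    rw [hpqs, norm_smul, P.norm_normal, mul_one, Real.norm_eq_abs]
  have hs0 : 0 < s := by
    by_contra hneg
    have hsneg : s < 0 := lt_of_le_of_ne (not_lt.1 hneg) fun h0 => by
      rw [h0, abs_zero] at hsn; linarith
    have hlim : ∀ᶠ ε in 𝓝[>] (0 : ℝ), ε * ‖v‖ < -s := by
      have hc : Continuous fun ε : ℝ => ε * ‖v‖ := by fun_prop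
      refine nhdsWithin_le_nhds (hc.continuousAt.eventually (gt_mem_nhds ?_))
      simpa using hsneg
    obtain ⟨e, ⟨-, he⟩, he1, he0⟩ := ((P.outward i (t₀ + τ)).and
      (hlim.and self_mem_nhdsWithin)).exists
    have he0' : 0 < e := he0
    have h1 := hmin' _ (interior_subset he)
    rw [hτt, ← hv] at h1
    have h2 : p - (q - e • !₂[v 1, -(v 0)]) = (s + e * ‖v‖) • P.normal i (t₀ + τ) := by
      rw [add_smul, ← hpqs, normal, ← hv, smul_smul, mul_assoc, mul_inv_cancel₀ hvpos.ne', mul_one]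
      abel
    rw [h2, norm_smul, P.norm_normal, mul_one, Real.norm_eq_abs, ← hsn, abs_of_neg hsneg,
      abs_of_neg (by linarith)] at h1
    nlinarith
  refine ⟨(t₀ + τ, s), hAB ⟨hεA (by simpa [Metric.mem_ball, dist_eq_norm] using hτε), hεB ⟨hs0, ?_⟩⟩, ?_⟩
  · rw [← abs_of_pos hs0, hsn]
    exact hr0.trans_lt (hpd.trans_le (min_le_right _ _))
  · simp only
    rw [hτt, ← hpqs]
    abel

theorem eventually_exists_bdryPoint (i₀ : Fin P.m) (t₀ : ℝ) {A : Set ℝ} (hA : A ∈ 𝓝 t₀) :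
    ∀ᶠ r in 𝓝 (P.bdryPoint i₀ t₀), ∃ t ∈ A, r = P.bdryPoint i₀ t := by
  obtain ⟨m, hm, hma⟩ := P.exists_chord_arc
  obtain ⟨d, hd, hdz⟩ := P.exists_dist_curves
  obtain ⟨ε, hε, hεA⟩ := Metric.mem_nhds_iff.1 hA
  filter_upwards [Metric.ball_mem_nhds (P.bdryPoint i₀ t₀) (show 0 < min d (m * ε) by positivity)]
    with r hr
  have hqz : ‖r.1 - P.z i₀ t₀‖ < min d (m * ε) := by
    rw [← dist_eq_norm]; exact hr
  obtain ⟨i, t', ht'⟩ := mem_iUnion.1 (P.frontier_D₀.subset r.2)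
  obtain rfl : i = i₀ := by
    by_contra hne
    have := hdz i i₀ hne t' t₀
    rw [ht'] at this
    exact absurd (hqz.trans_le (min_le_left _ _)) (not_lt.2 this)
  obtain ⟨y, hy, hyt⟩ := (P.z_periodic i).exists_mem_Ico Real.two_pi_pos t' (t₀ - Real.pi)
  refine ⟨y, hεA ?_, Subtype.ext (ht'.symm.trans hyt)⟩
  have h1 := hma i t₀ (y - t₀) (abs_le.2 ⟨by linarith [hy.1], by linarith [hy.2]⟩)
  rw [add_sub_cancel, ← hyt, ht'] at h1
  rw [Metric.mem_ball, Real.dist_eq]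
  exact lt_of_mul_lt_mul_left (h1.trans_lt (hqz.trans_le (min_le_right _ _))) hm.le

end ScatteringSetup

theorem exists_hankel_singular_bound {ka kb : ℝ} (hka : 0 < ka) : ∃ C : ℝ, 0 < C ∧
    ∀ k ∈ Icc ka kb, ∀ ρ : ℝ, 0 < ρ →
      ‖(k : ℂ) * hankelD 1 (k * ρ) - 2 * Complex.I / (Real.pi * ρ)‖ ≤ C * (ρ ^ (-(1 / 2) : ℝ) + 1) ∧
      ‖hankelD 0 (k * ρ)‖ ≤ C * ρ ^ (-(1 / 2) : ℝ) := by
  obtain ⟨C0, hC0, h0⟩ := norm_hankelD_le 0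
  obtain ⟨C1, hC1, h1⟩ := norm_hankelD_one_sub_le
  refine ⟨|kb| * C1 * ka ^ (-(1 / 2) : ℝ) + 2 * C0 * ka ^ (-(1 / 2) : ℝ) + |kb|, by positivity,
    fun k hk ρ hρ => ?_⟩
  have hk0 : 0 < k := hka.trans_le hk.1
  have hkb : k ≤ |kb| := hk.2.trans (le_abs_self _)
  have hre : ((k : ℂ) * ρ).re = k * ρ := by simp
  have him : ((k : ℂ) * ρ).im = 0 := by simp
  have hz : 0 < ((k : ℂ) * ρ).re := by rw [hre]; positivity
  have hpow : (k * ρ) ^ (-(1 / 2) : ℝ) ≤ ka ^ (-(1 / 2) : ℝ) * ρ ^ (-(1 / 2) : ℝ) := by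
    rw [Real.mul_rpow hk0.le hρ.le]
    exact mul_le_mul_of_nonneg_right (Real.rpow_le_rpow_of_nonpos hka hk.1 (by norm_num))
      (by positivity)
  have hρp : 0 ≤ ρ ^ (-(1 / 2) : ℝ) := by positivity
  constructor
  · have h2 := h1 _ hz
    rw [hre, him, neg_zero, Real.exp_zero, mul_one] at h2
    have h3 : (k : ℂ) * hankelD 1 (k * ρ) - 2 * Complex.I / (Real.pi * ρ) =
        k * (hankelD 1 (k * ρ) - 2 * Complex.I / Real.pi * Complex.exp (Complex.I * (k * ρ)) / (k * ρ)) +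
        2 * Complex.I / (Real.pi * ρ) * (Complex.exp (Complex.I * (k * ρ : ℝ)) - 1) := by
      have : (k : ℂ) ≠ 0 := by exact_mod_cast hk0.ne'
      have : (ρ : ℂ) ≠ 0 := by exact_mod_cast hρ.ne'
      have : (Real.pi : ℂ) ≠ 0 := by exact_mod_cast Real.pi_ne_zero
      push_cast
      field_simp
      ring
    have h4 : ‖2 * Complex.I / (Real.pi * ρ) * (Complex.exp (Complex.I * (k * ρ : ℝ)) - 1)‖ ≤ |kb| := by
      rw [norm_mul]
      have h5 := Real.norm_exp_I_mul_ofReal_sub_one_le (x := k * ρ)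
      have h6 : ‖2 * Complex.I / (Real.pi * ρ)‖ = 2 / (Real.pi * ρ) := by
        simp [abs_of_pos Real.pi_pos, abs_of_pos hρ]
      rw [h6]
      calc _ ≤ 2 / (Real.pi * ρ) * ‖k * ρ‖ := by gcongr
        _ = 2 / Real.pi * k := by
          rw [Real.norm_of_nonneg (by positivity)]
          have := Real.pi_ne_zero
          field_simp
        _ ≤ 1 * k := by
          gcongr
          rw [div_le_one Real.pi_pos]
          exact Real.two_le_pi
        _ ≤ _ := by rw [one_mul]; exact hkb
    rw [h3]
    calc _ ≤ k * (C1 * (k * ρ) ^ (-(1 / 2) : ℝ)) + |kb| := by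
          refine (norm_add_le _ _).trans (add_le_add ?_ h4)
          rw [norm_mul, Complex.norm_real, Real.norm_of_nonneg hk0.le]
          gcongr
      _ ≤ |kb| * (C1 * (ka ^ (-(1 / 2) : ℝ) * ρ ^ (-(1 / 2) : ℝ))) + |kb| := by gcongr
      _ ≤ _ := by
          have : 0 ≤ 2 * C0 * ka ^ (-(1 / 2) : ℝ) := by positivity
          have : 0 ≤ |kb| * C1 * ka ^ (-(1 / 2) : ℝ) := by positivity
          have : 0 ≤ |kb| := abs_nonneg _
          nlinarith
  · have h2 := h0 _ hz
    rw [hre, him, neg_zero, Real.exp_zero, mul_one, Nat.cast_zero, zero_add] at h2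
    calc _ ≤ C0 * ((k * ρ) ^ (-(1 / 2) : ℝ) + (k * ρ) ^ (-(1 / 2) : ℝ)) := h2
      _ ≤ C0 * (ka ^ (-(1 / 2) : ℝ) * ρ ^ (-(1 / 2) : ℝ) + ka ^ (-(1 / 2) : ℝ) * ρ ^ (-(1 / 2) : ℝ)) := by
          gcongr
      _ = 2 * C0 * ka ^ (-(1 / 2) : ℝ) * ρ ^ (-(1 / 2) : ℝ) := by ring
      _ ≤ _ := by
          gcongr
          have : 0 ≤ |kb| * C1 * ka ^ (-(1 / 2) : ℝ) := by positivity
          linarith [abs_nonneg kb]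

namespace ScatteringSetup

variable {P : ScatteringSetup}

/-! ### The kernel of the combined layer potential -/

variable (P) in
/-- The kernel of the combined layer potential with respect to the parameter. -/
noncomputable def greenKernel (k : ℝ) (p : Plane) : Fin P.m → ℝ → ℂ :=
  P.combinedKernel fun s => P.greenSum fullWeight k (p - s)

theorem greenKernel_eq {k : ℝ} (hk : 0 < k) {p : Plane} {i : Fin P.m} {t : ℝ}
    (hx : p - P.z i t ∈ P.regularPoints fullWeight) :
    P.greenKernel k p i t = (-(P.normal i t 0 * fderiv ℝ (P.greenSum fullWeight k) (p - P.z i t)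
        (EuclideanSpace.single 0 1) + P.normal i t 1 * fderiv ℝ (P.greenSum fullWeight k) (p - P.z i t)
        (EuclideanSpace.single 1 1)) - Complex.I * P.γ * P.greenSum fullWeight k (p - P.z i t)) *
      ‖deriv (P.z i) t‖ := by
  rw [greenKernel, combinedKernel, fderiv_comp_const_sub
    ((contDiffAt_greenSum hk hx finite_fullWeight 1).differentiableAt (by simp)),
    fderiv_apply_eq_coord]

theorem periodic_greenKernel (k : ℝ) (p : Plane) (i : Fin P.m) :
    Function.Periodic (P.greenKernel k p i) (2 * Real.pi) := fun t => by
  rw [greenKernel, combinedKernel, combinedKernel, P.z_periodic i t, periodic_normal i t,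
    periodic_deriv_z i t]

theorem continuousAt_greenKernel {k : ℝ} (hk : 0 < k) {p : Plane} {i : Fin P.m} {t : ℝ}
    (hx : p - P.z i t ∈ P.regularPoints fullWeight) :
    ContinuousAt (fun q : ℝ × Plane × ℝ => P.greenKernel q.1 q.2.1 i q.2.2) (k, p, t) := by
  have hz := P.continuous_z i
  have hx' : Continuous fun q : ℝ × Plane × ℝ => (q.1, q.2.1 - P.z i q.2.2) := by fun_prop
  have hn : ∀ l : Fin 2, Continuous fun q : ℝ × Plane × ℝ => ((P.normal i q.2.2 l : ℝ) : ℂ) := fun l => by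
    have h1 : Continuous fun t => P.normal i t l :=
      (EuclideanSpace.proj (𝕜 := ℝ) l).continuous.comp (P.continuous_normal i)
    exact Complex.continuous_ofReal.comp (h1.comp (continuous_snd.comp continuous_snd))
  have hd : Continuous fun q : ℝ × Plane × ℝ => ((‖deriv (P.z i) q.2.2‖ : ℝ) : ℂ) :=
    Complex.continuous_ofReal.comp ((P.continuous_deriv_z i).norm.comp (by fun_prop))
  have hf : ∀ v, ContinuousAt (fun q : ℝ × Plane × ℝ =>
      fderiv ℝ (P.greenSum fullWeight q.1) (q.2.1 - P.z i q.2.2) v) (k, p, t) := fun v =>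
    ContinuousAt.comp (g := fun w : ℝ × Plane => fderiv ℝ (P.greenSum fullWeight w.1) w.2 v)
      (f := fun q : ℝ × Plane × ℝ => (q.1, q.2.1 - P.z i q.2.2)) (x := (k, p, t))
      (continuousAt_fderiv_greenSum hk hx finite_fullWeight v) hx'.continuousAt
  have hg : ContinuousAt (fun q : ℝ × Plane × ℝ =>
      P.greenSum fullWeight q.1 (q.2.1 - P.z i q.2.2)) (k, p, t) :=
    ContinuousAt.comp (g := fun w : ℝ × Plane => P.greenSum fullWeight w.1 w.2)
      (f := fun q : ℝ × Plane × ℝ => (q.1, q.2.1 - P.z i q.2.2)) (x := (k, p, t))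
      (continuousAt_greenSum hk hx finite_fullWeight) hx'.continuousAt
  have h1 := (((((hn 0).continuousAt.mul (hf (EuclideanSpace.single 0 1))).add
    ((hn 1).continuousAt.mul (hf (EuclideanSpace.single 1 1)))).neg.sub
    ((continuousAt_const (y := Complex.I * P.γ)).mul hg)).mul hd.continuousAt)
  refine h1.congr ?_
  have e1 : ∀ᶠ q : ℝ × Plane × ℝ in 𝓝 (k, p, t), 0 < q.1 :=
    continuous_fst.continuousAt.eventually (lt_mem_nhds hk)
  have e2 : ∀ᶠ q : ℝ × Plane × ℝ in 𝓝 (k, p, t), q.2.1 - P.z i q.2.2 ∈ P.regularPoints fullWeight :=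
    hx'.snd.continuousAt.eventually_mem ((isOpen_regularPoints _).mem_nhds hx)
  filter_upwards [e1, e2] with q hq1 hq2
  exact (greenKernel_eq hq1 hq2).symm

theorem sub_mem_regularPoints_reg {r s : Plane} (hr : r ∈ frontier P.D₀) (hs : s ∈ frontier P.D₀) :
    r - s ∈ P.regularPoints regWeight := by
  intro n l hl hw
  rcases eq_or_ne n 0 with rfl | hn
  · have hl0 : l ≠ 0 := fun h => hw (if_pos ⟨rfl, h⟩)
    have h1 := (abs_lt.1 (P.h_large r hr s hs)).1
    have h2 : (1 : ℝ) ≤ l := by exact_mod_cast Nat.one_le_iff_ne_zero.2 hl0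
    have h3 : 0 < (r - s) 1 + l * P.h := by
      have := P.h_pos
      simp only [PiLp.sub_apply]
      nlinarith
    positivity
  · by_contra h
    have h0 : ((r - s) 0 + n * P.L) ^ 2 + ((r - s) 1 + l * P.h) ^ 2 = 0 :=
      le_antisymm (not_lt.1 h) (by positivity)
    have h1 : (r - s) 0 + n * P.L = 0 := by
      nlinarith [sq_nonneg ((r - s) 0 + n * P.L), sq_nonneg ((r - s) 1 + l * P.h)]
    have h2 : (r - s) 1 + l * P.h = 0 := by
      rw [h1] at h0
      simpa using h0
    have hlz : (l : ℝ) * P.h = 0 := by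
      have h4 := (abs_lt.1 (P.h_large r hr s hs)).1
      simp only [PiLp.sub_apply] at h2
      rcases l with _ | l
      · simp
      · exfalso
        have := P.h_pos
        have : 0 ≤ (l : ℝ) * P.h := by positivity
        push_cast at h2
        linarith
    refine P.disjoint_translates n hn r (frontier_subset hr) ?_
    have : r + !₂[n * P.L, 0] = s := by
      ext i
      fin_cases i
      · simp at h1 ⊢; linarith
      · simp [hlz] at h2 ⊢; linarith
    rw [this]
    exact frontier_subset hs

theorem mem_regularPoints_full_of_reg {x : Plane} (hx : x ∈ P.regularPoints regWeight) (h0 : x ≠ 0) :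
    x ∈ P.regularPoints fullWeight := by
  intro n l hl _
  by_cases h : n = 0 ∧ l = 0
  · have : 0 < ‖x‖ ^ 2 := by positivity
    rw [plane_norm_sq] at this
    simpa [h.1, h.2] using this
  · exact hx n l hl (by simp [regWeight, h])

theorem fderiv_hankelAt_zero {k : ℝ} (hk : 0 < k) {x : Plane} (hx : x ≠ 0) (v : Plane) :
    fderiv ℝ (hankelAt k 0 0) x v =
      k * hankelD 1 (k * ‖x‖) * (((x 0 * v 0 + x 1 * v 1) / ‖x‖ : ℝ) : ℂ) := by
  have hn : Real.sqrt (x 0 ^ 2 + x 1 ^ 2) = ‖x‖ := by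
    rw [← plane_norm_sq, Real.sqrt_sq (norm_nonneg _)]
  have h0 : 0 < x 0 ^ 2 + x 1 ^ 2 := by rw [← plane_norm_sq]; positivity
  rw [fderiv_hankelAt_apply hk (by simpa using h0), hankelGrad, hankelGrad]
  simp only [add_zero]
  rw [add_comm (x 1 ^ 2), hn]
  push_cast
  ring

theorem greenKernel_sub_eq {k : ℝ} (hk : 0 < k) {p : Plane} {i : Fin P.m} {t : ℝ}
    (hx : p - P.z i t ∈ P.regularPoints fullWeight) (hx0 : p - P.z i t ≠ 0) :
    P.greenKernel k p i t -
        ((1 / (2 * Real.pi) * wedge (p - P.z i t) (deriv (P.z i) t) / ‖p - P.z i t‖ ^ 2 : ℝ) : ℂ) =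
      -(Complex.I / 4) * (k * hankelD 1 (k * ‖p - P.z i t‖) - 2 * Complex.I / (Real.pi * ‖p - P.z i t‖)) *
        ((wedge (p - P.z i t) (deriv (P.z i) t) / ‖p - P.z i t‖ : ℝ) : ℂ) +
      (-(Complex.I * P.γ) * (Complex.I / 4 * hankelD 0 (k * ‖p - P.z i t‖)) * ‖deriv (P.z i) t‖ +
      (-fderiv ℝ (P.greenSum regWeight k) (p - P.z i t) (P.normal i t) -
        Complex.I * P.γ * P.greenSum regWeight k (p - P.z i t)) * ‖deriv (P.z i) t‖) := by
  set x := p - P.z i t with hxdef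
  have hxn : 0 < ‖x‖ := norm_pos_iff.2 hx0
  have hv := P.norm_deriv_z_pos i t
  have h0 : 0 < (x 0 + 0) ^ 2 + (x 1 + 0) ^ 2 := by
    rw [add_zero, add_zero, ← plane_norm_sq]; positivity
  have hval : hankelAt k 0 0 x = hankelD 0 (k * ‖x‖) := by
    rw [hankelAt, add_zero, add_zero, ← plane_norm_sq, Real.sqrt_sq (norm_nonneg _)]
  have hreg := regularPoints_full_subset hx regWeight
  have hev : P.greenSum fullWeight k =ᶠ[𝓝 x] fun q => Complex.I / 4 * hankelAt k 0 0 q +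
      P.greenSum regWeight k q :=
    eventually_of_mem ((isOpen_regularPoints _).mem_nhds hx) fun q hq => greenSum_full_eq hk hq
  have hd1 : DifferentiableAt ℝ (hankelAt k 0 0) x := (hasFDerivAt_hankelAt hk h0).differentiableAt
  have hd2 : DifferentiableAt ℝ (P.greenSum regWeight k) x :=
    (contDiffAt_greenSum hk hreg finite_regWeight 1).differentiableAt (by simp)
  rw [greenKernel, combinedKernel, fderiv_comp_const_sub
    ((contDiffAt_greenSum hk hx finite_fullWeight 1).differentiableAt (by simp)), ← hxdef,
    hev.fderiv_eq, hev.self_of_nhds, fderiv_fun_add (hd1.const_mul _) hd2, fderiv_const_mul hd1]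
  simp only [add_apply, smul_apply, smul_eq_mul]
  rw [fderiv_hankelAt_zero hk hx0, hval]
  have hw : x 0 * P.normal i t 0 + x 1 * P.normal i t 1 =
      ‖deriv (P.z i) t‖⁻¹ * wedge x (deriv (P.z i) t) := by
    simp [normal, wedge]; ring
  rw [hw]
  have e1 : (‖x‖ : ℂ) ≠ 0 := by exact_mod_cast hxn.ne'
  have e2 : (‖deriv (P.z i) t‖ : ℂ) ≠ 0 := by exact_mod_cast hv.ne'
  have e3 : (Real.pi : ℂ) ≠ 0 := by exact_mod_cast Real.pi_ne_zero
  push_cast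
  field_simp
  linear_combination (-4 * (wedge x (deriv (P.z i) t) : ℂ)) * Complex.I_sq

theorem exists_greenKernel_bound {ka kb : ℝ} (hka : 0 < ka) : ∃ δ C : ℝ, 0 < δ ∧ 0 < C ∧
    ∀ k ∈ Icc ka kb, ∀ r ∈ frontier P.D₀, ∀ p, ‖p - r‖ ≤ δ → ∀ i t, p - P.z i t ≠ 0 →
      p - P.z i t ∈ P.regularPoints fullWeight ∧
      ‖P.greenKernel k p i t - ((1 / (2 * Real.pi) * wedge (p - P.z i t) (deriv (P.z i) t) /
        ‖p - P.z i t‖ ^ 2 : ℝ) : ℂ)‖ ≤ C * ‖p - P.z i t‖ ^ (-(1 / 2) : ℝ) := by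
  obtain ⟨C1, hC1, hH⟩ := exists_hankel_singular_bound (kb := kb) hka
  obtain ⟨B, hB, hBz⟩ := P.exists_norm_deriv_z_le
  set D : Set Plane := (fun q : Plane × Plane => q.1 - q.2) '' (frontier P.D₀ ×ˢ frontier P.D₀) with hD
  have hDc : IsCompact D :=
    (P.isCompact_frontier.prod P.isCompact_frontier).image (by fun_prop)
  have hDreg : D ⊆ P.regularPoints regWeight := by
    rintro _ ⟨q, hq, rfl⟩
    exact sub_mem_regularPoints_reg hq.1 hq.2
  obtain ⟨δ, hδ, hδD⟩ := hDc.exists_cthickening_subset_open (isOpen_regularPoints _) hDreg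
  have hTc : IsCompact (Icc ka kb ×ˢ Metric.cthickening δ D) := isCompact_Icc.prod hDc.cthickening
  have hcont : ∀ q ∈ Icc ka kb ×ˢ Metric.cthickening δ D, 0 < q.1 ∧ q.2 ∈ P.regularPoints regWeight :=
    fun q hq => ⟨hka.trans_le hq.1.1, hδD hq.2⟩
  obtain ⟨M, hM⟩ := hTc.exists_bound_of_continuousOn (f := fun q : ℝ × Plane => P.greenSum regWeight q.1 q.2)
    fun q hq => (continuousAt_greenSum (hcont q hq).1 (hcont q hq).2 finite_regWeight).continuousWithinAt
  have hMf := fun v => hTc.exists_bound_of_continuousOn (f := fun q : ℝ × Plane =>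
    fderiv ℝ (P.greenSum regWeight q.1) q.2 v) fun q hq =>
      (continuousAt_fderiv_greenSum (hcont q hq).1 (hcont q hq).2 finite_regWeight v).continuousWithinAt
  obtain ⟨M0, hM0⟩ := hMf (EuclideanSpace.single 0 1)
  obtain ⟨M1, hM1⟩ := hMf (EuclideanSpace.single 1 1)
  obtain ⟨R, hR⟩ := (hDc.cthickening (r := δ)).isBounded.exists_norm_le
  set R' : ℝ := |R| + 1 with hR'
  set M' : ℝ := |M0| + |M1| + P.γ * |M| with hM'
  have hγ := P.γ_nonneg
  have hM'0 : 0 ≤ M' := by positivity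
  refine ⟨δ, 1 / 4 * (C1 * (1 + R' ^ (1 / 2 : ℝ))) * B + (P.γ * (1 / 4 * C1) * B +
    M' * B * R' ^ (1 / 2 : ℝ)), hδ, by positivity, fun k hk r hr p hp i t hx0 => ?_⟩
  have hz := P.z_mem_frontier i t
  set x := p - P.z i t with hx
  have hxn : 0 < ‖x‖ := norm_pos_iff.2 hx0
  have hxT : x ∈ Metric.cthickening δ D := by
    refine Metric.mem_cthickening_of_dist_le _ (r - P.z i t) _ _ ⟨(r, P.z i t), ⟨hr, hz⟩, rfl⟩ ?_
    rw [hx, dist_sub_right, dist_eq_norm]; exact hp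
  have hk0 := hka.trans_le hk.1
  have hfull := mem_regularPoints_full_of_reg (hδD hxT) hx0
  refine ⟨hfull, ?_⟩
  rw [greenKernel_sub_eq hk0 hfull hx0, ← hx]
  obtain ⟨b1, b2⟩ := hH k hk ‖x‖ hxn
  have hE : 0 < ‖x‖ ^ (-(1 / 2) : ℝ) := by positivity
  have hone : 1 ≤ R' ^ (1 / 2 : ℝ) * ‖x‖ ^ (-(1 / 2) : ℝ) := by
    rw [Real.rpow_neg hxn.le, ← div_eq_mul_inv, one_le_div (by positivity)]
    exact Real.rpow_le_rpow hxn.le ((hR x hxT).trans (by rw [hR']; linarith [le_abs_self R])) (by norm_num)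
  have hv := hBz i t
  have hvn := norm_nonneg (deriv (P.z i) t)
  have n1 : ∀ l, |P.normal i t l| ≤ 1 := fun l =>
    (abs_apply_le_norm _ _).trans (P.norm_normal i t).le
  refine (norm_add_le _ _).trans ?_
  rw [add_mul]
  refine add_le_add ?_ ((norm_add_le _ _).trans ?_)
  · rw [norm_mul, norm_mul, norm_neg]
    have w1 : ‖((wedge x (deriv (P.z i) t) / ‖x‖ : ℝ) : ℂ)‖ ≤ B := by
      rw [Complex.norm_real, Real.norm_eq_abs, abs_div, abs_of_pos hxn, div_le_iff₀ hxn]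
      refine (abs_wedge_le _ _).trans ?_
      rw [mul_comm]; gcongr
    have q1 : ‖Complex.I / 4‖ = 1 / 4 := by simp
    rw [q1]
    calc _ ≤ 1 / 4 * (C1 * (‖x‖ ^ (-(1 / 2) : ℝ) + 1)) * B := by gcongr
      _ ≤ 1 / 4 * (C1 * (‖x‖ ^ (-(1 / 2) : ℝ) + R' ^ (1 / 2 : ℝ) * ‖x‖ ^ (-(1 / 2) : ℝ))) * B := by gcongr
      _ = _ := by ring
  · rw [add_mul]
    refine add_le_add ?_ ?_
    · simp only [norm_mul, norm_neg, norm_div, Complex.norm_I, one_mul, Complex.norm_real, norm_norm,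
        Real.norm_of_nonneg hγ, Complex.norm_ofNat]
      calc _ ≤ P.γ * (1 / 4 * (C1 * ‖x‖ ^ (-(1 / 2) : ℝ))) * B := by gcongr
        _ = _ := by ring
    · rw [norm_mul, Complex.norm_real, norm_norm]
      have hq : (k, x) ∈ Icc ka kb ×ˢ Metric.cthickening δ D := ⟨hk, hxT⟩
      have g1 : ‖-fderiv ℝ (P.greenSum regWeight k) x (P.normal i t) -
          Complex.I * P.γ * P.greenSum regWeight k x‖ ≤ M' := by
        refine (norm_sub_le _ _).trans (add_le_add ?_ ?_)
        · rw [norm_neg, fderiv_apply_eq_coord]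
          refine (norm_add_le _ _).trans (add_le_add ?_ ?_) <;>
            rw [norm_mul, Complex.norm_real, Real.norm_eq_abs]
          · exact (mul_le_of_le_one_left (norm_nonneg _) (n1 0)).trans ((hM0 _ hq).trans (le_abs_self _))
          · exact (mul_le_of_le_one_left (norm_nonneg _) (n1 1)).trans ((hM1 _ hq).trans (le_abs_self _))
        · rw [norm_mul, norm_mul, Complex.norm_I, one_mul, Complex.norm_real, Real.norm_of_nonneg hγ]
          exact mul_le_mul_of_nonneg_left ((hM _ hq).trans (le_abs_self _)) hγ
      calc _ ≤ M' * B := by gcongr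
        _ ≤ M' * B * (R' ^ (1 / 2 : ℝ) * ‖x‖ ^ (-(1 / 2) : ℝ)) :=
            le_mul_of_one_le_right (by positivity) hone
        _ = _ := by ring

end ScatteringSetup

theorem wedge_add_smul (x y v : Plane) (s : ℝ) : wedge (x + s • y) v = wedge x v + s * wedge y v := by
  simp [wedge]; ring

@[fun_prop]
theorem Continuous.wedge {X : Type*} [TopologicalSpace X] {f g : X → Plane} (hf : Continuous f)
    (hg : Continuous g) : Continuous fun x => wedge (f x) (g x) := by
  unfold _root_.wedge; fun_prop

theorem intervalIntegral_shift {E : Type*} [NormedAddCommGroup E] [NormedSpace ℝ E] {f : ℝ → E} (hf : Function.Periodic f (2 * Real.pi)) (t : ℝ) :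
    ∫ τ in (-Real.pi)..Real.pi, f (t + τ) = ∫ τ in (0 : ℝ)..(2 * Real.pi), f τ := by
  rw [intervalIntegral.integral_comp_add_left]
  have h := hf.intervalIntegral_add_eq (t + -Real.pi) 0
  rw [zero_add] at h
  rw [← h]
  congr 1; ring

theorem aestronglyMeasurable_of_continuousAt {E : Type*} [NormedAddCommGroup E] {f : ℝ → E}
    (h : ∀ τ, τ ≠ 0 → |τ| ≤ Real.pi → ContinuousAt f τ) :
    AEStronglyMeasurable f (volume.restrict (uIoc (-Real.pi) Real.pi)) := by
  have hpi := Real.pi_pos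
  have hs : MeasurableSet (Ioc (-Real.pi) Real.pi \ {0}) := measurableSet_Ioc.diff (measurableSet_singleton 0)
  have h1 : ContinuousOn f (Ioc (-Real.pi) Real.pi \ {0}) := fun τ hτ =>
    (h τ hτ.2 (abs_le.2 ⟨hτ.1.1.le, hτ.1.2⟩)).continuousWithinAt
  have h2 := h1.aestronglyMeasurable (μ := volume) hs
  rw [uIoc_of_le (by linarith)]
  rwa [Measure.restrict_congr_set (sdiff_null_ae_eq_self (measure_singleton (μ := volume) (0 : ℝ)))] at h2

theorem intervalIntegrable_abs_rpow (C : ℝ) :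
    IntervalIntegrable (fun τ : ℝ => C * |τ| ^ (-(1 / 2) : ℝ)) volume (-Real.pi) Real.pi := by
  have hp : IntervalIntegrable (fun τ : ℝ => |τ| ^ (-(1 / 2) : ℝ)) volume 0 Real.pi := by
    refine (intervalIntegral.intervalIntegrable_rpow' (r := -(1 / 2)) (by norm_num)).congr ?_
    intro τ hτ
    rw [uIoc_of_le Real.pi_pos.le] at hτ
    simp only [abs_of_pos hτ.1]
  have hn : IntervalIntegrable (fun τ : ℝ => |τ| ^ (-(1 / 2) : ℝ)) volume (-Real.pi) 0 := by
    have := (IntervalIntegrable.iff_comp_neg (by simp)).1 hp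
    simpa using this.symm
  exact (hn.trans hp).const_mul C

theorem ae_ne_zero (s : Set ℝ) : ∀ᵐ τ : ℝ, τ ∈ s → τ ≠ 0 := by
  have : ∀ᵐ τ : ℝ, τ ≠ 0 := Measure.ae_ne volume 0
  filter_upwards [this] with τ h _ using h

theorem abs_le_pi_of_mem {τ : ℝ} (h : τ ∈ uIoc (-Real.pi) Real.pi) : |τ| ≤ Real.pi := by
  rw [uIoc_of_le (by linarith [Real.pi_pos])] at h
  exact abs_le.2 ⟨h.1.le, h.2⟩

namespace ScatteringSetup

variable {P : ScatteringSetup}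

/-! ### Boundary limits of the layer potential -/

variable (P) in
/-- The point at signed distance `s` from the boundary point with parameter `t`. -/
noncomputable def framePoint (i₀ : Fin P.m) (t s : ℝ) : Plane := P.z i₀ t + s • P.normal i₀ t

variable (P) in
/-- The part of the kernel that produces the jump of the double layer potential. -/
noncomputable def jumpKernel (i₀ : Fin P.m) (t s : ℝ) (i : Fin P.m) (τ : ℝ) : ℂ :=
  if i = i₀ then ((1 / (2 * Real.pi) * (s * wedge (P.normal i₀ t) (deriv (P.z i) (t + τ))) /
    ‖P.framePoint i₀ t s - P.z i (t + τ)‖ ^ 2 : ℝ) : ℂ) else 0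

variable (P) in
/-- The kernel without its jump part, in coordinates moving along the boundary. -/
noncomputable def frameKernel (k : ℝ) (i₀ : Fin P.m) (t s : ℝ) (i : Fin P.m) (τ : ℝ) : ℂ :=
  P.greenKernel k (P.framePoint i₀ t s) i (t + τ) - P.jumpKernel i₀ t s i τ

theorem framePoint_zero (i₀ : Fin P.m) (t : ℝ) : P.framePoint i₀ t 0 = P.z i₀ t := by simp [framePoint]

theorem jumpKernel_zero (i₀ : Fin P.m) (t : ℝ) (i : Fin P.m) (τ : ℝ) : P.jumpKernel i₀ t 0 i τ = 0 := by
  simp [jumpKernel]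

theorem frameKernel_zero (k : ℝ) (i₀ : Fin P.m) (t : ℝ) (i : Fin P.m) (τ : ℝ) :
    P.frameKernel k i₀ t 0 i τ = P.greenKernel k (P.z i₀ t) i (t + τ) := by
  rw [frameKernel, jumpKernel_zero, framePoint_zero, sub_zero]

theorem continuous_framePoint (i₀ : Fin P.m) : Continuous fun q : ℝ × ℝ => P.framePoint i₀ q.1 q.2 := by
  have h1 := P.continuous_z i₀
  have h2 := P.continuous_normal i₀
  unfold framePoint; fun_prop

theorem wedge_normal (i : Fin P.m) (t : ℝ) : wedge (P.normal i t) (deriv (P.z i) t) = ‖deriv (P.z i) t‖ := by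
  have h := P.norm_deriv_z_pos i t
  have h2 := plane_norm_sq (deriv (P.z i) t)
  simp only [wedge, normal, PiLp.smul_apply, smul_eq_mul, Matrix.cons_val_zero, Matrix.cons_val_one]
  field_simp
  linarith

variable (P) in
theorem exists_frame_bounds : ∃ s₀ c C d : ℝ, 0 < s₀ ∧ 0 < c ∧ 0 < C ∧ 0 < d ∧
    ∀ i₀ t, ∀ s ∈ Icc 0 s₀, ∀ τ, |τ| ≤ Real.pi →
      c * (τ ^ 2 + s ^ 2) ≤ ‖P.framePoint i₀ t s - P.z i₀ (t + τ)‖ ^ 2 ∧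
      |wedge (P.framePoint i₀ t s - P.z i₀ (t + τ)) (deriv (P.z i₀) (t + τ)) -
        s * wedge (P.normal i₀ t) (deriv (P.z i₀) (t + τ))| ≤ C * τ ^ 2 ∧
      ∀ i, i ≠ i₀ → d ≤ ‖P.framePoint i₀ t s - P.z i (t + τ)‖ := by
  obtain ⟨m, hm, hma⟩ := P.exists_chord_arc
  obtain ⟨C, hC, hT⟩ := P.exists_taylor_z
  obtain ⟨B, hB, hBz⟩ := P.exists_norm_deriv_z_le
  obtain ⟨d, hd, hdz⟩ := P.exists_dist_curves
  refine ⟨min (d / 2) (m ^ 2 / (4 * C)), min (m ^ 2 / 2) 1, C * B, d / 2, by positivity, by positivity,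
    by positivity, by positivity, fun i₀ t s hs τ hτ => ?_⟩
  have hs1 : s ≤ d / 2 := hs.2.trans (min_le_left _ _)
  have hs2 : s * (4 * C) ≤ m ^ 2 := (le_div_iff₀ (by positivity)).1 (hs.2.trans (min_le_right _ _))
  have e0 : ∀ i, P.framePoint i₀ t s - P.z i (t + τ) = (P.z i₀ t - P.z i (t + τ)) + s • P.normal i₀ t :=
    fun i => by rw [framePoint]; abel
  refine ⟨?_, ?_, fun i hi => ?_⟩
  · rw [e0, norm_add_smul_sq, P.norm_normal]
    set e := P.z i₀ (t + τ) - P.z i₀ t - τ • deriv (P.z i₀) t with he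
    have hen : ‖e‖ ≤ C * τ ^ 2 := hT i₀ t τ
    have hdot : (P.z i₀ t - P.z i₀ (t + τ)) 0 * P.normal i₀ t 0 + (P.z i₀ t - P.z i₀ (t + τ)) 1 * P.normal i₀ t 1
        = wedge (‖deriv (P.z i₀) t‖⁻¹ • deriv (P.z i₀) t) e := by
      simp [he, wedge, normal]; ring
    have h1 : |wedge (‖deriv (P.z i₀) t‖⁻¹ • deriv (P.z i₀) t) e| ≤ C * τ ^ 2 := by
      refine (abs_wedge_le _ _).trans ?_
      rw [norm_smul, norm_inv, norm_norm, inv_mul_cancel₀ (P.norm_deriv_z_pos i₀ t).ne', one_mul]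
      exact hen
    have h2 : m ^ 2 * τ ^ 2 ≤ ‖P.z i₀ t - P.z i₀ (t + τ)‖ ^ 2 := by
      rw [← sq_abs τ, ← mul_pow, norm_sub_rev]
      exact pow_le_pow_left₀ (by positivity) (hma i₀ t τ hτ) 2
    rw [hdot]
    have h3 := (abs_le.1 h1).1
    have h4 : min (m ^ 2 / 2) 1 * (τ ^ 2 + s ^ 2) ≤ m ^ 2 / 2 * τ ^ 2 + 1 * s ^ 2 := by
      rw [mul_add]
      exact add_le_add (mul_le_mul_of_nonneg_right (min_le_left _ _) (sq_nonneg _))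
        (mul_le_mul_of_nonneg_right (min_le_right _ _) (sq_nonneg _))
    have h5 : s * (-(C * τ ^ 2)) ≤ s * wedge (‖deriv (P.z i₀) t‖⁻¹ • deriv (P.z i₀) t) e :=
      mul_le_mul_of_nonneg_left h3 hs.1
    nlinarith [mul_le_mul_of_nonneg_right hs2 (sq_nonneg τ)]
  · rw [e0, wedge_add_smul, add_sub_cancel_right]
    have h := hT i₀ (t + τ) (-τ)
    rw [neg_sq, add_neg_cancel_right] at h
    have h1 : wedge (P.z i₀ t - P.z i₀ (t + τ)) (deriv (P.z i₀) (t + τ)) =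
        wedge (P.z i₀ t - P.z i₀ (t + τ) - -τ • deriv (P.z i₀) (t + τ)) (deriv (P.z i₀) (t + τ)) := by
      simp [wedge]; ring
    rw [h1]
    refine (abs_wedge_le _ _).trans ?_
    rw [mul_right_comm]
    exact mul_le_mul h (hBz _ _) (norm_nonneg _) (by positivity)
  · rw [e0]
    have h1 := hdz i₀ i hi.symm t (t + τ)
    have h2 := norm_sub_le_norm_add (P.z i₀ t - P.z i (t + τ)) (s • P.normal i₀ t)
    rw [norm_smul, P.norm_normal, mul_one, Real.norm_eq_abs, abs_of_nonneg hs.1] at h2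
    linarith

theorem continuousAt_jumpKernel {i₀ : Fin P.m} {t s : ℝ} {i : Fin P.m} {τ : ℝ}
    (h : i = i₀ → P.framePoint i₀ t s - P.z i (t + τ) ≠ 0) :
    ContinuousAt (fun q : ℝ × ℝ × ℝ => P.jumpKernel i₀ q.1 q.2.1 i q.2.2) (t, s, τ) := by
  have hz := P.continuous_z i
  have hz' := P.continuous_deriv_z i
  have hn := P.continuous_normal i₀
  have hp : Continuous fun q : ℝ × ℝ × ℝ => P.framePoint i₀ q.1 q.2.1 :=
    (P.continuous_framePoint i₀).comp (f := fun q : ℝ × ℝ × ℝ => (q.1, q.2.1)) (by fun_prop)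
  unfold jumpKernel
  split_ifs with hi
  · have h2 := h hi
    exact Complex.continuous_ofReal.continuousAt.comp (ContinuousAt.div
      (Continuous.continuousAt (by fun_prop)) (Continuous.continuousAt (by fun_prop)) (by positivity))
  · exact continuousAt_const

theorem exists_frameKernel_bound {ka kb : ℝ} (hka : 0 < ka) : ∃ s₀ c C : ℝ, 0 < s₀ ∧ 0 < c ∧ 0 < C ∧
    ∀ k ∈ Icc ka kb, ∀ i₀ t, ∀ s ∈ Icc 0 s₀, ∀ i τ, |τ| ≤ Real.pi →
      (i = i₀ → c * (τ ^ 2 + s ^ 2) ≤ ‖P.framePoint i₀ t s - P.z i (t + τ)‖ ^ 2) ∧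
      (τ ≠ 0 → P.framePoint i₀ t s - P.z i (t + τ) ∈ P.regularPoints fullWeight ∧
        P.framePoint i₀ t s - P.z i (t + τ) ≠ 0 ∧
        ‖P.frameKernel k i₀ t s i τ‖ ≤ C * |τ| ^ (-(1 / 2) : ℝ)) := by
  obtain ⟨δ, C1, hδ, hC1, h1⟩ := P.exists_greenKernel_bound (kb := kb) hka
  obtain ⟨s₀, c, C2, d, hs₀, hc, hC2, hd, h2⟩ := P.exists_frame_bounds
  obtain ⟨B, hB, hBz⟩ := P.exists_norm_deriv_z_le
  have hpi := Real.pi_pos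
  set M : ℝ := C1 * d ^ (-(1 / 2) : ℝ) + 1 / (2 * Real.pi) * (B / d) + 1 / (2 * Real.pi) * (C2 / c) with hM
  have hM0 : 0 < M := by positivity
  refine ⟨min s₀ δ, c, C1 * (Real.sqrt c) ^ (-(1 / 2) : ℝ) + M * Real.pi ^ (1 / 2 : ℝ), by positivity, hc,
    by positivity, fun k hk i₀ t s hs i τ hτ => ?_⟩
  obtain ⟨b1, b2, b3⟩ := h2 i₀ t s ⟨hs.1, hs.2.trans (min_le_left _ _)⟩ τ hτ
  refine ⟨fun hi => by subst hi; exact b1, fun hτ0 => ?_⟩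
  have hτp : 0 < |τ| := abs_pos.2 hτ0
  have hne : P.framePoint i₀ t s - P.z i (t + τ) ≠ 0 := by
    rw [← norm_pos_iff]
    by_cases hi : i = i₀
    · subst hi
      have : 0 < c * (τ ^ 2 + s ^ 2) := by positivity
      have h3 := this.trans_le b1
      by_contra h4
      rw [le_antisymm (not_lt.1 h4) (norm_nonneg _)] at h3
      simp at h3
    · exact hd.trans_le (b3 i hi)
  have hps : ‖P.framePoint i₀ t s - P.z i₀ t‖ ≤ δ := by
    rw [framePoint, add_sub_cancel_left, norm_smul, P.norm_normal, mul_one, Real.norm_eq_abs, abs_of_nonneg hs.1]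
    exact hs.2.trans (min_le_right _ _)
  obtain ⟨g1, g2⟩ := h1 k hk _ (P.z_mem_frontier i₀ t) _ hps i (t + τ) hne
  refine ⟨g1, hne, ?_⟩
  set x := P.framePoint i₀ t s - P.z i (t + τ) with hx
  have hxn : 0 < ‖x‖ := norm_pos_iff.2 hne
  have hone : 1 ≤ Real.pi ^ (1 / 2 : ℝ) * |τ| ^ (-(1 / 2) : ℝ) := by
    rw [Real.rpow_neg hτp.le, ← div_eq_mul_inv, one_le_div (by positivity)]
    exact Real.rpow_le_rpow hτp.le hτ (by norm_num)
  have key : ‖P.frameKernel k i₀ t s i τ‖ ≤ C1 * (Real.sqrt c) ^ (-(1 / 2) : ℝ) * |τ| ^ (-(1 / 2) : ℝ) + M := by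
    have e1 : P.frameKernel k i₀ t s i τ = (P.greenKernel k (P.framePoint i₀ t s) i (t + τ) -
        ((1 / (2 * Real.pi) * wedge x (deriv (P.z i) (t + τ)) / ‖x‖ ^ 2 : ℝ) : ℂ)) +
        (((1 / (2 * Real.pi) * wedge x (deriv (P.z i) (t + τ)) / ‖x‖ ^ 2 : ℝ) : ℂ) -
          P.jumpKernel i₀ t s i τ) := by rw [frameKernel]; ring
    rw [e1]
    by_cases hi : i = i₀
    · subst hi
      have b5 : Real.sqrt c * |τ| ≤ ‖x‖ := by
        rw [← Real.sqrt_sq_eq_abs, ← Real.sqrt_mul hc.le]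
        exact Real.sqrt_le_iff.2 ⟨hxn.le, le_trans (by nlinarith [sq_nonneg s]) b1⟩
      have b6 : ‖x‖ ^ (-(1 / 2) : ℝ) ≤ (Real.sqrt c) ^ (-(1 / 2) : ℝ) * |τ| ^ (-(1 / 2) : ℝ) := by
        rw [← Real.mul_rpow (Real.sqrt_nonneg _) (abs_nonneg _)]
        have : 0 < Real.sqrt c := Real.sqrt_pos.2 hc
        exact Real.rpow_le_rpow_of_nonpos (by positivity) b5 (by norm_num)
      have b7 : ‖((1 / (2 * Real.pi) * wedge x (deriv (P.z i) (t + τ)) / ‖x‖ ^ 2 : ℝ) : ℂ) -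
          P.jumpKernel i t s i τ‖ ≤ 1 / (2 * Real.pi) * (C2 / c) := by
        rw [jumpKernel, if_pos rfl, ← hx, ← Complex.ofReal_sub, Complex.norm_real, Real.norm_eq_abs, ← sub_div,
          ← mul_sub, mul_div_assoc, abs_mul, abs_of_pos (by positivity : 0 < 1 / (2 * Real.pi)), abs_div,
          abs_of_pos (by positivity : 0 < ‖x‖ ^ 2)]
        refine mul_le_mul_of_nonneg_left ?_ (by positivity)
        rw [div_le_div_iff₀ (by positivity) hc]
        have : c * τ ^ 2 ≤ ‖x‖ ^ 2 := le_trans (by nlinarith [sq_nonneg s]) b1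
        calc _ ≤ C2 * τ ^ 2 * c := by gcongr
          _ = C2 * (c * τ ^ 2) := by ring
          _ ≤ _ := by gcongr
      refine (norm_add_le _ _).trans (add_le_add (g2.trans ?_) (b7.trans ?_))
      · rw [mul_assoc]; gcongr
      · rw [hM]
        have : 0 ≤ C1 * d ^ (-(1 / 2) : ℝ) + 1 / (2 * Real.pi) * (B / d) := by positivity
        linarith
    · have b4 := b3 i hi
      rw [jumpKernel, if_neg hi, sub_zero]
      have b6 : ‖x‖ ^ (-(1 / 2) : ℝ) ≤ d ^ (-(1 / 2) : ℝ) :=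
        Real.rpow_le_rpow_of_nonpos hd b4 (by norm_num)
      have b7 : ‖((1 / (2 * Real.pi) * wedge x (deriv (P.z i) (t + τ)) / ‖x‖ ^ 2 : ℝ) : ℂ)‖ ≤
          1 / (2 * Real.pi) * (B / d) := by
        rw [Complex.norm_real, Real.norm_eq_abs, mul_div_assoc, abs_mul,
          abs_of_pos (by positivity : 0 < 1 / (2 * Real.pi)), abs_div, abs_of_pos (by positivity : 0 < ‖x‖ ^ 2)]
        refine mul_le_mul_of_nonneg_left ?_ (by positivity)
        rw [div_le_div_iff₀ (by positivity) hd]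
        calc _ ≤ ‖x‖ * B * d := by
              gcongr
              exact (abs_wedge_le _ _).trans (by gcongr; exact hBz _ _)
          _ ≤ ‖x‖ * B * ‖x‖ := by gcongr
          _ = _ := by ring
      refine (norm_add_le _ _).trans ((add_le_add g2 b7).trans ?_)
      have h8 : C1 * ‖x‖ ^ (-(1 / 2) : ℝ) ≤ C1 * d ^ (-(1 / 2) : ℝ) := by gcongr
      have h9 : 0 ≤ C1 * (Real.sqrt c) ^ (-(1 / 2) : ℝ) * |τ| ^ (-(1 / 2) : ℝ) := by positivity
      have h10 : 0 ≤ 1 / (2 * Real.pi) * (C2 / c) := by positivity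
      rw [hM]; linarith
  refine key.trans ?_
  have : M ≤ M * (Real.pi ^ (1 / 2 : ℝ) * |τ| ^ (-(1 / 2) : ℝ)) := le_mul_of_one_le_right hM0.le hone
  linarith

end ScatteringSetup

theorem tendsto_integral_of_abs_rpow_bound {E ι : Type*} [NormedAddCommGroup E] [NormedSpace ℝ E]
    {l : Filter ι} [l.IsCountablyGenerated] {F : ι → ℝ → E} {f : ℝ → E} (C : ℝ)
    (hF : ∀ᶠ q in l, ∀ τ, τ ≠ 0 → |τ| ≤ Real.pi → ContinuousAt (F q) τ ∧ ‖F q τ‖ ≤ C * |τ| ^ (-(1 / 2) : ℝ))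
    (hl : ∀ τ, τ ≠ 0 → |τ| ≤ Real.pi → Tendsto (fun q => F q τ) l (𝓝 (f τ))) :
    Tendsto (fun q => ∫ τ in (-Real.pi)..Real.pi, F q τ) l (𝓝 (∫ τ in (-Real.pi)..Real.pi, f τ)) := by
  refine intervalIntegral.tendsto_integral_filter_of_dominated_convergence
    (fun τ => C * |τ| ^ (-(1 / 2) : ℝ)) ?_ ?_ (intervalIntegrable_abs_rpow C) ?_
  · filter_upwards [hF] with q hq
    exact aestronglyMeasurable_of_continuousAt fun τ h0 hτ => (hq τ h0 hτ).1
  · filter_upwards [hF] with q hq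
    filter_upwards [ae_ne_zero (uIoc (-Real.pi) Real.pi)] with τ h hτ
    exact (hq τ (h hτ) (abs_le_pi_of_mem hτ)).2
  · filter_upwards [ae_ne_zero (uIoc (-Real.pi) Real.pi)] with τ h hτ
    exact hl τ (h hτ) (abs_le_pi_of_mem hτ)

theorem integral_poisson_kernel {b : ℝ} (hb : 0 < b) :
    ∫ σ : ℝ, 1 / (2 * Real.pi) * (b / (1 + b ^ 2 * σ ^ 2)) = 1 / 2 := by
  have h := Measure.integral_comp_mul_left (fun x : ℝ => (1 + x ^ 2)⁻¹) b
  rw [integral_univ_inv_one_add_sq, abs_of_pos (inv_pos.2 hb)] at h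
  rw [integral_const_mul]
  have h2 : (fun σ : ℝ => b / (1 + b ^ 2 * σ ^ 2)) = fun σ => b * (1 + (b * σ) ^ 2)⁻¹ := by
    ext σ; rw [mul_pow, div_eq_mul_inv]
  rw [h2, integral_const_mul, h]
  have := Real.pi_pos
  simp only [smul_eq_mul]
  field_simp

namespace ScatteringSetup

variable {P : ScatteringSetup}

theorem continuousAt_frameKernel {k : ℝ} (hk : 0 < k) {i₀ i : Fin P.m} {t s τ : ℝ}
    (h1 : P.framePoint i₀ t s - P.z i (t + τ) ∈ P.regularPoints fullWeight)
    (h2 : P.framePoint i₀ t s - P.z i (t + τ) ≠ 0) :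
    ContinuousAt (fun q : ℝ × ℝ × ℝ × ℝ => P.frameKernel q.1 i₀ q.2.1 q.2.2.1 i q.2.2.2) (k, t, s, τ) := by
  have hz := P.continuous_z i
  have hp : Continuous fun q : ℝ × ℝ × ℝ × ℝ => P.framePoint i₀ q.2.1 q.2.2.1 :=
    (P.continuous_framePoint i₀).comp (f := fun q : ℝ × ℝ × ℝ × ℝ => (q.2.1, q.2.2.1)) (by fun_prop)
  refine ContinuousAt.sub ?_ ?_
  · exact ContinuousAt.comp (g := fun w : ℝ × Plane × ℝ => P.greenKernel w.1 w.2.1 i w.2.2)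
      (f := fun q : ℝ × ℝ × ℝ × ℝ => (q.1, P.framePoint i₀ q.2.1 q.2.2.1, q.2.1 + q.2.2.2))
      (x := (k, t, s, τ)) (continuousAt_greenKernel hk h1)
      (Continuous.continuousAt (by fun_prop))
  · exact ContinuousAt.comp (g := fun w : ℝ × ℝ × ℝ => P.jumpKernel i₀ w.1 w.2.1 i w.2.2)
      (f := fun q : ℝ × ℝ × ℝ × ℝ => q.2) (x := (k, t, s, τ)) (continuousAt_jumpKernel fun _ => h2)
      continuous_snd.continuousAt

/-- The frame kernel is dominated by an integrable singularity and continuous off the origin,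
locally uniformly in the wave number. -/
theorem exists_frameKernel_control {k₁ : ℝ} (hk₁ : 0 < k₁) : ∃ C : ℝ, ∀ (i₀ : Fin P.m) (t₀ : ℝ),
    ∀ᶠ q : ℝ × ℝ × ℝ in 𝓝[{q | 0 ≤ q.2.2}] (k₁, t₀, 0), ∀ i τ, τ ≠ 0 → |τ| ≤ Real.pi →
      ContinuousAt (fun w : ℝ × ℝ × ℝ × ℝ => P.frameKernel w.1 i₀ w.2.1 w.2.2.1 i w.2.2.2)
        (q.1, q.2.1, q.2.2, τ) ∧ ‖P.frameKernel q.1 i₀ q.2.1 q.2.2 i τ‖ ≤ C * |τ| ^ (-(1 / 2) : ℝ) := by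
  obtain ⟨s₀, c, C, hs₀, hc, hC, h⟩ := P.exists_frameKernel_bound (kb := 2 * k₁) (half_pos hk₁)
  refine ⟨C, fun i₀ t₀ => ?_⟩
  have e1 : ∀ᶠ q : ℝ × ℝ × ℝ in 𝓝 (k₁, t₀, 0), q.1 ∈ Icc (k₁ / 2) (2 * k₁) :=
    continuousAt_fst.eventually_mem (Icc_mem_nhds (by linarith) (by linarith))
  have e2 : ∀ᶠ q : ℝ × ℝ × ℝ in 𝓝 (k₁, t₀, 0), q.2.2 < s₀ :=
    (continuous_snd.comp continuous_snd).continuousAt.eventually (gt_mem_nhds hs₀)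
  filter_upwards [e1.filter_mono nhdsWithin_le_nhds, e2.filter_mono nhdsWithin_le_nhds,
    self_mem_nhdsWithin] with q hq1 hq2 hq3 i τ h0 hτ
  obtain ⟨g1, g2, g3⟩ := (h q.1 hq1 i₀ q.2.1 q.2.2 ⟨hq3, hq2.le⟩ i τ hτ).2 h0
  exact ⟨continuousAt_frameKernel ((half_pos hk₁).trans_le hq1.1) g1 g2, g3⟩

theorem mem_nhdsWithin_frame (k₁ t₀ : ℝ) :
    ((k₁, t₀, 0) : ℝ × ℝ × ℝ) ∈ {q : ℝ × ℝ × ℝ | 0 ≤ q.2.2} := le_refl (0 : ℝ)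

theorem tendsto_integral_frameKernel_mul {k₁ : ℝ} (hk₁ : 0 < k₁) (i₀ : Fin P.m) (t₀ : ℝ) (i : Fin P.m)
    (ψ : P.Density) :
    Tendsto (fun q : ℝ × ℝ × ℝ => ∫ τ in (-Real.pi)..Real.pi,
      P.frameKernel q.1 i₀ q.2.1 q.2.2 i τ * ψ (P.bdryPoint i (q.2.1 + τ)))
      (𝓝[{q | 0 ≤ q.2.2}] (k₁, t₀, 0)) (𝓝 (∫ τ in (-Real.pi)..Real.pi,
        P.greenKernel k₁ (P.z i₀ t₀) i (t₀ + τ) * ψ (P.bdryPoint i (t₀ + τ)))) := by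
  obtain ⟨C, hC⟩ := P.exists_frameKernel_control hk₁
  have hψ : Continuous fun t => ψ (P.bdryPoint i t) := ψ.continuous.comp (P.continuous_bdryPoint i)
  have hbd := P.continuous_bdryPoint i
  refine tendsto_integral_of_abs_rpow_bound (C * ‖ψ‖) ?_ fun τ h0 hτ => ?_
  · filter_upwards [hC i₀ t₀] with q hq τ h0 hτ
    obtain ⟨h1, h2⟩ := hq i τ h0 hτ
    refine ⟨ContinuousAt.mul (ContinuousAt.comp (x := τ) (f := fun τ => (q.1, q.2.1, q.2.2, τ)) h1
      (Continuous.continuousAt (by fun_prop))) (Continuous.continuousAt (by fun_prop)), ?_⟩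
    rw [norm_mul, mul_right_comm]
    exact mul_le_mul h2 (ψ.norm_coe_le_norm _) (norm_nonneg _) ((norm_nonneg _).trans h2)
  · have h1 := ((hC i₀ t₀).self_of_nhdsWithin (mem_nhdsWithin_frame k₁ t₀) i τ h0 hτ).1
    rw [← frameKernel_zero]
    refine (show Tendsto _ (𝓝 ((k₁, t₀, 0) : ℝ × ℝ × ℝ)) _ from ?_).mono_left nhdsWithin_le_nhds
    exact ContinuousAt.mul (ContinuousAt.comp (x := ((k₁, t₀, 0) : ℝ × ℝ × ℝ))
      (f := fun q : ℝ × ℝ × ℝ => (q.1, q.2.1, q.2.2, τ)) h1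
      (Continuous.continuousAt (by fun_prop)))
      (Continuous.continuousAt (f := fun q : ℝ × ℝ × ℝ => ψ (P.bdryPoint i (q.2.1 + τ))) (by fun_prop))

theorem tendsto_integral_norm_frameKernel_sub {k₁ : ℝ} (hk₁ : 0 < k₁) (i₀ : Fin P.m) (t₀ : ℝ) (i : Fin P.m) :
    Tendsto (fun q : ℝ × ℝ × ℝ => ∫ τ in (-Real.pi)..Real.pi,
      ‖P.frameKernel q.1 i₀ q.2.1 q.2.2 i τ - P.greenKernel k₁ (P.z i₀ t₀) i (t₀ + τ)‖)
      (𝓝[{q | 0 ≤ q.2.2}] (k₁, t₀, 0)) (𝓝 0) := by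
  obtain ⟨C, hC⟩ := P.exists_frameKernel_control hk₁
  have key := (hC i₀ t₀).self_of_nhdsWithin (mem_nhdsWithin_frame k₁ t₀)
  have h := tendsto_integral_of_abs_rpow_bound (l := 𝓝[{q | 0 ≤ q.2.2}] ((k₁, t₀, 0) : ℝ × ℝ × ℝ))
    (F := fun q τ => ‖P.frameKernel q.1 i₀ q.2.1 q.2.2 i τ - P.frameKernel k₁ i₀ t₀ 0 i τ‖)
    (f := fun _ => (0 : ℝ)) (C + C) ?_ fun τ h0 hτ => ?_
  · simpa [frameKernel_zero] using h
  · filter_upwards [hC i₀ t₀] with q hq τ h0 hτ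
    obtain ⟨h1, h2⟩ := hq i τ h0 hτ
    obtain ⟨h3, h4⟩ := key i τ h0 hτ
    refine ⟨(ContinuousAt.sub (ContinuousAt.comp (x := τ) (f := fun τ => (q.1, q.2.1, q.2.2, τ)) h1
      (Continuous.continuousAt (by fun_prop))) (ContinuousAt.comp (x := τ) (f := fun τ => (k₁, t₀, 0, τ)) h3
      (Continuous.continuousAt (by fun_prop)))).norm, ?_⟩
    rw [norm_norm, add_mul]
    exact (norm_sub_le _ _).trans (add_le_add h2 h4)
  · have h1 := (key i τ h0 hτ).1
    refine (show Tendsto _ (𝓝 ((k₁, t₀, 0) : ℝ × ℝ × ℝ)) _ from ?_).mono_left nhdsWithin_le_nhds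
    have h2 : ContinuousAt (fun q : ℝ × ℝ × ℝ => P.frameKernel q.1 i₀ q.2.1 q.2.2 i τ) (k₁, t₀, 0) :=
      ContinuousAt.comp (x := ((k₁, t₀, 0) : ℝ × ℝ × ℝ))
        (f := fun q : ℝ × ℝ × ℝ => (q.1, q.2.1, q.2.2, τ)) h1 (Continuous.continuousAt (by fun_prop))
    exact tendsto_iff_norm_sub_tendsto_zero.1 h2

theorem tendsto_difference_quotient_z (i : Fin P.m) (t₀ σ : ℝ) :
    Tendsto (fun q : ℝ × ℝ => q.2⁻¹ • (P.z i (q.1 + q.2 * σ) - P.z i q.1)) (𝓝 t₀ ×ˢ 𝓝[>] 0)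
      (𝓝 (σ • deriv (P.z i) t₀)) := by
  obtain ⟨C, hC, hT⟩ := P.exists_taylor_z
  have hfst : Tendsto (fun q : ℝ × ℝ => q.1) (𝓝 t₀ ×ˢ 𝓝[>] 0) (𝓝 t₀) := tendsto_fst
  have hsnd : Tendsto (fun q : ℝ × ℝ => q.2) (𝓝 t₀ ×ˢ 𝓝[>] 0) (𝓝 0) :=
    tendsto_snd.mono_right nhdsWithin_le_nhds
  have hpos : ∀ᶠ q : ℝ × ℝ in 𝓝 t₀ ×ˢ 𝓝[>] 0, 0 < q.2 :=
    (tendsto_snd (f := 𝓝 t₀)).eventually self_mem_nhdsWithin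
  have h1 : Tendsto (fun q : ℝ × ℝ => σ • deriv (P.z i) q.1) (𝓝 t₀ ×ˢ 𝓝[>] 0) (𝓝 (σ • deriv (P.z i) t₀)) :=
    (((P.continuous_deriv_z i).tendsto t₀).comp hfst).const_smul σ
  refine (tendsto_iff_of_dist ?_).2 h1
  have h2 : Tendsto (fun q : ℝ × ℝ => C * σ ^ 2 * q.2) (𝓝 t₀ ×ˢ 𝓝[>] 0) (𝓝 0) := by
    simpa using hsnd.const_mul (C * σ ^ 2)
  refine squeeze_zero' (Eventually.of_forall fun _ => dist_nonneg) ?_ h2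
  filter_upwards [hpos] with q hq
  have h3 : q.2⁻¹ • (P.z i (q.1 + q.2 * σ) - P.z i q.1) - σ • deriv (P.z i) q.1 =
      q.2⁻¹ • (P.z i (q.1 + q.2 * σ) - P.z i q.1 - (q.2 * σ) • deriv (P.z i) q.1) := by
    rw [smul_sub q.2⁻¹ (_ - _), smul_smul, inv_mul_cancel_left₀ hq.ne']
  rw [dist_eq_norm, h3, norm_smul, norm_inv, Real.norm_of_nonneg hq.le, inv_mul_le_iff₀ hq]
  exact (hT i q.1 (q.2 * σ)).trans (le_of_eq (by ring))

theorem tendsto_integral_jumpKernel (i₀ : Fin P.m) (t₀ : ℝ) (ψ : P.Density) :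
    Tendsto (fun q : ℝ × ℝ => ∫ τ in (-Real.pi)..Real.pi,
      P.jumpKernel i₀ q.1 q.2 i₀ τ * ψ (P.bdryPoint i₀ (q.1 + τ))) (𝓝 t₀ ×ˢ 𝓝[>] 0)
      (𝓝 (1 / 2 * ψ (P.bdryPoint i₀ t₀))) := by
  obtain ⟨s₀, c, C, d, hs₀, hc, hC, hd, hb⟩ := P.exists_frame_bounds
  obtain ⟨B, hB, hBz⟩ := P.exists_norm_deriv_z_le
  have hpi := Real.pi_pos
  have hbd := P.continuous_bdryPoint i₀
  have hψ : Continuous fun t => ψ (P.bdryPoint i₀ t) := ψ.continuous.comp (P.continuous_bdryPoint i₀)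
  set b := ‖deriv (P.z i₀) t₀‖ with hbdef
  have hb0 : 0 < b := P.norm_deriv_z_pos i₀ t₀
  set f : ℝ × ℝ → ℝ → ℂ := fun q τ => P.jumpKernel i₀ q.1 q.2 i₀ τ * ψ (P.bdryPoint i₀ (q.1 + τ)) with hf
  set H : ℝ × ℝ → ℝ → ℂ := fun q =>
    indicator (Ioc (-(Real.pi / q.2)) (Real.pi / q.2)) fun σ => q.2 * f q (q.2 * σ) with hH
  have hfst : Tendsto (fun q : ℝ × ℝ => q.1) (𝓝 t₀ ×ˢ 𝓝[>] 0) (𝓝 t₀) := tendsto_fst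
  have hsnd : Tendsto (fun q : ℝ × ℝ => q.2) (𝓝 t₀ ×ˢ 𝓝[>] 0) (𝓝 0) :=
    tendsto_snd.mono_right nhdsWithin_le_nhds
  have hpos : ∀ᶠ q : ℝ × ℝ in 𝓝 t₀ ×ˢ 𝓝[>] 0, 0 < q.2 :=
    (tendsto_snd (f := 𝓝 t₀)).eventually self_mem_nhdsWithin
  have hsmall : ∀ᶠ q : ℝ × ℝ in 𝓝 t₀ ×ˢ 𝓝[>] 0, q.2 < s₀ := hsnd.eventually (gt_mem_nhds hs₀)
  have hx0 : ∀ q : ℝ × ℝ, 0 < q.2 → q.2 < s₀ → ∀ τ, |τ| ≤ Real.pi →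
      c * (τ ^ 2 + q.2 ^ 2) ≤ ‖P.framePoint i₀ q.1 q.2 - P.z i₀ (q.1 + τ)‖ ^ 2 :=
    fun q h1 h2 τ hτ => (hb i₀ q.1 q.2 ⟨h1.le, h2.le⟩ τ hτ).1
  have hmem : ∀ q : ℝ × ℝ, 0 < q.2 → ∀ σ ∈ Ioc (-(Real.pi / q.2)) (Real.pi / q.2), |q.2 * σ| ≤ Real.pi := by
    intro q hq σ hσ
    rw [abs_mul, abs_of_pos hq, ← le_div_iff₀' hq]
    exact abs_le.2 ⟨hσ.1.le, hσ.2⟩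
  have heq : ∀ᶠ q : ℝ × ℝ in 𝓝 t₀ ×ˢ 𝓝[>] 0, ∫ σ, H q σ = ∫ τ in (-Real.pi)..Real.pi, f q τ := by
    filter_upwards [hpos] with q hq
    rw [hH]
    dsimp only
    rw [integral_indicator measurableSet_Ioc, ← intervalIntegral.integral_of_le (by
      have : 0 < Real.pi / q.2 := by positivity
      linarith), intervalIntegral.integral_const_mul, intervalIntegral.integral_comp_mul_left _ hq.ne',
      mul_neg, mul_div_cancel₀ _ hq.ne', Complex.real_smul, ← mul_assoc, ← Complex.ofReal_mul,
      mul_inv_cancel₀ hq.ne', Complex.ofReal_one, one_mul]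
  have hlim : ∫ σ : ℝ, ((1 / (2 * Real.pi) * (b / (1 + b ^ 2 * σ ^ 2)) : ℝ) : ℂ) * ψ (P.bdryPoint i₀ t₀) =
      1 / 2 * ψ (P.bdryPoint i₀ t₀) := by
    rw [integral_mul_const, integral_complex_ofReal, integral_poisson_kernel hb0]
    norm_num
  rw [← hlim]
  refine Tendsto.congr' heq (tendsto_integral_filter_of_dominated_convergence
    (fun σ => B / (2 * Real.pi * c) * ‖ψ‖ * (1 + σ ^ 2)⁻¹) ?_ ?_ (integrable_inv_one_add_sq.const_mul _) ?_)
  · filter_upwards [hpos, hsmall] with q hq hq2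
    have hcont : ContinuousOn (fun σ => (q.2 : ℂ) * f q (q.2 * σ)) (Ioc (-(Real.pi / q.2)) (Real.pi / q.2)) := by
      intro σ hσ
      have h1 := hx0 q hq hq2 _ (hmem q hq σ hσ)
      have h2 : P.framePoint i₀ q.1 q.2 - P.z i₀ (q.1 + q.2 * σ) ≠ 0 := fun h => by
        rw [h, norm_zero] at h1
        have : 0 < c * ((q.2 * σ) ^ 2 + q.2 ^ 2) := by positivity
        linarith [zero_pow (M₀ := ℝ) two_ne_zero]
      refine (continuousAt_const.mul (ContinuousAt.mul ?_
        (Continuous.continuousAt (by fun_prop)))).continuousWithinAt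
      exact ContinuousAt.comp (g := fun w : ℝ × ℝ × ℝ => P.jumpKernel i₀ w.1 w.2.1 i₀ w.2.2)
        (f := fun σ : ℝ => (q.1, q.2, q.2 * σ)) (x := σ) (continuousAt_jumpKernel fun _ => h2)
        (Continuous.continuousAt (by fun_prop))
    exact (aestronglyMeasurable_indicator_iff measurableSet_Ioc).2
      (hcont.aestronglyMeasurable measurableSet_Ioc)
  · filter_upwards [hpos, hsmall] with q hq hq2
    refine Eventually.of_forall fun σ => ?_
    have hnn : 0 ≤ B / (2 * Real.pi * c) * ‖ψ‖ * (1 + σ ^ 2)⁻¹ := by positivity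
    rw [hH]
    dsimp only
    by_cases hσ : σ ∈ Ioc (-(Real.pi / q.2)) (Real.pi / q.2)
    · rw [indicator_of_mem hσ, hf]
      dsimp only
      have h1 := hx0 q hq hq2 _ (hmem q hq σ hσ)
      rw [jumpKernel, if_pos rfl, ← mul_assoc, norm_mul, mul_right_comm]
      refine mul_le_mul ?_ (ψ.norm_coe_le_norm _) (norm_nonneg _) (by positivity)
      rw [← Complex.ofReal_mul, Complex.norm_real, Real.norm_eq_abs, abs_mul, abs_of_pos hq, abs_div, abs_mul,
        abs_mul, abs_of_pos hq, abs_of_pos (by positivity : 0 < 1 / (2 * Real.pi)), 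
        abs_of_nonneg (sq_nonneg ‖P.framePoint i₀ q.1 q.2 - P.z i₀ (q.1 + q.2 * σ)‖)]
      have h2 : c * q.2 ^ 2 * (1 + σ ^ 2) ≤ ‖P.framePoint i₀ q.1 q.2 - P.z i₀ (q.1 + q.2 * σ)‖ ^ 2 :=
        le_trans (le_of_eq (by ring)) h1
      have h3 : |wedge (P.normal i₀ q.1) (deriv (P.z i₀) (q.1 + q.2 * σ))| ≤ B := by
        refine (abs_wedge_le _ _).trans ?_
        rw [P.norm_normal, one_mul]; exact hBz _ _
      calc _ ≤ q.2 * (1 / (2 * Real.pi) * (q.2 * B) / (c * q.2 ^ 2 * (1 + σ ^ 2))) := by gcongr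
        _ = _ := by field_simp
    · rw [indicator_of_notMem hσ, norm_zero]; exact hnn
  · refine Eventually.of_forall fun σ => ?_
    have hs1 : ∀ᶠ q : ℝ × ℝ in 𝓝 t₀ ×ˢ 𝓝[>] 0, |q.2 * σ| < Real.pi := by
      have : Tendsto (fun q : ℝ × ℝ => |q.2 * σ|) (𝓝 t₀ ×ˢ 𝓝[>] 0) (𝓝 0) := by
        simpa using (hsnd.mul_const σ).abs
      exact this.eventually (gt_mem_nhds hpi)
    have ht : Tendsto (fun q : ℝ × ℝ => q.1 + q.2 * σ) (𝓝 t₀ ×ˢ 𝓝[>] 0) (𝓝 t₀) := by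
      simpa using hfst.add (hsnd.mul_const σ)
    have hn := ((P.continuous_normal i₀).tendsto t₀).comp hfst
    have hw := ((show Continuous fun q : Plane × Plane => wedge q.1 q.2 by fun_prop).tendsto
      (P.normal i₀ t₀, deriv (P.z i₀) t₀)).comp
      (hn.prodMk_nhds (((P.continuous_deriv_z i₀).tendsto t₀).comp ht))
    have hden := ((hn.sub (P.tendsto_difference_quotient_z i₀ t₀ σ)).norm).pow 2
    have hval : ‖P.normal i₀ t₀ - σ • deriv (P.z i₀) t₀‖ ^ 2 = 1 + b ^ 2 * σ ^ 2 := by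
      rw [sub_eq_add_neg, ← neg_smul, norm_add_smul_sq, P.norm_normal]
      simp [normal]; ring
    rw [hval] at hden
    rw [wedge_normal] at hw
    have hlim2 := (Complex.continuous_ofReal.tendsto _).comp
      ((hw.div hden (by positivity)).const_mul (1 / (2 * Real.pi)))
    refine Tendsto.congr' ?_ (hlim2.mul ((hψ.tendsto t₀).comp ht))
    filter_upwards [hs1, hpos] with q hq1 hq
    have hσ : σ ∈ Ioc (-(Real.pi / q.2)) (Real.pi / q.2) := by
      rw [abs_mul, abs_of_pos hq, ← lt_div_iff₀' hq, abs_lt] at hq1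
      exact ⟨hq1.1, hq1.2.le⟩
    rw [hH]
    dsimp only
    rw [indicator_of_mem hσ, hf]
    dsimp only
    rw [jumpKernel, if_pos rfl, ← mul_assoc, ← Complex.ofReal_mul]
    simp only [Function.comp_apply, Pi.div_apply]
    congr 2
    have h4 : P.framePoint i₀ q.1 q.2 - P.z i₀ (q.1 + q.2 * σ) =
        q.2 • (P.normal i₀ q.1 - q.2⁻¹ • (P.z i₀ (q.1 + q.2 * σ) - P.z i₀ q.1)) := by
      rw [smul_sub, smul_smul, mul_inv_cancel₀ hq.ne', one_smul, framePoint]; abel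
    rw [h4, norm_smul, Real.norm_of_nonneg hq.le, mul_pow]
    field_simp

end ScatteringSetup

theorem intervalIntegrable_of_abs_rpow_bound {E : Type*} [NormedAddCommGroup E] {f : ℝ → E} (C : ℝ)
    (hf : ∀ τ, τ ≠ 0 → |τ| ≤ Real.pi → ContinuousAt f τ ∧ ‖f τ‖ ≤ C * |τ| ^ (-(1 / 2) : ℝ)) :
    IntervalIntegrable f volume (-Real.pi) Real.pi := by
  refine (intervalIntegrable_abs_rpow C).mono_fun'
    (aestronglyMeasurable_of_continuousAt fun τ h0 hτ => (hf τ h0 hτ).1) ?_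
  refine (ae_restrict_iff' measurableSet_uIoc).2 ?_
  filter_upwards [ae_ne_zero (uIoc (-Real.pi) Real.pi)] with τ h hτ
  exact (hf τ (h hτ) (abs_le_pi_of_mem hτ)).2

theorem intervalIntegrable_of_shift {f : ℝ → ℂ} (hf : Function.Periodic f (2 * Real.pi)) (t : ℝ)
    (h : IntervalIntegrable (fun τ => f (t + τ)) volume (-Real.pi) Real.pi) (a b : ℝ) :
    IntervalIntegrable f volume a b := by
  have h1 := h.comp_add_left (-t)
  simp only [add_neg_cancel_left] at h1
  refine hf.intervalIntegrable Real.two_pi_pos.ne' (t := -Real.pi - -t) ?_ a b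
  have : -Real.pi - -t + 2 * Real.pi = Real.pi - -t := by ring
  rwa [this]

theorem intervalIntegrable_shift {f : ℝ → ℂ} (hf : Function.Periodic f (2 * Real.pi))
    (h : IntervalIntegrable f volume 0 (2 * Real.pi)) (t : ℝ) :
    IntervalIntegrable (fun τ => f (t + τ)) volume (-Real.pi) Real.pi := by
  have h1 := (hf.intervalIntegrable₀ Real.two_pi_pos.ne' h (-Real.pi + t) (Real.pi + t)).comp_add_left t
  simpa using h1

namespace ScatteringSetup

variable {P : ScatteringSetup}

theorem kernelIntegral_greenKernel (k : ℝ) (p : Plane) (t : ℝ) (ψ : P.Density) :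
    P.kernelIntegral (P.greenKernel k p) ψ = ∑ i, ∫ τ in (-Real.pi)..Real.pi,
      P.greenKernel k p i (t + τ) * ψ (P.bdryPoint i (t + τ)) := by
  refine Finset.sum_congr rfl fun i _ => (intervalIntegral_shift
    (f := fun τ => P.greenKernel k p i τ * ψ (P.bdryPoint i τ)) (fun τ => ?_) t).symm
  simp only [periodic_greenKernel k p i τ, P.periodic_bdryPoint i τ]

theorem exists_bdryPoint (r : frontier P.D₀) : ∃ i t, r = P.bdryPoint i t := by
  have hr : r.1 ∈ ⋃ i, range (P.z i) := by rw [← P.frontier_D₀]; exact r.2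
  obtain ⟨i, t, h⟩ := mem_iUnion.1 hr
  exact ⟨i, t, Subtype.ext h.symm⟩

variable (P) in
theorem exists_greenKernel_integral_bound {ka kb : ℝ} (hka : 0 < ka) : ∃ C : ℝ, ∀ k ∈ Icc ka kb,
    ∀ r : frontier P.D₀, P.KernelIntegrable (P.greenKernel k r) ∧
      ∑ i, ∫ t in (0 : ℝ)..(2 * Real.pi), ‖P.greenKernel k r i t‖ ≤ C := by
  obtain ⟨s₀, c, C, hs₀, hc, hC, h⟩ := P.exists_frameKernel_bound (kb := kb) hka
  refine ⟨∑ _i : Fin P.m, ∫ τ in (-Real.pi)..Real.pi, C * |τ| ^ (-(1 / 2) : ℝ), fun k hk r => ?_⟩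
  obtain ⟨i₀, t₀, rfl⟩ := P.exists_bdryPoint r
  have key : ∀ i τ, τ ≠ 0 → |τ| ≤ Real.pi → ContinuousAt (fun τ => P.greenKernel k (P.z i₀ t₀) i (t₀ + τ)) τ ∧
      ‖P.greenKernel k (P.z i₀ t₀) i (t₀ + τ)‖ ≤ C * |τ| ^ (-(1 / 2) : ℝ) := fun i τ h0 hτ => by
    obtain ⟨g1, g2, g3⟩ := (h k hk i₀ t₀ 0 ⟨le_rfl, hs₀.le⟩ i τ hτ).2 h0
    have g4 := continuousAt_frameKernel (hka.trans_le hk.1) g1 g2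
    simp_rw [← frameKernel_zero]
    exact ⟨ContinuousAt.comp (x := τ) (f := fun τ => (k, t₀, 0, τ)) g4
      (Continuous.continuousAt (by fun_prop)), g3⟩
  have hint := fun i => intervalIntegrable_of_abs_rpow_bound C (key i)
  refine ⟨fun i => intervalIntegrable_of_shift (periodic_greenKernel _ _ _) t₀ (hint i) _ _,
    Finset.sum_le_sum fun i _ => ?_⟩
  rw [show ((P.bdryPoint i₀ t₀ : frontier P.D₀) : Plane) = P.z i₀ t₀ from rfl,
    ← intervalIntegral_shift (f := fun t => ‖P.greenKernel k (P.z i₀ t₀) i t‖)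
    (fun τ => congrArg norm (periodic_greenKernel _ _ _ _)) t₀]
  refine intervalIntegral.integral_mono_ae_restrict (by linarith [Real.pi_pos]) (hint i).norm
    (intervalIntegrable_abs_rpow C) ((ae_restrict_iff' measurableSet_Icc).2 ?_)
  filter_upwards [ae_ne_zero (Icc (-Real.pi) Real.pi)] with τ h0 hτ
  exact (key i τ (h0 hτ) (abs_le.2 hτ)).2

theorem kernelIntegrable_greenKernel {k : ℝ} (hk : 0 < k) (r : frontier P.D₀) :
    P.KernelIntegrable (P.greenKernel k r) := by
  obtain ⟨C, hC⟩ := P.exists_greenKernel_integral_bound (kb := k) hk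
  exact (hC k ⟨le_rfl, le_rfl⟩ r).1

theorem tendsto_of_tendsto_bdryPoint {α : Type*} {l : Filter α} (i₀ : Fin P.m) (t₀ : ℝ)
    {f : frontier P.D₀ → α} (h : Tendsto (fun t => f (P.bdryPoint i₀ t)) (𝓝 t₀) l) :
    Tendsto f (𝓝 (P.bdryPoint i₀ t₀)) l := fun s hs => by
  rw [mem_map]
  filter_upwards [P.eventually_exists_bdryPoint i₀ t₀ (h hs)] with r hr
  obtain ⟨t, ht, rfl⟩ := hr
  exact ht

theorem nhds_bdryPoint_le (k : ℝ) (i₀ : Fin P.m) (t₀ : ℝ) :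
    𝓝 (k, P.bdryPoint i₀ t₀) ≤ map (fun q : ℝ × ℝ => (q.1, P.bdryPoint i₀ q.2)) (𝓝 (k, t₀)) := by
  rw [nhds_prod_eq, nhds_prod_eq]
  refine (Filter.prod_mono le_rfl (?_ : 𝓝 (P.bdryPoint i₀ t₀) ≤ map (P.bdryPoint i₀) (𝓝 t₀))).trans
    (le_of_eq ?_)
  · exact tendsto_of_tendsto_bdryPoint (f := id) i₀ t₀ tendsto_map
  · exact (prod_map_map_eq (m₁ := id)).trans rfl

theorem tendsto_frame_zero (k₁ t₀ : ℝ) : Tendsto (fun q : ℝ × ℝ => (q.1, q.2, (0 : ℝ))) (𝓝 (k₁, t₀))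
    (𝓝[{q | 0 ≤ q.2.2}] (k₁, t₀, 0)) :=
  tendsto_nhdsWithin_iff.2 ⟨Continuous.tendsto (f := fun q : ℝ × ℝ => (q.1, q.2, (0 : ℝ))) (by fun_prop) _,
    Eventually.of_forall fun _ => le_refl (0 : ℝ)⟩

theorem tendsto_kernelIntegral_greenKernel {k : ℝ} (hk : 0 < k) (r : frontier P.D₀) (ψ : P.Density) :
    Tendsto (fun q : ℝ × frontier P.D₀ => P.kernelIntegral (P.greenKernel q.1 q.2) ψ) (𝓝 (k, r))
      (𝓝 (P.kernelIntegral (P.greenKernel k r) ψ)) := by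
  obtain ⟨i₀, t₀, rfl⟩ := P.exists_bdryPoint r
  refine Tendsto.mono_left ?_ (P.nhds_bdryPoint_le k i₀ t₀)
  rw [tendsto_map'_iff]
  have h := tendsto_finsetSum Finset.univ fun i _ =>
    (tendsto_integral_frameKernel_mul hk i₀ t₀ i ψ).comp (tendsto_frame_zero k t₀)
  rw [← kernelIntegral_greenKernel] at h
  refine h.congr fun q => ?_
  simp only [Function.comp_apply, frameKernel_zero]
  rw [← kernelIntegral_greenKernel]
  rfl

theorem tendsto_integral_norm_greenKernel_sub {k₁ : ℝ} (hk₁ : 0 < k₁) (r : frontier P.D₀) :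
    Tendsto (fun q : ℝ × frontier P.D₀ => ∑ i, ∫ t in (0 : ℝ)..(2 * Real.pi),
      ‖P.greenKernel q.1 q.2 i t - P.greenKernel k₁ q.2 i t‖) (𝓝 (k₁, r)) (𝓝 0) := by
  obtain ⟨i₀, t₀, rfl⟩ := P.exists_bdryPoint r
  refine Tendsto.mono_left ?_ (P.nhds_bdryPoint_le k₁ i₀ t₀)
  rw [tendsto_map'_iff]
  have hfix : Tendsto (fun q : ℝ × ℝ => (k₁, q.2)) (𝓝 (k₁, t₀)) (𝓝 (k₁, t₀)) :=
    Continuous.tendsto (f := fun q : ℝ × ℝ => (k₁, q.2)) (by fun_prop) _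
  have h1 := fun i => (tendsto_integral_norm_frameKernel_sub hk₁ i₀ t₀ i).comp (tendsto_frame_zero k₁ t₀)
  have h := tendsto_finsetSum Finset.univ fun i _ => (h1 i).add ((h1 i).comp hfix)
  simp only [add_zero, Finset.sum_const_zero] at h
  have hpos : ∀ᶠ q : ℝ × ℝ in 𝓝 (k₁, t₀), 0 < q.1 := continuousAt_fst.eventually (lt_mem_nhds hk₁)
  refine squeeze_zero' (Eventually.of_forall fun q => Finset.sum_nonneg fun i _ =>
    intervalIntegral.integral_nonneg Real.two_pi_pos.le fun _ _ => norm_nonneg _) ?_ h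
  filter_upwards [hpos] with q hq
  refine Finset.sum_le_sum fun i _ => ?_
  have hint : ∀ k, 0 < k → ∀ t, IntervalIntegrable (fun τ => P.greenKernel k (P.z i₀ t) i (t + τ)) volume
      (-Real.pi) Real.pi := fun k hk t =>
    intervalIntegrable_shift (periodic_greenKernel _ _ _) (kernelIntegrable_greenKernel hk (P.bdryPoint i₀ t) i) t
  simp only [Function.comp_apply, frameKernel_zero]
  rw [show ((P.bdryPoint i₀ q.2 : frontier P.D₀) : Plane) = P.z i₀ q.2 from rfl,
    ← intervalIntegral_shift (f := fun t => ‖P.greenKernel q.1 (P.z i₀ q.2) i t - P.greenKernel k₁ (P.z i₀ q.2) i t‖)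
    (fun τ => by simp only [periodic_greenKernel _ _ _ τ]) q.2,
    ← intervalIntegral.integral_add ((hint _ hq q.2).sub (hint _ hk₁ t₀)).norm
      ((hint _ hk₁ q.2).sub (hint _ hk₁ t₀)).norm]
  refine intervalIntegral.integral_mono_on (by linarith [Real.pi_pos]) ((hint _ hq q.2).sub (hint _ hk₁ q.2)).norm
    (((hint _ hq q.2).sub (hint _ hk₁ t₀)).norm.add ((hint _ hk₁ q.2).sub (hint _ hk₁ t₀)).norm) fun τ _ => ?_
  have h4 := norm_sub_le (P.greenKernel q.1 (P.z i₀ q.2) i (q.2 + τ) - P.greenKernel k₁ (P.z i₀ t₀) i (t₀ + τ))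
    (P.greenKernel k₁ (P.z i₀ q.2) i (q.2 + τ) - P.greenKernel k₁ (P.z i₀ t₀) i (t₀ + τ))
  rwa [sub_sub_sub_cancel_right] at h4

/-- The layer potential operators on the space of densities depend continuously on the wave number
in the operator norm. -/
theorem exists_layerOperator : ∃ G : ℝ → (P.Density →L[ℂ] P.Density),
    (∀ k, 0 < k → ∀ ψ r, G k ψ r = P.kernelIntegral (P.greenKernel k r) ψ) ∧
    ∀ k, 0 < k → ContinuousAt G k := by
  have hex : ∀ k, ∃ G : P.Density →L[ℂ] P.Density, 0 < k →
      ∀ ψ r, G ψ r = P.kernelIntegral (P.greenKernel k r) ψ := fun k => by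
    by_cases hk : 0 < k
    · obtain ⟨C, hC⟩ := P.exists_greenKernel_integral_bound (kb := k) hk
      have hC := hC k ⟨le_rfl, le_rfl⟩
      have hcont : ∀ ψ : P.Density, Continuous fun r : frontier P.D₀ => P.kernelIntegral (P.greenKernel k r) ψ :=
        fun ψ => continuous_iff_continuousAt.2 fun r => Tendsto.comp (y := 𝓝 (k, r))
          (g := fun q : ℝ × frontier P.D₀ => P.kernelIntegral (P.greenKernel q.1 q.2) ψ)
          (f := fun r : frontier P.D₀ => (k, r)) (tendsto_kernelIntegral_greenKernel hk r ψ)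
          (Continuous.tendsto (f := fun r : frontier P.D₀ => (k, r)) (by fun_prop) r)
      refine ⟨LinearMap.mkContinuous
        { toFun := fun ψ => ⟨_, hcont ψ⟩
          map_add' := fun φ ψ => by ext r; exact kernelIntegral_add (hC r).1 φ ψ
          map_smul' := fun c ψ => by ext r; exact kernelIntegral_smul _ c ψ } |C| fun ψ => ?_,
        fun _ ψ r => rfl⟩
      refine (ContinuousMap.norm_le _ (by positivity)).2 fun r =>
        (norm_kernelIntegral_le (hC r).1 ψ).trans ?_
      gcongr
      exact (hC r).2.trans (le_abs_self C)
    · exact ⟨0, fun h => absurd h hk⟩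
  choose G hG using hex
  refine ⟨G, hG, fun k₁ hk₁ => Metric.tendsto_nhds.2 fun ε hε => ?_⟩
  have h1 := isCompact_univ.eventually_forall_of_forall_eventually (K := (univ : Set (frontier P.D₀)))
    (P := fun k r => ∑ i, ∫ t in (0 : ℝ)..(2 * Real.pi),
      ‖P.greenKernel k r i t - P.greenKernel k₁ r i t‖ < ε / 2) (x₀ := k₁)
    fun r _ => (tendsto_integral_norm_greenKernel_sub hk₁ r).eventually (gt_mem_nhds (half_pos hε))
  filter_upwards [h1, lt_mem_nhds hk₁] with k hk hk0
  rw [dist_eq_norm]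
  refine (ContinuousLinearMap.opNorm_le_bound _ (half_pos hε).le fun ψ => ?_).trans_lt (half_lt_self hε)
  refine (ContinuousMap.norm_le _ (by positivity)).2 fun r => ?_
  have i1 := kernelIntegrable_greenKernel hk0 r
  have i2 := kernelIntegrable_greenKernel hk₁ r
  rw [sub_apply, ContinuousMap.sub_apply, hG k hk0, hG k₁ hk₁, ← kernelIntegral_sub_kernel i1 i2]
  refine (norm_kernelIntegral_le (fun i => (i1 i).sub (i2 i)) ψ).trans ?_
  gcongr
  exact (hk r (mem_univ r)).le

theorem combinedIntegral_quasiGreen {k : ℝ} (hk : 0 < k) (r : frontier P.D₀) (ψ : P.Density) :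
    P.combinedIntegral (fun s => P.quasiGreen k (r.1 - s)) ψ = P.kernelIntegral (P.greenKernel k r) ψ := by
  rw [combinedIntegral_eq]
  refine Finset.sum_congr rfl fun i _ => intervalIntegral.integral_congr_ae ?_
  have hnull : volume {t | P.z i t = r} = 0 := by
    refine Set.Countable.measure_zero ?_ _
    rcases Set.eq_empty_or_nonempty {t | P.z i t = r} with h | ⟨t₀, ht₀⟩
    · rw [h]; exact countable_empty
    · refine (countable_range fun n : ℤ => t₀ + n * (2 * Real.pi)).mono fun t ht => ?_
      obtain ⟨n, hn⟩ := (P.z_simple i i t t₀ (Eq.trans ht (Eq.symm ht₀))).2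
      exact ⟨n, hn.symm⟩
  filter_upwards [compl_mem_ae_iff.2 hnull] with t ht _
  have hx := mem_regularPoints_full_of_reg (sub_mem_regularPoints_reg r.2 (P.z_mem_frontier i t))
    (sub_ne_zero.2 (Ne.symm ht))
  have hev : (fun s => P.quasiGreen k (r.1 - s)) =ᶠ[𝓝 (P.z i t)] fun s => P.greenSum fullWeight k (r.1 - s) :=
    (quasiGreen_eventuallyEq hk hx).comp_tendsto
      (Continuous.tendsto (f := fun s : Plane => r.1 - s) (by fun_prop) (P.z i t))
  have hev0 := hev.self_of_nhds
  dsimp only at hev0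
  rw [greenKernel, combinedKernel, combinedKernel, hev.fderiv_eq, hev0]

/-- The jump relation for the combined layer potential. -/
theorem tendsto_kernelIntegral_framePoint {k : ℝ} (hk : 0 < k) (i₀ : Fin P.m) (t₀ : ℝ) (ψ : P.Density) :
    Tendsto (fun q : ℝ × ℝ => P.kernelIntegral (P.greenKernel k (P.framePoint i₀ q.1 q.2)) ψ)
      (𝓝 t₀ ×ˢ 𝓝[>] 0) (𝓝 (1 / 2 * ψ (P.bdryPoint i₀ t₀) +
        P.kernelIntegral (P.greenKernel k (P.z i₀ t₀)) ψ)) := by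
  obtain ⟨C, hC⟩ := P.exists_frameKernel_control hk
  obtain ⟨s₀, c, C', d, hs₀, hc, -, -, hb⟩ := P.exists_frame_bounds
  have hmap : Tendsto (fun q : ℝ × ℝ => (k, q.1, q.2)) (𝓝 t₀ ×ˢ 𝓝[>] 0) (𝓝[{q | 0 ≤ q.2.2}] (k, t₀, 0)) := by
    have hpos : ∀ᶠ q : ℝ × ℝ in 𝓝 t₀ ×ˢ 𝓝[>] 0, 0 < q.2 :=
      (tendsto_snd (f := 𝓝 t₀)).eventually self_mem_nhdsWithin
    refine tendsto_nhdsWithin_iff.2 ⟨?_, hpos.mono fun q hq => hq.le⟩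
    refine (Continuous.tendsto (f := fun q : ℝ × ℝ => (k, q.1, q.2)) (by fun_prop) (t₀, 0)).mono_left ?_
    rw [nhds_prod_eq]
    exact Filter.prod_mono le_rfl nhdsWithin_le_nhds
  have h1 := tendsto_finsetSum Finset.univ fun i _ =>
    (tendsto_integral_frameKernel_mul hk i₀ t₀ i ψ).comp hmap
  rw [← kernelIntegral_greenKernel] at h1
  refine ((P.tendsto_integral_jumpKernel i₀ t₀ ψ).add h1).congr' ?_
  have hpos : ∀ᶠ q : ℝ × ℝ in 𝓝 t₀ ×ˢ 𝓝[>] 0, q.2 ∈ Ioo 0 s₀ :=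
    (tendsto_snd (f := 𝓝 t₀)).eventually (Ioo_mem_nhdsGT hs₀)
  filter_upwards [hmap.eventually (hC i₀ t₀), hpos] with q hq hs
  have hjump : ∀ i, ContinuousOn (P.jumpKernel i₀ q.1 q.2 i) (uIcc (-Real.pi) Real.pi) := fun i τ hτ => by
    rw [uIcc_of_le (by linarith [Real.pi_pos])] at hτ
    refine (ContinuousAt.comp (x := τ) (f := fun τ => (q.1, q.2, τ))
      (g := fun w : ℝ × ℝ × ℝ => P.jumpKernel i₀ w.1 w.2.1 i w.2.2)
      (continuousAt_jumpKernel fun hi h => ?_) (Continuous.continuousAt (by fun_prop))).continuousWithinAt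
    subst hi
    have h2 := (hb i q.1 q.2 ⟨hs.1.le, hs.2.le⟩ τ (abs_le.2 hτ)).1
    rw [h, norm_zero, zero_pow two_ne_zero] at h2
    have h3 := hs.1
    have : 0 < c * (τ ^ 2 + q.2 ^ 2) := by positivity
    linarith
  have hψ : ∀ i, ContinuousOn (fun τ => ψ (P.bdryPoint i (q.1 + τ))) (uIcc (-Real.pi) Real.pi) := fun i =>
    (ψ.continuous.comp ((P.continuous_bdryPoint i).comp (by fun_prop))).continuousOn
  have hsum : ∑ i, ∫ τ in (-Real.pi)..Real.pi, P.jumpKernel i₀ q.1 q.2 i τ * ψ (P.bdryPoint i (q.1 + τ)) =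
      ∫ τ in (-Real.pi)..Real.pi, P.jumpKernel i₀ q.1 q.2 i₀ τ * ψ (P.bdryPoint i₀ (q.1 + τ)) := by
    refine Finset.sum_eq_single i₀ (fun i _ hi => ?_) fun h => absurd (Finset.mem_univ _) h
    simp [jumpKernel, hi]
  rw [kernelIntegral_greenKernel k _ q.1, ← hsum]
  simp only [Function.comp_apply]
  rw [← Finset.sum_add_distrib]
  refine Finset.sum_congr rfl fun i _ => ?_
  have hfi : IntervalIntegrable (P.frameKernel k i₀ q.1 q.2 i) volume (-Real.pi) Real.pi :=
    intervalIntegrable_of_abs_rpow_bound C fun τ h0 hτ =>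
      ⟨ContinuousAt.comp (x := τ) (f := fun τ => (k, q.1, q.2, τ)) (hq i τ h0 hτ).1
        (Continuous.continuousAt (by fun_prop)), (hq i τ h0 hτ).2⟩
  rw [← intervalIntegral.integral_add (((hjump i).intervalIntegrable).mul_continuousOn (hψ i)) (hfi.mul_continuousOn (hψ i))]
  refine intervalIntegral.integral_congr fun τ _ => ?_
  simp only [frameKernel]
  ring

end ScatteringSetup

theorem exists_continuousLinearEquiv_symm_continuousOn {E : Type*} [NormedAddCommGroup E] [NormedSpace ℂ E]
    [CompleteSpace E] {F : ℝ → (E →L[ℂ] E)} {k₀ : ℝ} (hF : ∀ᶠ k in 𝓝 k₀, ContinuousAt F k)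
    (hbij : Function.Bijective (F k₀)) : ∃ A : ℝ → (E ≃L[ℂ] E),
    (∀ᶠ k in 𝓝 k₀, ContinuousAt (fun k => ((A k).symm : E →L[ℂ] E)) k) ∧
      ∀ᶠ k in 𝓝 k₀, ∀ x, A k x = F k x := by
  have hu₀ : IsUnit (F k₀) := by
    refine ⟨(ContinuousLinearEquiv.unitsEquiv ℂ E).symm (ContinuousLinearEquiv.ofBijective (F k₀)
      (LinearMap.ker_eq_bot.2 hbij.1) (LinearMap.range_eq_top.2 hbij.2)), ?_⟩
    ext x
    rfl
  have hu : ∀ᶠ k in 𝓝 k₀, IsUnit (F k) := hF.self_of_nhds.eventually (Units.isOpen.mem_nhds hu₀)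
  classical
  set A : ℝ → (E ≃L[ℂ] E) := fun k =>
    if h : IsUnit (F k) then ContinuousLinearEquiv.unitsEquiv ℂ E h.unit else ContinuousLinearEquiv.refl ℂ E with hA
  have hA1 : ∀ k (h : IsUnit (F k)), A k = ContinuousLinearEquiv.unitsEquiv ℂ E h.unit := fun k h => dif_pos h
  have hA2 : ∀ k, IsUnit (F k) → ((A k).symm : E →L[ℂ] E) = Ring.inverse (F k) := fun k h => by
    have h1 := Ring.inverse_unit h.unit
    rw [h.unit_spec] at h1
    rw [hA1 k h, h1]
    rfl
  refine ⟨A, ?_, hu.mono fun k h x => by rw [hA1 k h]; rfl⟩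
  filter_upwards [hF, hu.eventually_nhds] with k h1 h2
  have h3 := NormedRing.inverse_continuousAt h2.self_of_nhds.unit
  refine (ContinuousAt.comp (f := F) (g := Ring.inverse) h3 h1).congr ?_
  filter_upwards [h2] with k' h4 using (hA2 k' h4).symm

namespace ScatteringSetup

variable {P : ScatteringSetup}

/-! ### The boundary operators -/

theorem norm_mode_le (n : ℤ) (k : ℝ) : ‖P.mode n k‖ ≤ Real.exp (-(P.yMin * (P.βn n k).im)) := by
  refine (ContinuousMap.norm_le _ (Real.exp_pos _).le).2 fun r => ?_
  have h : P.mode n k r = P.planeWave 1 k n r := by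
    rw [planeWave]; simp [mode]
  rw [h, norm_planeWave, one_mul]
  exact Real.exp_le_exp.2 (neg_le_neg (mul_le_mul_of_nonneg_right (yMin_le (frontier_subset r.2))
    (P.βn_im_nonneg n k)))

variable (P) in
theorem continuous_mode (n : ℤ) : Continuous (P.mode n) := by
  have h1 := P.continuous_αn n
  have h2 := P.continuous_βn n
  refine ContinuousMap.continuous_of_continuous_uncurry _ ?_
  simp only [mode, Function.uncurry_def, ContinuousMap.coe_mk]
  fun_prop

variable (P) in
theorem continuous_uinc : Continuous P.uinc := by
  refine ContinuousMap.continuous_of_continuous_uncurry _ ?_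
  simp only [uinc, α, Function.uncurry_def, ContinuousMap.coe_mk]
  fun_prop

variable (P) in
theorem continuous_σn (n : ℤ) : Continuous (P.σn n) := by
  have h2 := P.continuous_βn n
  unfold σn
  fun_prop

variable (P) in
/-- The functional `I⁺_{n,k}` as a continuous linear map. -/
noncomputable def IplusL (n : ℤ) (k : ℝ) : P.Density →L[ℂ] ℂ :=
  LinearMap.mkContinuous
    { toFun := P.Iplus n k
      map_add' := fun φ ψ => by
        simp only [Iplus_eq, modeIntegral, combinedIntegral_eq]
        exact kernelIntegral_add (kernelIntegrable_combinedKernel fun q _ => contDiffAt_planeWave_neg 1 k n q) φ ψ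
      map_smul' := fun c ψ => by
        simp only [Iplus_eq, modeIntegral, combinedIntegral_eq]
        exact kernelIntegral_smul _ c ψ }
    ((3 * |k| + 2 * (2 * Real.pi / P.L) + P.γ) * (1 + |(n : ℝ)|) *
      Real.exp (P.yMax * (P.βn n k).im) * P.boundaryLength) (norm_Iplus_le n k)

@[simp]
theorem IplusL_apply (n : ℤ) (k : ℝ) (ψ : P.Density) : P.IplusL n k ψ = P.Iplus n k ψ := rfl

theorem norm_IplusL_le (n : ℤ) (k : ℝ) : ‖P.IplusL n k‖ ≤
    (3 * |k| + 2 * (2 * Real.pi / P.L) + P.γ) * (1 + |(n : ℝ)|) *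
      Real.exp (P.yMax * (P.βn n k).im) * P.boundaryLength := by
  have := P.L_pos
  have := P.γ_nonneg
  have := P.boundaryLength_nonneg
  exact LinearMap.mkContinuous_norm_le _ (by positivity) _

variable (P) in
theorem continuous_IplusL (n : ℤ) : Continuous (P.IplusL n) := by
  have h1 := P.continuous_αn n
  have h2 := P.continuous_βn n
  have hK : ∀ i, Continuous fun q : ℝ × ℝ =>
      P.combinedKernel (fun x => P.planeWave 1 q.1 n (-x)) i q.2 := fun i => by
    have hz := P.continuous_z i
    have hz' := P.continuous_deriv_z i
    have hn := P.continuous_normal i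
    simp only [combinedKernel, fderiv_planeWave_neg_apply]
    simp only [planeWave]
    generalize P.normal i = ν at hn ⊢
    generalize deriv (P.z i) = z' at hz' ⊢
    fun_prop
  refine continuous_iff_continuousAt.2 fun k₁ => tendsto_iff_norm_sub_tendsto_zero.2 ?_
  have hcont : Continuous fun k => ∑ i, ∫ t in (0 : ℝ)..(2 * Real.pi),
      ‖P.combinedKernel (fun x => P.planeWave 1 k n (-x)) i t -
        P.combinedKernel (fun x => P.planeWave 1 k₁ n (-x)) i t‖ := by
    refine continuous_finsetSum _ fun i _ =>
      intervalIntegral.continuous_parametric_intervalIntegral_of_continuous' ?_ _ _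
    have h3 := hK i
    have h4 : Continuous fun q : ℝ × ℝ => P.combinedKernel (fun x => P.planeWave 1 k₁ n (-x)) i q.2 :=
      h3.comp (f := fun q : ℝ × ℝ => (k₁, q.2)) (by fun_prop)
    exact (h3.sub h4).norm
  have h0 := hcont.tendsto k₁
  simp only [sub_self, norm_zero, intervalIntegral.integral_zero, Finset.sum_const_zero] at h0
  refine squeeze_zero (fun _ => norm_nonneg _) (fun k => ContinuousLinearMap.opNorm_le_bound _
    (Finset.sum_nonneg fun i _ => intervalIntegral.integral_nonneg Real.two_pi_pos.le fun _ _ => norm_nonneg _)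
    fun ψ => ?_) h0
  have i1 : ∀ k, P.KernelIntegrable (P.combinedKernel fun x => P.planeWave 1 k n (-x)) := fun k =>
    kernelIntegrable_combinedKernel fun q _ => contDiffAt_planeWave_neg 1 k n q
  rw [sub_apply, IplusL_apply, IplusL_apply, Iplus_eq, Iplus_eq, modeIntegral, modeIntegral,
    combinedIntegral_eq, combinedIntegral_eq, ← kernelIntegral_sub_kernel (i1 k) (i1 k₁)]
  exact norm_kernelIntegral_le (fun i => (i1 k i).sub (i1 k₁ i)) ψ

variable (P) in
/-- The term of the `n`-th mode in the hybrid integral equation. -/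
noncomputable def modalTerm (n : ℤ) (k : ℝ) : P.Density →L[ℂ] P.Density :=
  (-(Complex.I / (2 * P.L)) * P.σn n k / P.βn n k) • (P.IplusL n k).smulRight (P.mode n k)

theorem modalTerm_apply (n : ℤ) (k : ℝ) (ψ : P.Density) :
    P.modalTerm n k ψ = (-(Complex.I / (2 * P.L)) * P.σn n k / P.βn n k * P.Iplus n k ψ) • P.mode n k := by
  rw [modalTerm, smul_apply, ContinuousLinearMap.smulRight_apply, smul_smul, IplusL_apply]

theorem continuousAt_modalTerm {n : ℤ} {k : ℝ} (h : P.βn n k ≠ 0) : ContinuousAt (P.modalTerm n) k := by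
  have h1 := (P.continuous_σn n).continuousAt (x := k)
  have h2 := (P.continuous_βn n).continuousAt (x := k)
  have h3 := (ContinuousLinearMap.smulRightL ℂ P.Density P.Density).continuous₂.comp
    ((P.continuous_IplusL n).prodMk (P.continuous_mode n))
  exact ((continuousAt_const.mul h1).div h2 h).smul (h3.continuousAt (x := k))

variable (P) in
theorem exists_norm_modalTerm_le (K m : ℝ) (hm : 0 < m) : ∃ u : ℤ → ℝ, Summable u ∧ ∀ n k, |k| ≤ K →
    m ≤ ‖P.βn n k‖ → ‖P.modalTerm n k‖ ≤ u n := by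
  have hL := P.L_pos
  have hγ := P.γ_nonneg
  have hb := P.boundaryLength_nonneg
  set d := P.yMin - (P.yMax - P.h) with hd
  have hd0 : 0 < d := sub_pos.2 P.yMax_sub_lt_yMin
  set S := ∑ l ∈ Finset.range P.j, ‖P.shiftCoeff (l + 1)‖ with hS
  have hS0 : 0 ≤ S := Finset.sum_nonneg fun _ _ => norm_nonneg _
  set c := 2 * Real.pi / P.L with hc
  have hc0 : 0 < c := by positivity
  set C := 1 / (2 * P.L) * S / m * ((3 * K + 2 * c + P.γ) * P.boundaryLength) * Real.exp (d * (2 * K)) with hC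
  refine ⟨fun n => C * ((1 + |(n : ℝ)|) * Real.exp (-(d * c) * |(n : ℝ)|)),
    (summable_one_add_abs_mul_exp (by positivity)).mul_left _, fun n k hk hβ => ?_⟩
  have hK : 0 ≤ K := (abs_nonneg k).trans hk
  rw [modalTerm, norm_smul, ContinuousLinearMap.norm_smulRight_apply]
  set b := (P.βn n k).im with hbdef
  have h1 : ‖-(Complex.I / (2 * P.L)) * P.σn n k / P.βn n k‖ ≤ 1 / (2 * P.L) * (S * Real.exp (-(b * P.h))) / m := by
    rw [norm_div, norm_mul, norm_neg]
    have : ‖Complex.I / (2 * (P.L : ℂ))‖ = 1 / (2 * P.L) := by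
      simp [abs_of_pos hL]
    rw [this]
    gcongr
    exact P.norm_σn_le n k
  have h2 : ‖P.IplusL n k‖ ≤ (3 * K + 2 * c + P.γ) * (1 + |(n : ℝ)|) * Real.exp (P.yMax * b) * P.boundaryLength :=
    (norm_IplusL_le n k).trans (by gcongr)
  have h3 : Real.exp (-(b * P.h)) * Real.exp (P.yMax * b) * Real.exp (-(P.yMin * b)) ≤
      Real.exp (d * (2 * K)) * Real.exp (-(d * c) * |(n : ℝ)|) := by
    rw [← Real.exp_add, ← Real.exp_add, ← Real.exp_add, Real.exp_le_exp]
    have := mul_le_mul_of_nonneg_left (P.le_βn_im n k) hd0.le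
    have h5 : d * (2 * |k|) ≤ d * (2 * K) := by gcongr
    have h6 : -(b * P.h) + P.yMax * b + -(P.yMin * b) = -(d * b) := by rw [hd]; ring
    rw [h6]
    linarith
  calc _ ≤ (1 / (2 * P.L) * (S * Real.exp (-(b * P.h))) / m) * (((3 * K + 2 * c + P.γ) * (1 + |(n : ℝ)|) *
        Real.exp (P.yMax * b) * P.boundaryLength) * Real.exp (-(P.yMin * b))) := by
        gcongr
        exact norm_mode_le n k
    _ = 1 / (2 * P.L) * S / m * ((3 * K + 2 * c + P.γ) * P.boundaryLength) * (1 + |(n : ℝ)|) *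
        (Real.exp (-(b * P.h)) * Real.exp (P.yMax * b) * Real.exp (-(P.yMin * b))) := by ring
    _ ≤ 1 / (2 * P.L) * S / m * ((3 * K + 2 * c + P.γ) * P.boundaryLength) * (1 + |(n : ℝ)|) *
        (Real.exp (d * (2 * K)) * Real.exp (-(d * c) * |(n : ℝ)|)) := by gcongr
    _ = _ := by rw [hC]; ring

theorem summable_modalTerm (s : Set ℤ) {k m : ℝ} (hm : 0 < m) (h : ∀ n ∈ s, m ≤ ‖P.βn n k‖) :
    Summable fun n : s => P.modalTerm n k := by
  obtain ⟨u, hu, hb⟩ := P.exists_norm_modalTerm_le |k| m hm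
  exact Summable.of_norm_bounded (hu.subtype s) fun n => hb n k le_rfl (h n n.2)

theorem hasSum_modalTerm_apply {s : Set ℤ} {k : ℝ} (h : Summable fun n : s => P.modalTerm n k)
    (ψ : P.Density) (r : frontier P.D₀) :
    HasSum (fun n : s => -(Complex.I / (2 * P.L)) * (P.σn n k * (P.Iplus n k ψ / P.βn n k) * P.mode n k r))
      ((∑' n : s, P.modalTerm n k) ψ r) := by
  have h1 := h.hasSum.mapL ((ContinuousMap.evalCLM ℂ r).comp (ContinuousLinearMap.apply ℂ P.Density ψ))
  refine h1.congr_fun ?_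
  intro n
  simp [modalTerm_apply]
  ring

theorem exists_opA {k₀ : ℝ} (hk₀ : 0 < k₀) : ∃ F : ℝ → (P.Density →L[ℂ] P.Density),
    (∀ᶠ k in 𝓝 k₀, ContinuousAt F k) ∧ ∀ᶠ k in 𝓝 k₀, ∀ ψ r, F k ψ r = P.opA k₀ k ψ r := by
  obtain ⟨G, hG, hGc⟩ := P.exists_layerOperator
  obtain ⟨m, hm, hmk⟩ := P.exists_le_norm_βn k₀
  obtain ⟨u, hu, hub⟩ := P.exists_norm_modalTerm_le (|k₀| + 1) m hm
  have hK : ∀ᶠ k in 𝓝 k₀, |k| < |k₀| + 1 := continuous_abs.continuousAt.eventually (gt_mem_nhds (by linarith))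
  refine ⟨fun k => (1 / 2 : ℂ) • ContinuousLinearMap.id ℂ P.Density + G k +
    ∑' n : ↥(P.Nwa k₀)ᶜ, P.modalTerm n k, ?_, ?_⟩
  · filter_upwards [hmk.eventually_nhds, hK.eventually_nhds, lt_mem_nhds hk₀] with k h1 h2 h3
    refine (continuousAt_const.add (hGc k h3)).add ?_
    have h4 : {κ | (∀ n ∉ P.Nwa k₀, m ≤ ‖P.βn n κ‖) ∧ |κ| < |k₀| + 1} ∈ 𝓝 k := h1.and h2
    refine ContinuousOn.continuousAt (continuousOn_tsum
      (f := fun (n : ↥(P.Nwa k₀)ᶜ) k => P.modalTerm n k) (s := {κ | (∀ n ∉ P.Nwa k₀, m ≤ ‖P.βn n κ‖) ∧ |κ| < |k₀| + 1}) (fun n κ hκ => ?_) (hu.subtype (P.Nwa k₀)ᶜ)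
      fun n κ hκ => hub n κ hκ.2.le (hκ.1 n n.2)) h4
    exact (continuousAt_modalTerm (norm_pos_iff.1 (hm.trans_le (hκ.1 n n.2)))).continuousWithinAt
  · filter_upwards [hmk, lt_mem_nhds hk₀] with k h1 h3 ψ r
    have hs := hasSum_modalTerm_apply (summable_modalTerm (P.Nwa k₀)ᶜ hm h1) ψ r
    rw [opA, combinedIntegral_quasiGreen h3, ← hG k h3, sub_eq_add_neg, ← neg_mul, ← tsum_mul_left, hs.tsum_eq]
    rfl

theorem exists_opA_equiv {k₀ : ℝ} (hk₀ : 0 < k₀) (hA : P.OpAInvertible k₀) :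
    ∃ A : ℝ → (P.Density ≃L[ℂ] P.Density),
      (∀ᶠ k in 𝓝 k₀, ContinuousAt (fun k => ((A k).symm : P.Density →L[ℂ] P.Density)) k) ∧
      ∀ᶠ k in 𝓝 k₀, ∀ ψ r, A k ψ r = P.opA k₀ k ψ r := by
  obtain ⟨F, hF, hFA⟩ := P.exists_opA hk₀
  have hF0 := hFA.self_of_nhds
  obtain ⟨A, h1, h2⟩ := exists_continuousLinearEquiv_symm_continuousOn hF
    ⟨fun φ ψ h => (hA (F k₀ φ)).unique (fun r => (hF0 φ r).symm) fun r => by rw [h, hF0],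
      fun f => (hA f).exists.imp fun ψ hψ => by ext r; rw [hF0, hψ]⟩
  refine ⟨A, h1, ?_⟩
  filter_upwards [h2, hFA] with k h3 h4 ψ r
  rw [h3, h4]

end ScatteringSetup

theorem eq_zero_of_hasSum_exp_eq_zero {L : ℝ} (hL : 0 < L) {d : ℤ → ℂ}
    (h : ∀ x : ℝ, HasSum (fun n : ℤ => d n * Complex.exp (Complex.I * (2 * Real.pi / L * n) * x)) 0) (m : ℤ) :
    d m = 0 := by
  have hs : Summable fun n => ‖d n‖ := by
    have := (h 0).summable.norm
    simpa using this
  have hLc : (L : ℂ) ≠ 0 := by exact_mod_cast hL.ne'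
  have hn : ∀ (n : ℤ) (x : ℝ), ‖Complex.exp (Complex.I * (2 * Real.pi / L * (n - m)) * x)‖ = 1 := fun n x => by
    have := Complex.norm_exp_ofReal_mul_I (2 * Real.pi / L * (n - m) * x)
    rw [← this]; congr 2; push_cast; ring
  have h1 := intervalIntegral.hasSum_integral_of_dominated_convergence (μ := volume) (a := 0) (b := L)
    (F := fun (n : ℤ) (x : ℝ) => d n * Complex.exp (Complex.I * (2 * Real.pi / L * (n - m)) * x))
    (f := fun _ => (0 : ℂ)) (fun n _ => ‖d n‖)
    (fun n => Continuous.aestronglyMeasurable (by fun_prop))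
    (fun n => Eventually.of_forall fun x _ => by rw [norm_mul, hn, mul_one])
    (Eventually.of_forall fun x _ => hs) intervalIntegrable_const (Eventually.of_forall fun x _ => by
      have := (h x).mul_right (Complex.exp (-(Complex.I * (2 * Real.pi / L * m) * x)))
      rw [zero_mul] at this
      refine this.congr_fun fun n => ?_
      rw [mul_assoc (d n), ← Complex.exp_add]
      congr 2; ring)
  have h2 : ∀ n : ℤ, n ≠ m → ∫ x in (0 : ℝ)..L, d n * Complex.exp (Complex.I * (2 * Real.pi / L * (n - m)) * x) = 0 := by
    intro n hnm
    have hnm' : (n : ℂ) - m ≠ 0 := sub_ne_zero.2 (by exact_mod_cast hnm)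
    have hc : Complex.I * (2 * Real.pi / L * (n - m)) ≠ 0 := by
      have : (Real.pi : ℂ) ≠ 0 := by exact_mod_cast Real.pi_ne_zero
      exact mul_ne_zero Complex.I_ne_zero (mul_ne_zero (div_ne_zero (mul_ne_zero two_ne_zero this) hLc) hnm')
    rw [intervalIntegral.integral_const_mul, integral_exp_mul_complex hc]
    have : Complex.I * (2 * Real.pi / L * (n - m)) * L = ((n - m : ℤ) : ℂ) * (2 * Real.pi * Complex.I) := by
      push_cast; field_simp
    rw [this, Complex.exp_int_mul_two_pi_mul_I]
    simp
  have h3 := h1.unique (hasSum_single m h2)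
  simp only [sub_self, mul_zero, zero_mul, Complex.exp_zero, mul_one, intervalIntegral.integral_const,
    sub_zero, smul_zero, Complex.real_smul] at h3
  exact (mul_eq_zero.1 h3.symm).resolve_left hLc

namespace ScatteringSetup

variable {P : ScatteringSetup}

/-! ### Uniqueness of the coefficients of the Wood modes -/

theorem planeWave_add (s k : ℝ) (n m : ℤ) (p : Plane) : P.planeWave s k n (p + !₂[(m : ℝ) * P.L, 0]) =
    Complex.exp (Complex.I * P.α k * m * P.L) * P.planeWave s k n p := by
  have hL : (P.L : ℂ) ≠ 0 := by exact_mod_cast P.L_pos.ne'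
  rw [planeWave, planeWave, ← Complex.exp_add, Complex.exp_eq_exp_iff_exists_int]
  refine ⟨n * m, ?_⟩
  simp [αn]
  field_simp
  ring

theorem add_shift (p : Plane) (a b : ℤ) :
    p + !₂[(a : ℝ) * P.L, 0] + !₂[(b : ℝ) * P.L, 0] = p + !₂[((a + b : ℤ) : ℝ) * P.L, 0] := by
  ext i; fin_cases i <;> simp; ring

theorem mem_array_add {p : Plane} {m : ℤ} : p + !₂[(m : ℝ) * P.L, 0] ∈ P.array ↔ p ∈ P.array := by
  constructor
  · rintro ⟨n, hn⟩
    exact ⟨m + n, by rwa [add_shift] at hn⟩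
  · rintro ⟨n, hn⟩
    refine ⟨n - m, ?_⟩
    rwa [add_shift, add_sub_cancel]

theorem subset_array : P.D₀ ⊆ P.array := fun p hp => ⟨0, by
  have : (!₂[((0 : ℤ) : ℝ) * P.L, 0] : Plane) = 0 := by ext i; fin_cases i <;> simp
  rwa [this, add_zero]⟩

theorem yMin_le_of_mem_array {p : Plane} (hp : p ∈ P.array) : P.yMin ≤ p 1 := by
  obtain ⟨n, hn⟩ := hp
  simpa using yMin_le hn

theorem le_yMax_of_mem_array {p : Plane} (hp : p ∈ P.array) : p 1 ≤ P.yMax := by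
  obtain ⟨n, hn⟩ := hp
  simpa using le_yMax hn

variable (P) in
theorem isClosed_array : IsClosed P.array := by
  have h : P.array = ⋃ n : ℤ, (fun p : Plane => p + !₂[(n : ℝ) * P.L, 0]) ⁻¹' P.D₀ := by
    ext p; simp [array]
  rw [h]
  refine LocallyFinite.isClosed_iUnion (fun p => ?_) fun n =>
    P.compact_D₀.isClosed.preimage (continuous_add_const _)
  obtain ⟨R, hR⟩ := P.compact_D₀.isBounded.exists_norm_le
  refine ⟨Metric.ball p 1, Metric.ball_mem_nhds p one_pos,
    (finite_setOf_abs_mul_lt P.L_pos (R + ‖p‖ + 2)).subset ?_⟩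
  rintro n ⟨q, hq1, hq2⟩ hn
  have h1 := (abs_apply_le_norm _ 0).trans (hR _ hq1)
  have h2 := abs_apply_le_norm (q - p) 0
  rw [mem_ball_iff_norm] at hq2
  have h3 := abs_apply_le_norm p 0
  simp only [PiLp.add_apply, PiLp.sub_apply, Matrix.cons_val_zero] at h1 h2
  have h4 : |(n : ℝ)| * P.L = |(n : ℝ) * P.L| := by rw [abs_mul, abs_of_pos P.L_pos]
  have h5 : |(n : ℝ) * P.L| ≤ |q 0 + n * P.L| + |q 0 - p 0| + |p 0| := by
    have := abs_sub (q 0 + n * P.L) (q 0)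
    have h6 := abs_add_le (q 0 - p 0) (p 0)
    rw [add_sub_cancel_left] at this
    rw [sub_add_cancel] at h6
    linarith
  linarith

theorem hybridPotential_add {k : ℝ} (hk : 0 < k) (ψ : P.Density) {p : Plane} (hp : p ∈ P.arrayᶜ)
    (hp1 : P.yMax - P.h < p 1) (m : ℤ) : P.hybridPotential k ψ (p + !₂[(m : ℝ) * P.L, 0]) =
      Complex.exp (Complex.I * P.α k * m * P.L) * P.hybridPotential k ψ p := by
  rw [hybridPotential, hybridPotential, mul_sub, ← tsum_mul_left]
  congr 1
  · have hreg : ∀ q ∈ frontier P.D₀, p - q ∈ P.regularPoints fullWeight := fun q hq =>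
      sub_mem_regularPoints hp hp1 hq
    rw [← combinedIntegral_const_mul _ fun q hq => ?_]
    · refine combinedIntegral_congr (fun q hq => ?_) ψ
      have hc : ContinuousAt (fun s : Plane => p - s) q := by fun_prop
      filter_upwards [hc.eventually_mem ((isOpen_regularPoints _).mem_nhds (hreg q hq))] with s hs
      have e : p + !₂[(m : ℝ) * P.L, 0] - s = p - s + !₂[(m : ℝ) * P.L, 0] := by abel
      rw [e, ← quasiGreen_eq_greenSum hk (regularPoints_full_add hs m), quasiGreen_add,
        quasiGreen_eq_greenSum hk hs]
    · exact (contDiffAt_greenSum hk (hreg q hq) finite_fullWeight 1).comp q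
        (contDiff_const.sub contDiff_id).contDiffAt
  · refine tsum_congr fun n => ?_
    rw [planeWave_add]; ring

theorem tendsto_hybridPotential {k : ℝ} (hk : 0 < k) (ψ : P.Density) (r : frontier P.D₀) :
    Tendsto (P.hybridPotential k ψ) (𝓝[P.D₀ᶜ] r) (𝓝 (P.opA k k ψ r)) := by
  have hR : ContinuousAt (fun p => ∑' n : ℤ, P.reflectedCoeff k n * P.Iplus n k ψ * P.planeWave 1 k n p) r :=
    ((holSeries_reflected k ψ (yMax_sub_lt r.2)).contDiffAt_tsum (mem_singleton k) 0).continuousAt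
  have hA : P.opA k k ψ r = 1 / 2 * ψ r + P.kernelIntegral (P.greenKernel k r) ψ -
      ∑' n : ℤ, P.reflectedCoeff k n * P.Iplus n k ψ * P.planeWave 1 k n r := by
    rw [opA, combinedIntegral_quasiGreen hk, ← tsum_mul_left]
    congr 1
    rw [← tsum_subtype_eq_of_support_subset (s := (P.Nwa k)ᶜ) fun n hn hn' =>
      hn (by simp [reflectedCoeff, show P.βn n k = 0 from hn'])]
    refine tsum_congr fun n => ?_
    have hn : P.βn n k ≠ 0 := n.2
    rw [reflectedCoeff, if_neg hn, planeWave]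
    simp only [mode, ContinuousMap.coe_mk, Complex.ofReal_one, one_mul]
    field_simp
  rw [hA]
  refine Tendsto.sub ?_ (hR.tendsto.mono_left nhdsWithin_le_nhds)
  obtain ⟨i₀, t₀, rfl⟩ := P.exists_bdryPoint r
  intro s hs
  rw [mem_map]
  filter_upwards [P.eventually_exists_normal_coordinates i₀ t₀
    (P.tendsto_kernelIntegral_framePoint hk i₀ t₀ ψ hs)] with p hp
  obtain ⟨q, hq, rfl⟩ := hp
  rw [mem_preimage, combinedIntegral_eq]
  exact hq

theorem holSeries_wood (k : ℝ) {c : ℤ → ℂ} (hc : ∀ n ∉ P.Nwa k, c n = 0) (s : ℝ) (p : Plane) :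
    HolSeries {k} (fun _ n p => c n * P.planeWave s k n p) p :=
  HolSeries.of_finite (P.finite_Nwa k) (F := fun n z => c n *
    Complex.exp (Complex.I * P.αn n k * z.1 + s * Complex.I * P.βn n k * z.2))
    (fun n => by fun_prop) (fun n hn z => by simp [hc n hn]) fun n p => rfl

theorem contDiffAt_helm_series {k s : ℝ} (hs : s ^ 2 = 1) {c : ℤ → ℂ} {p : Plane}
    (h : HolSeries {k} (fun _ n p => c n * P.planeWave s k n p) p) :
    ContDiffAt ℝ 2 (fun p => ∑' n, c n * P.planeWave s k n p) p ∧
      helm k (fun p => ∑' n, c n * P.planeWave s k n p) p = 0 :=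
  ⟨h.contDiffAt_tsum (mem_singleton k) 2, h.helm_tsum (mem_singleton k) k fun n => by
    rw [helm_const_mul _ ((P.contDiff_planeWave s k n).contDiffAt.of_le (WithTop.coe_le_coe.2 le_top)),
      P.helm_planeWave hs, mul_zero]⟩

theorem contDiffAt_helm_sub {k : ℝ} {f g : Plane → ℂ} {p : Plane} (hf : ContDiffAt ℝ 2 f p ∧ helm k f p = 0)
    (hg : ContDiffAt ℝ 2 g p ∧ helm k g p = 0) :
    ContDiffAt ℝ 2 (fun p => f p - g p) p ∧ helm k (fun p => f p - g p) p = 0 := by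
  refine ⟨hf.1.sub hg.1, ?_⟩
  have h : (fun p => f p - g p) = fun p => f p + (-1) * g p := by ext q; ring
  rw [h, helm_add hf.1 (contDiffAt_const.mul hg.1), helm_const_mul _ hg.1, hf.2, hg.2, mul_zero, add_zero]

/-- A density without Wood mode moments whose image under `A` is a combination of Wood modes has
image zero. -/
theorem woodCoeff_eq_zero {k : ℝ} (hk : 0 < k) (hU : P.UniqueRadiating k) {ψ : P.Density}
    (hI : ∀ n, P.βn n k = 0 → P.Iplus n k ψ = 0) {c : ℤ → ℂ} (hc : ∀ n ∉ P.Nwa k, c n = 0)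
    (h : ∀ r : frontier P.D₀, P.opA k k ψ r = ∑' n, c n * P.planeWave 1 k n r) (n : ℤ) : c n = 0 := by
  classical
  set H := P.hybridPotential k ψ with hH
  set B : Plane → ℂ := fun p => ∑' n, P.belowCoeff k ψ n * P.planeWave (-1) k n p with hB
  set W : Plane → ℂ := fun p => ∑' n, c n * P.planeWave 1 k n p with hW
  set u : Plane → ℂ := fun p => if P.yMax - P.h < p 1 then H p else B p with hu
  set v : Plane → ℂ := fun p => if p ∈ P.array then 0 else u p - W p with hv
  have hopen : IsOpen P.arrayᶜ := P.isClosed_array.isOpen_compl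
  have hW2 : ∀ p, W p = ∑' n, c n * P.planeWave (-1) k n p := fun p => tsum_congr fun n => by
    by_cases hn : n ∈ P.Nwa k
    · rw [planeWave, planeWave, show P.βn n k = 0 from hn]; simp
    · rw [hc n hn, zero_mul, zero_mul]
  have hvu : ∀ p ∈ P.arrayᶜ, v p = u p - W p := fun p hp => if_neg hp
  have huH : ∀ p : Plane, P.yMax - P.h < p 1 → u p = H p := fun p hp => if_pos hp
  have huB : ∀ p : Plane, p 1 < P.yMin → u p = B p := fun p hp => by
    by_cases h1 : P.yMax - P.h < p 1
    · rw [huH p h1]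
      exact (hasSum_hybridPotential_below hk hI h1 hp).tsum_eq.symm
    · exact if_neg h1
  have hy : Continuous fun p : Plane => p 1 := by fun_prop
  have hreg : ∀ p ∈ P.arrayᶜ, ContDiffAt ℝ 2 v p ∧ helm k v p = 0 := by
    intro p hp
    have key : ∀ f : Plane → ℂ, u =ᶠ[𝓝 p] f → ContDiffAt ℝ 2 f p ∧ helm k f p = 0 →
        ContDiffAt ℝ 2 v p ∧ helm k v p = 0 := by
      intro f hf h1
      have h2 := contDiffAt_helm_sub h1 (contDiffAt_helm_series (by norm_num) (holSeries_wood k hc 1 p))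
      have h3 : v =ᶠ[𝓝 p] fun p => f p - W p := by
        filter_upwards [hopen.mem_nhds hp, hf] with q hq1 hq2
        rw [hvu q hq1, hq2]
      exact ⟨h2.1.congr_of_eventuallyEq h3, (helm_congr h3).trans h2.2⟩
    by_cases h1 : P.yMax - P.h < p 1
    · exact key H ((hy.continuousAt.eventually (lt_mem_nhds h1)).mono huH)
        ⟨contDiffAt_hybridPotential hk ψ hp h1, helm_hybridPotential hk ψ hp h1⟩
    · have h2 : p 1 < P.yMin := (not_lt.1 h1).trans_lt P.yMax_sub_lt_yMin
      refine key B ((hy.continuousAt.eventually (gt_mem_nhds h2)).mono huB)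
        (contDiffAt_helm_series (by norm_num) ((holSeries_below k ψ h2).congr fun k' hk' n p => ?_))
      rw [mem_singleton_iff.1 hk']
  have hqp : ∀ p, ∀ m : ℤ, v (p + !₂[(m : ℝ) * P.L, 0]) = Complex.exp (Complex.I * P.α k * m * P.L) * v p := by
    intro p m
    by_cases hp : p ∈ P.array
    · simp only [hv]
      rw [if_pos hp, if_pos (mem_array_add.2 hp), mul_zero]
    · have hp' : p + !₂[(m : ℝ) * P.L, 0] ∈ P.arrayᶜ := fun h => hp (mem_array_add.1 h)
      have hWm : W (p + !₂[(m : ℝ) * P.L, 0]) = Complex.exp (Complex.I * P.α k * m * P.L) * W p := by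
        simp only [hW]
        rw [← tsum_mul_left]
        exact tsum_congr fun n => by rw [planeWave_add]; ring
      have hy1 : (p + !₂[(m : ℝ) * P.L, 0]) 1 = p 1 := by simp
      rw [hvu p hp, hvu _ hp', hWm, mul_sub]
      congr 1
      by_cases h1 : P.yMax - P.h < p 1
      · rw [huH p h1, huH _ (by rwa [hy1])]
        exact hybridPotential_add hk ψ hp h1 m
      · have h2 : p 1 < P.yMin := (not_lt.1 h1).trans_lt P.yMax_sub_lt_yMin
        rw [huB p h2, huB _ (by rwa [hy1])]
        simp only [hB]
        rw [← tsum_mul_left]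
        exact tsum_congr fun n => by rw [planeWave_add]; ring
  have hbd : ∀ r : frontier P.D₀, Tendsto v (𝓝 (r : Plane)) (𝓝 0) := by
    intro r
    have h1 : Tendsto (fun p => H p - W p) (𝓝[P.D₀ᶜ] (r : Plane)) (𝓝 0) := by
      have h2 := (contDiffAt_helm_series (by norm_num) (holSeries_wood k hc 1 (r : Plane))).1.continuousAt
      have h3 := (tendsto_hybridPotential hk ψ r).sub (h2.tendsto.mono_left nhdsWithin_le_nhds)
      rwa [h r, sub_self] at h3
    rw [Metric.tendsto_nhds] at h1 ⊢
    intro ε hε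
    filter_upwards [eventually_nhdsWithin_iff.1 (h1 ε hε),
      hy.continuousAt.eventually (lt_mem_nhds (yMax_sub_lt r.2))] with p hp1 hp2
    by_cases hp : p ∈ P.array
    · simp only [hv]
      rwa [if_pos hp, dist_self]
    · rw [hvu p hp, huH p hp2]
      exact hp1 fun hD => hp (subset_array hD)
  have hcont : ContinuousOn v (closure P.arrayᶜ) := by
    intro p hp
    by_cases hpa : p ∈ P.array
    · obtain ⟨m, hm⟩ := hpa
      have hfr : p + !₂[(m : ℝ) * P.L, 0] ∈ frontier P.D₀ := by
        refine ⟨subset_closure hm, fun hi => ?_⟩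
        have hc1 : Continuous fun q : Plane => q + !₂[(m : ℝ) * P.L, 0] := by fun_prop
        obtain ⟨q, hq1, hq2⟩ := mem_closure_iff_nhds.1 hp _
          (hc1.continuousAt.preimage_mem_nhds (mem_interior_iff_mem_nhds.1 hi))
        exact hq2 ⟨m, hq1⟩
      have hc1 : Continuous fun q : Plane => q + !₂[(m : ℝ) * P.L, 0] := by fun_prop
      have h1 := (hbd ⟨_, hfr⟩).comp (hc1.tendsto p)
      have h2 : Tendsto v (𝓝 p) (𝓝 0) := by
        rw [← mul_zero (Complex.exp (-(Complex.I * P.α k * m * P.L)))]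
        refine (h1.const_mul _).congr fun q => ?_
        rw [Function.comp_apply, hqp, ← mul_assoc, ← Complex.exp_add, neg_add_cancel, Complex.exp_zero, one_mul]
      have h3 : v p = 0 := if_pos ⟨m, hm⟩
      rw [ContinuousWithinAt, h3]
      exact h2.mono_left nhdsWithin_le_nhds
    · exact (hreg p hpa).1.continuousAt.continuousWithinAt
  have habove : ∀ p : Plane, P.yMax < p 1 → HasSum (fun n => ((P.upperCoeff k n - P.reflectedCoeff k n) *
      P.Iplus n k ψ - c n) * P.planeWave 1 k n p) (v p) := by
    intro p hp
    have hpa : p ∈ P.arrayᶜ := fun h => hp.not_ge (le_yMax_of_mem_array h)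
    rw [hvu p hpa, huH p (by linarith [P.h_pos])]
    refine ((hasSum_hybridPotential_above hk hp).sub
      ((holSeries_wood k hc 1 p).summable (mem_singleton k)).hasSum).congr_fun fun n => ?_
    ring
  have hbelow : ∀ p : Plane, p 1 < P.yMin → HasSum (fun n => (P.belowCoeff k ψ n - c n) *
      P.planeWave (-1) k n p) (v p) := by
    intro p hp
    have hpa : p ∈ P.arrayᶜ := fun h => hp.not_ge (yMin_le_of_mem_array h)
    rw [hvu p hpa, huB p hp, hW2]
    refine (((holSeries_below k ψ hp).summable (mem_singleton k)).hasSum.sub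
      ((holSeries_wood k hc (-1) p).summable (mem_singleton k)).hasSum).congr_fun fun n => ?_
    ring
  have hrad : P.IsRadiatingSolution k v :=
    { smooth := fun p hp => (hreg p hp).1.contDiffWithinAt
      continuous := hcont
      helmholtz := fun p hp => by rw [← helm_eq_laplacian (hreg p hp).1, (hreg p hp).2]
      quasiperiodic := fun p _ m => hqp p m
      radiating_above := ⟨fun n => (P.upperCoeff k n - P.reflectedCoeff k n) * P.Iplus n k ψ - c n, fun p hp => by
        refine (habove p (above_iff.1 hp)).congr_fun fun n => ?_
        rw [planeWave]; simp⟩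
      radiating_below := ⟨fun n => P.belowCoeff k ψ n - c n, fun p hp => by
        refine (hbelow p (below_iff.1 hp)).congr_fun fun n => ?_
        rw [planeWave]; simp [sub_eq_add_neg]⟩ }
  have hzero := hU v hrad fun p hp => if_pos (P.isClosed_array.frontier_subset hp)
  by_cases hn : n ∈ P.Nwa k
  · have hL := P.L_pos
    have h1 := eq_zero_of_hasSum_exp_eq_zero hL (d := fun n => ((P.upperCoeff k n - P.reflectedCoeff k n) *
      P.Iplus n k ψ - c n) * Complex.exp (Complex.I * P.βn n k * ((P.yMax + 1 : ℝ) : ℂ))) (fun x => ?_) n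
    · rw [hI n hn, mul_zero, zero_sub] at h1
      simpa using h1
    · have h2 := habove !₂[x, P.yMax + 1] (by simp)
      rw [hzero _ fun ha => by
        have := le_yMax_of_mem_array ha
        norm_num at this] at h2
      have h3 := h2.mul_left (Complex.exp (-(Complex.I * P.α k * x)))
      rw [mul_zero] at h3
      refine h3.congr_fun fun n => ?_
      generalize (P.upperCoeff k n - P.reflectedCoeff k n) * P.Iplus n k ψ - c n = C
      rw [planeWave, mul_assoc C, mul_left_comm _ C, ← Complex.exp_add, ← Complex.exp_add]
      congr 2
      simp [αn]
      ring
  · exact hc n hn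

end ScatteringSetup

namespace ScatteringSetup

variable {P : ScatteringSetup}

/-! ### The finite-dimensional operators on the span of the Wood modes -/

theorem eventually_wood_ne {k₀ : ℝ} (hk₀ : 0 < k₀) {n : ℤ} (hn : n ∈ P.Nwa k₀) :
    ∀ᶠ k in 𝓝 k₀, k ≠ k₀ → P.βn n k ≠ 0 := by
  set s := Real.sin P.θ with hs
  set a := 2 * Real.pi / P.L * n with ha
  have hα : ∀ k, P.αn n k = k * s + a := fun k => rfl
  have h0 : k₀ ^ 2 = (k₀ * s + a) ^ 2 := by rw [← hα]; exact (P.βn_eq_zero_iff n k₀).1 hn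
  have hs1 : s ^ 2 < 1 := by
    have := Real.sin_sq_add_cos_sq P.θ
    have h1 : 0 < Real.cos P.θ ^ 2 := by have := P.cos_ne_zero; positivity
    linarith
  have hne : k₀ + k₀ - s * (k₀ * s + k₀ * s + 2 * a) ≠ 0 := by
    intro h
    have h1 : k₀ = s * (k₀ * s + a) := by linarith
    have h2 : k₀ ^ 2 = s ^ 2 * k₀ ^ 2 := by
      conv_lhs => rw [h1, mul_pow, ← h0]
    nlinarith [pow_pos hk₀ 2]
  have hc : Continuous fun k => k + k₀ - s * (k * s + k₀ * s + 2 * a) := by fun_prop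
  filter_upwards [hc.continuousAt.eventually_ne hne] with k hk hkk h
  have h1 := (P.βn_eq_zero_iff n k).1 h
  rw [hα] at h1
  have h2 : (k - k₀) * (k + k₀ - s * (k * s + k₀ * s + 2 * a)) = 0 := by linear_combination h1 - h0
  exact (mul_ne_zero (sub_ne_zero.2 hkk) hk) h2

theorem eventually_notMem_woodFrequencies {k₀ : ℝ} (hk₀ : 0 < k₀) :
    ∀ᶠ k in 𝓝 k₀, k ≠ k₀ → ∀ n, P.βn n k ≠ 0 := by
  obtain ⟨m, hm, h⟩ := P.exists_le_norm_βn k₀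
  have h1 := (P.finite_Nwa k₀).eventually_all.2 fun n hn => eventually_wood_ne hk₀ hn
  filter_upwards [h, h1] with k h2 h3 hk n
  by_cases hn : n ∈ P.Nwa k₀
  · exact h3 n hn hk
  · exact norm_pos_iff.1 (hm.trans_le (h2 n hn))

variable (P) in
/-- The coefficient of `R̃_k φ` with respect to the Wood mode `w_n`. -/
noncomputable def woodCoeff (k : ℝ) (n : ℤ) : P.Density →ₗ[ℂ] ℂ :=
  (-(Complex.I / (2 * P.L)) * P.σn n k) • (P.IplusL n k : P.Density →ₗ[ℂ] ℂ)

theorem woodCoeff_apply (k : ℝ) (n : ℤ) (φ : P.Density) :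
    P.woodCoeff k n φ = -(Complex.I / (2 * P.L)) * (P.σn n k * P.Iplus n k φ) := by
  simp [woodCoeff]; ring

theorem Rtilde_eq (k₀ k : ℝ) (φ : P.Density) :
    P.Rtilde k₀ k φ = ∑ n : P.Nwa k₀, P.woodCoeff k n φ • P.woodMode k₀ k n := by
  simp only [Rtilde, woodCoeff_apply]

variable (P) in
/-- The operator `R̃_k` as a linear map. -/
noncomputable def RtildeL (k₀ k : ℝ) : P.Density →ₗ[ℂ] P.woodSpan k₀ k :=
  ∑ n : P.Nwa k₀, (P.woodCoeff k n).smulRight (P.woodMode k₀ k n)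

theorem RtildeL_apply (k₀ k : ℝ) (φ : P.Density) : P.RtildeL k₀ k φ = P.Rtilde k₀ k φ := by
  rw [Rtilde_eq, RtildeL]
  simp

variable (P) in
/-- The matrix of `R̃_k A⁻¹` with respect to the Wood modes. -/
noncomputable def tauMatrix (k₀ k : ℝ) (A : P.Density ≃L[ℂ] P.Density) :
    Matrix (P.Nwa k₀) (P.Nwa k₀) ℂ := fun l n => P.woodCoeff k l (A.symm (P.mode n k))

theorem tauMatrix_mulVec (k₀ k : ℝ) (A : P.Density ≃L[ℂ] P.Density) (a : P.Nwa k₀ → ℂ) (l : P.Nwa k₀) :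
    (P.tauMatrix k₀ k A).mulVec a l = P.woodCoeff k l (A.symm (∑ n, a n • P.mode n k)) := by
  simp only [Matrix.mulVec, dotProduct, tauMatrix, map_sum, map_smul, smul_eq_mul, mul_comm]

theorem det_tauMatrix_ne_zero {k₀ : ℝ} (hk₀ : 0 < k₀) (hU : P.UniqueRadiating k₀)
    {A : P.Density ≃L[ℂ] P.Density} (hA : ∀ ψ r, A ψ r = P.opA k₀ k₀ ψ r) :
    (P.tauMatrix k₀ k₀ A).det ≠ 0 := by
  classical
  intro h
  obtain ⟨a, ha, hτ⟩ := Matrix.exists_mulVec_eq_zero_iff.2 h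
  refine ha (funext fun l => ?_)
  set φ := ∑ n, a n • P.mode n k₀ with hφ
  set c : ℤ → ℂ := fun n => if h : n ∈ P.Nwa k₀ then a ⟨n, h⟩ else 0 with hc
  have hcn : ∀ n : P.Nwa k₀, c n = a n := fun n => dif_pos n.2
  have hI : ∀ n, P.βn n k₀ = 0 → P.Iplus n k₀ (A.symm φ) = 0 := fun n hn => by
    have h1 := congrFun hτ ⟨n, hn⟩
    rw [tauMatrix_mulVec, ← hφ, woodCoeff_apply] at h1
    have hj : P.j ≠ 0 := Nat.one_le_iff_ne_zero.1 P.one_le_j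
    have hL : (P.L : ℂ) ≠ 0 := by exact_mod_cast P.L_pos.ne'
    have hσ : P.σn n k₀ = -1 := by simp [σn, hn, hj]
    simpa [hσ, hL] using h1
  have h2 := woodCoeff_eq_zero hk₀ hU hI (c := c) (fun n hn => dif_neg hn) (fun r => ?_) l
  · rw [hcn] at h2; exact h2
  · rw [← hA, ContinuousLinearEquiv.apply_symm_apply, ← tsum_subtype_eq_of_support_subset (s := P.Nwa k₀)
      fun n hn => by_contra fun hn' => hn (by simp [hc, hn']), tsum_fintype, hφ]
    simp only [ContinuousMap.coe_sum, Finset.sum_apply, ContinuousMap.coe_smul, Pi.smul_apply, smul_eq_mul]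
    refine Finset.sum_congr rfl fun n _ => ?_
    rw [hcn, planeWave]
    simp [mode]

theorem linearIndependent_mode {k₀ k : ℝ} {A : P.Density ≃L[ℂ] P.Density}
    (h : (P.tauMatrix k₀ k A).det ≠ 0) : LinearIndependent ℂ fun n : P.Nwa k₀ => P.mode n k := by
  refine Fintype.linearIndependent_iff.2 fun g hg => ?_
  have h1 : (P.tauMatrix k₀ k A).mulVec g = 0 := funext fun l => by
    rw [tauMatrix_mulVec, hg, map_zero, map_zero]; rfl
  exact congrFun (Matrix.eq_zero_of_mulVec_eq_zero h h1)

/-- The operators on the span of the Wood modes at one wave number. -/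
theorem exists_wood_operators {k₀ k : ℝ} {A : P.Density ≃L[ℂ] P.Density}
    (h : (P.tauMatrix k₀ k A).det ≠ 0)
    (h' : (Matrix.diagonal (fun n : P.Nwa k₀ => P.βn n k) + P.tauMatrix k₀ k A).det ≠ 0) :
    LinearIndependent ℂ (P.woodMode k₀ k) ∧
    ∃ (T : P.woodSpan k₀ k ≃L[ℂ] P.woodSpan k₀ k) (D : P.woodSpan k₀ k →ₗ[ℂ] P.woodSpan k₀ k)
      (E : P.woodSpan k₀ k ≃L[ℂ] P.woodSpan k₀ k),
      (∀ f : P.woodSpan k₀ k, T f = P.Rtilde k₀ k (A.symm f)) ∧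
      (∀ n, T.symm (P.woodMode k₀ k n) = ∑ l, (P.tauMatrix k₀ k A)⁻¹ l n • P.woodMode k₀ k l) ∧
      (∀ n, D (P.woodMode k₀ k n) = P.βn n k • P.woodMode k₀ k n) ∧
      (∀ f, E f = D f + T f) ∧
      (∀ n, E.symm (P.woodMode k₀ k n) = ∑ l, (Matrix.diagonal (fun n : P.Nwa k₀ => P.βn n k) +
        P.tauMatrix k₀ k A)⁻¹ l n • P.woodMode k₀ k l) ∧
      ((∀ n : P.Nwa k₀, P.βn n k ≠ 0) → Function.Injective D) := by
  have : FiniteDimensional ℂ (P.woodSpan k₀ k) := FiniteDimensional.span_of_finite ℂ (Set.finite_range _)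
  set b : Module.Basis (P.Nwa k₀) ℂ (P.woodSpan k₀ k) := Module.Basis.span (linearIndependent_mode h) with hb
  have hbn : ∀ n, b n = P.woodMode k₀ k n := fun n => Module.Basis.span_apply _ n
  have hbf : ⇑b = P.woodMode k₀ k := funext hbn
  set τ := P.tauMatrix k₀ k A
  set T := Matrix.toLinearEquiv b τ h.isUnit
  set B := Matrix.diagonal (fun n : P.Nwa k₀ => P.βn n k) with hB
  set E := Matrix.toLinearEquiv b (B + τ) h'.isUnit
  have hT : (T : P.woodSpan k₀ k →ₗ[ℂ] P.woodSpan k₀ k) =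
      P.RtildeL k₀ k ∘ₗ (A.symm : P.Density →ₗ[ℂ] P.Density) ∘ₗ (P.woodSpan k₀ k).subtype := by
    refine b.ext fun n => ?_
    have h1 : T (b n) = ∑ l, τ l n • b l := Matrix.toLin_self b b τ n
    rw [LinearEquiv.coe_coe, h1, LinearMap.comp_apply, LinearMap.comp_apply, RtildeL_apply, Rtilde_eq, hbf]
    rfl
  refine ⟨hbf ▸ b.linearIndependent, T.toContinuousLinearEquiv, Matrix.toLin b b B, E.toContinuousLinearEquiv,
    fun f => ?_, fun n => ?_, fun n => ?_, fun f => ?_, fun n => ?_, fun hβ => ?_⟩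
  · have := LinearMap.congr_fun hT f
    rw [LinearMap.comp_apply, LinearMap.comp_apply, RtildeL_apply] at this
    exact this
  · have := Matrix.toLin_self b b τ⁻¹ n
    rw [hbf] at this
    exact this
  · have := Matrix.toLin_self b b B n
    rw [hbf] at this
    rw [this]
    simp only [hB, Matrix.diagonal_apply, ite_smul, zero_smul, Finset.sum_ite_eq', Finset.mem_univ, if_true]
  · change Matrix.toLin b b (B + τ) f = Matrix.toLin b b B f + Matrix.toLin b b τ f
    rw [map_add, LinearMap.add_apply]
  · have := Matrix.toLin_self b b (B + τ)⁻¹ n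
    rw [hbf] at this
    exact this
  · have hdet : B.det ≠ 0 := by
      rw [Matrix.det_diagonal]; exact Finset.prod_ne_zero_iff.2 fun n _ => hβ n
    exact (Matrix.toLinearEquiv b B hdet.isUnit).injective

/-- Away from the Wood frequencies, the hybrid equation in terms of `A` and the Wood modes. -/
theorem solvesHybrid_iff {k₀ k m : ℝ} (hm : 0 < m) (h : ∀ n ∉ P.Nwa k₀, m ≤ ‖P.βn n k‖)
    {A : P.Density ≃L[ℂ] P.Density} (hA : ∀ ψ r, A ψ r = P.opA k₀ k ψ r) (φ : P.Density) :
    P.SolvesHybrid k φ ↔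
      A φ + ∑ n : P.Nwa k₀, (P.woodCoeff k n φ / P.βn n k) • P.mode n k = -P.uinc k := by
  rw [ContinuousMap.ext_iff]
  refine forall_congr' fun r => ?_
  have hs := hasSum_modalTerm_apply (summable_modalTerm (P.Nwa k₀)ᶜ hm h) φ r
  have hsplit := Summable.tsum_add_tsum_compl (s := P.Nwa k₀) (f := fun n : ℤ => -(Complex.I / (2 * P.L)) *
    (P.σn n k * (P.Iplus n k φ / P.βn n k) * P.mode n k r)) (Summable.of_finite) hs.summable
  rw [tsum_fintype (fun n : P.Nwa k₀ => _)] at hsplit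
  have e1 : (A φ + ∑ n : P.Nwa k₀, (P.woodCoeff k n φ / P.βn n k) • P.mode n k) r =
      1 / 2 * φ r + P.combinedIntegral (fun s => P.quasiGreen k (r.1 - s)) φ
      - Complex.I / (2 * P.L) * ∑' n : ℤ, P.σn n k * (P.Iplus n k φ / P.βn n k) * P.mode n k r := by
    rw [sub_eq_add_neg, ← neg_mul, ← tsum_mul_left, ← hsplit, ContinuousMap.add_apply, hA, opA, sub_eq_add_neg,
      ← neg_mul, ← tsum_mul_left]
    simp only [ContinuousMap.coe_sum, Finset.sum_apply, ContinuousMap.coe_smul, Pi.smul_apply, smul_eq_mul,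
      woodCoeff_apply]
    have e2 : ∑ n : P.Nwa k₀, -(Complex.I / (2 * P.L)) * (P.σn n k * P.Iplus n k φ) / P.βn n k * P.mode n k r =
        ∑ n : P.Nwa k₀, -(Complex.I / (2 * P.L)) * (P.σn n k * (P.Iplus n k φ / P.βn n k) * P.mode n k r) :=
      Finset.sum_congr rfl fun n _ => by ring
    rw [e2]; ring
  rw [e1]
  rfl

theorem continuousAt_woodCoeff {k : ℝ} (n : ℤ) {φ : ℝ → P.Density} (h : ContinuousAt φ k) :
    ContinuousAt (fun k => P.woodCoeff k n (φ k)) k := by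
  simp only [woodCoeff_apply, ← IplusL_apply]
  exact continuousAt_const.mul ((P.continuous_σn n).continuousAt.mul
    ((P.continuous_IplusL n).continuousAt.clm_apply h))

end ScatteringSetup

theorem continuousAt_inv_matrix {n : Type*} [Fintype n] [DecidableEq n] {M : ℝ → Matrix n n ℂ} {k : ℝ}
    (hM : ContinuousAt M k) (h : (M k).det ≠ 0) : ContinuousAt (fun k => (M k)⁻¹) k := by
  refine ContinuousAt.comp (g := fun M : Matrix n n ℂ => M⁻¹) (continuousAt_matrix_inv _ ?_) hM
  rw [Ring.inverse_eq_inv']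
  exact continuousAt_inv₀ h

end

open scoped Topology ContDiff
open MeasureTheory Set Filter

theorem mainTheorem1 (P : ScatteringSetup) (k₀ : ℝ) (hk₀ : k₀ ∈ P.woodFrequencies)
    (hA : P.OpAInvertible k₀) (hU : P.UniqueRadiating k₀) :
    ∃ δ : ℝ, 0 < δ ∧
    -- the operators `A_k` and `T̃_k`, `D_{β(k)}`, `D_{β(k)} + T̃_k` on `S`, and the densities `ψ_k`
    ∃ (A : ℝ → (P.Density ≃L[ℂ] P.Density))
      (T : ∀ k : ℝ, P.woodSpan k₀ k ≃L[ℂ] P.woodSpan k₀ k)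
      (D : ∀ k : ℝ, P.woodSpan k₀ k →ₗ[ℂ] P.woodSpan k₀ k)
      (E : ∀ k : ℝ, P.woodSpan k₀ k ≃L[ℂ] P.woodSpan k₀ k)
      (ψ : ℝ → P.Density),
    -- 1. `A_k` maps `C(∂D₀)` into itself and is invertible, with inverse continuous in `k`
    (∀ k, |k - k₀| < δ → ∀ φ r, A k φ r = P.opA k₀ k φ r) ∧
    ContinuousOn (fun k => ((A k).symm : P.Density →L[ℂ] P.Density)) {k | |k - k₀| < δ} ∧
    -- 2. `T̃_k` is bijective and bicontinuous on `S`, with inverse continuous in `k`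
    -- (the matrix of the inverse in the basis of the Wood modes depends continuously on `k`)
    (∀ k, |k - k₀| < δ → LinearIndependent ℂ (P.woodMode k₀ k)) ∧
    (∀ k, |k - k₀| < δ → ∀ f : P.woodSpan k₀ k, T k f = P.Rtilde k₀ k ((A k).symm f)) ∧
    (∃ M : ℝ → Matrix (P.Nwa k₀) (P.Nwa k₀) ℂ, ContinuousOn M {k | |k - k₀| < δ} ∧
      ∀ k, |k - k₀| < δ → ∀ n,
        (T k).symm (P.woodMode k₀ k n) = ∑ l, M k l n • P.woodMode k₀ k l) ∧
    -- 3. `ψ_k` is well defined for all `k`, and solves the hybrid equation uniquely for `k ≠ k₀`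
    (∀ k, |k - k₀| < δ → ∀ n, D k (P.woodMode k₀ k n) = P.βn n k • P.woodMode k₀ k n) ∧
    (∀ k, |k - k₀| < δ → ∀ f, E k f = D k f + T k f) ∧
    (∀ k, |k - k₀| < δ → ψ k = -(A k).symm
      (P.uinc k - ((E k).symm (P.Rtilde k₀ k ((A k).symm (P.uinc k))) : P.Density))) ∧
    (∀ k, 0 < |k - k₀| → |k - k₀| < δ → 0 < k ∧ k ∉ P.woodFrequencies ∧
      ∀ φ : P.Density, P.SolvesHybrid k φ ↔ φ = ψ k) ∧
    -- 4. the densities depend continuously on `k` and converge uniformly as `k → k₀`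
    ContinuousOn ψ {k | |k - k₀| < δ} ∧
    Filter.Tendsto ψ (𝓝[≠] k₀) (𝓝 (ψ k₀)) := by
  classical
  have hk₀' : 0 < k₀ := hk₀.1
  obtain ⟨A, hAc, hAop⟩ := ScatteringSetup.exists_opA_equiv hk₀' hA
  obtain ⟨m, hm, hmβ⟩ := P.exists_le_norm_βn k₀
  set τ : ℝ → Matrix (P.Nwa k₀) (P.Nwa k₀) ℂ := fun k => P.tauMatrix k₀ k (A k) with hτ
  set B : ℝ → Matrix (P.Nwa k₀) (P.Nwa k₀) ℂ := fun k =>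
    Matrix.diagonal (fun n : P.Nwa k₀ => P.βn n k) + τ k with hB
  have hτc : ∀ᶠ k in 𝓝 k₀, ContinuousAt τ k := hAc.mono fun k hk =>
    continuousAt_pi.2 fun l => continuousAt_pi.2 fun n =>
      ScatteringSetup.continuousAt_woodCoeff l (hk.clm_apply (P.continuous_mode n).continuousAt)
  have hBc : ∀ᶠ k in 𝓝 k₀, ContinuousAt B k := hτc.mono fun k hk =>
    (Continuous.matrix_diagonal (continuous_pi fun n : P.Nwa k₀ => P.continuous_βn n)).continuousAt.add hk
  have hdet : ∀ {M : ℝ → Matrix (P.Nwa k₀) (P.Nwa k₀) ℂ}, ContinuousAt M k₀ → (M k₀).det ≠ 0 →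
      ∀ᶠ k in 𝓝 k₀, (M k).det ≠ 0 := fun hM h =>
    (ContinuousAt.comp (g := fun M : Matrix (P.Nwa k₀) (P.Nwa k₀) ℂ => M.det)
      (continuous_id.matrix_det).continuousAt hM).eventually_ne h
  have hτ₀ : (τ k₀).det ≠ 0 := ScatteringSetup.det_tauMatrix_ne_zero hk₀' hU hAop.self_of_nhds
  have hB₀ : (B k₀).det ≠ 0 := by
    have h0 : (fun n : P.Nwa k₀ => P.βn n k₀) = 0 := funext fun n => n.2
    have : B k₀ = τ k₀ := by simp only [hB, h0]; rw [Matrix.diagonal_zero', zero_add]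
    rwa [this]
  have hall := hAc.and (hAop.and (hmβ.and ((hτc.and (hdet hτc.self_of_nhds hτ₀)).and
    ((hBc.and (hdet hBc.self_of_nhds hB₀)).and ((ScatteringSetup.eventually_notMem_woodFrequencies (P := P) hk₀').and
      (lt_mem_nhds hk₀'))))))
  obtain ⟨δ, hδ, hgood⟩ := Metric.eventually_nhds_iff.1 hall
  have hset : ∀ k, |k - k₀| < δ → dist k k₀ < δ := fun k hk => by rwa [Real.dist_eq]
  have hops : ∀ k, ∃ (T : P.woodSpan k₀ k ≃L[ℂ] P.woodSpan k₀ k)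
      (D : P.woodSpan k₀ k →ₗ[ℂ] P.woodSpan k₀ k) (E : P.woodSpan k₀ k ≃L[ℂ] P.woodSpan k₀ k),
      |k - k₀| < δ → LinearIndependent ℂ (P.woodMode k₀ k) ∧
      (∀ f : P.woodSpan k₀ k, T f = P.Rtilde k₀ k ((A k).symm f)) ∧
      (∀ n, T.symm (P.woodMode k₀ k n) = ∑ l, (τ k)⁻¹ l n • P.woodMode k₀ k l) ∧
      (∀ n, D (P.woodMode k₀ k n) = P.βn n k • P.woodMode k₀ k n) ∧
      (∀ f, E f = D f + T f) ∧
      (∀ n, E.symm (P.woodMode k₀ k n) = ∑ l, (B k)⁻¹ l n • P.woodMode k₀ k l) ∧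
      ((∀ n : P.Nwa k₀, P.βn n k ≠ 0) → Function.Injective D) := fun k => by
    by_cases hk : |k - k₀| < δ
    · obtain ⟨-, -, -, ⟨-, h1⟩, ⟨-, h2⟩, -⟩ := hgood (hset k hk)
      obtain ⟨h3, T, D, E, h4⟩ := ScatteringSetup.exists_wood_operators h1 h2
      exact ⟨T, D, E, fun _ => ⟨h3, h4⟩⟩
    · exact ⟨.refl ℂ _, 0, .refl ℂ _, fun h => absurd h hk⟩
  choose T D E hTDE using hops
  set ψ : ℝ → P.Density := fun k => -(A k).symm
    (P.uinc k - ((E k).symm (P.Rtilde k₀ k ((A k).symm (P.uinc k))) : P.Density)) with hψ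
  have hψc : ∀ k, |k - k₀| < δ → ContinuousAt ψ k := fun k hk => by
    obtain ⟨hAk, -, -, -, ⟨hBk, hBd⟩, -⟩ := hgood (hset k hk)
    have hu := P.continuous_uinc.continuousAt (x := k)
    have hφ := hAk.clm_apply hu
    have hinv := continuousAt_inv_matrix hBk hBd
    have h1 : ContinuousAt (fun k => ∑ n : P.Nwa k₀, P.woodCoeff k n ((A k).symm (P.uinc k)) •
        ∑ l, (B k)⁻¹ l n • P.mode l k) k :=
      tendsto_finsetSum _ fun n _ => (ScatteringSetup.continuousAt_woodCoeff n hφ).smul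
        (tendsto_finsetSum _ fun l _ => ((continuousAt_pi.1 (continuousAt_pi.1 hinv l) n)).smul
          (P.continuous_mode l).continuousAt)
    refine (hAk.clm_apply (hu.sub h1)).neg.congr ?_
    filter_upwards [(continuous_abs.comp (continuous_id.sub continuous_const)).continuousAt.eventually
      (gt_mem_nhds hk)] with κ hκ
    obtain ⟨-, -, -, -, -, h2, -⟩ := hTDE κ hκ
    simp only [hψ, ScatteringSetup.Rtilde_eq, map_sum, map_smul, h2, Submodule.coe_sum, Submodule.coe_smul]
    rfl
  refine ⟨δ, hδ, A, T, D, E, ψ, fun k hk => (hgood (hset k hk)).2.1,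
    fun k hk => (hgood (hset k hk)).1.continuousWithinAt, fun k hk => (hTDE k hk).1,
    fun k hk => (hTDE k hk).2.1, ⟨fun k => (τ k)⁻¹, fun k hk => ?_, fun k hk => (hTDE k hk).2.2.1⟩,
    fun k hk => (hTDE k hk).2.2.2.1, fun k hk => (hTDE k hk).2.2.2.2.1, fun k _ => rfl, fun k hk0 hk => ?_,
    fun k hk => (hψc k hk).continuousWithinAt, ?_⟩
  · obtain ⟨-, -, -, ⟨h1, h2⟩, -⟩ := hgood (hset k hk)
    exact (continuousAt_inv_matrix h1 h2).continuousWithinAt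
  · obtain ⟨-, hop, hβm, -, -, hβ, hkp⟩ := hgood (hset k hk)
    have hβ := hβ (sub_ne_zero.1 (abs_pos.1 hk0))
    refine ⟨hkp, fun ⟨_, n, hn⟩ => hβ n ((P.βn_eq_zero_iff n k).2 hn), fun φ => ?_⟩
    obtain ⟨-, hT, -, hD, hE, -, hinj⟩ := hTDE k hk
    have hinj := hinj fun n => hβ n
    rw [ScatteringSetup.solvesHybrid_iff hm hβm hop]
    set u := P.uinc k
    set g : P.woodSpan k₀ k := ∑ n : P.Nwa k₀, (P.woodCoeff k n φ / P.βn n k) • P.woodMode k₀ k n with hg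
    have hgc : (g : P.Density) = ∑ n : P.Nwa k₀, (P.woodCoeff k n φ / P.βn n k) • P.mode n k := by
      rw [hg, Submodule.coe_sum]; rfl
    have hDg : D k g = P.Rtilde k₀ k φ := by
      rw [hg, map_sum, ScatteringSetup.Rtilde_eq]
      refine Finset.sum_congr rfl fun n _ => ?_
      rw [map_smul, hD, smul_smul, div_mul_cancel₀ _ (hβ n)]
    set R := P.RtildeL k₀ k with hR
    have hRφ : ∀ φ, P.Rtilde k₀ k φ = R φ := fun φ => (ScatteringSetup.RtildeL_apply k₀ k φ).symm
    rw [← hgc]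
    constructor
    · intro h
      have h1 : A k φ = -(u + g) := by rw [neg_add, ← h, add_neg_cancel_right]
      have h2 : φ = -(A k).symm (u + g) := by
        rw [← map_neg, ← h1, ContinuousLinearEquiv.symm_apply_apply]
      have h3 : E k g = -R ((A k).symm u) := by
        rw [hE, hT, hDg, hRφ, hRφ, h2, map_neg, map_add, map_add]
        abel
      have h4 : g = -(E k).symm (R ((A k).symm u)) := by
        rw [← map_neg, ← h3, ContinuousLinearEquiv.symm_apply_apply]
      rw [h2, h4, hψ]
      dsimp only
      rw [hRφ, Submodule.coe_neg, ← sub_eq_add_neg]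
    · intro h
      set g' : P.woodSpan k₀ k := -(E k).symm (R ((A k).symm u)) with hg'
      have h2 : φ = -(A k).symm (u + g') := by
        rw [h, hψ]
        dsimp only
        rw [hRφ, hg', Submodule.coe_neg, ← sub_eq_add_neg]
      have h3 : E k g' = -R ((A k).symm u) := by
        rw [hg', map_neg, ContinuousLinearEquiv.apply_symm_apply]
      clear_value g'
      have h4 : D k g' = R φ := by
        rw [hE, hT, hRφ] at h3
        have h6 : R φ = -R ((A k).symm u) - R ((A k).symm g') := by
          rw [h2, map_neg R, map_add (A k).symm, map_add R]
          abel
        rw [h6, ← h3, add_sub_cancel_right]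
      have h5 : g = g' := hinj (by rw [hDg, hRφ, h4])
      rw [h5, h2, map_neg, ContinuousLinearEquiv.apply_symm_apply]
      abel
  · exact (hψc k₀ (by simpa using hδ)).tendsto.mono_left nhdsWithin_le_nhds
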